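/- Let $M$ be a $2m$-dimensional smooth manifold (Hausdorff, second countable, without boundary) and let $\sigma\in\Omega^2(M)$ be folded-symplectic: $d\sigma=0$, the section $\sigma^m$ of $\Lambda^{2m}T^*M$ is transverse to the zero section, so that its zero set $Z$ (the fold) is an embedded hypersurface $i_Z:Z\hookrightarrow M$, and $i_Z^*\sigma$ has maximal rank $2m-2$. Let $G$ be a compact, connected Lie group with Lie algebra $\mathfrak g$, acting smoothly on $M$ by maps $\tau_g$ with $\tau_g^*\sigma=\sigma$ for all $g\in G$ and with a moment map, i.e. a smooth $G$-equivariant map $\mu:M\to\mathfrak g^*$ (for the coadjoint action) with $i_{X_M}\sigma=-d\langle\mu,X\rangle$ for all $X\in\mathfrak g$, where $X_M$ is the vector field induced by $X$. Then $Z$ is $G$-invariant. The null line bundle $\ker(i_Z^*\sigma):=\ker(\sigma)\cap TZ$ over $Z$ carries a canonical orientation: $v\in\ker(\sigma_z)\cap T_zZ$ is positive if $d(\sigma(\tilde w,\tilde v))_z(\tilde w_z)>0$, where $\tilde w,\tilde v$ are smooth vector fields on $M$ near $z$ such that along $Z$ the field $\tilde w$ has values in $\ker(\sigma)$ and is transverse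 to $Z$, and $\tilde v_z=v$ (this does not depend on the choice of $\tilde w,\tilde v$). Suppose that $Z$ is co-orientable, i.e. that its normal bundle $TM|_Z/TZ$ is orientable. Let $G$ act on $Z\times\mathbb R$ by $g\cdot(z,t)=(g\cdot z,t)$ and let $p:Z\times\mathbb R\to Z$ be the projection. Then there exist a $G$-invariant open neighborhood $U_1$ of $Z\times\{0\}$ in $Z\times\mathbb R$, a $G$-invariant open neighborhood $U_2$ of $Z$ in $M$, a $G$-equivariant diffeomorphism $\phi:U_1\to U_2$, and a $G$-invariant smooth $1$-form $\alpha\in\Omega^1(Z)^G$ such that $\phi(z,0)=z$ for all $z\in Z$, the form $\alpha$ does not vanish on nonzero vectors of $\ker(i_Z^*\sigma)$ and induces its canonical orientation (for $v\in\ker(i_Z^*\sigma)$, $\alpha(v)>0$ if and only if $v$ is positive), and $$\phi^*\sigma = p^*i_Z^*\sigma + d(t^2\,p^*\alpha)\quad\text{on } U_1 .$$ -/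

import Mathlib

open scoped Manifold ContDiff Topology

noncomputable section

namespace FoldedSymplectic

/-! ### Differential forms on manifolds without boundary -/

section Forms

variable {E : Type*} [NormedAddCommGroup E] [NormedSpace ℝ E] {H : Type*} [TopologicalSpace H]
  {E' : Type*} [NormedAddCommGroup E'] [NormedSpace ℝ E'] {H' : Type*} [TopologicalSpace H']

/-- A (not necessarily smooth) differential `k`-form on the manifold `M`: an alternating
`k`-linear form on each tangent space. -/
abbrev DForm (I : ModelWithCorners ℝ E H) (M : Type*) [TopologicalSpace M] [ChartedSpace H M]
    (k : ℕ) : Type _ :=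
  ∀ x : M, (TangentSpace I x) [⋀^Fin k]→L[ℝ] ℝ

variable {I : ModelWithCorners ℝ E H} {I' : ModelWithCorners ℝ E' H'}
  {M : Type*} [TopologicalSpace M] [ChartedSpace H M]
  {N : Type*} [TopologicalSpace N] [ChartedSpace H' N] {k : ℕ}

/-- The pullback `f^* η` of a form along a map, `(f^* η)_x = η_{f x} ∘ (df_x × ⋯ × df_x)`. -/
def pullback (I : ModelWithCorners ℝ E H) (f : M → N) (η : DForm I' N k) : DForm I M k :=
  fun x => (η (f x)).compContinuousLinearMap (mfderiv I I' f x)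

/-- The expression of a form in the preferred chart around `x₀`: its pullback along the inverse of
this chart, a form on (the target of the chart in) the model vector space. -/
def inChart (x₀ : M) (η : DForm I M k) (y : E) : E [⋀^Fin k]→L[ℝ] ℝ :=
  (η ((extChartAt I x₀).symm y)).compContinuousLinearMap
    (mfderiv 𝓘(ℝ, E) I (extChartAt I x₀).symm y)

/-- A form on a manifold without boundary is smooth if its expressions in charts are smooth. -/
def IsSmooth (η : DForm I M k) : Prop :=
  ∀ x₀ : M, ContDiffOn ℝ ∞ (inChart x₀ η) (extChartAt I x₀).target

/-- The exterior derivative of a form on a manifold without boundary: at each point it is computed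
in the preferred chart around that point and pulled back to the manifold. -/
def extD (η : DForm I M k) : DForm I M (k + 1) := fun x =>
  (extDeriv (inChart x η) (extChartAt I x x)).compContinuousLinearMap
    (mfderiv I 𝓘(ℝ, E) (extChartAt I x) x)

end Forms

/-! ### Powers of two-forms -/

section Linear

variable {V : Type*} [AddCommGroup V] [Module ℝ V] [TopologicalSpace V]

/-- The value of the `m`-fold wedge power `η ∧ ⋯ ∧ η` of an alternating two-form on `2m` vectors,
`2⁻ᵐ ∑_π sgn(π) η(v_{π(0)}, v_{π(1)}) ⋯ η(v_{π(2m-2)}, v_{π(2m-1)})`. -/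
def wedgePow {m : ℕ} (η : V [⋀^Fin 2]→L[ℝ] ℝ) (v : Fin (2 * m) → V) : ℝ :=
  ((2 : ℝ) ^ m)⁻¹ * ∑ π : Equiv.Perm (Fin (2 * m)), ((Equiv.Perm.sign π : ℤ) : ℝ) *
    ∏ i : Fin m, η ![v (π ⟨2 * i, by omega⟩), v (π ⟨2 * i + 1, by omega⟩)]

/-- The rank of an alternating two-form: the rank of `v ↦ η(v, ·)`. -/
def formRank (η : V [⋀^Fin 2]→L[ℝ] ℝ) : ℕ :=
  Module.finrank ℝ (LinearMap.range (AlternatingMap.curryLeft η.toAlternatingMap))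

end Linear

/-! ### Folded-symplectic manifolds -/

section Folded

variable {m : ℕ} {M : Type*} [TopologicalSpace M] [ChartedSpace (EuclideanSpace ℝ (Fin (2 * m))) M]

/-- The fold `Z` of a two-form `σ` on a `2m`-dimensional manifold: the zero set of `σ^m`. -/
def fold (σ : DForm (𝓡 (2 * m)) M 2) : Set M :=
  {x | ∀ v : Fin (2 * m) → TangentSpace (𝓡 (2 * m)) x, wedgePow (σ x) v = 0}

/-- The coefficient of `dx₁ ∧ ⋯ ∧ dx_{2m}` in the expression of `σ^m` in the preferred chart
around `x₀`. -/
def topCoeff (σ : DForm (𝓡 (2 * m)) M 2) (x₀ : M) (y : EuclideanSpace ℝ (Fin (2 * m))) : ℝ :=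
  wedgePow (inChart x₀ σ y) (fun i => EuclideanSpace.single i (1 : ℝ))

/-- The kernel `ker(σ_x) = {v ∈ T_xM | i_v σ_x = 0}`. -/
def formKer (σ : DForm (𝓡 (2 * m)) M 2) (x : M) : Set (TangentSpace (𝓡 (2 * m)) x) :=
  {v | ∀ w : TangentSpace (𝓡 (2 * m)) x, σ x ![v, w] = 0}

variable (σ : DForm (𝓡 (2 * m)) M 2)
  [ChartedSpace (EuclideanSpace ℝ (Fin (2 * m - 1))) (fold σ)]

/-- The differential `T_zZ → T_zM` of the inclusion of the fold. -/
def dIncl (z : fold σ) : TangentSpace (𝓡 (2 * m - 1)) z →L[ℝ] TangentSpace (𝓡 (2 * m)) (z : M) :=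
  mfderiv (𝓡 (2 * m - 1)) (𝓡 (2 * m)) (Subtype.val : fold σ → M) z

/-- The tangent space `T_zZ` as a subspace of `T_zM`. -/
def tangentFold (z : fold σ) : Submodule ℝ (TangentSpace (𝓡 (2 * m)) (z : M)) :=
  LinearMap.range (dIncl σ z).toLinearMap

/-- The restriction `i_Z^* σ` of `σ` to its fold. -/
def restrictFold : DForm (𝓡 (2 * m - 1)) (fold σ) 2 :=
  pullback (𝓡 (2 * m - 1)) (Subtype.val : fold σ → M) σ

/-- `σ` is a folded-symplectic form on the `2m`-dimensional manifold `M`: it is smooth and closed,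
`σ^m` is transverse to the zero section of `Λ^{2m} T^*M`, and its restriction to the fold
(with its structure of a `(2m-1)`-dimensional manifold) has maximal rank `2m - 2`.
Transversality to the zero section says that in a chart the coefficient of `σ^m` has nonzero
differential at the points where it vanishes. -/
structure IsFoldedSymplectic : Prop where
  smooth : IsSmooth σ
  closed : extD σ = 0
  transverse : ∀ x ∈ fold σ, fderiv ℝ (topCoeff σ x) (extChartAt (𝓡 (2 * m)) x x) ≠ 0
  maximal_rank : ∀ z : fold σ, formRank (restrictFold σ z) = 2 * m - 2

/-- The fibre at `z` of the normal bundle `ν(Z) = TM|_Z / TZ`. -/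
abbrev NormalFibre (z : fold σ) : Type :=
  TangentSpace (𝓡 (2 * m)) (z : M) ⧸ tangentFold σ z

/-- The fold is co-orientable: its normal line bundle is orientable, i.e. there is a choice of an
orientation (a ray) in each fibre of the normal bundle which is locally represented by a smooth
section of `TM|_Z`. -/
def IsCoorientable [IsManifold (𝓡 (2 * m)) ∞ M] : Prop :=
  ∃ o : ∀ z : fold σ, Module.Ray ℝ (NormalFibre σ z),
    ∀ z₀ : fold σ, ∃ O ∈ 𝓝 z₀, ∃ w : ∀ z : fold σ, TangentSpace (𝓡 (2 * m)) (z : M),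
      ContMDiffOn (𝓡 (2 * m - 1)) (𝓡 (2 * m)).tangent ∞
        (fun z : fold σ => (⟨(z : M), w z⟩ : TangentBundle (𝓡 (2 * m)) M)) O ∧
      ∀ z ∈ O, ∃ hw : (tangentFold σ z).mkQ (w z) ≠ 0,
        o z = rayOfNeZero ℝ ((tangentFold σ z).mkQ (w z)) hw

/-- The fibre at `z` of the null line bundle `ker(i_Z^* σ) = ker(σ) ∩ TZ` of the fold. -/
def nullFibre (z : fold σ) : Set (TangentSpace (𝓡 (2 * m - 1)) z) :=
  {u | dIncl σ z u ∈ formKer σ (z : M)}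

/-- `u ∈ ker(σ_z) ∩ T_zZ` is positively oriented for the orientation of the null line bundle
induced by `σ`: it satisfies `d(σ(W, V))_z(W_z) > 0`, where `W`, `V` are smooth vector fields
near `z` in `M` such that `W` has values in `ker(σ)` along the fold and is transverse to it, and
`V` extends `u`. (The sign does not depend on the choice of `W` and `V`.) -/
def IsPositiveNull [IsManifold (𝓡 (2 * m)) ∞ M] (z : fold σ) (u : TangentSpace (𝓡 (2 * m - 1)) z) : Prop :=
  u ∈ nullFibre σ z ∧
  ∃ (O : Set M) (W V : ∀ x : M, TangentSpace (𝓡 (2 * m)) x),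
    IsOpen O ∧ (z : M) ∈ O ∧
    ContMDiffOn (𝓡 (2 * m)) (𝓡 (2 * m)).tangent ∞
      (fun x => (⟨x, W x⟩ : TangentBundle (𝓡 (2 * m)) M)) O ∧
    ContMDiffOn (𝓡 (2 * m)) (𝓡 (2 * m)).tangent ∞
      (fun x => (⟨x, V x⟩ : TangentBundle (𝓡 (2 * m)) M)) O ∧
    (∀ z' : fold σ, (z' : M) ∈ O → W z' ∈ formKer σ (z' : M) ∧ W z' ∉ tangentFold σ z') ∧
    V z = dIncl σ z u ∧
    (0 : ℝ) < mfderiv (𝓡 (2 * m)) 𝓘(ℝ, ℝ) (fun x => σ x ![W x, V x]) (z : M) (W z)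

/-- The form `p^* i_Z^* σ + d(t² p^* α)` on `Z × ℝ`, with `p : Z × ℝ → Z` the projection. -/
def modelForm (α : DForm (𝓡 (2 * m - 1)) (fold σ) 1) :
    DForm ((𝓡 (2 * m - 1)).prod 𝓘(ℝ, ℝ)) (fold σ × ℝ) 2 :=
  pullback ((𝓡 (2 * m - 1)).prod 𝓘(ℝ, ℝ)) (Prod.fst : fold σ × ℝ → fold σ) (restrictFold σ) +
    extD (fun q : fold σ × ℝ => q.2 ^ 2 •
      pullback ((𝓡 (2 * m - 1)).prod 𝓘(ℝ, ℝ)) (Prod.fst : fold σ × ℝ → fold σ) α q)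

end Folded

/-! ### Hamiltonian actions -/

section Invariance

variable {m : ℕ} {M : Type*} [TopologicalSpace M] [ChartedSpace (EuclideanSpace ℝ (Fin (2 * m))) M]
  {G : Type*} [Group G] [MulAction G M]

variable (G) in
/-- The two-form `σ` is invariant: `τ_g^* σ = σ` for all `g ∈ G`. -/
def IsInvariant (σ : DForm (𝓡 (2 * m)) M 2) : Prop :=
  ∀ g : G, pullback (𝓡 (2 * m)) (fun x : M => g • x) σ = σ

theorem smul_mem_fold {σ : DForm (𝓡 (2 * m)) M 2} (h : IsInvariant G σ) (g : G) {x : M}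
    (hx : x ∈ fold σ) : g • x ∈ fold σ := by
  intro v
  have e : σ (g • x) = pullback (𝓡 (2 * m)) (fun x : M => g⁻¹ • x) σ (g • x) := by rw [h]
  rw [e]
  have hx' : g⁻¹ • (g • x) ∈ fold σ := by rwa [inv_smul_smul]
  have := hx' (fun i => mfderiv (𝓡 (2 * m)) (𝓡 (2 * m)) (fun x : M => g⁻¹ • x) (g • x) (v i))
  rw [← this]
  unfold wedgePow pullback
  congr 1
  refine Finset.sum_congr rfl fun π _ => ?_
  congr 1
  refine Finset.prod_congr rfl fun i _ => ?_
  rw [ContinuousAlternatingMap.compContinuousLinearMap_apply]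
  congr 1
  ext j
  fin_cases j <;> rfl

/-- The restriction to the fold of an action that preserves `σ`. -/
def foldAct {σ : DForm (𝓡 (2 * m)) M 2} (h : IsInvariant G σ) (g : G) (z : fold σ) : fold σ :=
  ⟨g • (z : M), smul_mem_fold h g z.2⟩

end Invariance

section Actions

variable {m : ℕ} {M : Type*} [TopologicalSpace M] [ChartedSpace (EuclideanSpace ℝ (Fin (2 * m))) M]
  {n : ℕ} {G : Type*} [TopologicalSpace G] [ChartedSpace (EuclideanSpace ℝ (Fin n)) G] [Group G]
  [MulAction G M]

/-- The induced vector field of `X ∈ 𝔤`: `X_M(x)` is the derivative at `1` of `g ↦ g • x`,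
applied to `X`. -/
def inducedField (M : Type*) [TopologicalSpace M]
    [ChartedSpace (EuclideanSpace ℝ (Fin (2 * m))) M] [MulAction G M]
    (X : GroupLieAlgebra (𝓡 n) G) (x : M) : TangentSpace (𝓡 (2 * m)) x :=
  mfderiv (𝓡 n) (𝓡 (2 * m)) (fun g : G => g • x) 1 X

/-- The adjoint action of `g ∈ G` on `𝔤`: the derivative at `1` of `h ↦ g h g⁻¹`. -/
def adjoint (g : G) (X : GroupLieAlgebra (𝓡 n) G) : GroupLieAlgebra (𝓡 n) G :=
  mfderiv (𝓡 n) (𝓡 n) (fun h : G => g * h * g⁻¹) 1 X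

/-- `μ : M → 𝔤^*` is a moment map for the action of `G` on `(M, σ)`, and the action preserves `σ`.
The moment map is smooth, equivariant for the coadjoint action, and satisfies
`i_{X_M} σ = -d⟨μ, X⟩` for all `X ∈ 𝔤`. -/
structure IsHamiltonian (σ : DForm (𝓡 (2 * m)) M 2)
    (μ : M → Module.Dual ℝ (GroupLieAlgebra (𝓡 n) G)) : Prop where
  invariant : IsInvariant G σ
  smooth : ∀ X : GroupLieAlgebra (𝓡 n) G, ContMDiff (𝓡 (2 * m)) 𝓘(ℝ, ℝ) ∞ (fun x => μ x X)
  equivariant : ∀ (g : G) (x : M) (X : GroupLieAlgebra (𝓡 n) G), μ (g • x) X = μ x (adjoint g⁻¹ X)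
  moment : ∀ (X : GroupLieAlgebra (𝓡 n) G) (x : M) (v : TangentSpace (𝓡 (2 * m)) x),
    σ x ![inducedField M X x, v] = -(mfderiv (𝓡 (2 * m)) 𝓘(ℝ, ℝ) (fun y => μ y X) x v : ℝ)

end Actions

end FoldedSymplectic

end

/-! Flow out of the fold along an invariant transverse field with values in ker σ, then correct the
resulting collar by Moser's trick; the Moser equation is degenerate along the fold but becomes
regular after a rescaling of the normal direction.

Kernel. Transversality of σ^m and maximal rank of the restriction force ker σ_z to be spanned by the
null direction n and a vector w transverse to Z, with D_wσ(w, n) ≠ 0 (`exists_fold_frame`). The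
reason is that a first order variation of σ vanishing on ker σ × ker σ is an infinitesimal change of
frame, so it cannot move σ^m to first order (`exists_first_order_variation`,
`fderiv_wedgePow_eq_zero`). Kernel vectors on the positive side of a co-orientation form a convex
set, so a partition of unity gives a global field, and averaging over G makes it invariant;
connectedness of G keeps the average transverse (`exists_transverse_field`,
`exists_invariant_transverse_field`).

Collar. Let κ(z, t) be the time-t flow of this field W from z, and ψ₁ = κ^*σ. The contraction of ψ₁
with ∂/∂t vanishes at t = 0, and α is half of its t-derivative there. On null vectors α(u) = ½
D_Wσ(W, u), whose sign is the canonical orientation (`foldOneForm_apply`, `isPositiveNull_iff`).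

Moser. Write ψ₀ for the model form. Integrating the contraction in t gives ψ₁ - ψ₀ = dβ with β = ∫₀ᵗ
i_{∂/∂t} ψ₁ - t²α; the choice of α makes β = O(t³), and β(∂/∂t) = 0. The forms ψ_s = ψ₀ + s(ψ₁ - ψ₀)
degenerate at t = 0 only through a factor t in the ∂/∂t slot. Dividing it out leaves a form that is
nondegenerate near the fold because α(n) ≠ 0. So the solution X of i_X ψ_s = -β is smooth and
divisible by t² (`exists_moserField_smooth`). Its time-one map is defined near the fold, is the
identity to first order there, and pulls ψ₁ back to ψ₀ (`form_transport`, `MoserData.exists_flow`).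
Smooth dependence of flows comes from the inverse function theorem on a space of curves
(`exists_smooth_solution`).

Globalization. Field and flow are given by pointwise formulas natural under chart changes and under
G (`moserField_covariant`), so the local computations fit together and the composite φ of Moser flow
and collar map is equivariant. It is a local diffeomorphism near the zero section and the inclusion
on it, hence injective on a neighborhood (`exists_isOpen_injOn`), which compactness of G shrinks to
an invariant one (`isOpen_forall_mem_of_compactSpace`). -/

noncomputable section

set_option linter.unusedSectionVars false

namespace FoldedSymplectic

section

/-! ### Superposition operators on spaces of continuous functions -/

section Superposition

universe u w

open Set Filter

variable {K : Type w} [TopologicalSpace K] {X : Type u} [NormedAddCommGroup X] [NormedSpace ℝ X]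

/-- The family `g k : X → Y`, `k ∈ K`, has iterated derivatives up to order `n` which are jointly
continuous in `k` and in the point. -/
def ContDiffFamily : ℕ → ∀ {Y : Type u} [NormedAddCommGroup Y] [NormedSpace ℝ Y],
    (K → X → Y) → Prop
  | 0, _, _, _, g => Continuous (Function.uncurry g)
  | n + 1, _, _, _, g => Continuous (Function.uncurry g) ∧ (∀ k, Differentiable ℝ (g k)) ∧
      ContDiffFamily n (fun k x => fderiv ℝ (g k) x)

theorem ContDiffFamily.continuous {n : ℕ} {Y : Type u} [NormedAddCommGroup Y] [NormedSpace ℝ Y]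
    {g : K → X → Y} (h : ContDiffFamily n g) : Continuous (Function.uncurry g) := by
  cases n with
  | zero => exact h
  | succ n => exact h.1

variable [CompactSpace K] [T2Space K]

/-- The superposition operator `γ ↦ (k ↦ g k (γ k))` of a jointly continuous family. -/
def superposition {Y : Type*} [TopologicalSpace Y] (g : K → X → Y)
    (hg : Continuous (Function.uncurry g)) (γ : C(K, X)) : C(K, Y) :=
  ⟨fun k => g k (γ k), hg.comp (continuous_id.prodMk γ.continuous)⟩

theorem superposition_apply {Y : Type*} [TopologicalSpace Y] (g : K → X → Y)
    (hg : Continuous (Function.uncurry g)) (γ : C(K, X)) (k : K) :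
    superposition g hg γ k = g k (γ k) := rfl

theorem continuous_superposition {Y : Type*} [TopologicalSpace Y] (g : K → X → Y)
    (hg : Continuous (Function.uncurry g)) : Continuous (superposition g hg) := by
  apply ContinuousMap.continuous_of_continuous_uncurry
  have : Continuous fun p : C(K, X) × K => (p.2, p.1 p.2) := by fun_prop
  exact hg.comp this

/-- Pointwise application of a continuous family of operators to a continuous function. -/
def pointwiseApply (K : Type*) [TopologicalSpace K] [CompactSpace K] (X Y : Type*)
    [NormedAddCommGroup X] [NormedSpace ℝ X] [NormedAddCommGroup Y] [NormedSpace ℝ Y] :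
    C(K, X →L[ℝ] Y) →L[ℝ] C(K, X) →L[ℝ] C(K, Y) :=
  LinearMap.mkContinuous₂
    (LinearMap.mk₂ ℝ (fun (A : C(K, X →L[ℝ] Y)) (h : C(K, X)) => (⟨fun k => A k (h k), by fun_prop⟩ : C(K, Y)))
      (fun _ _ _ => by ext; simp) (fun _ _ _ => by ext; simp)
      (fun _ _ _ => by ext; simp) (fun _ _ _ => by ext; simp)) 1 (fun A h => by
        rw [ContinuousMap.norm_le _ (by positivity)]
        intro k
        calc ‖A k (h k)‖ ≤ ‖A k‖ * ‖h k‖ := (A k).le_opNorm _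
          _ ≤ ‖A‖ * ‖h‖ := by gcongr <;> exact ContinuousMap.norm_coe_le_norm _ _
          _ = 1 * ‖A‖ * ‖h‖ := by ring)

theorem pointwiseApply_apply {Y : Type*} [NormedAddCommGroup Y] [NormedSpace ℝ Y]
    (A : C(K, X →L[ℝ] Y)) (h : C(K, X)) (k : K) :
    pointwiseApply K X Y A h k = A k (h k) := rfl

/-- Continuity of the superposition operator of the derivative gives, for small h, an ε-bound on the
variation of the partial derivative along the segment from γ k to γ k + h k, uniformly in k. The
mean value inequality then bounds the remainder in sup norm. -/
theorem hasFDerivAt_superposition {Y : Type*} [NormedAddCommGroup Y] [NormedSpace ℝ Y]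
    (g : K → X → Y) (hg : Continuous (Function.uncurry g)) (hd : ∀ k, Differentiable ℝ (g k))
    (hg' : Continuous (Function.uncurry fun k x => fderiv ℝ (g k) x)) (γ : C(K, X)) :
    HasFDerivAt (superposition g hg) (pointwiseApply K X Y (superposition _ hg' γ)) γ := by
  rw [hasFDerivAt_iff_isLittleO_nhds_zero, Asymptotics.isLittleO_iff]
  intro ε hε
  obtain ⟨δ, hδ, hδ'⟩ := (Metric.continuous_iff (f := superposition _ hg')).1
    (continuous_superposition _ hg') γ ε hε
  filter_upwards [Metric.ball_mem_nhds (0 : C(K, X)) hδ] with h hh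
  rw [ContinuousMap.norm_le _ (by positivity)]
  intro k
  have key : ‖g k (γ k + h k) - g k (γ k) - fderiv ℝ (g k) (γ k) ((γ k + h k) - γ k)‖
      ≤ ε * ‖(γ k + h k) - γ k‖ := by
    apply Convex.norm_image_sub_le_of_norm_hasFDerivWithin_le' (f := g k)
      (f' := fun x => fderiv ℝ (g k) x) (s := segment ℝ (γ k) (γ k + h k))
    · exact fun x _ => ((hd k) x).hasFDerivAt.hasFDerivWithinAt
    · intro x hx
      rw [segment_eq_image'] at hx
      obtain ⟨τ, hτ, rfl⟩ := hx
      have h1 : dist (γ + τ • h) γ < δ := by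
        rw [dist_eq_norm]
        simp only [add_sub_cancel_left, norm_smul, Real.norm_eq_abs, abs_of_nonneg hτ.1]
        rw [mem_ball_zero_iff] at hh
        calc τ * ‖h‖ ≤ 1 * ‖h‖ := by gcongr; exact hτ.2
          _ < δ := by simpa using hh
      have h2 := (ContinuousMap.dist_apply_le_dist (f := superposition _ hg' (γ + τ • h))
        (g := superposition _ hg' γ) k).trans (hδ' _ h1).le
      rw [dist_eq_norm] at h2
      simpa [superposition_apply] using h2
    · exact convex_segment _ _
    · exact left_mem_segment _ _ _
    · exact right_mem_segment _ _ _
  calc _ = ‖g k (γ k + h k) - g k (γ k) - fderiv ℝ (g k) (γ k) ((γ k + h k) - γ k)‖ := by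
        simp [superposition_apply, pointwiseApply_apply]
    _ ≤ ε * ‖(γ k + h k) - γ k‖ := key
    _ ≤ ε * ‖h‖ := by
        rw [add_sub_cancel_left]
        gcongr
        exact ContinuousMap.norm_coe_le_norm _ _

/-- The derivative is a fixed continuous linear map applied to the superposition operator of the
derivative family, so the order of smoothness goes up by induction. -/
theorem ContDiffFamily.contDiff_superposition (n : ℕ) : ∀ {Y : Type u} [NormedAddCommGroup Y]
    [NormedSpace ℝ Y] {g : K → X → Y} (h : ContDiffFamily n g),
    ContDiff ℝ n (superposition g h.continuous) := by
  induction n with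
  | zero => exact fun h => contDiff_zero.2 (continuous_superposition _ _)
  | succ n ih =>
    intro Y _ _ g h
    have hF := hasFDerivAt_superposition g h.1 h.2.1 h.2.2.continuous
    push_cast
    rw [contDiff_succ_iff_fderiv]
    refine ⟨fun γ => (hF γ).differentiableAt, by simp, ?_⟩
    rw [show fderiv ℝ (superposition g h.continuous) = fun γ =>
      pointwiseApply K X Y (superposition _ h.2.2.continuous γ) from funext fun γ => (hF γ).fderiv]
    exact (pointwiseApply K X Y).contDiff.comp (ih h.2.2)

theorem contDiff_superposition {Y : Type u} [NormedAddCommGroup Y]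
    [NormedSpace ℝ Y] {g : K → X → Y} (h : ∀ n, ContDiffFamily n g) :
    ContDiff ℝ ∞ (superposition g (h 0)) :=
  contDiff_infty.2 fun n => (h n).contDiff_superposition

/-- A jointly smooth function of a real parameter gives a smooth family. -/
theorem ContDiff.contDiffFamily {X : Type} [NormedAddCommGroup X] [NormedSpace ℝ X]
    {s : Set ℝ} (n : ℕ) : ∀ {Y : Type} [NormedAddCommGroup Y] [NormedSpace ℝ Y] {f : ℝ × X → Y}
    (_ : ContDiff ℝ ∞ f), ContDiffFamily n (fun (k : s) x => f (k, x)) := by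
  induction n with
  | zero =>
    intro Y _ _ f hf
    exact hf.continuous.comp (by fun_prop : Continuous fun p : s × X => ((p.1 : ℝ), p.2))
  | succ n ih =>
    intro Y _ _ f hf
    have hd : ∀ (k : s) x, HasFDerivAt (fun x => f (k, x))
        ((fderiv ℝ f (k, x)).comp (ContinuousLinearMap.inr ℝ ℝ X)) x := fun k x =>
      ((hf.differentiable (by simp)) _).hasFDerivAt.comp x (hasFDerivAt_prodMk_right _ _)
    refine ⟨hf.continuous.comp (by fun_prop : Continuous fun p : s × X => ((p.1 : ℝ), p.2)),
      fun k x => (hd k x).differentiableAt, ?_⟩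
    have h2 : ContDiff ℝ ∞ fun q : ℝ × X =>
        (fderiv ℝ f q).comp (ContinuousLinearMap.inr ℝ ℝ X) :=
      (hf.fderiv_right (by simp)).clm_comp contDiff_const
    have := ih h2
    convert this using 3 with k x
    exact (hd k x).fderiv

end Superposition

/-! ### Smooth cutoffs -/

section Cutoff

open Set

/-- A function that is smooth on a neighborhood of a compact set agrees near it with a globally
smooth function. -/
theorem exists_contDiff_eqOn_nhds {X Y : Type*} [NormedAddCommGroup X] [NormedSpace ℝ X]
    [FiniteDimensional ℝ X] [NormedAddCommGroup Y] [NormedSpace ℝ Y] {f : X → Y} {Ω C : Set X}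
    (hΩ : IsOpen Ω) (hC : IsCompact C) (hCΩ : C ⊆ Ω) (hf : ContDiffOn ℝ ∞ f Ω) :
    ∃ (g : X → Y) (O : Set X), ContDiff ℝ ∞ g ∧ IsOpen O ∧ C ⊆ O ∧ O ⊆ Ω ∧ EqOn g f O := by
  -- The cutoff χ equals 1 on the closure of O and vanishes off O', whose closure lies in Ω; hence χ
  -- f agrees with f on O and extends by zero beyond Ω.
  obtain ⟨O, hO, hCO, hOΩ, hOc⟩ := exists_open_between_and_isCompact_closure hC hΩ hCΩ
  obtain ⟨O', hO', hCO', hOO', hOc'⟩ := exists_open_between_and_isCompact_closure hOc hΩ hOΩ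
  obtain ⟨χ, hχ, -, hχs, hχ1⟩ := exists_contMDiff_support_eq_eq_one_iff (n := (⊤ : ℕ∞)) 𝓘(ℝ, X) hO'
    (isClosed_closure (s := O)) hCO'
  refine ⟨fun x => χ x • f x, O, ?_, hO, hCO, subset_closure.trans hOΩ, fun x hx => ?_⟩
  · rw [contDiff_iff_contDiffAt]
    intro x
    by_cases hx : x ∈ Ω
    · exact hχ.contDiff.contDiffAt.smul (hf.contDiffAt (hΩ.mem_nhds hx))
    · have : (fun x => χ x • f x) =ᶠ[𝓝 x] fun _ => 0 := by
        have hx' : (closure O')ᶜ ∈ 𝓝 x := isClosed_closure.isOpen_compl.mem_nhds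
          fun h => hx (hOO' h)
        filter_upwards [hx'] with y hy
        have : χ y = 0 := by
          by_contra h0
          exact hy (subset_closure (hχs ▸ (show y ∈ Function.support χ from h0)))
        simp [this]
      exact contDiffAt_const.congr_of_eventuallyEq this
  · have : χ x = 1 := (hχ1 x).1 (subset_closure hx)
    simp [this]

end Cutoff

end

end FoldedSymplectic

namespace FoldedSymplectic

section

open Set Filter

/-! ### Smooth local inverses -/

/-- Restricting the local inverse to the open set where the derivative of f is invertible makes the
inverse smooth at every point of its domain, not only at the image of a. -/
theorem exists_smooth_localInverse {E F : Type*} [NormedAddCommGroup E] [NormedSpace ℝ E]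
    [CompleteSpace E] [NormedAddCommGroup F] [NormedSpace ℝ F] {f : E → F} {s : Set E} {a : E}
    (hs : IsOpen s) (ha : a ∈ s) (hf : ContDiffOn ℝ ∞ f s) (f' : E ≃L[ℝ] F)
    (hf' : HasFDerivAt f (f' : E →L[ℝ] F) a) :
    ∃ e : OpenPartialHomeomorph E F, a ∈ e.source ∧ e.source ⊆ s ∧ (e : E → F) = f ∧
      ContDiffOn ℝ ∞ e.symm e.target := by
  have hfa : ContDiffAt ℝ ∞ f a := hf.contDiffAt (hs.mem_nhds ha)
  set e₀ := hfa.toOpenPartialHomeomorph f hf' (by simp)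
  have hinv : IsOpen (s ∩ fderiv ℝ f ⁻¹' range ((↑) : (E ≃L[ℝ] F) → E →L[ℝ] F)) :=
    (hf.continuousOn_fderiv_of_isOpen hs (by simp)).isOpen_inter_preimage hs
      ContinuousLinearEquiv.isOpen
  set e := e₀.restrOpen _ hinv
  have hee : (e : E → F) = f := rfl
  refine ⟨e, ⟨hfa.mem_toOpenPartialHomeomorph_source hf' (by simp), ha, ⟨f', hf'.fderiv.symm⟩⟩,
    fun x hx => hx.2.1, hee, fun y hy => ?_⟩
  have hx := e.map_target hy
  obtain ⟨A, hA⟩ := hx.2.2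
  have hxa : ContDiffAt ℝ ∞ f (e.symm y) := hf.contDiffAt (hs.mem_nhds hx.2.1)
  refine (e.contDiffAt_symm (f₀' := A) hy ?_ ?_).contDiffWithinAt
  · rw [hA, hee]
    exact (hxa.differentiableAt (by simp)).hasFDerivAt
  · rwa [hee]

/-! ### Integration of curves on the unit interval -/

section Integrals

variable {E : Type*} [NormedAddCommGroup E] [NormedSpace ℝ E]

/-- The constant functions on the unit interval, as a continuous linear map. -/
def constCurve (E : Type*) [NormedAddCommGroup E] [NormedSpace ℝ E] :
    E →L[ℝ] C(Icc (0 : ℝ) 1, E) :=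
  LinearMap.mkContinuous
    { toFun := fun x => ContinuousMap.const _ x
      map_add' := fun _ _ => rfl
      map_smul' := fun _ _ => rfl } 1 (fun x => by
        rw [one_mul, ContinuousMap.norm_le _ (norm_nonneg _)]
        exact fun _ => le_rfl)

@[simp] theorem constCurve_apply (x : E) (k : Icc (0 : ℝ) 1) : constCurve E x k = x := rfl

/-- The evaluation of curves on the unit interval, as a continuous linear map. -/
def evalCurve (E : Type*) [NormedAddCommGroup E] [NormedSpace ℝ E] (k : Icc (0 : ℝ) 1) :
    C(Icc (0 : ℝ) 1, E) →L[ℝ] E :=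
  LinearMap.mkContinuous
    { toFun := fun γ => γ k
      map_add' := fun _ _ => rfl
      map_smul' := fun _ _ => rfl } 1 (fun γ => by
        rw [one_mul]
        exact γ.norm_coe_le_norm k)

@[simp] theorem evalCurve_apply (γ : C(Icc (0 : ℝ) 1, E)) (k : Icc (0 : ℝ) 1) :
    evalCurve E k γ = γ k := rfl

/-- The extension of a curve on the unit interval by constants. -/
def extendCurve (γ : C(Icc (0 : ℝ) 1, E)) (s : ℝ) : E := γ (projIcc 0 1 zero_le_one s)

theorem continuous_extendCurve (γ : C(Icc (0 : ℝ) 1, E)) : Continuous (extendCurve γ) :=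
  γ.continuous.comp continuous_projIcc

theorem extendCurve_of_mem (γ : C(Icc (0 : ℝ) 1, E)) {s : ℝ} (hs : s ∈ Icc (0 : ℝ) 1) :
    extendCurve γ s = γ ⟨s, hs⟩ := by
  rw [extendCurve, projIcc_of_mem]

variable [CompleteSpace E]

/-- The primitive `s ↦ ∫₀ˢ γ` of a curve on the unit interval. -/
def primitiveCurve (E : Type*) [NormedAddCommGroup E] [NormedSpace ℝ E] [CompleteSpace E] :
    C(Icc (0 : ℝ) 1, E) →L[ℝ] C(Icc (0 : ℝ) 1, E) :=
  LinearMap.mkContinuous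
    { toFun := fun γ => ⟨fun s => ∫ r in (0 : ℝ)..s, extendCurve γ r,
        (intervalIntegral.continuous_primitive
          (fun a b => (continuous_extendCurve γ).intervalIntegrable a b) 0).comp
            continuous_subtype_val⟩
      map_add' := fun γ η => by
        ext s
        exact intervalIntegral.integral_add ((continuous_extendCurve γ).intervalIntegrable _ _)
          ((continuous_extendCurve η).intervalIntegrable _ _)
      map_smul' := fun c γ => by
        ext s
        exact intervalIntegral.integral_smul c _ } 1 (fun γ => by
        rw [one_mul, ContinuousMap.norm_le _ (norm_nonneg _)]
        intro s
        have := intervalIntegral.norm_integral_le_of_norm_le_const (a := 0) (b := s)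
          (f := extendCurve γ) (C := ‖γ‖) (fun r _ => γ.norm_coe_le_norm _)
        refine this.trans ?_
        rw [sub_zero, abs_of_nonneg s.2.1]
        exact mul_le_of_le_one_right (norm_nonneg _) s.2.2)

theorem primitiveCurve_apply (γ : C(Icc (0 : ℝ) 1, E)) (s : Icc (0 : ℝ) 1) :
    primitiveCurve E γ s = ∫ r in (0 : ℝ)..s, extendCurve γ r := rfl

theorem hasDerivWithinAt_extendCurve_primitiveCurve (γ : C(Icc (0 : ℝ) 1, E)) {s : ℝ}
    (hs : s ∈ Icc (0 : ℝ) 1) :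
    HasDerivWithinAt (extendCurve (primitiveCurve E γ)) (extendCurve γ s) (Icc 0 1) s := by
  have h := ((continuous_extendCurve γ).integral_hasStrictDerivAt 0 s).hasDerivAt.hasDerivWithinAt
    (s := Icc 0 1)
  refine h.congr (fun r hr => ?_) ?_
  · rw [extendCurve_of_mem _ hr]; rfl
  · rw [extendCurve_of_mem _ hs]; rfl

/-- Integrals over the unit interval depend smoothly on parameters. -/
theorem contDiffOn_integral_unitInterval {X Y : Type} [NormedAddCommGroup X] [NormedSpace ℝ X]
    [FiniteDimensional ℝ X] [NormedAddCommGroup Y] [NormedSpace ℝ Y] [CompleteSpace Y]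
    {f : ℝ × X → Y} {Ω : Set (ℝ × X)} (hΩ : IsOpen Ω) (hf : ContDiffOn ℝ ∞ f Ω) {O : Set X}
    (hO : ∀ x ∈ O, ∀ r ∈ Icc (0 : ℝ) 1, (r, x) ∈ Ω) :
    ContDiffOn ℝ ∞ (fun x => ∫ r in (0 : ℝ)..1, f (r, x)) O := by
  intro x₀ hx₀
  apply ContDiffAt.contDiffWithinAt
  obtain ⟨g, O₁, hg, hO₁, hC, -, hgf⟩ := exists_contDiff_eqOn_nhds hΩ
    (isCompact_Icc.prod isCompact_singleton : IsCompact (Icc (0 : ℝ) 1 ×ˢ {x₀}))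
    (by rintro ⟨r, x⟩ ⟨hr, rfl⟩; exact hO _ hx₀ r hr) hf
  obtain ⟨u, v, hu, hv, hu', hv', huv⟩ := generalized_tube_lemma isCompact_Icc
    (isCompact_singleton (x := x₀)) hO₁ hC
  -- The integral is a composite of constant curve, superposition, primitive and evaluation at 1,
  -- all smooth maps between normed spaces.
  have hs : ContDiff ℝ ∞ fun x => primitiveCurve Y
      (superposition (fun (k : Icc (0 : ℝ) 1) x => g (k, x)) (ContDiff.contDiffFamily 0 hg)
        (constCurve X x)) ⟨1, by simp⟩ := by
    have h1 := contDiff_superposition (fun n => ContDiff.contDiffFamily (s := Icc (0 : ℝ) 1) n hg)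
    have h2 : ContDiff ℝ ∞ fun γ : C(Icc (0 : ℝ) 1, Y) => γ ⟨1, by simp⟩ :=
      (evalCurve Y ⟨1, by simp⟩).contDiff
    exact h2.comp ((primitiveCurve Y).contDiff.comp (h1.comp (constCurve X).contDiff))
  refine hs.contDiffAt.congr_of_eventuallyEq ?_
  filter_upwards [hv.mem_nhds (hv' rfl)] with x hx
  rw [primitiveCurve_apply]
  refine intervalIntegral.integral_congr fun r hr => ?_
  rw [uIcc_of_le zero_le_one] at hr
  rw [extendCurve_of_mem _ hr]
  exact (hgf (huv ⟨hu' hr, hx⟩)).symm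

end Integrals

/-! ### Smooth dependence of solutions of differential equations -/

section Flow

variable {P E : Type} [NormedAddCommGroup P] [NormedSpace ℝ P] [FiniteDimensional ℝ P]
  [NormedAddCommGroup E] [NormedSpace ℝ E] [FiniteDimensional ℝ E]

/-- The pairing of a parameter and a curve. -/
def pairCurve (P E : Type*) [NormedAddCommGroup P] [NormedSpace ℝ P]
    [NormedAddCommGroup E] [NormedSpace ℝ E] :
    P × C(Icc (0 : ℝ) 1, E) →L[ℝ] C(Icc (0 : ℝ) 1, P × E) :=
  ((ContinuousLinearMap.inl ℝ P E).compLeftContinuous ℝ _).comp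
      ((constCurve P).comp (ContinuousLinearMap.fst ℝ _ _)) +
    ((ContinuousLinearMap.inr ℝ P E).compLeftContinuous ℝ _).comp
      (ContinuousLinearMap.snd ℝ _ _)

theorem pairCurve_apply (q : P × C(Icc (0 : ℝ) 1, E)) (k : Icc (0 : ℝ) 1) :
    pairCurve P E q k = (q.1, q.2 k) := by
  simp [pairCurve]

/-- Existence and smooth dependence on parameters of the solutions on the unit time interval of
`γ' = f(s, p, γ)`, `γ(0) = ι p`, near a parameter where the solution is stationary and the equation
has vanishing linearization in the space direction. -/
theorem exists_smooth_solution (ι : P →L[ℝ] E) (p₀ : P) {Ω : Set (ℝ × P × E)} (hΩ : IsOpen Ω)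
    (h0 : ∀ s ∈ Icc (0 : ℝ) 1, (s, p₀, ι p₀) ∈ Ω) {f : ℝ × P × E → E} (hf : ContDiffOn ℝ ∞ f Ω)
    (hf0 : ∀ s ∈ Icc (0 : ℝ) 1, f (s, p₀, ι p₀) = 0)
    (hf' : ∀ s ∈ Icc (0 : ℝ) 1, ∀ v : E, fderiv ℝ f (s, p₀, ι p₀) (0, 0, v) = 0) :
    ∃ O : Set P, IsOpen O ∧ p₀ ∈ O ∧ ∃ Γ : P → C(Icc (0 : ℝ) 1, E), ContDiffOn ℝ ∞ Γ O ∧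
      (∀ s ∈ Icc (0 : ℝ) 1, extendCurve (Γ p₀) s = ι p₀) ∧
      ∀ p ∈ O, extendCurve (Γ p) 0 = ι p ∧
        (∀ s ∈ Icc (0 : ℝ) 1, (s, p, extendCurve (Γ p) s) ∈ Ω ∧
          HasDerivWithinAt (extendCurve (Γ p)) (f (s, p, extendCurve (Γ p) s)) (Icc 0 1) s) ∧
        ∀ u : P, extendCurve (fderiv ℝ Γ p u) 0 = ι u ∧ ∀ s ∈ Icc (0 : ℝ) 1,
          HasDerivWithinAt (extendCurve (fderiv ℝ Γ p u))
            (fderiv ℝ f (s, p, extendCurve (Γ p) s) (0, u, extendCurve (fderiv ℝ Γ p u) s))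
            (Icc 0 1) s := by
  -- Near the stationary trajectory f is replaced by a globally smooth g, so that the superposition
  -- operator is defined on all curves.
  obtain ⟨g, O₁, hg, hO₁, hC, hOΩ, hgf⟩ := exists_contDiff_eqOn_nhds hΩ
    (isCompact_Icc.prod isCompact_singleton : IsCompact (Icc (0 : ℝ) 1 ×ˢ {(p₀, ι p₀)}))
    (by rintro ⟨r, x⟩ ⟨hr, rfl⟩; exact h0 r hr) hf
  have hC' : ∀ s ∈ Icc (0 : ℝ) 1, (s, p₀, ι p₀) ∈ O₁ := fun s hs => hC ⟨hs, rfl⟩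
  have hgf' : ∀ x ∈ O₁, fderiv ℝ g x = fderiv ℝ f x := fun x hx =>
    (hgf.eventuallyEq_of_mem (hO₁.mem_nhds hx)).fderiv_eq
  have hfam := fun n => ContDiff.contDiffFamily (s := Icc (0 : ℝ) 1) n hg
  have hg0 : Continuous (Function.uncurry fun (k : Icc (0 : ℝ) 1) (x : P × E) => g (k, x)) :=
    hfam 0
  have hg1 : Continuous (Function.uncurry fun (k : Icc (0 : ℝ) 1) (x : P × E) =>
    fderiv ℝ (fun x => g (k, x)) x) := (hfam 1).2.2
  set N := superposition (fun (k : Icc (0 : ℝ) 1) (x : P × E) => g (k, x)) hg0 with hN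
  have hNs : ContDiff ℝ ∞ N := contDiff_superposition hfam
  have hgd : ∀ (k : Icc (0 : ℝ) 1) (x : P × E), HasFDerivAt (fun x => g (k, x))
      ((fderiv ℝ g (k, x)).comp (ContinuousLinearMap.inr ℝ ℝ (P × E))) x := fun k x =>
    ((hg.differentiable (by simp)) _).hasFDerivAt.comp x (hasFDerivAt_prodMk_right _ _)
  have hNd : ∀ η h k, fderiv ℝ N η h k = fderiv ℝ g (k, η k) (0, h k) := by
    intro η h k
    have := hasFDerivAt_superposition (fun (k : Icc (0 : ℝ) 1) (x : P × E) => g (k, x)) hg0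
      (hfam 1).2.1 hg1 η
    rw [hN, this.fderiv, pointwiseApply_apply, superposition_apply, (hgd k (η k)).fderiv]
    rfl
  -- The Picard operator: γ = T(p, γ) is the integral form of the initial value problem with
  -- parameter p.
  set T : P × C(Icc (0 : ℝ) 1, E) → C(Icc (0 : ℝ) 1, E) := fun q =>
    constCurve E (ι q.1) + primitiveCurve E (N (pairCurve P E q)) with hT
  have hTd : ∀ q, HasFDerivAt T (((constCurve E).comp (ι.comp (ContinuousLinearMap.fst ℝ _ _))) +
      (primitiveCurve E).comp ((fderiv ℝ N (pairCurve P E q)).comp (pairCurve P E))) q := by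
    intro q
    refine HasFDerivAt.add ?_ ?_
    · exact (constCurve E).hasFDerivAt.comp q (ι.hasFDerivAt.comp q hasFDerivAt_fst)
    · exact (primitiveCurve E).hasFDerivAt.comp q
        (((hNs.differentiable (by simp)) _).hasFDerivAt.comp q (pairCurve P E).hasFDerivAt)
  have hTs : ContDiff ℝ ∞ T :=
    ((constCurve E).contDiff.comp (ι.contDiff.comp contDiff_fst)).add
      ((primitiveCurve E).contDiff.comp (hNs.comp (pairCurve P E).contDiff))
  set q₀ : P × C(Icc (0 : ℝ) 1, E) := (p₀, constCurve E (ι p₀)) with hq₀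
  have hTq₀ : T q₀ = q₀.2 := by
    have : N (pairCurve P E q₀) = 0 := by
      ext k
      rw [hN, superposition_apply, pairCurve_apply]
      simp only [hq₀, constCurve_apply, ContinuousMap.zero_apply]
      rw [hgf (hC' k k.2), hf0 k k.2]
    change constCurve E (ι p₀) + primitiveCurve E (N (pairCurve P E q₀)) = _
    rw [this, map_zero, add_zero]
  set T' := fderiv ℝ T q₀ with hT'
  have hT'0 : ∀ η, T' (0, η) = 0 := by
    intro η
    rw [hT', (hTd q₀).fderiv]
    have : fderiv ℝ N (pairCurve P E q₀) (pairCurve P E (0, η)) = 0 := by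
      ext k
      rw [hNd, pairCurve_apply, pairCurve_apply]
      simp only [hq₀, constCurve_apply, ContinuousMap.zero_apply]
      rw [hgf' _ (hC' k k.2), hf' k k.2]
    simp [this]
  -- Since T has vanishing derivative in the curve direction at the base point, the derivative of F
  -- there is unipotent with explicit inverse. The inverse function theorem therefore works on the
  -- whole unit interval, with no smallness of time.
  set F : P × C(Icc (0 : ℝ) 1, E) → P × C(Icc (0 : ℝ) 1, E) := fun q => (q.1, q.2 - T q) with hF
  have hFs : ContDiff ℝ ∞ F := contDiff_fst.prodMk (contDiff_snd.sub hTs)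
  set A : (P × C(Icc (0 : ℝ) 1, E)) ≃L[ℝ] P × C(Icc (0 : ℝ) 1, E) :=
    ContinuousLinearEquiv.equivOfInverse
      ((ContinuousLinearMap.fst ℝ _ _).prod (ContinuousLinearMap.snd ℝ _ _ - T'))
      ((ContinuousLinearMap.fst ℝ _ _).prod (ContinuousLinearMap.snd ℝ _ _ +
        T'.comp ((ContinuousLinearMap.inl ℝ _ _).comp (ContinuousLinearMap.fst ℝ _ _))))
      (fun q => by
        have : T' q = T' (q.1, 0) := by
          rw [show q = (q.1, 0) + (0, q.2) by simp, map_add, hT'0]; simp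
        simp [this])
      (fun q => by
        have : ∀ x, T' (q.1, x) = T' (q.1, 0) := fun x => by
          rw [show ((q.1, x) : P × C(Icc (0 : ℝ) 1, E)) = (q.1, 0) + (0, x) by simp, map_add, hT'0]
          simp
        simp [this (q.2 + _)])
  have hFA : HasFDerivAt F (A : _ →L[ℝ] P × C(Icc (0 : ℝ) 1, E)) q₀ := by
    have h2 : HasFDerivAt T T' q₀ := (hTd q₀).differentiableAt.hasFDerivAt
    exact hasFDerivAt_fst.prodMk (hasFDerivAt_snd.sub h2)
  -- Curves that stay where g agrees with f; open by compactness of the interval.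
  set S : Set (P × C(Icc (0 : ℝ) 1, E)) :=
    {q | ∀ k : Icc (0 : ℝ) 1, ((k : ℝ), q.1, q.2 k) ∈ O₁} with hS
  have hSo : IsOpen S := by
    have hc : Continuous fun q : P × C(Icc (0 : ℝ) 1, E) =>
        (⟨fun k => ((k : ℝ), pairCurve P E q k), by fun_prop⟩ :
          C(Icc (0 : ℝ) 1, ℝ × P × E)) := by
      apply ContinuousMap.continuous_of_continuous_uncurry
      simp only [pairCurve_apply]
      change Continuous fun z : (P × C(Icc (0 : ℝ) 1, E)) × Icc (0 : ℝ) 1 =>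
        ((z.2 : ℝ), z.1.1, z.1.2 z.2)
      fun_prop
    have := (ContinuousMap.isOpen_setOfPred_mapsTo (isCompact_univ (X := Icc (0 : ℝ) 1)) hO₁).preimage hc
    convert this using 1
    ext q
    simp [hS, MapsTo, pairCurve_apply]
  have hqS : q₀ ∈ S := fun k => hC' k k.2
  obtain ⟨e, hqe, heS, heF, hes⟩ := exists_smooth_localInverse hSo hqS hFs.contDiffOn A hFA
  have heq₀ : e q₀ = (p₀, 0) := by
    rw [heF]
    exact Prod.ext rfl (sub_eq_zero.2 hTq₀.symm)
  set j : P → P × C(Icc (0 : ℝ) 1, E) := fun p => (p, 0) with hj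
  have hjs : ContDiff ℝ ∞ j := contDiff_id.prodMk contDiff_const
  set O : Set P := j ⁻¹' e.target with hO
  have hOo : IsOpen O := e.open_target.preimage hjs.continuous
  -- F(p, γ) = (p, 0) says exactly that γ is a fixed point of T(p, ·).
  set Γ : P → C(Icc (0 : ℝ) 1, E) := fun p => (e.symm (j p)).2 with hΓ
  have hΓs : ContDiffOn ℝ ∞ Γ O :=
    contDiff_snd.comp_contDiffOn (hes.comp hjs.contDiffOn fun p hp => hp)
  have hp₀ : p₀ ∈ O := by
    have := e.map_source hqe
    rwa [heq₀] at this
  have hΓp₀ : Γ p₀ = constCurve E (ι p₀) := by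
    simp only [hΓ, hj]
    rw [← heq₀, e.left_inv hqe]
  have hΓp : ∀ p ∈ O, (p, Γ p) ∈ S ∧ Γ p = T (p, Γ p) := by
    intro p hp
    have h1 : e (e.symm (j p)) = j p := e.right_inv hp
    rw [heF] at h1
    have h2 : (e.symm (j p)).1 = p := congrArg Prod.fst h1
    have h3 : (p, Γ p) = e.symm (j p) := Prod.ext h2.symm rfl
    refine ⟨h3 ▸ heS (e.map_target hp), ?_⟩
    have h4 := congrArg Prod.snd h1
    rw [← h3] at h4
    exact sub_eq_zero.1 h4
  refine ⟨O, hOo, hp₀, Γ, hΓs, fun s hs => by rw [hΓp₀, extendCurve_of_mem _ hs]; rfl,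
    fun p hp => ?_⟩
  obtain ⟨hpS, hpT⟩ := hΓp p hp
  have hmem : ∀ s (hs : s ∈ Icc (0 : ℝ) 1), (s, p, extendCurve (Γ p) s) ∈ O₁ := fun s hs => by
    rw [extendCurve_of_mem _ hs]; exact hpS ⟨s, hs⟩
  have hext : ∀ (x : E) (η : C(Icc (0 : ℝ) 1, E)) (s : ℝ),
      extendCurve (constCurve E x + primitiveCurve E η) s = x + extendCurve (primitiveCurve E η) s :=
    fun x η s => rfl
  have hext0 : ∀ (x : E) (η : C(Icc (0 : ℝ) 1, E)),
      extendCurve (constCurve E x + primitiveCurve E η) 0 = x := fun x η => by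
    rw [hext, extendCurve_of_mem _ (by simp), primitiveCurve_apply]; simp
  have hextd : ∀ (x : E) (η : C(Icc (0 : ℝ) 1, E)), ∀ s ∈ Icc (0 : ℝ) 1, HasDerivWithinAt
      (extendCurve (constCurve E x + primitiveCurve E η)) (extendCurve η s) (Icc 0 1) s :=
    fun x η s hs => (hasDerivWithinAt_extendCurve_primitiveCurve η hs).const_add x
  refine ⟨?_, fun s hs => ⟨hOΩ (hmem s hs), ?_⟩, fun u => ?_⟩
  · rw [hpT]; exact hext0 _ _
  · have h1 := hextd (ι p) (N (pairCurve P E (p, Γ p))) s hs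
    have h2 : extendCurve (N (pairCurve P E (p, Γ p))) s = f (s, p, extendCurve (Γ p) s) := by
      rw [← hgf (hmem s hs), extendCurve_of_mem _ hs, extendCurve_of_mem _ hs, hN,
        superposition_apply, pairCurve_apply]
    rw [h2] at h1
    change HasDerivWithinAt (extendCurve (T (p, Γ p))) _ _ _ at h1
    rwa [← hpT] at h1
  · have hd : HasFDerivAt Γ (fderiv ℝ Γ p) p :=
      ((hΓs.contDiffAt (hOo.mem_nhds hp)).differentiableAt (by simp)).hasFDerivAt
    -- Differentiating Γ p = T(p, Γ p) in p gives the variational equation in integral form.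
    have h1 : HasFDerivAt (fun p => T (p, Γ p)) _ p :=
      (hTd (p, Γ p)).comp p ((hasFDerivAt_id p).prodMk hd)
    have h2 : (fun p => T (p, Γ p)) =ᶠ[𝓝 p] Γ := by
      filter_upwards [hOo.mem_nhds hp] with p hp using (hΓp p hp).2.symm
    have h3 := (h2.hasFDerivAt_iff.1 h1).unique hd
    set η := fderiv ℝ N (pairCurve P E (p, Γ p)) (pairCurve P E (u, fderiv ℝ Γ p u)) with hη
    have h4 : fderiv ℝ Γ p u = constCurve E (ι u) + primitiveCurve E η := by
      conv_lhs => rw [← h3]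
      simp [hη]
    refine ⟨by rw [h4]; exact hext0 _ _, fun s hs => ?_⟩
    have h5 := hextd (ι u) η s hs
    rw [← h4] at h5
    convert h5 using 1
    rw [← hgf' _ (hmem s hs), extendCurve_of_mem _ hs, extendCurve_of_mem _ hs,
      extendCurve_of_mem _ hs, hη, hNd, pairCurve_apply, pairCurve_apply]

end Flow

end

end FoldedSymplectic

namespace FoldedSymplectic

section

open Set Filter

/-! ### Alternating forms as bilinear maps -/

section Bilinear

variable {Q Q' : Type*} [NormedAddCommGroup Q] [NormedSpace ℝ Q]
  [NormedAddCommGroup Q'] [NormedSpace ℝ Q']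

/-- Linear forms as alternating one-forms. -/
def oneForm (Q : Type*) [NormedAddCommGroup Q] [NormedSpace ℝ Q] :
    (Q →L[ℝ] ℝ) →L[ℝ] Q [⋀^Fin 1]→L[ℝ] ℝ :=
  (ContinuousAlternatingMap.ofSubsingletonLIE (𝕜 := ℝ) (E := Q) (F := ℝ) (0 : Fin 1)).toContinuousLinearEquiv

@[simp] theorem oneForm_apply (f : Q →L[ℝ] ℝ) (v : Fin 1 → Q) : oneForm Q f v = f (v 0) := rfl

/-- Alternating one-forms as linear forms. -/
def ofOneForm (Q : Type*) [NormedAddCommGroup Q] [NormedSpace ℝ Q] :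
    (Q [⋀^Fin 1]→L[ℝ] ℝ) →L[ℝ] Q →L[ℝ] ℝ :=
  (ContinuousAlternatingMap.ofSubsingletonLIE (𝕜 := ℝ) (E := Q) (F := ℝ) (0 : Fin 1)).symm.toContinuousLinearEquiv

@[simp] theorem ofOneForm_apply (η : Q [⋀^Fin 1]→L[ℝ] ℝ) (v : Q) : ofOneForm Q η v = η ![v] := by
  obtain ⟨f, rfl⟩ : ∃ f, oneForm Q f = η :=
    (ContinuousAlternatingMap.ofSubsingletonLIE (𝕜 := ℝ) (E := Q) (F := ℝ) (0 : Fin 1)).surjective η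
  have : ofOneForm Q (oneForm Q f) = f :=
    (ContinuousAlternatingMap.ofSubsingletonLIE (𝕜 := ℝ) (E := Q) (F := ℝ) (0 : Fin 1)).symm_apply_apply f
  rw [this]; simp

/-- Alternating two-forms as bilinear maps. -/
def toBilin (Q : Type*) [NormedAddCommGroup Q] [NormedSpace ℝ Q] :
    (Q [⋀^Fin 2]→L[ℝ] ℝ) →L[ℝ] Q →L[ℝ] Q →L[ℝ] ℝ :=
  (ContinuousLinearMap.compL ℝ Q (Q [⋀^Fin 1]→L[ℝ] ℝ) (Q →L[ℝ] ℝ) (ofOneForm Q)).comp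
    (ContinuousAlternatingMap.curryLeftLI : (Q [⋀^Fin 2]→L[ℝ] ℝ) →ₗᵢ[ℝ] _).toContinuousLinearMap

@[simp] theorem toBilin_apply (ψ : Q [⋀^Fin 2]→L[ℝ] ℝ) (u v : Q) :
    toBilin Q ψ u v = ψ ![u, v] := by
  change ofOneForm Q (ψ.curryLeft u) v = _
  rw [ofOneForm_apply]
  rfl

theorem contDiff_toBilin {n : WithTop ℕ∞} :
    ContDiff ℝ n (fun ψ : Q [⋀^Fin 2]→L[ℝ] ℝ => toBilin Q ψ) := by
  have h1 : ContDiff ℝ n (fun ψ : Q [⋀^Fin 2]→L[ℝ] ℝ => ψ.curryLeft) :=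
    IsBoundedLinearMap.contDiff ⟨⟨fun _ _ => rfl, fun _ _ => rfl⟩, 1, one_pos, fun x => by
      rw [ContinuousAlternatingMap.norm_curryLeft, one_mul]⟩
  have h2 : ContDiff ℝ n (fun f : Q →L[ℝ] Q [⋀^Fin 1]→L[ℝ] ℝ => (ofOneForm Q).comp f) :=
    contDiff_const.clm_comp contDiff_id
  exact h2.comp h1

theorem contDiff_oneForm {n : WithTop ℕ∞} :
    ContDiff ℝ n (fun f : Q →L[ℝ] ℝ => oneForm Q f) :=
  ContinuousLinearMap.contDiff (oneForm Q)

theorem toBilin_injective : Function.Injective (toBilin Q) := by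
  intro ψ η h
  ext v
  have : v = ![v 0, v 1] := by ext i; fin_cases i <;> rfl
  rw [this, ← toBilin_apply, ← toBilin_apply, h]

theorem form_swap (ψ : Q [⋀^Fin 2]→L[ℝ] ℝ) (u v : Q) : ψ ![u, v] = -ψ ![v, u] := by
  have h := ψ.toAlternatingMap.map_swap ![v, u] (i := 0) (j := 1) (by decide)
  have e : (![v, u] : Fin 2 → Q) ∘ (Equiv.swap (0 : Fin 2) 1) = ![u, v] := by
    ext i; fin_cases i <;> rfl
  rw [e] at h
  exact h

theorem form_self (ψ : Q [⋀^Fin 2]→L[ℝ] ℝ) (u : Q) : ψ ![u, u] = 0 := by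
  have := form_swap ψ u u
  linarith

theorem toBilin_comp (ψ : Q' [⋀^Fin 2]→L[ℝ] ℝ) (A : Q →L[ℝ] Q') (u v : Q) :
    toBilin Q (ψ.compContinuousLinearMap A) u v = toBilin Q' ψ (A u) (A v) := by
  rw [toBilin_apply, toBilin_apply, ContinuousAlternatingMap.compContinuousLinearMap_apply]
  congr 1
  ext i; fin_cases i <;> rfl

theorem comp_form_apply (ψ : Q' [⋀^Fin 2]→L[ℝ] ℝ) (A : Q →L[ℝ] Q') (u v : Q) :
    (ψ.compContinuousLinearMap A) ![u, v] = ψ ![A u, A v] := by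
  simpa using toBilin_comp ψ A u v

theorem extDeriv_oneForm_apply {Λ : Q → Q →L[ℝ] ℝ} {q : Q} (h : DifferentiableAt ℝ Λ q) (u v : Q) :
    extDeriv (fun x => oneForm Q (Λ x)) q ![u, v] = fderiv ℝ Λ q u v - fderiv ℝ Λ q v u := by
  have h0 : DifferentiableAt ℝ (fun x => oneForm Q (Λ x)) q := (oneForm Q).differentiableAt.comp q h
  rw [extDeriv_apply h0, Fin.sum_univ_two]
  have e : ∀ w : Q, fderiv ℝ (fun x => Λ x w) q = (fderiv ℝ Λ q).flip w := fun w => by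
    rw [fderiv_clm_apply h (differentiableAt_const w)]; simp
  have e' : ∀ w : Fin 1 → Q, (fun x => oneForm Q (Λ x) w) = fun x => Λ x (w 0) := fun w => rfl
  simp only [e', e]
  simp [Fin.removeNth, Fin.succAbove, sub_eq_add_neg]

theorem extDeriv_twoForm_apply {ψ : Q → Q [⋀^Fin 2]→L[ℝ] ℝ} {q : Q} (h : DifferentiableAt ℝ ψ q)
    (a b c : Q) : extDeriv ψ q ![a, b, c] =
      fderiv ℝ (fun x => toBilin Q (ψ x)) q a b c - fderiv ℝ (fun x => toBilin Q (ψ x)) q b a c +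
        fderiv ℝ (fun x => toBilin Q (ψ x)) q c a b := by
  have hb : DifferentiableAt ℝ (fun x => toBilin Q (ψ x)) q :=
    ((contDiff_toBilin (n := 1)).differentiable one_ne_zero).differentiableAt.comp q h
  rw [extDeriv_apply h, Fin.sum_univ_three]
  have e : ∀ u v w : Q, fderiv ℝ (fun x => ψ x ![u, v]) q w =
      fderiv ℝ (fun x => toBilin Q (ψ x)) q w u v := fun u v w => by
    have h1 : (fun x => ψ x ![u, v]) = fun x => toBilin Q (ψ x) u v := by
      funext x; rw [toBilin_apply]
    rw [h1, fderiv_clm_apply (hb.clm_apply (differentiableAt_const u)) (differentiableAt_const v),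
      fderiv_clm_apply hb (differentiableAt_const u)]
    simp
  have r0 : (0 : Fin 3).removeNth ![a, b, c] = ![b, c] := by ext i; fin_cases i <;> rfl
  have r1 : (1 : Fin 3).removeNth ![a, b, c] = ![a, c] := by ext i; fin_cases i <;> rfl
  have r2 : (2 : Fin 3).removeNth ![a, b, c] = ![a, b] := by ext i; fin_cases i <;> rfl
  rw [r0, r1, r2, e, e, e]
  simp [sub_eq_add_neg]

theorem isInvertible_of_injective [FiniteDimensional ℝ Q] (B : Q →L[ℝ] Q →L[ℝ] ℝ)
    (h : ∀ u, B u = 0 → u = 0) : B.IsInvertible := by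
  have hi : Function.Injective B := (injective_iff_map_eq_zero B).2 h
  have hd : Module.finrank ℝ Q = Module.finrank ℝ (Q →L[ℝ] ℝ) := by
    rw [← (LinearMap.toContinuousLinearMap : (Q →ₗ[ℝ] ℝ) ≃ₗ[ℝ] Q →L[ℝ] ℝ).finrank_eq]
    exact (Subspace.dual_finrank_eq (K := ℝ) (V := Q)).symm
  exact ⟨(LinearEquiv.ofInjectiveOfFinrankEq (B : Q →ₗ[ℝ] Q →L[ℝ] ℝ) hi
    hd).toContinuousLinearEquiv, by ext; rfl⟩

end Bilinear

/-! ### The forms in the normal form on a product with the real line -/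

section ProductForms

variable {B V : Type*} [NormedAddCommGroup V] [NormedSpace ℝ V]

/-- The contraction `i_{∂/∂t} ψ`. -/
def tContract (ψ : B × ℝ → (V × ℝ) [⋀^Fin 2]→L[ℝ] ℝ) (q : B × ℝ) : V × ℝ →L[ℝ] ℝ :=
  toBilin (V × ℝ) (ψ q) (0, 1)

/-- Half of the `t`-derivative at `t = 0` of `i_{∂/∂t} ψ`. -/
def nullOneForm (ψ : B × ℝ → (V × ℝ) [⋀^Fin 2]→L[ℝ] ℝ) (b : B) : V × ℝ →L[ℝ] ℝ :=
  (2⁻¹ : ℝ) • deriv (fun t : ℝ => tContract ψ (b, t)) 0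

/-- The primitive `∫₀ᵗ i_{∂/∂t} ψ`. -/
def tPrimitive (ψ : B × ℝ → (V × ℝ) [⋀^Fin 2]→L[ℝ] ℝ) (q : B × ℝ) : V × ℝ →L[ℝ] ℝ :=
  ∫ r in (0 : ℝ)..q.2, tContract ψ (q.1, r)

/-- The primitive of the difference between `ψ` and its normal form. -/
def moserForm (ψ : B × ℝ → (V × ℝ) [⋀^Fin 2]→L[ℝ] ℝ) (q : B × ℝ) : V × ℝ →L[ℝ] ℝ :=
  tPrimitive ψ q - q.2 ^ 2 • nullOneForm ψ q.1

/-- The time-dependent vector field of the Moser argument for the path from `ψ₀` to `ψ₁`. -/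
def moserField (ψ₀ ψ₁ : B × ℝ → (V × ℝ) [⋀^Fin 2]→L[ℝ] ℝ) (s : ℝ) (q : B × ℝ) : V × ℝ :=
  (toBilin (V × ℝ) (ψ₀ q + s • (ψ₁ q - ψ₀ q))).inverse (-moserForm ψ₁ q)

end ProductForms

/-! ### Division by the transverse coordinate -/

section Division

variable {V Y : Type} [NormedAddCommGroup V] [NormedSpace ℝ V] [FiniteDimensional ℝ V]
  [NormedAddCommGroup Y] [NormedSpace ℝ Y] [CompleteSpace Y] {U : Set V} {ε : ℝ}

theorem mul_mem_Ioo {t r : ℝ} (ht : t ∈ Ioo (-ε) ε) (hr : r ∈ Icc (0 : ℝ) 1) :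
    r * t ∈ Ioo (-ε) ε := by
  rw [mem_Ioo, ← abs_lt, abs_mul, abs_of_nonneg hr.1]
  have := abs_lt.2 ht
  nlinarith [abs_nonneg t, hr.2]

theorem contDiffOn_integral_scaled (hU : IsOpen U) {h : ℝ × V × ℝ → Y}
    (hh : ContDiffOn ℝ ∞ h (univ ×ˢ U ×ˢ Ioo (-ε) ε)) :
    ContDiffOn ℝ ∞ (fun q : V × ℝ => ∫ r in (0 : ℝ)..1, h (r, q.1, r * q.2)) (U ×ˢ Ioo (-ε) ε) := by
  have hsm : ContDiff ℝ ∞ fun x : ℝ × V × ℝ => (x.1, x.2.1, x.1 * x.2.2) := by fun_prop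
  have hΩ : IsOpen ((fun x : ℝ × V × ℝ => (x.1, x.2.1, x.1 * x.2.2)) ⁻¹'
      (univ ×ˢ U ×ˢ Ioo (-ε) ε)) :=
    (isOpen_univ.prod (hU.prod isOpen_Ioo)).preimage hsm.continuous
  refine contDiffOn_integral_unitInterval (f := fun x : ℝ × V × ℝ => h (x.1, x.2.1, x.1 * x.2.2))
    hΩ (hh.comp hsm.contDiffOn fun x hx => hx) ?_
  rintro ⟨y, t⟩ ⟨hy, ht⟩ r hr
  exact ⟨mem_univ _, hy, mul_mem_Ioo ht hr⟩

/-- Hadamard's lemma in the transverse variable: h(y, t) = t ∫₀¹ ∂ₜh(y, rt) dr. -/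
theorem exists_eq_smul_of_vanishing (hU : IsOpen U) {h : V × ℝ → Y}
    (hh : ContDiffOn ℝ ∞ h (U ×ˢ Ioo (-ε) ε)) (h0 : ∀ y ∈ U, h (y, 0) = 0) :
    ∃ k : V × ℝ → Y, ContDiffOn ℝ ∞ k (U ×ˢ Ioo (-ε) ε) ∧
      (∀ q ∈ U ×ˢ Ioo (-ε) ε, h q = q.2 • k q) ∧ ∀ y, k (y, 0) = fderiv ℝ h (y, 0) (0, 1) := by
  have hD : IsOpen (U ×ˢ Ioo (-ε) ε) := hU.prod isOpen_Ioo
  have hd : ContDiffOn ℝ ∞ (fun q => fderiv ℝ h q (0, 1)) (U ×ˢ Ioo (-ε) ε) :=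
    (hh.fderiv_of_isOpen hD (by simp)).clm_apply contDiffOn_const
  refine ⟨fun q => ∫ r in (0 : ℝ)..1, fderiv ℝ h (q.1, r * q.2) (0, 1), ?_, ?_, fun y => by simp⟩
  · exact contDiffOn_integral_scaled hU (h := fun x => fderiv ℝ h x.2 (0, 1))
      (hd.comp contDiffOn_snd fun x hx => hx.2)
  · rintro ⟨y, t⟩ ⟨hy, ht⟩
    have h1 : ∀ r ∈ uIcc (0 : ℝ) 1, HasDerivAt (fun r : ℝ => h (y, r * t))
        (t • fderiv ℝ h (y, r * t) (0, 1)) r := by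
      intro r hr
      rw [uIcc_of_le zero_le_one] at hr
      have hm : (y, r * t) ∈ U ×ˢ Ioo (-ε) ε := ⟨hy, mul_mem_Ioo ht hr⟩
      have h2 := ((hh.contDiffAt (hD.mem_nhds hm)).differentiableAt (by simp)).hasFDerivAt
      have h3 : HasDerivAt (fun r : ℝ => (y, r * t)) ((0 : V), t) r :=
        (hasDerivAt_const r y).prodMk (by simpa using (hasDerivAt_id r).mul_const t)
      have h5 := h2.comp_hasDerivAt r h3
      rwa [show ((0 : V), t) = t • ((0 : V), (1 : ℝ)) by simp, map_smul] at h5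
    have hc : ContinuousOn (fun r : ℝ => t • fderiv ℝ h (y, r * t) (0, 1)) (uIcc 0 1) := by
      refine ContinuousOn.const_smul ?_ t
      refine hd.continuousOn.comp (by fun_prop) fun r hr => ?_
      rw [uIcc_of_le zero_le_one] at hr
      exact ⟨hy, mul_mem_Ioo ht hr⟩
    have h4 := intervalIntegral.integral_eq_sub_of_hasDerivAt h1 hc.intervalIntegrable
    rw [intervalIntegral.integral_smul] at h4
    simp only [one_mul, zero_mul, h0 y hy, sub_zero] at h4
    exact h4.symm

end Division

end

end FoldedSymplectic

namespace FoldedSymplectic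

section

open Set Filter

/-! ### Smoothness and exterior derivatives of alternating forms -/

section FormCalculus

theorem two_le_infty : (2 : WithTop ℕ∞) ≤ ∞ :=
  WithTop.coe_le_coe.2 (le_top : (2 : ℕ∞) ≤ ⊤)

variable {Q : Type*} [NormedAddCommGroup Q] [NormedSpace ℝ Q]
  {X : Type*} [NormedAddCommGroup X] [NormedSpace ℝ X]

theorem contDiff_alternatize {n : ℕ} {r : WithTop ℕ∞} :
    ContDiff ℝ r (fun f : Q →L[ℝ] Q [⋀^Fin n]→L[ℝ] ℝ =>
      ContinuousAlternatingMap.alternatizeUncurryFin f) :=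
  IsBoundedLinearMap.contDiff ⟨⟨fun f g => ContinuousAlternatingMap.alternatizeUncurryFin_add f g,
    fun c f => ContinuousAlternatingMap.alternatizeUncurryFin_smul c f⟩, n + 1, by positivity,
    fun f => by simpa using ContinuousAlternatingMap.norm_alternatizeUncurryFin_le f⟩

/-- Smoothness of two-forms can thus be checked on bilinear maps, where the calculus of continuous
linear maps applies. The form is recovered as half the alternatization of its curried map. -/
theorem contDiffWithinAt_twoForm_iff {r : WithTop ℕ∞} {ψ : X → Q [⋀^Fin 2]→L[ℝ] ℝ} {s : Set X}
    {x : X} :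
    ContDiffWithinAt ℝ r ψ s x ↔ ContDiffWithinAt ℝ r (fun x => toBilin Q (ψ x)) s x := by
  refine ⟨fun h => contDiff_toBilin.comp_contDiffWithinAt h, fun h => ?_⟩
  have h1 : ContDiff ℝ r (fun f : Q →L[ℝ] Q →L[ℝ] ℝ => (oneForm Q).comp f) :=
    contDiff_const.clm_comp contDiff_id
  -- The factor ½ compensates for alternatizing a form of degree two that is already alternating.
  have h2 := contDiff_const.smul ((contDiff_alternatize (n := 1) (Q := Q) (r := r)).comp h1)
    (f := fun _ => (2⁻¹ : ℝ))
  have h3 := h2.comp_contDiffWithinAt h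
  refine h3.congr_of_eventuallyEq (Eventually.of_forall fun x => ?_) ?_ <;>
  · have e : (oneForm Q).comp (toBilin Q (ψ x)) = (ψ x).curryLeft := by
      ext u v
      have : v = ![v 0] := by ext i; rw [Subsingleton.elim i 0]; rfl
      rw [this]
      simp
    change _ = (2⁻¹ : ℝ) • ContinuousAlternatingMap.alternatizeUncurryFin
      ((oneForm Q).comp (toBilin Q (ψ _)))
    rw [e, ContinuousAlternatingMap.alternatizeUncurryFin_curryLeft]
    ext v
    simp

theorem contDiffOn_twoForm_iff {r : WithTop ℕ∞} {ψ : X → Q [⋀^Fin 2]→L[ℝ] ℝ} {s : Set X} :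
    ContDiffOn ℝ r ψ s ↔ ContDiffOn ℝ r (fun x => toBilin Q (ψ x)) s :=
  forall₂_congr fun _ _ => contDiffWithinAt_twoForm_iff

theorem contDiffAt_twoForm_iff {r : WithTop ℕ∞} {ψ : X → Q [⋀^Fin 2]→L[ℝ] ℝ} {x : X} :
    ContDiffAt ℝ r ψ x ↔ ContDiffAt ℝ r (fun x => toBilin Q (ψ x)) x := by
  simp only [← contDiffWithinAt_univ]
  exact contDiffWithinAt_twoForm_iff

theorem contDiffOn_extDeriv {n : ℕ} {ψ : Q → Q [⋀^Fin n]→L[ℝ] ℝ} {s : Set Q} (hs : IsOpen s)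
    (h : ContDiffOn ℝ ∞ ψ s) : ContDiffOn ℝ ∞ (extDeriv ψ) s :=
  contDiff_alternatize.comp_contDiffOn (h.fderiv_of_isOpen hs (by simp))

theorem extDeriv_sub {n : ℕ} {ψ χ : Q → Q [⋀^Fin n]→L[ℝ] ℝ} {q : Q} (h : DifferentiableAt ℝ ψ q)
    (h' : DifferentiableAt ℝ χ q) :
    extDeriv (fun x => ψ x - χ x) q = extDeriv ψ q - extDeriv χ q := by
  have : (fun x => ψ x - χ x) = ψ + (-1 : ℝ) • χ := by
    funext x
    exact (sub_eq_add_neg _ _).trans (congrArg _ (neg_one_smul ℝ (χ x)).symm)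
  rw [this, extDeriv_add h (h'.const_smul _), extDeriv_smul]
  simp [sub_eq_add_neg]

theorem differentiableAt_toBilin {ψ : X → Q [⋀^Fin 2]→L[ℝ] ℝ} {x : X}
    (h : DifferentiableAt ℝ ψ x) : DifferentiableAt ℝ (fun x => toBilin Q (ψ x)) x :=
  ((contDiff_toBilin (n := 1)).differentiable one_ne_zero).differentiableAt.comp x h

theorem fderiv_toBilin_apply {ψ : X → Q [⋀^Fin 2]→L[ℝ] ℝ} {x : X}
    (h : DifferentiableAt ℝ ψ x) (w : X) (u v : Q) :
    fderiv ℝ (fun x => toBilin Q (ψ x)) x w u v = fderiv ℝ (fun x => ψ x ![u, v]) x w := by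
  have hb := differentiableAt_toBilin h
  have h1 : (fun x => ψ x ![u, v]) = fun x => toBilin Q (ψ x) u v := by
    funext x; rw [toBilin_apply]
  rw [h1, fderiv_clm_apply (hb.clm_apply (differentiableAt_const u)) (differentiableAt_const v),
    fderiv_clm_apply hb (differentiableAt_const u)]
  simp

theorem extDeriv_extDeriv_of_smooth {n : ℕ} {ψ : Q → Q [⋀^Fin n]→L[ℝ] ℝ} {s : Set Q}
    (hs : IsOpen s) (h : ContDiffOn ℝ ∞ ψ s) {q : Q} (hq : q ∈ s) : extDeriv (extDeriv ψ) q = 0 :=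
  extDeriv_extDeriv_apply (h.contDiffAt (hs.mem_nhds hq)) (by simpa using two_le_infty)

end FormCalculus

/-! ### The local Moser argument -/

section Moser

variable {V : Type} [NormedAddCommGroup V] [NormedSpace ℝ V]

/-- The projection of `V × ℝ` to the hyperplane `t = 0`. -/
def projZero (V : Type*) [NormedAddCommGroup V] [NormedSpace ℝ V] : V × ℝ →L[ℝ] V × ℝ :=
  (ContinuousLinearMap.inl ℝ V ℝ).comp (ContinuousLinearMap.fst ℝ V ℝ)

@[simp] theorem projZero_apply (q : V × ℝ) : projZero V q = (q.1, 0) := rfl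

/-- A closed two-form `ψ₁` on a product neighborhood `U × (-ε, ε)` whose contraction with `∂/∂t`
vanishes for `t = 0`, and its normal form `ψ₀`. -/
structure MoserData (U : Set V) (ε : ℝ) (ψ₀ ψ₁ : V × ℝ → (V × ℝ) [⋀^Fin 2]→L[ℝ] ℝ) : Prop where
  isOpen : IsOpen U
  pos : 0 < ε
  smooth : ContDiffOn ℝ ∞ ψ₁ (U ×ˢ Ioo (-ε) ε)
  closed : ∀ q ∈ U ×ˢ Ioo (-ε) ε, extDeriv ψ₁ q = 0
  ker : ∀ y ∈ U, ∀ w, ψ₁ (y, 0) ![(0, 1), w] = 0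
  model : ∀ q ∈ U ×ˢ Ioo (-ε) ε, ψ₀ q = (ψ₁ (q.1, 0)).compContinuousLinearMap (projZero V) +
    extDeriv (fun x => oneForm _ (x.2 ^ 2 • nullOneForm ψ₁ x.1)) q

theorem tContract_self {B : Type*} (ψ : B × ℝ → (V × ℝ) [⋀^Fin 2]→L[ℝ] ℝ) (q : B × ℝ) :
    tContract ψ q (0, 1) = 0 := by
  rw [tContract, toBilin_apply, form_self]

namespace MoserData

variable {U : Set V} {ε : ℝ} {ψ₀ ψ₁ : V × ℝ → (V × ℝ) [⋀^Fin 2]→L[ℝ] ℝ} (d : MoserData U ε ψ₀ ψ₁)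
include d

theorem isOpen_prod : IsOpen (U ×ˢ Ioo (-ε) ε) := d.isOpen.prod isOpen_Ioo

theorem mem_zero {y : V} (hy : y ∈ U) : (y, (0 : ℝ)) ∈ U ×ˢ Ioo (-ε) ε :=
  ⟨hy, by simpa using d.pos⟩

theorem contDiffOn_tContract : ContDiffOn ℝ ∞ (tContract ψ₁) (U ×ˢ Ioo (-ε) ε) :=
  (contDiff_toBilin.comp_contDiffOn d.smooth).clm_apply contDiffOn_const

theorem tContract_zero {y : V} (hy : y ∈ U) : tContract ψ₁ (y, 0) = 0 := by
  refine ContinuousLinearMap.ext fun w => ?_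
  rw [tContract, toBilin_apply, d.ker y hy]; rfl

theorem nullOneForm_eq {y : V} (hy : y ∈ U) :
    nullOneForm ψ₁ y = (2⁻¹ : ℝ) • fderiv ℝ (tContract ψ₁) (y, 0) (0, 1) := by
  have h1 := ((d.contDiffOn_tContract.contDiffAt
    (d.isOpen_prod.mem_nhds (d.mem_zero hy))).differentiableAt (by simp)).hasFDerivAt
  have h3 : HasDerivAt (fun t : ℝ => (y, t)) ((0 : V), (1 : ℝ)) 0 :=
    (hasDerivAt_const _ y).prodMk (hasDerivAt_id _)
  have h4 : HasDerivAt (fun t => tContract ψ₁ (y, t)) _ 0 := h1.comp_hasDerivAt (0 : ℝ) h3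
  rw [nullOneForm, h4.deriv]

theorem contDiffOn_nullOneForm :
    ContDiffOn ℝ ∞ (fun q : V × ℝ => nullOneForm ψ₁ q.1) (U ×ˢ Ioo (-ε) ε) := by
  have h1 : ContDiffOn ℝ ∞ (fun q => (2⁻¹ : ℝ) • fderiv ℝ (tContract ψ₁) q (0, 1))
      (U ×ˢ Ioo (-ε) ε) :=
    ((d.contDiffOn_tContract.fderiv_of_isOpen d.isOpen_prod (by simp)).clm_apply
      contDiffOn_const).const_smul _
  have h2 := h1.comp (projZero V).contDiff.contDiffOn (s := U ×ˢ Ioo (-ε) ε)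
    (fun q hq => d.mem_zero hq.1)
  exact h2.congr fun q hq => d.nullOneForm_eq hq.1

/-- Differentiate ψ₁(∂/∂t, ∂/∂t) = 0 in t. -/
theorem nullOneForm_self {y : V} (hy : y ∈ U) : nullOneForm ψ₁ y (0, 1) = 0 := by
  have h1 := (d.contDiffOn_tContract.contDiffAt
    (d.isOpen_prod.mem_nhds (d.mem_zero hy))).differentiableAt (by simp)
  have h2 : fderiv ℝ (fun q => tContract ψ₁ q (0, 1)) (y, 0) = 0 := by
    simp only [tContract_self]; simp
  rw [fderiv_clm_apply h1 (differentiableAt_const _)] at h2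
  have h3 := congrArg (fun A => A (0, 1)) h2
  rw [d.nullOneForm_eq hy]
  simp at h3
  simp [h3]

/-- The primitive in the transverse direction by rescaling to the unit interval. -/
theorem tPrimitive_eq (q : V × ℝ) :
    tPrimitive ψ₁ q = q.2 • ∫ r in (0 : ℝ)..1, tContract ψ₁ (q.1, r * q.2) := by
  have := intervalIntegral.smul_integral_comp_mul_left (a := 0) (b := 1)
    (fun r => tContract ψ₁ (q.1, r)) q.2
  rw [mul_zero, mul_one] at this
  rw [tPrimitive, ← this]
  simp only [mul_comm]

theorem contDiffOn_tPrimitive [FiniteDimensional ℝ V] :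
    ContDiffOn ℝ ∞ (tPrimitive ψ₁) (U ×ˢ Ioo (-ε) ε) := by
  have h := contDiffOn_integral_scaled d.isOpen (h := fun x => tContract ψ₁ x.2)
    (d.contDiffOn_tContract.comp contDiffOn_snd fun x hx => hx.2)
  exact (contDiff_snd.contDiffOn.smul h).congr fun q hq => d.tPrimitive_eq q

theorem continuousOn_tContract_slice {y : V} (hy : y ∈ U) :
    ContinuousOn (fun r => tContract ψ₁ (y, r)) (Ioo (-ε) ε) :=
  d.contDiffOn_tContract.continuousOn.comp (by fun_prop) fun _ hr => ⟨hy, hr⟩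

theorem uIcc_subset {t : ℝ} (ht : t ∈ Ioo (-ε) ε) : uIcc 0 t ⊆ Ioo (-ε) ε := by
  have h0 : (0 : ℝ) ∈ Ioo (-ε) ε := by simpa using d.pos
  exact (ordConnected_Ioo).uIcc_subset h0 ht

theorem hasDerivAt_tPrimitive {y : V} (hy : y ∈ U) {t : ℝ} (ht : t ∈ Ioo (-ε) ε) :
    HasDerivAt (fun t => tPrimitive ψ₁ (y, t)) (tContract ψ₁ (y, t)) t := by
  have hc := d.continuousOn_tContract_slice hy
  exact intervalIntegral.integral_hasDerivAt_right
    ((hc.mono (d.uIcc_subset ht)).intervalIntegrable)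
    (hc.stronglyMeasurableAtFilter isOpen_Ioo t ht) (hc.continuousAt (isOpen_Ioo.mem_nhds ht))

theorem fderiv_tPrimitive [FiniteDimensional ℝ V] {q : V × ℝ} (hq : q ∈ U ×ˢ Ioo (-ε) ε) :
    fderiv ℝ (tPrimitive ψ₁) q (0, 1) = tContract ψ₁ q := by
  have h1 := ((d.contDiffOn_tPrimitive.contDiffAt
    (d.isOpen_prod.mem_nhds hq)).differentiableAt (by simp)).hasFDerivAt
  have h3 : HasDerivAt (fun t : ℝ => (q.1, t)) ((0 : V), (1 : ℝ)) q.2 :=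
    (hasDerivAt_const _ q.1).prodMk (hasDerivAt_id _)
  have h4 : HasDerivAt (fun t => tPrimitive ψ₁ (q.1, t)) (fderiv ℝ (tPrimitive ψ₁) q (0, 1)) q.2 :=
    HasFDerivAt.comp_hasDerivAt (l := tPrimitive ψ₁) (f := fun t => (q.1, t)) q.2 h1 h3
  exact h4.unique (d.hasDerivAt_tPrimitive hq.1 hq.2)

theorem tPrimitive_self [FiniteDimensional ℝ V] {q : V × ℝ} (hq : q ∈ U ×ˢ Ioo (-ε) ε) :
    tPrimitive ψ₁ q (0, 1) = 0 := by
  rw [tPrimitive, ContinuousLinearMap.intervalIntegral_apply]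
  · simp [tContract_self]
  · exact ((d.continuousOn_tContract_slice hq.1).mono (d.uIcc_subset hq.2)).intervalIntegrable

theorem contDiffOn_moserForm [FiniteDimensional ℝ V] :
    ContDiffOn ℝ ∞ (moserForm ψ₁) (U ×ˢ Ioo (-ε) ε) :=
  d.contDiffOn_tPrimitive.sub ((contDiff_snd.pow 2).contDiffOn.smul d.contDiffOn_nullOneForm)

theorem moserForm_self [FiniteDimensional ℝ V] {q : V × ℝ} (hq : q ∈ U ×ˢ Ioo (-ε) ε) :
    moserForm ψ₁ q (0, 1) = 0 := by
  rw [moserForm]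
  simp [d.tPrimitive_self hq, d.nullOneForm_self hq.1]

/-- `ψ₁` differs from its restriction to `t = 0` by the differential of the primitive. -/
theorem eq_add_extDeriv_tPrimitive [FiniteDimensional ℝ V] {q : V × ℝ}
    (hq : q ∈ U ×ˢ Ioo (-ε) ε) :
    ψ₁ q = (ψ₁ (q.1, 0)).compContinuousLinearMap (projZero V) +
      extDeriv (fun x => oneForm _ (tPrimitive ψ₁ x)) q := by
  have hD := d.isOpen_prod
  set R : V × ℝ → (V × ℝ) [⋀^Fin 2]→L[ℝ] ℝ := fun q =>
    (ψ₁ (q.1, 0)).compContinuousLinearMap (projZero V) with hR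
  have hψd : ∀ q ∈ U ×ˢ Ioo (-ε) ε, DifferentiableAt ℝ ψ₁ q := fun q hq =>
    (d.smooth.contDiffAt (hD.mem_nhds hq)).differentiableAt (by simp)
  have hRs : ContDiffOn ℝ ∞ R (U ×ˢ Ioo (-ε) ε) := by
    rw [contDiffOn_twoForm_iff]
    have h1 : ContDiffOn ℝ ∞ (fun q : V × ℝ => toBilin _ (ψ₁ (projZero V q))) (U ×ˢ Ioo (-ε) ε) :=
      contDiff_toBilin.comp_contDiffOn (d.smooth.comp (projZero V).contDiff.contDiffOn
        fun q hq => d.mem_zero hq.1)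
    have h2 : ContDiffOn ℝ ∞ (fun q : V × ℝ => ((ContinuousLinearMap.compL ℝ (V × ℝ) (V × ℝ) ℝ).flip
        (projZero V)).comp ((toBilin _ (ψ₁ (projZero V q))).comp (projZero V))) (U ×ˢ Ioo (-ε) ε) :=
      contDiffOn_const.clm_comp (h1.clm_comp contDiffOn_const)
    refine h2.congr fun q hq => ?_
    refine ContinuousLinearMap.ext fun u => ContinuousLinearMap.ext fun v => ?_
    rw [toBilin_comp]; rfl
  have hRc : ∀ q ∈ U ×ˢ Ioo (-ε) ε, extDeriv R q = 0 := by
    intro q hq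
    have h := extDeriv_pullback (r := ∞) (f := projZero V) (x := q) (hψd _ (d.mem_zero hq.1))
      (projZero V).contDiff.contDiffAt (by simpa using two_le_infty)
    simp only [ContinuousLinearMap.fderiv] at h
    rw [show projZero V q = (q.1, 0) from rfl, d.closed _ (d.mem_zero hq.1)] at h
    exact h
  have hPs : ContDiffOn ℝ ∞ (fun x => oneForm _ (tPrimitive ψ₁ x)) (U ×ˢ Ioo (-ε) ε) :=
    contDiff_oneForm.comp_contDiffOn d.contDiffOn_tPrimitive
  have hEs := contDiffOn_extDeriv hD hPs
  have hdiff : ∀ {f : V × ℝ → (V × ℝ) [⋀^Fin 2]→L[ℝ] ℝ}, ContDiffOn ℝ ∞ f (U ×ˢ Ioo (-ε) ε) →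
      ∀ q ∈ U ×ˢ Ioo (-ε) ε, DifferentiableAt ℝ f q := fun h q hq =>
    (h.contDiffAt (hD.mem_nhds hq)).differentiableAt (by simp)
  have hPd : ∀ q ∈ U ×ˢ Ioo (-ε) ε, ∀ u v, extDeriv (fun x => oneForm _ (tPrimitive ψ₁ x)) q ![u, v]
      = fderiv ℝ (tPrimitive ψ₁) q u v - fderiv ℝ (tPrimitive ψ₁) q v u := fun q hq u v =>
    extDeriv_oneForm_apply ((d.contDiffOn_tPrimitive.contDiffAt
      (hD.mem_nhds hq)).differentiableAt (by simp)) u v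
  -- The defect C is closed, is annihilated by ∂/∂t and vanishes at t = 0. Closedness makes it
  -- independent of t, so it vanishes.
  set C : V × ℝ → (V × ℝ) [⋀^Fin 2]→L[ℝ] ℝ := fun q =>
    ψ₁ q - R q - extDeriv (fun x => oneForm _ (tPrimitive ψ₁ x)) q with hC
  have hCs : ContDiffOn ℝ ∞ C (U ×ˢ Ioo (-ε) ε) := (d.smooth.sub hRs).sub hEs
  have hCc : ∀ q ∈ U ×ˢ Ioo (-ε) ε, extDeriv C q = 0 := by
    intro q hq
    rw [hC, extDeriv_sub (hdiff (d.smooth.sub hRs) q hq) (hdiff hEs q hq),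
      extDeriv_sub (hdiff d.smooth q hq) (hdiff hRs q hq), d.closed q hq, hRc q hq,
      extDeriv_extDeriv_of_smooth hD hPs hq]
    simp
  have hCt : ∀ q ∈ U ×ˢ Ioo (-ε) ε, ∀ w, C q ![(0, 1), w] = 0 := by
    intro q hq w
    have h1 : R q ![(0, 1), w] = 0 := by
      rw [hR, comp_form_apply, ← toBilin_apply]
      simp [show projZero V (0, 1) = 0 from rfl]
    have h2 : fderiv ℝ (tPrimitive ψ₁) q w (0, 1) = 0 := by
      have h3 : fderiv ℝ (fun q => tPrimitive ψ₁ q (0, 1)) q = 0 := by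
        have : (fun q => tPrimitive ψ₁ q (0, 1)) =ᶠ[𝓝 q] fun _ => 0 := by
          filter_upwards [hD.mem_nhds hq] with x hx using d.tPrimitive_self hx
        rw [this.fderiv_eq]; simp
      rw [fderiv_clm_apply ((d.contDiffOn_tPrimitive.contDiffAt
        (hD.mem_nhds hq)).differentiableAt (by simp)) (differentiableAt_const _)] at h3
      simpa using congrArg (fun A => A w) h3
    have h4 : C q ![(0, 1), w] = ψ₁ q ![(0, 1), w] - R q ![(0, 1), w] -
      extDeriv (fun x => oneForm _ (tPrimitive ψ₁ x)) q ![(0, 1), w] := rfl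
    rw [h4, h1, hPd q hq, h2, d.fderiv_tPrimitive hq, tContract, toBilin_apply]
    ring
  -- In dC(∂/∂t, a, b) = 0 the two terms containing the contraction of C with ∂/∂t drop out.
  have hCd : ∀ q ∈ U ×ˢ Ioo (-ε) ε, ∀ a b, fderiv ℝ (fun x => C x ![a, b]) q (0, 1) = 0 := by
    intro q hq a b
    have hCq := hdiff hCs q hq
    have h1 := extDeriv_twoForm_apply hCq (0, 1) a b
    rw [hCc q hq] at h1
    have h2 : ∀ u, fderiv ℝ (fun x => C x ![(0, 1), u]) q = 0 := fun u => by
      have : (fun x => C x ![(0, 1), u]) =ᶠ[𝓝 q] fun _ => 0 := by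
        filter_upwards [hD.mem_nhds hq] with x hx using hCt x hx u
      rw [this.fderiv_eq]; simp
    rw [fderiv_toBilin_apply hCq, fderiv_toBilin_apply hCq, fderiv_toBilin_apply hCq, h2, h2] at h1
    simpa using h1.symm
  -- Horizontal vectors suffice. On them ψ₁ and R agree at t = 0, and the primitive vanishes along t
  -- = 0 together with its horizontal derivatives.
  have hC0 : ∀ y ∈ U, ∀ a b, C (y, 0) ![a, b] = 0 := by
    intro y hy a b
    have hy' := d.mem_zero hy
    have hsplit : ∀ a : V × ℝ, a = projZero V a + a.2 • (0, 1) := fun a => by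
      ext <;> simp
    have hlin : ∀ a b, C (y, 0) ![a, b] = C (y, 0) ![projZero V a, projZero V b] := by
      intro a b
      rw [← toBilin_apply, ← toBilin_apply]
      conv_lhs => rw [hsplit a, hsplit b]
      have e1 : ∀ w, toBilin _ (C (y, 0)) (0, 1) w = 0 := fun w => by
        rw [toBilin_apply]; exact hCt _ hy' w
      have e2 : ∀ w, toBilin _ (C (y, 0)) w (0, 1) = 0 := fun w => by
        rw [toBilin_apply, form_swap]; rw [hCt _ hy' w]; simp
      simp only [map_add, map_smul, add_apply, smul_apply,
        e1, e2, smul_zero, add_zero]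
    rw [hlin]
    have h1 : ∀ w : V, fderiv ℝ (tPrimitive ψ₁) (y, 0) (w, 0) = 0 := by
      intro w
      have h2 := ((d.contDiffOn_tPrimitive.contDiffAt
        (hD.mem_nhds hy')).differentiableAt (by simp)).hasFDerivAt
      have h3 : HasFDerivAt (fun x : V => tPrimitive ψ₁ (x, 0)) _ y :=
        HasFDerivAt.comp (g := tPrimitive ψ₁) y h2 (hasFDerivAt_prodMk_left (𝕜 := ℝ) y (0 : ℝ))
      have h4 : (fun x : V => tPrimitive ψ₁ (x, 0)) = fun _ => 0 := by
        funext x; simp [tPrimitive]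
      rw [h4] at h3
      have h5 := h3.unique (hasFDerivAt_const _ _)
      simpa using congrArg (fun A => A w) h5
    have h4 : ∀ a b, C (y, 0) ![a, b] = ψ₁ (y, 0) ![a, b] - R (y, 0) ![a, b] -
      extDeriv (fun x => oneForm _ (tPrimitive ψ₁ x)) (y, 0) ![a, b] := fun a b => rfl
    rw [h4, hPd _ hy', hR]
    simp only [comp_form_apply, projZero_apply]
    rw [h1, h1]
    simp
  have hCq : C q = 0 := by
    apply toBilin_injective
    refine ContinuousLinearMap.ext fun a => ContinuousLinearMap.ext fun b => ?_
    rw [toBilin_apply]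
    have h1 : ∀ t ∈ Ioo (-ε) ε, HasDerivAt (fun t => C (q.1, t) ![a, b]) 0 t := by
      intro t ht
      have hq' : (q.1, t) ∈ U ×ˢ Ioo (-ε) ε := ⟨hq.1, ht⟩
      have h2 : DifferentiableAt ℝ (fun x => C x ![a, b]) (q.1, t) := by
        have := (differentiableAt_toBilin (hdiff hCs _ hq')).clm_apply (differentiableAt_const a)
          |>.clm_apply (differentiableAt_const b)
        simpa only [toBilin_apply] using this
      have h3 : HasDerivAt (fun t : ℝ => (q.1, t)) ((0 : V), (1 : ℝ)) t :=
        (hasDerivAt_const _ q.1).prodMk (hasDerivAt_id _)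
      have h4 := h2.hasFDerivAt.comp_hasDerivAt t h3
      rwa [hCd _ hq'] at h4
    have h2 := isOpen_Ioo.is_const_of_deriv_eq_zero isPreconnected_Ioo
      (fun t ht => (h1 t ht).differentiableAt.differentiableWithinAt)
      (fun t ht => (h1 t ht).deriv) hq.2 (d.mem_zero hq.1).2
    rw [h2, hC0 _ hq.1]
    simp
  rw [hC] at hCq
  have := sub_eq_zero.1 hCq
  rw [← this]
  abel

theorem sub_eq_extDeriv [FiniteDimensional ℝ V] {q : V × ℝ} (hq : q ∈ U ×ˢ Ioo (-ε) ε) :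
    ψ₁ q - ψ₀ q = extDeriv (fun x => oneForm _ (moserForm ψ₁ x)) q := by
  have hD := d.isOpen_prod
  have h1 : (fun x => oneForm _ (moserForm ψ₁ x)) = fun x =>
      oneForm _ (tPrimitive ψ₁ x) - oneForm _ (x.2 ^ 2 • nullOneForm ψ₁ x.1) := by
    funext x; rw [moserForm, map_sub]
  have hd : ∀ {f : V × ℝ → V × ℝ →L[ℝ] ℝ}, ContDiffOn ℝ ∞ f (U ×ˢ Ioo (-ε) ε) →
      DifferentiableAt ℝ (fun x => oneForm _ (f x)) q := fun h =>
    ((contDiff_oneForm.comp_contDiffOn h).contDiffAt (hD.mem_nhds hq)).differentiableAt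
      (by simp)
  have h2 : ContDiffOn ℝ ∞ (fun x : V × ℝ => x.2 ^ 2 • nullOneForm ψ₁ x.1) (U ×ˢ Ioo (-ε) ε) :=
    (contDiff_snd.pow 2).contDiffOn.smul d.contDiffOn_nullOneForm
  rw [h1, extDeriv_sub (hd d.contDiffOn_tPrimitive) (hd h2), d.model q hq]
  conv_lhs => rw [d.eq_add_extDeriv_tPrimitive hq]
  abel

end MoserData

end Moser

end

end FoldedSymplectic

namespace FoldedSymplectic

section

open Set Filter

/-! ### Transport of a path of closed forms along a flow -/

section Transport

variable {Q : Type*} [NormedAddCommGroup Q] [NormedSpace ℝ Q]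

/-- The Moser argument: a path of closed two-forms with `∂B/∂s = dβ` and `i_X B = -β` is preserved
by the flow of `X`. -/
theorem form_transport {B : ℝ × Q → Q [⋀^Fin 2]→L[ℝ] ℝ} {X : ℝ × Q → Q} {β : Q → Q →L[ℝ] ℝ}
    {Ω : Set (ℝ × Q)} (hΩ : IsOpen Ω) (hB : ∀ x ∈ Ω, DifferentiableAt ℝ B x)
    (hX : ∀ x ∈ Ω, DifferentiableAt ℝ X x) (hβ : ∀ x ∈ Ω, DifferentiableAt ℝ β x.2)
    (hBX : ∀ x ∈ Ω, toBilin Q (B x) (X x) = -β x.2)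
    (hcl : ∀ x ∈ Ω, extDeriv (fun q => B (x.1, q)) x.2 = 0)
    (hs : ∀ x ∈ Ω, ∀ u v, fderiv ℝ (fun x => toBilin Q (B x)) x (1, 0) u v =
      fderiv ℝ β x.2 u v - fderiv ℝ β x.2 v u) {c u w : ℝ → Q}
    (hc : ∀ s ∈ Icc (0 : ℝ) 1, (s, c s) ∈ Ω ∧ HasDerivWithinAt c (X (s, c s)) (Icc 0 1) s)
    (hu : ∀ s ∈ Icc (0 : ℝ) 1, HasDerivWithinAt u (fderiv ℝ X (s, c s) (0, u s)) (Icc 0 1) s)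
    (hw : ∀ s ∈ Icc (0 : ℝ) 1, HasDerivWithinAt w (fderiv ℝ X (s, c s) (0, w s)) (Icc 0 1) s) :
    B (1, c 1) ![u 1, w 1] = B (0, c 0) ![u 0, w 0] := by
  -- Along solutions u, w of the variational equation, the derivative of B(u, w) is ∂ₛB(u, w) + (L_X
  -- B)(u, w), which is dβ(u, w) - dβ(u, w) by closedness and i_X B = -β.
  have key : ∀ s ∈ Icc (0 : ℝ) 1,
      HasDerivWithinAt (fun s => toBilin Q (B (s, c s)) (u s) (w s)) 0 (Icc 0 1) s := by
    intro s hs'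
    obtain ⟨hm, hc'⟩ := hc s hs'
    have hb := differentiableAt_toBilin (hB _ hm)
    have h1 : HasDerivWithinAt (fun s => (s, c s)) ((1 : ℝ), X (s, c s)) (Icc 0 1) s :=
      (hasDerivWithinAt_id s _).prodMk hc'
    have h2 : HasDerivWithinAt (fun s => toBilin Q (B (s, c s))) _ (Icc 0 1) s :=
      HasFDerivAt.comp_hasDerivWithinAt (l := fun x => toBilin Q (B x)) (f := fun s => (s, c s)) s
        hb.hasFDerivAt h1
    have h3 := (h2.clm_apply (hu s hs')).clm_apply (hw s hs')
    refine h3.congr_deriv ?_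
    have e1 : ((1 : ℝ), X (s, c s)) = (1, 0) + (0, X (s, c s)) := by simp
    have hslice : ∀ a, fderiv ℝ (fun q => toBilin Q (B (s, q))) (c s) a =
        fderiv ℝ (fun x => toBilin Q (B x)) (s, c s) (0, a) := by
      intro a
      have h4 : HasFDerivAt (fun q => toBilin Q (B (s, q))) _ (c s) :=
        HasFDerivAt.comp (g := fun x => toBilin Q (B x)) (c s) hb.hasFDerivAt
          (hasFDerivAt_prodMk_right (𝕜 := ℝ) s (c s))
      rw [h4.fderiv]
      simp
    have hBs : DifferentiableAt ℝ (fun q => B (s, q)) (c s) :=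
      (hB _ hm).comp (c s) (hasFDerivAt_prodMk_right (𝕜 := ℝ) s (c s)).differentiableAt
    have h5 := extDeriv_twoForm_apply hBs (X (s, c s)) (u s) (w s)
    rw [hcl _ hm] at h5
    rw [hslice, hslice, hslice] at h5
    -- The identity i_X B = -β, differentiated in the direction a and evaluated on b.
    have h6 : ∀ a b, fderiv ℝ (fun x => toBilin Q (B x)) (s, c s) (0, a) (X (s, c s)) b +
        toBilin Q (B (s, c s)) (fderiv ℝ X (s, c s) (0, a)) b = -fderiv ℝ β (c s) a b := by
      intro a b
      have h7 : fderiv ℝ (fun x => toBilin Q (B x) (X x)) (s, c s) =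
          fderiv ℝ (fun x : ℝ × Q => -β x.2) (s, c s) :=
        Filter.EventuallyEq.fderiv_eq (by filter_upwards [hΩ.mem_nhds hm] with x hx using hBX x hx)
      have h8 : HasFDerivAt (fun x : ℝ × Q => -β x.2) _ (s, c s) :=
        (HasFDerivAt.comp (g := β) (s, c s) (hβ _ hm).hasFDerivAt
          (hasFDerivAt_snd (𝕜 := ℝ) (p := (s, c s)))).neg
      rw [h8.fderiv, fderiv_clm_apply hb (hX _ hm)] at h7
      have h9 := congrArg (fun A => A (0, a) b) h7
      simp at h9
      rw [toBilin_apply, ← h9]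
      ring
    have h9 := h6 (u s) (w s)
    have h10 := h6 (w s) (u s)
    have h11 := hs _ hm (u s) (w s)
    have sw : ∀ a b, toBilin Q (B (s, c s)) a b = -toBilin Q (B (s, c s)) b a := fun a b => by
      rw [toBilin_apply, toBilin_apply, form_swap]
    have sw' : ∀ p a b, fderiv ℝ (fun x => toBilin Q (B x)) (s, c s) p a b =
        -fderiv ℝ (fun x => toBilin Q (B x)) (s, c s) p b a := fun p a b => by
      rw [fderiv_toBilin_apply (hB _ hm), fderiv_toBilin_apply (hB _ hm)]
      have : (fun x => B x ![a, b]) = fun x => -B x ![b, a] := by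
        funext x; exact form_swap _ _ _
      rw [this, fderiv_fun_neg]; simp
    rw [e1, map_add]
    simp only [add_apply]
    have h12 := sw (u s) (fderiv ℝ X (s, c s) (0, w s))
    have h13 := sw' (0, w s) (X (s, c s)) (u s)
    have h14 : (0 : Q [⋀^Fin 3]→L[ℝ] ℝ) ![X (s, c s), u s, w s] = 0 := rfl
    linarith
  have h := constant_of_derivWithin_zero (a := 0) (b := 1)
    (fun s hs => (key s hs).differentiableWithinAt)
    (fun s hs => (key s (Ico_subset_Icc_self hs)).derivWithin
      (uniqueDiffOn_Icc zero_lt_one s (Ico_subset_Icc_self hs))) 1 (by simp)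
  simpa using h

end Transport

/-! ### Regularity of the Moser vector field at the fold -/

section MoserField

variable {V : Type} [NormedAddCommGroup V] [NormedSpace ℝ V] [FiniteDimensional ℝ V]

/-- The path of two-forms from `ψ₀` to `ψ₁`. -/
def formPath {B : Type*} (ψ₀ ψ₁ : B × ℝ → (V × ℝ) [⋀^Fin 2]→L[ℝ] ℝ) (x : ℝ × B × ℝ) :
    (V × ℝ) [⋀^Fin 2]→L[ℝ] ℝ :=
  ψ₀ x.2 + x.1 • (ψ₁ x.2 - ψ₀ x.2)

namespace MoserData

variable {U : Set V} {ε : ℝ} {ψ₀ ψ₁ : V × ℝ → (V × ℝ) [⋀^Fin 2]→L[ℝ] ℝ} (d : MoserData U ε ψ₀ ψ₁)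
include d

theorem differentiableAt {Y : Type*} [NormedAddCommGroup Y] [NormedSpace ℝ Y] {f : V × ℝ → Y}
    (hf : ContDiffOn ℝ ∞ f (U ×ˢ Ioo (-ε) ε)) {q : V × ℝ} (hq : q ∈ U ×ˢ Ioo (-ε) ε) :
    DifferentiableAt ℝ f q :=
  (hf.contDiffAt (d.isOpen_prod.mem_nhds hq)).differentiableAt (by simp)

theorem tPrimitive_zero (y : V) : tPrimitive ψ₁ (y, 0) = 0 := by simp [tPrimitive]

theorem hasDerivAt_moserForm {y : V} (hy : y ∈ U) {t : ℝ} (ht : t ∈ Ioo (-ε) ε) :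
    HasDerivAt (fun t => moserForm ψ₁ (y, t))
      (tContract ψ₁ (y, t) - (2 * t) • nullOneForm ψ₁ y) t := by
  have h := (d.hasDerivAt_tPrimitive hy ht).sub
    (((hasDerivAt_id t).pow 2).smul_const (nullOneForm ψ₁ y))
  refine h.congr_deriv ?_
  simp

theorem fderiv_moserForm {q : V × ℝ} (hq : q ∈ U ×ˢ Ioo (-ε) ε) :
    fderiv ℝ (moserForm ψ₁) q (0, 1) = tContract ψ₁ q - (2 * q.2) • nullOneForm ψ₁ q.1 := by
  have h3 : HasDerivAt (fun t : ℝ => (q.1, t)) ((0 : V), (1 : ℝ)) q.2 :=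
    (hasDerivAt_const _ q.1).prodMk (hasDerivAt_id _)
  have h4 : HasDerivAt (fun t => moserForm ψ₁ (q.1, t)) (fderiv ℝ (moserForm ψ₁) q (0, 1)) q.2 :=
    HasFDerivAt.comp_hasDerivAt (l := moserForm ψ₁) (f := fun t => (q.1, t)) q.2
      (d.differentiableAt d.contDiffOn_moserForm hq).hasFDerivAt h3
  exact h4.unique (d.hasDerivAt_moserForm hq.1 hq.2)

/-- Hadamard's lemma applied twice: the contraction is divisible by t, with quotient 2α at t = 0, so
the quotient minus 2α is again divisible by t. Subtracting t²α therefore leaves β = ∫₀ᵗ r²ν dr,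
which is cubic in t. -/
theorem exists_factorization : ∃ ν δ : V × ℝ → V × ℝ →L[ℝ] ℝ,
    ContDiffOn ℝ ∞ ν (U ×ˢ Ioo (-ε) ε) ∧ ContDiffOn ℝ ∞ δ (U ×ˢ Ioo (-ε) ε) ∧
    (∀ q ∈ U ×ˢ Ioo (-ε) ε, tContract ψ₁ q = (2 * q.2) • nullOneForm ψ₁ q.1 + q.2 ^ 2 • ν q) ∧
    ∀ q ∈ U ×ˢ Ioo (-ε) ε, moserForm ψ₁ q = q.2 ^ 3 • δ q := by
  obtain ⟨κ, hκ, hκt, hκ0⟩ := exists_eq_smul_of_vanishing d.isOpen d.contDiffOn_tContract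
    fun y hy => d.tContract_zero hy
  have h1 : ContDiffOn ℝ ∞ (fun q : V × ℝ => κ q - (2 : ℝ) • nullOneForm ψ₁ q.1)
      (U ×ˢ Ioo (-ε) ε) := hκ.sub (d.contDiffOn_nullOneForm.const_smul _)
  obtain ⟨ν, hν, hνt, -⟩ := exists_eq_smul_of_vanishing d.isOpen h1 fun y hy => by
    rw [hκ0, d.nullOneForm_eq hy, smul_smul]; norm_num
  have hT : ∀ q ∈ U ×ˢ Ioo (-ε) ε,
      tContract ψ₁ q = (2 * q.2) • nullOneForm ψ₁ q.1 + q.2 ^ 2 • ν q := by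
    intro q hq
    rw [hκt q hq, sub_eq_iff_eq_add.1 (hνt q hq)]
    module
  refine ⟨ν, fun q => ∫ r in (0 : ℝ)..1, r ^ 2 • ν (q.1, r * q.2), hν, ?_, hT, ?_⟩
  · exact contDiffOn_integral_scaled d.isOpen (h := fun x => x.1 ^ 2 • ν x.2)
      ((contDiff_fst.pow 2).contDiffOn.smul (hν.comp contDiffOn_snd fun x hx => hx.2))
  · rintro ⟨y, t⟩ ⟨hy, ht⟩
    have h2 : ∀ r ∈ uIcc (0 : ℝ) 1, HasDerivAt (fun r : ℝ => moserForm ψ₁ (y, r * t))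
        (t ^ 3 • r ^ 2 • ν (y, r * t)) r := by
      intro r hr
      rw [uIcc_of_le zero_le_one] at hr
      have hm : r * t ∈ Ioo (-ε) ε := mul_mem_Ioo ht hr
      have h3 : HasDerivAt (fun r : ℝ => r * t) t r := by simpa using (hasDerivAt_id r).mul_const t
      have h4 : HasDerivAt (fun r : ℝ => moserForm ψ₁ (y, r * t)) _ r :=
        HasDerivAt.scomp (g₁ := fun t => moserForm ψ₁ (y, t)) (h := fun r => r * t) r
          (d.hasDerivAt_moserForm hy hm) h3
      refine h4.congr_deriv ?_
      rw [hT (y, r * t) ⟨hy, hm⟩]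
      module
    have hc : ContinuousOn (fun r : ℝ => t ^ 3 • r ^ 2 • ν (y, r * t)) (uIcc 0 1) := by
      have h5 : ContinuousOn (fun r : ℝ => ν (y, r * t)) (uIcc 0 1) := ?_
      · have h6 : ContinuousOn (fun r : ℝ => r ^ 2 • ν (y, r * t)) (uIcc 0 1) :=
          ContinuousOn.smul (f := fun r : ℝ => r ^ 2) (by fun_prop) h5
        exact h6.const_smul (t ^ 3)
      refine hν.continuousOn.comp (by fun_prop) fun r hr => ?_
      rw [uIcc_of_le zero_le_one] at hr
      exact ⟨hy, mul_mem_Ioo ht hr⟩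
    have h4 := intervalIntegral.integral_eq_sub_of_hasDerivAt h2 hc.intervalIntegrable
    rw [intervalIntegral.integral_smul] at h4
    simp only [one_mul, zero_mul] at h4
    rw [h4, moserForm, moserForm, d.tPrimitive_zero]
    simp

/-- Read off from ψ₀ = ψ₁ - dβ; closedness of the model below is obtained in the same way. -/
theorem contDiffOn_model : ContDiffOn ℝ ∞ ψ₀ (U ×ˢ Ioo (-ε) ε) := by
  have h := d.smooth.sub (contDiffOn_extDeriv d.isOpen_prod
    (contDiff_oneForm.comp_contDiffOn d.contDiffOn_moserForm))
  refine h.congr fun q hq => ?_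
  have := d.sub_eq_extDeriv hq
  rw [Function.comp_def, ← this]
  abel

theorem extDeriv_model {q : V × ℝ} (hq : q ∈ U ×ˢ Ioo (-ε) ε) : extDeriv ψ₀ q = 0 := by
  have hs : ContDiffOn ℝ ∞ (fun x => oneForm _ (moserForm ψ₁ x)) (U ×ˢ Ioo (-ε) ε) :=
    contDiff_oneForm.comp_contDiffOn d.contDiffOn_moserForm
  have h : ψ₀ =ᶠ[𝓝 q] fun q => ψ₁ q - extDeriv (fun x => oneForm _ (moserForm ψ₁ x)) q := by
    filter_upwards [d.isOpen_prod.mem_nhds hq] with x hx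
    rw [← d.sub_eq_extDeriv hx]
    abel
  rw [h.extDeriv_eq, extDeriv_sub (d.differentiableAt d.smooth hq)
    (d.differentiableAt (contDiffOn_extDeriv d.isOpen_prod hs) hq), d.closed q hq,
    extDeriv_extDeriv_of_smooth d.isOpen_prod hs hq, sub_zero]

theorem sub_apply {q : V × ℝ} (hq : q ∈ U ×ˢ Ioo (-ε) ε) (u v : V × ℝ) :
    ψ₁ q ![u, v] - ψ₀ q ![u, v] =
      fderiv ℝ (moserForm ψ₁) q u v - fderiv ℝ (moserForm ψ₁) q v u := by
  rw [← extDeriv_oneForm_apply (d.differentiableAt d.contDiffOn_moserForm hq),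
    ← d.sub_eq_extDeriv hq]
  rfl

theorem fderiv_moserForm_self {q : V × ℝ} (hq : q ∈ U ×ˢ Ioo (-ε) ε) (v : V × ℝ) :
    fderiv ℝ (moserForm ψ₁) q v (0, 1) = 0 := by
  have h3 : fderiv ℝ (fun q => moserForm ψ₁ q (0, 1)) q = 0 := by
    have : (fun q => moserForm ψ₁ q (0, 1)) =ᶠ[𝓝 q] fun _ => 0 := by
      filter_upwards [d.isOpen_prod.mem_nhds hq] with x hx using d.moserForm_self hx
    rw [this.fderiv_eq]; simp
  rw [fderiv_clm_apply (d.differentiableAt d.contDiffOn_moserForm hq)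
    (differentiableAt_const _)] at h3
  simpa using congrArg (fun A => A v) h3

/-- Because β(∂/∂t) vanishes identically, i_{∂/∂t} dβ = ∂ₜβ, which cancels all of the contraction of
ψ₁ except the term 2tα. -/
theorem tContract_model {q : V × ℝ} (hq : q ∈ U ×ˢ Ioo (-ε) ε) :
    tContract ψ₀ q = (2 * q.2) • nullOneForm ψ₁ q.1 := by
  refine ContinuousLinearMap.ext fun w => ?_
  have h := d.sub_apply hq (0, 1) w
  rw [d.fderiv_moserForm_self hq, d.fderiv_moserForm hq] at h
  simp only [tContract, toBilin_apply] at h ⊢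
  simp at h ⊢
  linarith

/-- β is cubic in t, so dβ vanishes at t = 0. -/
theorem model_zero {y : V} (hy : y ∈ U) : ψ₀ (y, 0) = ψ₁ (y, 0) := by
  have hq := d.mem_zero hy
  have h0 : fderiv ℝ (moserForm ψ₁) (y, 0) = 0 := by
    obtain ⟨ν, δ, hν, hδ, hT, hm⟩ := d.exists_factorization
    have : moserForm ψ₁ =ᶠ[𝓝 (y, 0)] fun q => q.2 ^ 3 • δ q := by
      filter_upwards [d.isOpen_prod.mem_nhds hq] with x hx using hm x hx
    rw [this.fderiv_eq, fderiv_fun_smul (by fun_prop) (d.differentiableAt hδ hq)]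
    have h5 : fderiv ℝ (fun q : V × ℝ => q.2 ^ 3) (y, 0) = 0 := by
      rw [fderiv_fun_pow _ (by fun_prop)]; simp
    rw [h5]
    ext <;> simp
  apply toBilin_injective
  refine ContinuousLinearMap.ext fun u => ContinuousLinearMap.ext fun v => ?_
  have := d.sub_apply hq u v
  rw [h0] at this
  simp only [toBilin_apply]
  simp at this
  linarith

/-- The Moser vector field extends smoothly to `t = 0`, where it vanishes to second order. -/
theorem exists_moserField_smooth {y₀ n : V} (hy : y₀ ∈ U)
    (hn : ∀ v, ψ₁ (y₀, 0) ![(n, 0), v] = 0) (hn' : nullOneForm ψ₁ y₀ (n, 0) ≠ 0)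
    (hker : ∀ v : V, (∀ v' : V, ψ₁ (y₀, 0) ![(v, 0), (v', 0)] = 0) → ∃ c : ℝ, v = c • n) :
    ∃ Ω : Set (ℝ × V × ℝ), IsOpen Ω ∧ Ω ⊆ univ ×ˢ U ×ˢ Ioo (-ε) ε ∧
      (∀ s : ℝ, (s, y₀, 0) ∈ Ω) ∧
      ContDiffOn ℝ ∞ (fun x : ℝ × V × ℝ => moserField ψ₀ ψ₁ x.1 x.2) Ω ∧
      (∀ s : ℝ, fderiv ℝ (fun x : ℝ × V × ℝ => moserField ψ₀ ψ₁ x.1 x.2) (s, y₀, 0) = 0) ∧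
      (∀ x ∈ Ω, x.2.2 = 0 → moserField ψ₀ ψ₁ x.1 x.2 = 0) ∧
      ∀ x ∈ Ω, toBilin _ (formPath ψ₀ ψ₁ x) (moserField ψ₀ ψ₁ x.1 x.2) = -moserForm ψ₁ x.2 := by
  obtain ⟨ν, δ, hν, hδ, hT, hm⟩ := d.exists_factorization
  set D : Set (ℝ × V × ℝ) := univ ×ˢ U ×ˢ Ioo (-ε) ε with hD
  have hDo : IsOpen D := isOpen_univ.prod d.isOpen_prod
  set Bp : ℝ × V × ℝ → V × ℝ →L[ℝ] V × ℝ →L[ℝ] ℝ := fun x => toBilin _ (formPath ψ₀ ψ₁ x) with hBp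
  have hlift : ∀ {Y : Type} [NormedAddCommGroup Y] [NormedSpace ℝ Y] {f : V × ℝ → Y},
      ContDiffOn ℝ ∞ f (U ×ˢ Ioo (-ε) ε) → ContDiffOn ℝ ∞ (fun x : ℝ × V × ℝ => f x.2) D :=
    fun hf => hf.comp contDiffOn_snd fun x hx => hx.2
  have hBps : ContDiffOn ℝ ∞ Bp D :=
    contDiff_toBilin.comp_contDiffOn ((hlift d.contDiffOn_model).add
      (contDiff_fst.contDiffOn.smul (hlift (d.smooth.sub d.contDiffOn_model))))
  -- On horizontal vectors the contraction of the path with ∂/∂t is 2tα + st²ν = tκ.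
  set κ : ℝ × V × ℝ → V × ℝ →L[ℝ] ℝ := fun x =>
    ((2 : ℝ) • nullOneForm ψ₁ x.2.1 + (x.1 * x.2.2) • ν x.2).comp (projZero V) with hκ
  have hκs : ContDiffOn ℝ ∞ κ D := by
    refine ContDiffOn.clm_comp ?_ contDiffOn_const
    have h1 : ContDiff ℝ ∞ fun x : ℝ × V × ℝ => x.1 * x.2.2 := by fun_prop
    exact ((hlift d.contDiffOn_nullOneForm).const_smul _).add (h1.contDiffOn.smul (hlift hν))
  -- S is the horizontal part of the path plus dt ∧ κ: the path with the factor t removed from the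
  -- ∂/∂t slot. The path itself is recovered by multiplying the t-components of both arguments by t.
  set S : ℝ × V × ℝ → V × ℝ →L[ℝ] V × ℝ →L[ℝ] ℝ := fun x =>
    ((ContinuousLinearMap.compL ℝ (V × ℝ) (V × ℝ) ℝ).flip (projZero V)).comp
      ((Bp x).comp (projZero V)) + (ContinuousLinearMap.snd ℝ V ℝ).smulRight (κ x) -
      (κ x).smulRight (ContinuousLinearMap.snd ℝ V ℝ) with hS
  have hSs : ContDiffOn ℝ ∞ S D :=
    ((contDiffOn_const.clm_comp (hBps.clm_comp contDiffOn_const)).add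
      (contDiffOn_const.smulRight hκs)).sub (hκs.smulRight contDiffOn_const)
  have hSa : ∀ x u v, S x u v = Bp x (u.1, 0) (v.1, 0) + u.2 * κ x v - κ x u * v.2 :=
    fun x u v => rfl
  have hκa : ∀ x (v : V × ℝ), κ x v = κ x (v.1, 0) := fun x v => rfl
  have hBt : ∀ x ∈ D, ∀ v : V, Bp x (0, 1) (v, 0) = x.2.2 * κ x (v, 0) := by
    intro x hx v
    have h1 : Bp x (0, 1) = tContract ψ₀ x.2 + x.1 • (tContract ψ₁ x.2 - tContract ψ₀ x.2) := by
      simp only [hBp, formPath, tContract, map_add, map_smul, map_sub]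
      rfl
    rw [h1, hT _ hx.2, d.tContract_model hx.2]
    simp [hκ]
    ring
  have hBsw : ∀ x u v, Bp x u v = -Bp x v u := fun x u v => by
    simp only [hBp, toBilin_apply]; exact form_swap _ _ _
  have hBS : ∀ x ∈ D, ∀ u v, Bp x u v = S x (u.1, x.2.2 * u.2) (v.1, x.2.2 * v.2) := by
    intro x hx u v
    have hsp : ∀ u : V × ℝ, u = (u.1, 0) + u.2 • (0, 1) := fun u => by ext <;> simp
    have h0 : Bp x (0, 1) (0, 1) = 0 := by simp only [hBp, toBilin_apply]; exact form_self _ _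
    conv_lhs => rw [hsp u, hsp v]
    simp only [map_add, map_smul, add_apply, smul_apply, h0, hBt x hx, hBsw x _ (0, 1), hSa,
      hκa x (_, x.2.2 * _), smul_eq_mul]
    ring
  -- The open set where the rescaled form S is nondegenerate; it reaches across t = 0, where the
  -- path itself is degenerate.
  set Ω : Set (ℝ × V × ℝ) := D ∩ S ⁻¹' range
    ((↑) : ((V × ℝ) ≃L[ℝ] (V × ℝ →L[ℝ] ℝ)) → (V × ℝ) →L[ℝ] (V × ℝ →L[ℝ] ℝ)) with hΩ
  have hΩo : IsOpen Ω := hSs.continuousOn.isOpen_inter_preimage hDo ContinuousLinearEquiv.isOpen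
  have hinv : ∀ x ∈ Ω, (S x).IsInvertible := fun x hx => hx.2
  have hinvB : ∀ x ∈ Ω, x.2.2 ≠ 0 → (Bp x).IsInvertible := by
    intro x hx h0
    apply isInvertible_of_injective
    intro u hu
    have h1 : S x (u.1, x.2.2 * u.2) = S x 0 := by
      refine ContinuousLinearMap.ext fun v => ?_
      have := hBS x hx.1 u (v.1, x.2.2⁻¹ * v.2)
      rw [hu] at this
      simp only [← mul_assoc, mul_inv_cancel₀ h0, one_mul] at this
      rw [← this]; simp
    have h2 := (hinv x hx).injective h1
    simp [h0] at h2
    ext <;> simp [h2]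
  set Y : ℝ × V × ℝ → V × ℝ := fun x => (S x).inverse (-δ x.2) with hY
  have hYs : ContDiffOn ℝ ∞ Y Ω := by
    intro x hx
    obtain ⟨e, he⟩ := hx.2
    have h1 : ContDiffAt ℝ ∞ ContinuousLinearMap.inverse (S x) := by
      rw [← he]; exact contDiffAt_map_inverse e
    exact (h1.comp_contDiffWithinAt x ((hSs x hx.1).mono inter_subset_left)).clm_apply
      ((hlift hδ x hx.1).mono inter_subset_left).neg
  -- With β = t³δ and S Y = -δ, the solution is t³ Y with its t-component divided by t, that is t²(t
  -- Y₁, Y₂).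
  have hX : ∀ x ∈ Ω, moserField ψ₀ ψ₁ x.1 x.2 = x.2.2 ^ 2 • (x.2.2 • (Y x).1, (Y x).2) := by
    intro x hx
    change (Bp x).inverse (-moserForm ψ₁ x.2) = _
    rcases eq_or_ne x.2.2 0 with h0 | h0
    -- At t = 0 the vector ∂/∂t lies in the kernel of the path, so `inverse` takes its default value
    -- 0, in agreement with the formula.
    · have hni : ¬ (Bp x).IsInvertible := by
        intro hi
        have h1 : Bp x (0, 1) = Bp x 0 := by
          refine ContinuousLinearMap.ext fun v => ?_
          rw [hBS x hx.1, h0, map_zero]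
          have h2 : ((((0 : V), (1 : ℝ)) : V × ℝ).1, (0 : ℝ) * (((0 : V), (1 : ℝ)) : V × ℝ).2) = 0 := by
            simp
          rw [h2, map_zero]; rfl
        have := hi.injective h1
        simp at this
      rw [ContinuousLinearMap.inverse_of_not_isInvertible hni, h0]
      simp
    · have hi := hinvB x hx h0
      rw [hi.inverse_apply_eq]
      refine ContinuousLinearMap.ext fun v => ?_
      rw [hBS x hx.1, hm _ hx.1.2]
      have h1 : (((x.2.2 ^ 2 • (x.2.2 • (Y x).1, (Y x).2) : V × ℝ).1, x.2.2 *
          (x.2.2 ^ 2 • (x.2.2 • (Y x).1, (Y x).2) : V × ℝ).2) : V × ℝ) = x.2.2 ^ 3 • Y x := by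
        ext
        · simp [smul_smul, pow_succ]
        · simp; ring
      rw [h1, map_smul, hY, (hinv x hx).self_apply_inverse]
      -- δ kills ∂/∂t, so rescaling the t-component of the argument does not change its value.
      have h2 : δ x.2 (0, 1) = 0 := by
        have := d.moserForm_self hx.1.2
        rw [hm _ hx.1.2] at this
        simpa [h0] using this
      have hsp : ∀ c, δ x.2 (v.1, c) = δ x.2 (v.1, 0) := fun c => by
        rw [show (v.1, c) = (v.1, 0) + c • ((0 : V), (1 : ℝ)) by simp, map_add, map_smul, h2]
        simp
      simp [hsp]
  have hg : ContDiffOn ℝ ∞ (fun x : ℝ × V × ℝ => (x.2.2 • (Y x).1, (Y x).2)) Ω :=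
    ((contDiff_snd.snd.contDiffOn).smul hYs.fst).prodMk hYs.snd
  -- Nondegeneracy of S at the base point. If S(u, ·) = 0, pairing with n gives u₂ = 0 because κ(n)
  -- = 2α(n) ≠ 0; pairing with horizontal vectors makes u₁ a multiple of n; pairing with ∂/∂t makes
  -- this multiple zero.
  have hmem : ∀ s : ℝ, (s, y₀, (0 : ℝ)) ∈ Ω := by
    intro s
    have hd : (s, y₀, (0 : ℝ)) ∈ D := ⟨mem_univ _, d.mem_zero hy⟩
    refine ⟨hd, isInvertible_of_injective _ fun u hu => ?_⟩
    have hB0 : ∀ v w, Bp (s, y₀, 0) v w = ψ₁ (y₀, 0) ![v, w] := by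
      intro v w
      simp only [hBp, formPath, d.model_zero hy, sub_self, smul_zero, add_zero, toBilin_apply]
    have hk0 : ∀ v : V, κ (s, y₀, 0) (v, 0) = 2 * nullOneForm ψ₁ y₀ (v, 0) := fun v => by
      simp [hκ]
    have h1 : ∀ v, S (s, y₀, 0) u v = 0 := fun v => by rw [hu]; rfl
    have ha := h1 (0, 1)
    have hb := h1 (n, 0)
    rw [hSa, hB0, hκa _ u, hκa _ (0, 1), hk0, hk0, show (((0 : V), (1 : ℝ)).1, (0 : ℝ)) = 0 from rfl] at ha
    rw [hSa, hB0, form_swap, hn, hκa _ u, hk0, hk0] at hb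
    have hu2 : u.2 = 0 := by simpa [hn'] using hb
    have hker' : ∀ v' : V, ψ₁ (y₀, 0) ![(u.1, 0), (v', 0)] = 0 := by
      intro v'
      have := h1 (v', 0)
      rw [hSa, hB0, hu2] at this
      simpa using this
    obtain ⟨c, hc⟩ := hker _ hker'
    rw [← toBilin_apply] at ha
    have hc0 : c = 0 := by
      have h3 : nullOneForm ψ₁ y₀ (u.1, 0) = c * nullOneForm ψ₁ y₀ (n, 0) := by
        rw [hc, show ((c • n, (0 : ℝ)) : V × ℝ) = c • (n, 0) by simp, map_smul, smul_eq_mul]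
      have h4 : toBilin (V × ℝ) (ψ₁ (y₀, 0)) (u.1, 0) 0 = 0 := map_zero _
      rw [h4, hu2, h3] at ha
      simpa [hn'] using ha
    ext
    · simp [hc, hc0]
    · simpa using hu2
  have hsm : ContDiffOn ℝ ∞ (fun x : ℝ × V × ℝ => moserField ψ₀ ψ₁ x.1 x.2) Ω :=
    (((contDiff_snd.snd.pow 2).contDiffOn).smul hg).congr hX
  refine ⟨Ω, hΩo, inter_subset_left, hmem, hsm, ?_, ?_, ?_⟩
  · intro s
    have h1 : (fun x : ℝ × V × ℝ => moserField ψ₀ ψ₁ x.1 x.2) =ᶠ[𝓝 (s, y₀, 0)]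
        fun x => x.2.2 ^ 2 • (x.2.2 • (Y x).1, (Y x).2) := by
      filter_upwards [hΩo.mem_nhds (hmem s)] with x hx using hX x hx
    have hgd := (hg.contDiffAt (hΩo.mem_nhds (hmem s))).differentiableAt (by simp)
    rw [h1.fderiv_eq, fderiv_fun_smul (by fun_prop) hgd]
    have h5 : fderiv ℝ (fun q : ℝ × V × ℝ => q.2.2 ^ 2) (s, y₀, 0) = 0 := by
      rw [fderiv_fun_pow _ (by fun_prop)]; simp
    rw [h5]
    refine ContinuousLinearMap.ext fun v => ?_
    simp
  · intro x hx h0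
    rw [hX x hx, h0]; simp
  · intro x hx
    rcases eq_or_ne x.2.2 0 with h0 | h0
    · rw [hX x hx, hm _ hx.1.2, h0]; simp
    · exact (hinvB x hx h0).self_apply_inverse _

end MoserData

end MoserField

end

end FoldedSymplectic

namespace FoldedSymplectic

section

open Set Filter

/-! ### The time-one map of the Moser field in a chart -/

section LocalFlow

variable {V : Type} [NormedAddCommGroup V] [NormedSpace ℝ V] [FiniteDimensional ℝ V]

theorem ContDiffOn.extendCurve_apply {P E : Type} [NormedAddCommGroup P] [NormedSpace ℝ P]
    [NormedAddCommGroup E] [NormedSpace ℝ E] {Γ : P → C(Icc (0 : ℝ) 1, E)} {O : Set P}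
    (h : ContDiffOn ℝ ∞ Γ O) (s : ℝ) : ContDiffOn ℝ ∞ (fun p => extendCurve (Γ p) s) O :=
  (evalCurve E (projIcc 0 1 zero_le_one s)).contDiff.comp_contDiffOn h

theorem fderiv_extendCurve_apply {P E : Type} [NormedAddCommGroup P] [NormedSpace ℝ P]
    [NormedAddCommGroup E] [NormedSpace ℝ E] {Γ : P → C(Icc (0 : ℝ) 1, E)} {p : P}
    (h : DifferentiableAt ℝ Γ p) (s : ℝ) (u : P) :
    fderiv ℝ (fun p => extendCurve (Γ p) s) p u = extendCurve (fderiv ℝ Γ p u) s := by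
  have h1 : HasFDerivAt (fun p => extendCurve (Γ p) s) _ p :=
    (evalCurve E (projIcc 0 1 zero_le_one s)).hasFDerivAt.comp p h.hasFDerivAt
  rw [h1.fderiv]
  rfl

/-- The Moser field and its differential vanish at the base point, which is what the existence
theorem needs for the full unit interval. The variational equation there has zero right-hand side,
so the time-one map has identity derivative. The pullback identity is the transport of forms. -/
theorem MoserData.exists_flow {U : Set V} {ε : ℝ} {ψ₀ ψ₁ : V × ℝ → (V × ℝ) [⋀^Fin 2]→L[ℝ] ℝ}
    (d : MoserData U ε ψ₀ ψ₁) {y₀ n : V} (hy : y₀ ∈ U)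
    (hn : ∀ v, ψ₁ (y₀, 0) ![(n, 0), v] = 0) (hn' : nullOneForm ψ₁ y₀ (n, 0) ≠ 0)
    (hker : ∀ v : V, (∀ v' : V, ψ₁ (y₀, 0) ![(v, 0), (v', 0)] = 0) → ∃ c : ℝ, v = c • n) :
    ∃ (Ω : Set (ℝ × V × ℝ)) (O : Set (V × ℝ)) (c : V × ℝ → ℝ → V × ℝ), IsOpen Ω ∧
      Ω ⊆ univ ×ˢ U ×ˢ Ioo (-ε) ε ∧
      ContDiffOn ℝ ∞ (fun x : ℝ × V × ℝ => moserField ψ₀ ψ₁ x.1 x.2) Ω ∧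
      (∀ x ∈ Ω, x.2.2 = 0 → moserField ψ₀ ψ₁ x.1 x.2 = 0) ∧
      IsOpen O ∧ (y₀, 0) ∈ O ∧
      (∀ p ∈ O, c p 0 = p ∧ ∀ s ∈ Icc (0 : ℝ) 1, (s, c p s) ∈ Ω ∧
        HasDerivWithinAt (c p) (moserField ψ₀ ψ₁ s (c p s)) (Icc 0 1) s) ∧
      ContDiffOn ℝ ∞ (fun p => c p 1) O ∧
      HasFDerivAt (fun p => c p 1) (ContinuousLinearMap.id ℝ (V × ℝ)) (y₀, 0) ∧
      ∀ p ∈ O, ∀ u v, ψ₁ (c p 1) ![fderiv ℝ (fun p => c p 1) p u, fderiv ℝ (fun p => c p 1) p v] =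
        ψ₀ p ![u, v] := by
  obtain ⟨Ω, hΩ, hΩD, hmem, hsm, hX', hX0, hBX⟩ := d.exists_moserField_smooth hy hn hn' hker
  set X : ℝ × V × ℝ → V × ℝ := fun x => moserField ψ₀ ψ₁ x.1 x.2 with hXdef
  -- The parameter is only the initial point; the field does not depend on it otherwise, so pr
  -- forgets it.
  set pr : ℝ × (V × ℝ) × (V × ℝ) →L[ℝ] ℝ × V × ℝ :=
    (ContinuousLinearMap.fst ℝ _ _).prod ((ContinuousLinearMap.snd ℝ _ _).comp
      (ContinuousLinearMap.snd ℝ _ _)) with hpr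
  have hfd : ∀ s p x, (s, x) ∈ Ω → ∀ u v, fderiv ℝ (fun z => X (pr z)) (s, p, x) (0, u, v) =
      fderiv ℝ X (s, x) (0, v) := by
    intro s p x hx u v
    have h1 : HasFDerivAt (fun z => X (pr z)) _ (s, p, x) :=
      HasFDerivAt.comp (g := X) (s, p, x) ((hsm.contDiffAt (hΩ.mem_nhds hx)).differentiableAt
        (by simp)).hasFDerivAt pr.hasFDerivAt
    rw [h1.fderiv]
    rfl
  obtain ⟨O, hO, hpO, Γ, hΓ, hΓ0, hΓp⟩ := exists_smooth_solution (ContinuousLinearMap.id ℝ (V × ℝ))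
    (y₀, (0 : ℝ)) (hΩ.preimage pr.continuous) (fun s hs => hmem s) (f := fun z => X (pr z))
    (hsm.comp pr.contDiff.contDiffOn fun x hx => hx)
    (fun s hs => hX0 _ (hmem s) rfl)
    (fun s hs v => by
      rw [ContinuousLinearMap.id_apply, hfd _ _ _ (hmem s), hX']; rfl)
  have hdΓ : ∀ p ∈ O, DifferentiableAt ℝ Γ p := fun p hp =>
    (hΓ.contDiffAt (hO.mem_nhds hp)).differentiableAt (by simp)
  refine ⟨Ω, O, fun p => extendCurve (Γ p), hΩ, hΩD, hsm, hX0, hO, hpO,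
    fun p hp => ⟨(hΓp p hp).1, (hΓp p hp).2.1⟩, ContDiffOn.extendCurve_apply hΓ 1, ?_, ?_⟩
  · have h1 := ((ContDiffOn.extendCurve_apply hΓ 1).contDiffAt
      (hO.mem_nhds hpO)).differentiableAt (by simp) |>.hasFDerivAt
    refine h1.congr_fderiv ?_
    refine ContinuousLinearMap.ext fun (u : V × ℝ) => ?_
    rw [fderiv_extendCurve_apply (hdΓ _ hpO)]
    obtain ⟨-, -, h2⟩ := hΓp _ hpO
    obtain ⟨h3, h4⟩ := h2 u
    have h5 := constant_of_derivWithin_zero (a := 0) (b := 1)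
      (fun s hs => (h4 s hs).differentiableWithinAt)
      (fun s hs => by
        have hs' := Ico_subset_Icc_self hs
        rw [(h4 s hs').derivWithin (uniqueDiffOn_Icc zero_lt_one s hs'), hΓ0 s hs',
          ContinuousLinearMap.id_apply, hfd _ _ _ (hmem s), hX']
        rfl) 1 (by simp)
    rw [h5, h3]
  · intro p hp u v
    rw [fderiv_extendCurve_apply (hdΓ _ hp), fderiv_extendCurve_apply (hdΓ _ hp)]
    obtain ⟨h0, h1, h2⟩ := hΓp _ hp
    have hd : ∀ {Y : Type} [NormedAddCommGroup Y] [NormedSpace ℝ Y] {f : V × ℝ → Y},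
      ContDiffOn ℝ ∞ f (U ×ˢ Ioo (-ε) ε) → ∀ x ∈ Ω, DifferentiableAt ℝ f x.2 :=
      fun hf x hx => d.differentiableAt hf (hΩD hx).2
    have hB : ∀ x ∈ Ω, DifferentiableAt ℝ (formPath ψ₀ ψ₁) x := fun x hx =>
      ((hd d.contDiffOn_model x hx).comp x differentiableAt_snd).add
        (differentiableAt_fst.smul (((hd d.smooth x hx).comp x differentiableAt_snd).sub
          ((hd d.contDiffOn_model x hx).comp x differentiableAt_snd)))
    have h := form_transport (B := formPath ψ₀ ψ₁) (X := X) (β := moserForm ψ₁) hΩ hB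
      (fun x hx => (hsm.contDiffAt (hΩ.mem_nhds hx)).differentiableAt (by simp))
      (hd d.contDiffOn_moserForm) hBX ?_ ?_ (c := extendCurve (Γ p))
      (u := extendCurve (fderiv ℝ Γ p u)) (w := extendCurve (fderiv ℝ Γ p v)) h1
      (fun s hs => by
        have := (h2 u).2 s hs
        rwa [hfd s p (extendCurve (Γ p) s) (h1 s hs).1] at this)
      (fun s hs => by
        have := (h2 v).2 s hs
        rwa [hfd s p (extendCurve (Γ p) s) (h1 s hs).1] at this)
    · rw [h0, (h2 u).1, (h2 v).1] at h
      simpa [formPath] using h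
    · intro x hx
      have hm := (hΩD hx).2
      have e : (fun q => formPath ψ₀ ψ₁ (x.1, q)) = ψ₀ + x.1 • (fun q => ψ₁ q - ψ₀ q) := rfl
      have h3 := hd d.smooth x hx
      have h4 := hd d.contDiffOn_model x hx
      rw [e, extDeriv_add h4 (DifferentiableAt.const_smul (f := fun q => ψ₁ q - ψ₀ q) (h3.sub h4) _),
        extDeriv_smul, extDeriv_sub h3 h4,
        d.closed _ hm, d.extDeriv_model hm]
      simp
    · intro x hx u v
      have hm := (hΩD hx).2
      rw [fderiv_toBilin_apply (hB x hx), ← d.sub_apply hm]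
      have h3 : HasDerivAt (fun r : ℝ => (x.1 + r, x.2)) ((1 : ℝ), (0 : V × ℝ)) 0 :=
        ((hasDerivAt_id (0 : ℝ)).const_add x.1).prodMk (hasDerivAt_const _ _)
      have hBd : DifferentiableAt ℝ (fun x => formPath ψ₀ ψ₁ x ![u, v]) x := by
        have := (differentiableAt_toBilin (hB x hx)).clm_apply (differentiableAt_const u)
          |>.clm_apply (differentiableAt_const v)
        simpa only [toBilin_apply] using this
      have h4 : HasDerivAt (fun r : ℝ => formPath ψ₀ ψ₁ (x.1 + r, x.2) ![u, v])
          (fderiv ℝ (fun x => formPath ψ₀ ψ₁ x ![u, v]) x (1, 0)) 0 :=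
        HasFDerivAt.comp_hasDerivAt (l := fun x => formPath ψ₀ ψ₁ x ![u, v])
          (f := fun r : ℝ => (x.1 + r, x.2)) 0 (by simpa using hBd.hasFDerivAt) h3
      have h5 : HasDerivAt (fun r : ℝ => formPath ψ₀ ψ₁ (x.1 + r, x.2) ![u, v])
          (ψ₁ x.2 ![u, v] - ψ₀ x.2 ![u, v]) 0 := by
        have e : (fun r : ℝ => formPath ψ₀ ψ₁ (x.1 + r, x.2) ![u, v]) = fun r =>
            ψ₀ x.2 ![u, v] + (x.1 + r) * (ψ₁ x.2 ![u, v] - ψ₀ x.2 ![u, v]) := rfl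
        rw [e]
        simpa using (((hasDerivAt_id (0 : ℝ)).const_add x.1).mul_const
          (ψ₁ x.2 ![u, v] - ψ₀ x.2 ![u, v])).const_add (ψ₀ x.2 ![u, v])
      exact h4.unique h5

end LocalFlow

end

end FoldedSymplectic

namespace FoldedSymplectic

section

open Set Filter

/-! ### Forms, pullbacks and the exterior derivative in charts -/

section Charts

variable {E : Type*} [NormedAddCommGroup E] [NormedSpace ℝ E] {H : Type*} [TopologicalSpace H]
  {E' : Type*} [NormedAddCommGroup E'] [NormedSpace ℝ E'] {H' : Type*} [TopologicalSpace H']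
  {I : ModelWithCorners ℝ E H} {I' : ModelWithCorners ℝ E' H'} [I.Boundaryless] [I'.Boundaryless]
  {M : Type*} [TopologicalSpace M] [ChartedSpace H M] [IsManifold I ∞ M]
  {N : Type*} [TopologicalSpace N] [ChartedSpace H' N] [IsManifold I' ∞ N] {k : ℕ}

variable (I) in
/-- The chart `extChartAt I x₀` in coordinates at the source of a map, for a map `f : M → N`. -/
def inCharts (I' : ModelWithCorners ℝ E' H') (x₀ : M) (y₀ : N) (f : M → N) (y : E) : E' :=
  extChartAt I' y₀ (f ((extChartAt I x₀).symm y))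

theorem mdifferentiableAt_extChartAt_symm {x₀ : M} {y : E} (hy : y ∈ (extChartAt I x₀).target) :
    MDifferentiableAt 𝓘(ℝ, E) I (extChartAt I x₀).symm y := by
  have : IsManifold I 1 M := .of_le (n := ∞) (by simp)
  have h := mdifferentiableWithinAt_extChartAt_symm (I := I) hy
  rwa [I.range_eq_univ, mdifferentiableWithinAt_univ] at h

theorem mdifferentiableAt_extChartAt_of_mem {x₀ x : M} (hx : x ∈ (extChartAt I x₀).source) :
    MDifferentiableAt I 𝓘(ℝ, E) (extChartAt I x₀) x := by
  have : IsManifold I 1 M := .of_le (n := ∞) (by simp)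
  exact mdifferentiableAt_extChartAt (by rwa [extChartAt_source] at hx)

theorem mfderiv_extChartAt_symm_apply {x₀ : M} {y : E} (hy : y ∈ (extChartAt I x₀).target) (v : E) :
    mfderiv I 𝓘(ℝ, E) (extChartAt I x₀) ((extChartAt I x₀).symm y)
      (mfderiv 𝓘(ℝ, E) I (extChartAt I x₀).symm y v) = v := by
  have : IsManifold I 1 M := .of_le (n := ∞) (by simp)
  have h := mfderiv_extChartAt_comp_mfderivWithin_extChartAt_symm (I := I) hy
  rw [I.range_eq_univ, mfderivWithin_univ] at h
  exact congrArg (fun A => A v) h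

theorem mfderiv_symm_extChartAt_apply {x₀ x : M} (hx : x ∈ (extChartAt I x₀).source)
    (v : TangentSpace I x) :
    mfderiv 𝓘(ℝ, E) I (extChartAt I x₀).symm (extChartAt I x₀ x)
      (mfderiv I 𝓘(ℝ, E) (extChartAt I x₀) x v) = v := by
  have : IsManifold I 1 M := .of_le (n := ∞) (by simp)
  have h := mfderivWithin_extChartAt_symm_comp_mfderiv_extChartAt' (I := I) hx
  rw [I.range_eq_univ, mfderivWithin_univ] at h
  exact congrArg (fun A => A v) h

theorem mfderiv_symm_extChartAt_symm_apply {x₀ : M} {y : E} (hy : y ∈ (extChartAt I x₀).target)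
    (v : TangentSpace I ((extChartAt I x₀).symm y)) :
    mfderiv 𝓘(ℝ, E) I (extChartAt I x₀).symm y
      (mfderiv I 𝓘(ℝ, E) (extChartAt I x₀) ((extChartAt I x₀).symm y) v) = v := by
  have : IsManifold I 1 M := .of_le (n := ∞) (by simp)
  have h := mfderivWithin_extChartAt_symm_comp_mfderiv_extChartAt (I := I) hy
  rw [I.range_eq_univ, mfderivWithin_univ] at h
  exact congrArg (fun A => A v) h

theorem hasFDerivAt_inCharts {x₀ : M} {y₀ : N} {f : M → N} {y : E}
    (hy : y ∈ (extChartAt I x₀).target)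
    (hf : MDifferentiableAt I I' f ((extChartAt I x₀).symm y))
    (hfy : f ((extChartAt I x₀).symm y) ∈ (extChartAt I' y₀).source) :
    ∃ L : E →L[ℝ] E', HasFDerivAt (inCharts I I' x₀ y₀ f) L y ∧ ∀ v : E, L v =
      mfderiv I' 𝓘(ℝ, E') (extChartAt I' y₀) (f ((extChartAt I x₀).symm y))
        (mfderiv I I' f ((extChartAt I x₀).symm y)
          (mfderiv 𝓘(ℝ, E) I (extChartAt I x₀).symm y v)) := by
  have h1 := (mdifferentiableAt_extChartAt_symm hy).hasMFDerivAt
  have h2 := hf.hasMFDerivAt.comp y h1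
  have h3 := (mdifferentiableAt_extChartAt_of_mem hfy).hasMFDerivAt.comp y h2
  exact ⟨_, h3.hasFDerivAt, fun v => rfl⟩

theorem fderiv_inCharts_apply {x₀ : M} {y₀ : N} {f : M → N} {y : E}
    (hy : y ∈ (extChartAt I x₀).target)
    (hf : MDifferentiableAt I I' f ((extChartAt I x₀).symm y))
    (hfy : f ((extChartAt I x₀).symm y) ∈ (extChartAt I' y₀).source) (v : E) :
    fderiv ℝ (inCharts I I' x₀ y₀ f) y v =
      mfderiv I' 𝓘(ℝ, E') (extChartAt I' y₀) (f ((extChartAt I x₀).symm y))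
        (mfderiv I I' f ((extChartAt I x₀).symm y)
          (mfderiv 𝓘(ℝ, E) I (extChartAt I x₀).symm y v)) := by
  obtain ⟨L, h, hL⟩ := hasFDerivAt_inCharts hy hf hfy
  rw [h.fderiv, hL]

theorem pullback_apply (f : M → N) (η : DForm I' N k) (x : M) (v : Fin k → TangentSpace I x) :
    pullback I f η x v = η (f x) (fun i => mfderiv I I' f x (v i)) := rfl

theorem inChart_apply (x₀ : M) (η : DForm I M k) (y : E) (v : Fin k → E) :
    inChart x₀ η y v = η ((extChartAt I x₀).symm y)
      (fun i => mfderiv 𝓘(ℝ, E) I (extChartAt I x₀).symm y (v i)) := rfl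

/-- All tangent spaces are definitionally the model space, so forms at propositionally equal points
can be compared on the same vectors. This is the device for moving base points throughout. -/
theorem form_congr {η : DForm I M k} {x x' : M} (h : x = x') (v : Fin k → E) :
    η x v = η x' v := by subst h; rfl

theorem inChart_pullback {x₀ : M} {y₀ : N} {f : M → N} {η : DForm I' N k} {y : E}
    (hy : y ∈ (extChartAt I x₀).target)
    (hf : MDifferentiableAt I I' f ((extChartAt I x₀).symm y))
    (hfy : f ((extChartAt I x₀).symm y) ∈ (extChartAt I' y₀).source) :
    inChart x₀ (pullback I f η) y = (inChart y₀ η (inCharts I I' x₀ y₀ f y)).compContinuousLinearMap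
      (fderiv ℝ (inCharts I I' x₀ y₀ f) y) := by
  refine ContinuousAlternatingMap.ext fun v : Fin k → E => ?_
  change pullback I f η ((extChartAt I x₀).symm y)
      (fun i => mfderiv 𝓘(ℝ, E) I (extChartAt I x₀).symm y (v i)) =
    inChart y₀ η (inCharts I I' x₀ y₀ f y) (fun i => fderiv ℝ (inCharts I I' x₀ y₀ f) y (v i))
  rw [pullback_apply, inChart_apply]
  refine (form_congr ((extChartAt I' y₀).left_inv hfy).symm _).trans ?_
  refine congrArg (η _) (funext fun i => ?_)
  rw [fderiv_inCharts_apply hy hf hfy]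
  exact (mfderiv_symm_extChartAt_apply hfy _).symm

theorem pullback_id (η : DForm I M k) : pullback I (id : M → M) η = η := by
  funext x
  refine ContinuousAlternatingMap.ext fun v => ?_
  rw [pullback_apply]
  refine congrArg (η x) (funext fun i => ?_)
  rw [mfderiv_id]; rfl

theorem contDiffAt_inCharts {x₀ : M} {y₀ : N} {f : M → N} {y : E}
    (hy : y ∈ (extChartAt I x₀).target)
    (hf : ContMDiffAt I I' ∞ f ((extChartAt I x₀).symm y))
    (hfy : f ((extChartAt I x₀).symm y) ∈ (extChartAt I' y₀).source) :
    ContDiffAt ℝ ∞ (inCharts I I' x₀ y₀ f) y := by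
  have h1 : ContMDiffAt 𝓘(ℝ, E) I ∞ (extChartAt I x₀).symm y := by
    have := contMDiffOn_extChartAt_symm (I := I) (n := ∞) x₀
    exact (this y hy).contMDiffAt ((isOpen_extChartAt_target x₀).mem_nhds hy)
  have h2 : ContMDiffAt I' 𝓘(ℝ, E') ∞ (extChartAt I' y₀) (f ((extChartAt I x₀).symm y)) :=
    contMDiffAt_extChartAt' (by rwa [extChartAt_source] at hfy)
  exact (h2.comp y (hf.comp y h1)).contDiffAt

/-- Change of charts. -/
theorem inChart_change {x₀ x₁ : M} {η : DForm I M k} {y : E} (hy : y ∈ (extChartAt I x₁).target)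
    (hy' : (extChartAt I x₁).symm y ∈ (extChartAt I x₀).source) :
    inChart x₁ η y = (inChart x₀ η (inCharts I I x₁ x₀ id y)).compContinuousLinearMap
      (fderiv ℝ (inCharts I I x₁ x₀ id) y) := by
  conv_lhs => rw [← pullback_id η]
  exact inChart_pullback hy mdifferentiableAt_id hy'

theorem contDiffAt_inCharts_id {x₀ x₁ : M} {y : E} (hy : y ∈ (extChartAt I x₁).target)
    (hy' : (extChartAt I x₁).symm y ∈ (extChartAt I x₀).source) :
    ContDiffAt ℝ ∞ (inCharts I I x₁ x₀ (id : M → M)) y :=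
  contDiffAt_inCharts hy contMDiffAt_id hy'

theorem eventually_mem_chart {x₀ x₁ : M} {y : E} (hy : y ∈ (extChartAt I x₁).target)
    (hy' : (extChartAt I x₁).symm y ∈ (extChartAt I x₀).source) :
    ∀ᶠ z in 𝓝 y, z ∈ (extChartAt I x₁).target ∧
      (extChartAt I x₁).symm z ∈ (extChartAt I x₀).source := by
  have h1 := (isOpen_extChartAt_target (I := I) x₁).mem_nhds hy
  have h2 := (continuousOn_extChartAt_symm (I := I) x₁).continuousAt h1
  filter_upwards [h1, h2.preimage_mem_nhds ((isOpen_extChartAt_source (I := I) x₀).mem_nhds hy')]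
    with z hz hz' using ⟨hz, hz'⟩

/-- The exterior derivative may be computed in any chart. -/
theorem extD_eq {x₀ x : M} {η : DForm I M k} (hx : x ∈ (extChartAt I x₀).source)
    (h : DifferentiableAt ℝ (inChart x₀ η) (extChartAt I x₀ x)) :
    extD η x = (extDeriv (inChart x₀ η) (extChartAt I x₀ x)).compContinuousLinearMap
      (mfderiv I 𝓘(ℝ, E) (extChartAt I x₀) x) := by
  have hy := mem_extChartAt_target (I := I) x
  have hy' : (extChartAt I x).symm (extChartAt I x x) ∈ (extChartAt I x₀).source := by
    rwa [extChartAt_to_inv]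
  set F := inCharts I I x x₀ (id : M → M) with hF
  have e1 : inChart x η =ᶠ[𝓝 (extChartAt I x x)] fun y =>
      (inChart x₀ η (F y)).compContinuousLinearMap (fderiv ℝ F y) := by
    filter_upwards [eventually_mem_chart hy hy'] with z hz using inChart_change hz.1 hz.2
  have e2 : F (extChartAt I x x) = extChartAt I x₀ x := by simp [hF, inCharts]
  have e3 : extDeriv (inChart x η) (extChartAt I x x) =
      (extDeriv (inChart x₀ η) (extChartAt I x₀ x)).compContinuousLinearMap
        (fderiv ℝ F (extChartAt I x x)) := by
    rw [e1.extDeriv_eq, extDeriv_pullback (r := ∞) (f := F) (by rwa [e2])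
      (contDiffAt_inCharts_id hy hy') (by simpa using two_le_infty), e2]
  refine ContinuousAlternatingMap.ext fun v => ?_
  change extDeriv (inChart x η) (extChartAt I x x)
    (fun i => mfderiv I 𝓘(ℝ, E) (extChartAt I x) x (v i)) = _
  rw [e3]
  refine congrArg (extDeriv (inChart x₀ η) (extChartAt I x₀ x)) (funext fun i => ?_)
  change fderiv ℝ F (extChartAt I x x) (mfderiv I 𝓘(ℝ, E) (extChartAt I x) x (v i)) = _
  refine (fderiv_inCharts_apply hy mdifferentiableAt_id hy' _).trans ?_
  rw [mfderiv_id]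
  change mfderiv I 𝓘(ℝ, E) (extChartAt I x₀) ((extChartAt I x).symm (extChartAt I x x))
    (mfderiv 𝓘(ℝ, E) I (extChartAt I x).symm (extChartAt I x x)
      (mfderiv I 𝓘(ℝ, E) (extChartAt I x) x (v i))) = _
  rw [mfderiv_symm_extChartAt_apply (mem_extChartAt_source x), extChartAt_to_inv]
  rfl

theorem inChart_extD {x₀ : M} {η : DForm I M k} {y : E} (hy : y ∈ (extChartAt I x₀).target)
    (h : DifferentiableAt ℝ (inChart x₀ η) y) :
    inChart x₀ (extD η) y = extDeriv (inChart x₀ η) y := by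
  have e := (extChartAt I x₀).right_inv hy
  rw [inChart, extD_eq ((extChartAt I x₀).map_target hy) (by rwa [e]), e]
  refine ContinuousAlternatingMap.ext fun v : Fin (k + 1) → E => ?_
  refine congrArg (extDeriv (inChart x₀ η) y) (funext fun i => ?_)
  exact mfderiv_extChartAt_symm_apply hy _

theorem eq_inChart_comp {x₀ x : M} (η : DForm I M k) (hx : x ∈ (extChartAt I x₀).source) :
    η x = (inChart x₀ η (extChartAt I x₀ x)).compContinuousLinearMap
      (mfderiv I 𝓘(ℝ, E) (extChartAt I x₀) x) := by
  refine ContinuousAlternatingMap.ext fun v => ?_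
  change _ = inChart x₀ η (extChartAt I x₀ x)
    (fun i => mfderiv I 𝓘(ℝ, E) (extChartAt I x₀) x (v i))
  refine Eq.trans ?_ (inChart_apply x₀ η (extChartAt I x₀ x) _).symm
  refine (form_congr ((extChartAt I x₀).left_inv hx).symm _).trans ?_
  refine congrArg (η _) (funext fun i => ?_)
  exact (mfderiv_symm_extChartAt_apply hx _).symm

theorem inChart_add (x₀ : M) (η χ : DForm I M k) (y : E) :
    inChart x₀ (η + χ) y = inChart x₀ η y + inChart x₀ χ y := rfl

theorem IsSmooth.contDiffAt {η : DForm I M k} (h : IsSmooth η) {x₀ : M} {y : E}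
    (hy : y ∈ (extChartAt I x₀).target) : ContDiffAt ℝ ∞ (inChart x₀ η) y :=
  (h x₀).contDiffAt ((isOpen_extChartAt_target x₀).mem_nhds hy)

theorem contDiffAt_twoForm_comp {X Q Q' : Type*} [NormedAddCommGroup X] [NormedSpace ℝ X]
    [NormedAddCommGroup Q] [NormedSpace ℝ Q] [NormedAddCommGroup Q'] [NormedSpace ℝ Q']
    {ψ : X → Q' [⋀^Fin 2]→L[ℝ] ℝ} {A : X → Q →L[ℝ] Q'} {x : X} {r : WithTop ℕ∞}
    (hψ : ContDiffAt ℝ r ψ x) (hA : ContDiffAt ℝ r A x) :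
    ContDiffAt ℝ r (fun x => (ψ x).compContinuousLinearMap (A x)) x := by
  rw [contDiffAt_twoForm_iff]
  have h1 : ContDiffAt ℝ r (fun x => ((ContinuousLinearMap.compL ℝ Q Q' ℝ).flip (A x)).comp
      ((toBilin Q' (ψ x)).comp (A x))) x :=
    (ContDiffAt.comp (g := (ContinuousLinearMap.compL ℝ Q Q' ℝ).flip) x
      (ContinuousLinearMap.contDiff _).contDiffAt hA).clm_comp
      ((contDiff_toBilin.contDiffAt.comp x hψ).clm_comp hA)
  refine h1.congr_of_eventuallyEq (Eventually.of_forall fun x => ?_)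
  refine ContinuousLinearMap.ext fun u => ContinuousLinearMap.ext fun v => ?_
  rw [toBilin_comp]; rfl

theorem eventually_pullback_chart {x₀ : M} {y₀ : N} {f : M → N} {y : E}
    (hy : y ∈ (extChartAt I x₀).target)
    (hf : ContMDiffAt I I' ∞ f ((extChartAt I x₀).symm y))
    (hfy : f ((extChartAt I x₀).symm y) ∈ (extChartAt I' y₀).source) :
    ∀ᶠ z in 𝓝 y, z ∈ (extChartAt I x₀).target ∧
      MDifferentiableAt I I' f ((extChartAt I x₀).symm z) ∧
      f ((extChartAt I x₀).symm z) ∈ (extChartAt I' y₀).source := by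
  have h1 := (isOpen_extChartAt_target (I := I) x₀).mem_nhds hy
  have h2 := (continuousOn_extChartAt_symm (I := I) x₀).continuousAt h1
  have h3 : ∀ᶠ x in 𝓝 ((extChartAt I x₀).symm y), MDifferentiableAt I I' f x := by
    have := (contMDiffAt_iff_contMDiffAt_nhds (n := 1) (by simp)).1 (hf.of_le (by simp))
    filter_upwards [this] with x hx using hx.mdifferentiableAt (by simp)
  filter_upwards [h1, h2.eventually h3, (hf.continuousAt.comp h2).preimage_mem_nhds
    ((isOpen_extChartAt_source (I := I') y₀).mem_nhds hfy)] with z a b c using ⟨a, b, c⟩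

theorem contDiffAt_inChart_pullback {x₀ : M} {f : M → N} {η : DForm I' N 2} {y : E}
    (hη : IsSmooth η) (hy : y ∈ (extChartAt I x₀).target)
    (hf : ContMDiffAt I I' ∞ f ((extChartAt I x₀).symm y)) :
    ContDiffAt ℝ ∞ (inChart x₀ (pullback I f η)) y := by
  set y₀ := f ((extChartAt I x₀).symm y)
  have hfy : f ((extChartAt I x₀).symm y) ∈ (extChartAt I' y₀).source := mem_extChartAt_source _
  have hF := contDiffAt_inCharts hy hf hfy
  have h1 : ContDiffAt ℝ ∞ (fun z => (inChart y₀ η (inCharts I I' x₀ y₀ f z)).compContinuousLinearMap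
      (fderiv ℝ (inCharts I I' x₀ y₀ f) z)) y :=
    contDiffAt_twoForm_comp (ContDiffAt.comp (g := inChart y₀ η) y
      (hη.contDiffAt ((extChartAt I' y₀).map_source hfy)) hF)
      (hF.fderiv_right (by simp))
  refine h1.congr_of_eventuallyEq ?_
  filter_upwards [eventually_pullback_chart hy hf hfy] with z hz
    using inChart_pullback hz.1 hz.2.1 hz.2.2

/-- Smoothness of f is only required at the point in question, since the collar map is only known to
be smooth near the fold. -/
theorem extDeriv_inChart_pullback {x₀ : M} {f : M → N} {η : DForm I' N k} {y : E}
    (hη : IsSmooth η) (hc : extD η = 0) (hy : y ∈ (extChartAt I x₀).target)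
    (hf : ContMDiffAt I I' ∞ f ((extChartAt I x₀).symm y)) :
    extDeriv (inChart x₀ (pullback I f η)) y = 0 := by
  set y₀ := f ((extChartAt I x₀).symm y)
  have hfy : f ((extChartAt I x₀).symm y) ∈ (extChartAt I' y₀).source := mem_extChartAt_source _
  have hF := contDiffAt_inCharts hy hf hfy
  have hm := (extChartAt I' y₀).map_source hfy
  have e1 : inChart x₀ (pullback I f η) =ᶠ[𝓝 y] fun z =>
      (inChart y₀ η (inCharts I I' x₀ y₀ f z)).compContinuousLinearMap
        (fderiv ℝ (inCharts I I' x₀ y₀ f) z) := by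
    filter_upwards [eventually_pullback_chart hy hf hfy] with z hz
      using inChart_pullback hz.1 hz.2.1 hz.2.2
  have hd : DifferentiableAt ℝ (inChart y₀ η) (inCharts I I' x₀ y₀ f y) :=
    (hη.contDiffAt hm).differentiableAt (by simp)
  rw [e1.extDeriv_eq, extDeriv_pullback (r := ∞) (f := inCharts I I' x₀ y₀ f) hd hF (by simpa using two_le_infty)]
  rw [inCharts, ← inChart_extD hm hd, hc]
  rfl

/-- The exterior derivative commutes with pullbacks. -/
theorem extD_pullback {f : M → N} {η : DForm I' N k} (hη : IsSmooth η) {x : M}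
    (hf : ContMDiffAt I I' ∞ f x) :
    extD (pullback I f η) x = (extD η (f x)).compContinuousLinearMap (mfderiv I I' f x) := by
  have hy := mem_extChartAt_target (I := I) x
  have hx := extChartAt_to_inv (I := I) x
  have hf' : ContMDiffAt I I' ∞ f ((extChartAt I x).symm (extChartAt I x x)) := by rwa [hx]
  have hfy : f ((extChartAt I x).symm (extChartAt I x x)) ∈ (extChartAt I' (f x)).source := by
    rw [hx]; exact mem_extChartAt_source _
  have hF := contDiffAt_inCharts hy hf' hfy
  have hm := (extChartAt I' (f x)).map_source hfy
  have e1 : inChart x (pullback I f η) =ᶠ[𝓝 (extChartAt I x x)] fun z =>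
      (inChart (f x) η (inCharts I I' x (f x) f z)).compContinuousLinearMap
        (fderiv ℝ (inCharts I I' x (f x) f) z) := by
    filter_upwards [eventually_pullback_chart hy hf' hfy] with z hz
      using inChart_pullback hz.1 hz.2.1 hz.2.2
  have hd : DifferentiableAt ℝ (inChart (f x) η)
      (inCharts I I' x (f x) f (extChartAt I x x)) :=
    (hη.contDiffAt hm).differentiableAt (by simp)
  have e2 : inCharts I I' x (f x) f (extChartAt I x x) = extChartAt I' (f x) (f x) := by
    simp [inCharts]
  have e3 : extDeriv (inChart x (pullback I f η)) (extChartAt I x x) =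
      (extDeriv (inChart (f x) η) (extChartAt I' (f x) (f x))).compContinuousLinearMap
        (fderiv ℝ (inCharts I I' x (f x) f) (extChartAt I x x)) := by
    rw [e1.extDeriv_eq, extDeriv_pullback (r := ∞)
      (f := inCharts I I' x (f x) f) hd hF (by simpa using two_le_infty), e2]
  refine ContinuousAlternatingMap.ext fun v => ?_
  change extDeriv (inChart x (pullback I f η)) (extChartAt I x x)
      (fun i => mfderiv I 𝓘(ℝ, E) (extChartAt I x) x (v i)) =
    extDeriv (inChart (f x) η) (extChartAt I' (f x) (f x))
      (fun i => mfderiv I' 𝓘(ℝ, E') (extChartAt I' (f x)) (f x) (mfderiv I I' f x (v i)))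
  rw [e3]
  refine congrArg (extDeriv (inChart (f x) η) (extChartAt I' (f x) (f x))) (funext fun i => ?_)
  change fderiv ℝ (inCharts I I' x (f x) f) (extChartAt I x x)
    (mfderiv I 𝓘(ℝ, E) (extChartAt I x) x (v i)) = _
  refine (fderiv_inCharts_apply hy (hf'.mdifferentiableAt (by simp)) hfy _).trans ?_
  change mfderiv I' 𝓘(ℝ, E') (extChartAt I' (f x)) (f ((extChartAt I x).symm (extChartAt I x x)))
    (mfderiv I I' f ((extChartAt I x).symm (extChartAt I x x))
      (mfderiv 𝓘(ℝ, E) I (extChartAt I x).symm (extChartAt I x x)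
        (mfderiv I 𝓘(ℝ, E) (extChartAt I x) x (v i)))) = _
  rw [mfderiv_symm_extChartAt_apply (mem_extChartAt_source x), extChartAt_to_inv]

end Charts

end

end FoldedSymplectic

namespace FoldedSymplectic

section

open Set Filter

/-! ### First order variations of the top power of a two-form -/

section WedgePower

/-- The Pfaffian sum defining the wedge power of a two-form, as a function of its matrix. -/
def pfSum (m : ℕ) (A : Fin (2 * m) → Fin (2 * m) → ℝ) : ℝ :=
  ((2 : ℝ) ^ m)⁻¹ * ∑ π : Equiv.Perm (Fin (2 * m)), ((Equiv.Perm.sign π : ℤ) : ℝ) *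
    ∏ i : Fin m, A (π ⟨2 * i, by omega⟩) (π ⟨2 * i + 1, by omega⟩)

theorem contDiff_pfSum (m : ℕ) {r : WithTop ℕ∞} : ContDiff ℝ r (pfSum m) := by
  unfold pfSum
  refine contDiff_const.mul (ContDiff.sum fun π _ => contDiff_const.mul ?_)
  exact contDiff_prod fun i _ => by fun_prop

theorem wedgePow_eq_pfSum {V : Type*} [AddCommGroup V] [Module ℝ V] [TopologicalSpace V] {m : ℕ}
    (η : V [⋀^Fin 2]→L[ℝ] ℝ) (v : Fin (2 * m) → V) :
    wedgePow η v = pfSum m (fun i j => η ![v i, v j]) := rfl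

variable {E : Type*} [NormedAddCommGroup E] [NormedSpace ℝ E]

/-- The image of the transpose of B is the annihilator of ker B. By skew symmetry the transpose is
-B after identifying T with its bidual, whence the witness -x. -/
theorem exists_apply_eq_of_ker {T : Type*} [AddCommGroup T] [Module ℝ T] [FiniteDimensional ℝ T]
    (B : T →ₗ[ℝ] T →ₗ[ℝ] ℝ) (hB : ∀ u v, B u v = -B v u) (φ : T →ₗ[ℝ] ℝ)
    (h : ∀ k, B k = 0 → φ k = 0) : ∃ a, B a = φ := by
  have h1 : φ ∈ LinearMap.range (LinearMap.dualMap B) := by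
    rw [LinearMap.range_dualMap_eq_dualAnnihilator_ker, Submodule.mem_dualAnnihilator]
    exact fun k hk => h k hk
  obtain ⟨θ, hθ⟩ := h1
  obtain ⟨x, rfl⟩ := (Module.evalEquiv ℝ T).surjective θ
  refine ⟨-x, LinearMap.ext fun y => ?_⟩
  rw [← hθ, map_neg, LinearMap.neg_apply, ← hB]
  rfl

variable [FiniteDimensional ℝ E]

theorem exists_form_eq_of_ker (B : E [⋀^Fin 2]→L[ℝ] ℝ) (φ : E →ₗ[ℝ] ℝ)
    (h : ∀ k, (∀ v, B ![k, v] = 0) → φ k = 0) : ∃ a, ∀ v, B ![a, v] = φ v := by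
  obtain ⟨a, ha⟩ := exists_apply_eq_of_ker
    ((ContinuousLinearMap.coeLM ℝ).comp (toBilin E B).toLinearMap)
    (fun u v => by
      change toBilin E B u v = -toBilin E B v u
      rw [toBilin_apply, toBilin_apply, form_swap]) φ
    (fun k hk => h k fun v => by
      rw [← toBilin_apply]
      exact LinearMap.congr_fun hk v)
  refine ⟨a, fun v => ?_⟩
  rw [← toBilin_apply]
  exact LinearMap.congr_fun ha v

theorem exists_ker_projection (B : E [⋀^Fin 2]→L[ℝ] ℝ) : ∃ p : E →ₗ[ℝ] E,
    (∀ u v, B ![p u, v] = 0) ∧ ∀ k, (∀ v, B ![k, v] = 0) → p k = k := by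
  have hKm : ∀ {k}, k ∈ LinearMap.ker (toBilin E B).toLinearMap ↔ ∀ v, B ![k, v] = 0 := by
    intro k
    rw [LinearMap.mem_ker]
    refine ⟨fun h v => ?_, fun h => ContinuousLinearMap.ext fun v => ?_⟩
    · rw [← toBilin_apply]
      exact congrArg (fun A : E →L[ℝ] ℝ => A v) h
    · change toBilin E B k v = 0
      rw [toBilin_apply, h]
  obtain ⟨f, hf⟩ := LinearMap.exists_leftInverse_of_injective
    (LinearMap.ker (toBilin E B).toLinearMap).subtype (Submodule.ker_subtype _)
  refine ⟨(LinearMap.ker (toBilin E B).toLinearMap).subtype.comp f, fun u => hKm.1 (f u).2,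
    fun k hk => ?_⟩
  exact congrArg Subtype.val (LinearMap.congr_fun hf ⟨k, hKm.2 hk⟩)

/-- C is the infinitesimal effect on B of moving vectors by S. With p a projection onto ker B, the
functional C(pu, v - pv) + ½ C(u - pu, v - pv) of v kills ker B, hence equals B(Su, ·);
antisymmetrizing in u, v gives back C. S is not required to be linear, since it is only applied to
the vectors of a frame. -/
theorem exists_first_order_variation (B C : E [⋀^Fin 2]→L[ℝ] ℝ)
    (hC : ∀ a b, (∀ v, B ![a, v] = 0) → (∀ v, B ![b, v] = 0) → C ![a, b] = 0) :
    ∃ S : E → E, ∀ u v, C ![u, v] = B ![S u, v] + B ![u, S v] := by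
  obtain ⟨p, hpm, hpk⟩ := exists_ker_projection B
  have hadd : ∀ u v w, C ![u, v + w] = C ![u, v] + C ![u, w] := fun u v w => by
    simp only [← toBilin_apply, map_add]
  have hS : ∀ u, ∃ s, ∀ v, B ![s, v] = C ![p u, v - p v] + 2⁻¹ * C ![u - p u, v - p v] := fun u =>
    exists_form_eq_of_ker B
      (((toBilin E C (p u)).toLinearMap + (2⁻¹ : ℝ) • (toBilin E C (u - p u)).toLinearMap).comp
        (LinearMap.id - p)) (fun k hk => by
          change toBilin E C (p u) (k - p k) + 2⁻¹ * toBilin E C (u - p u) (k - p k) = 0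
          rw [hpk k hk, sub_self, map_zero, map_zero]; ring)
      |>.imp fun s hs v => by
        rw [hs, ← toBilin_apply, ← toBilin_apply]; rfl
  choose S hS using hS
  refine ⟨S, fun u v => ?_⟩
  rw [form_swap B u (S v), hS, hS]
  have h1 := hC (p u) (p v) (hpm u) (hpm v)
  have h2 := form_swap C (v - p v) (u - p u)
  have h3 := form_swap C (p v) (u - p u)
  have h4 : C ![u, v] = C ![p u, p v] + C ![p u, v - p v] + C ![u - p u, p v] +
      C ![u - p u, v - p v] := by
    simp only [← toBilin_apply, map_sub, sub_apply]
    ring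
  linarith

/-- A first order variation of a degenerate two-form that vanishes on its kernel does not change
the top power to first order. -/
theorem fderiv_pfSum_eq_zero {m : ℕ} (B C : E [⋀^Fin 2]→L[ℝ] ℝ)
    (hB : ∀ v : Fin (2 * m) → E, wedgePow B v = 0)
    (hC : ∀ a b, (∀ v, B ![a, v] = 0) → (∀ v, B ![b, v] = 0) → C ![a, b] = 0)
    (e : Fin (2 * m) → E) :
    fderiv ℝ (pfSum m) (fun i j => B ![e i, e j]) (fun i j => C ![e i, e j]) = 0 := by
  obtain ⟨S, hCS⟩ := exists_first_order_variation B C hC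
  -- The Pfaffian sums of B on the moved frames e + εS(e) all vanish since B has zero top power, and
  -- the matrix of C is the ε-derivative at 0.
  set A : ℝ → Fin (2 * m) → Fin (2 * m) → ℝ := fun ε i j =>
    B ![e i + ε • S (e i), e j + ε • S (e j)] with hA
  have hA0 : ∀ ε, pfSum m (A ε) = 0 := fun ε => hB (fun i => e i + ε • S (e i))
  have hAd : HasDerivAt A (fun i j => C ![e i, e j]) 0 := by
    refine hasDerivAt_pi.2 fun i => hasDerivAt_pi.2 fun j => ?_
    have e1 : (fun ε => A ε i j) = fun ε : ℝ => B ![e i, e j] + ε * C ![e i, e j] +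
        ε ^ 2 * B ![S (e i), S (e j)] := by
      funext ε
      rw [hA, hCS]
      simp only [← toBilin_apply, map_add, map_smul, add_apply, smul_apply, smul_eq_mul]
      ring
    rw [e1]
    have h2 := (((hasDerivAt_id (0 : ℝ)).mul_const (C ![e i, e j])).const_add (B ![e i, e j])).add
      (((hasDerivAt_id (0 : ℝ)).pow 2).mul_const (B ![S (e i), S (e j)]))
    exact h2.congr_deriv (by simp)
  have hA00 : A 0 = fun i j => B ![e i, e j] := by
    funext i j; simp [hA]
  have h1 : HasDerivAt (fun ε => pfSum m (A ε)) (fderiv ℝ (pfSum m) (A 0)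
      (fun i j => C ![e i, e j])) 0 :=
    HasFDerivAt.comp_hasDerivAt (l := pfSum m) (f := A) 0
      (((contDiff_pfSum m (r := 1)).differentiable (by simp)) _).hasFDerivAt hAd
  simp only [hA0] at h1
  rw [← hA00]
  exact h1.unique (hasDerivAt_const _ _)

/-- The derivative of the top power of a family of two-forms at a degenerate one. -/
theorem fderiv_wedgePow_eq_zero {X : Type*} [NormedAddCommGroup X] [NormedSpace ℝ X] {m : ℕ}
    {ψ : X → E [⋀^Fin 2]→L[ℝ] ℝ} {x : X} (hψ : DifferentiableAt ℝ ψ x)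
    (hB : ∀ v : Fin (2 * m) → E, wedgePow (ψ x) v = 0) (u : X)
    (hC : ∀ a b, (∀ v, ψ x ![a, v] = 0) → (∀ v, ψ x ![b, v] = 0) →
      fderiv ℝ (fun x => ψ x ![a, b]) x u = 0) (e : Fin (2 * m) → E) :
    fderiv ℝ (fun x => wedgePow (ψ x) e) x u = 0 := by
  have hb := differentiableAt_toBilin hψ
  have hd : ∀ a b, DifferentiableAt ℝ (fun x => ψ x ![a, b]) x := fun a b => by
    have := (hb.clm_apply (differentiableAt_const a)).clm_apply (differentiableAt_const b)
    simpa only [toBilin_apply] using this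
  have hev : ∀ a b, fderiv ℝ (fun x => ψ x ![a, b]) x u = fderiv ℝ ψ x u ![a, b] := by
    intro a b
    exact congrArg (fun A => A u) (hψ.hasFDerivAt.continuousAlternatingMap_apply_const ![a, b]).fderiv
  have h1 : HasFDerivAt (fun x => (fun i j => ψ x ![e i, e j] : Fin (2 * m) → Fin (2 * m) → ℝ))
      (ContinuousLinearMap.pi fun i => ContinuousLinearMap.pi fun j =>
        fderiv ℝ (fun x => ψ x ![e i, e j]) x) x :=
    hasFDerivAt_pi.2 fun i => hasFDerivAt_pi.2 fun j => (hd _ _).hasFDerivAt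
  have h2 : HasFDerivAt (fun x => wedgePow (ψ x) e) _ x :=
    HasFDerivAt.comp (g := pfSum m) x
      (((contDiff_pfSum m (r := 1)).differentiable (by simp)) _).hasFDerivAt h1
  rw [h2.fderiv, ContinuousLinearMap.comp_apply]
  have h3 := fderiv_pfSum_eq_zero (ψ x) (fderiv ℝ ψ x u) hB
    (fun a b ha hb => by rw [← hev]; exact hC a b ha hb) e
  rw [← h3]
  congr 1
  funext i j
  exact hev _ _

end WedgePower

/-! ### Linear algebra of the kernel at the fold -/

section Kernel

variable {E : Type*} [NormedAddCommGroup E] [NormedSpace ℝ E] [FiniteDimensional ℝ E]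

/-- A degenerate two-form whose restriction to the hyperplane `D = 0` has one-dimensional kernel
spanned by `n`: its kernel is spanned by `n` and a vector transverse to the hyperplane. -/
theorem exists_transverse_ker (B : E [⋀^Fin 2]→L[ℝ] ℝ) (D : E →L[ℝ] ℝ) {n k e : E} (he : D e = 1)
    (hnT : ∀ b, D b = 0 → B ![n, b] = 0)
    (hker : ∀ a, D a = 0 → (∀ b, D b = 0 → B ![a, b] = 0) → ∃ c : ℝ, a = c • n)
    (hk0 : k ≠ 0) (hk : ∀ v, B ![k, v] = 0) :
    (∀ v, B ![n, v] = 0) ∧ ∃ w, (∀ v, B ![w, v] = 0) ∧ D w = 1 := by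
  have hsplit : ∀ (w' : E), D w' = 1 → ∀ v, ∃ a, D a = 0 ∧ v = a + D v • w' := fun w' hw' v =>
    ⟨v - D v • w', by simp [hw'], by simp⟩
  have hadd : ∀ u a b, B ![u, a + b] = B ![u, a] + B ![u, b] := fun u a b => by
    simp only [← toBilin_apply, map_add]
  have hsmul : ∀ u (c : ℝ) b, B ![u, c • b] = c * B ![u, b] := fun u c b => by
    simp only [← toBilin_apply, map_smul, smul_eq_mul]
  -- If k is tangent it is a multiple of n, so n is in the kernel, and a transverse kernel vector is
  -- found by correcting e. If k is transverse it only has to be normalized.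
  by_cases hDk : D k = 0
  · obtain ⟨c, rfl⟩ := hker k hDk fun b _ => hk b
    have hc : c ≠ 0 := by rintro rfl; simp at hk0
    have hn' : ∀ v, B ![n, v] = 0 := fun v => by
      have := hk v
      simp only [← toBilin_apply, map_smul, smul_apply, smul_eq_mul] at this ⊢
      exact (mul_eq_zero.1 this).resolve_left hc
    refine ⟨hn', ?_⟩
    set T := LinearMap.ker D.toLinearMap
    have hT : ∀ a : T, D a = 0 := fun a => a.2
    -- On the hyperplane the functional B(e, ·) kills the null direction n, so it is represented by
    -- a tangent vector a; then e - a pairs to zero with the hyperplane, and with itself.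
    obtain ⟨a, ha⟩ := exists_apply_eq_of_ker (T := T)
      (((ContinuousLinearMap.coeLM ℝ).comp (toBilin E B).toLinearMap).compl₁₂ T.subtype T.subtype)
      (fun u v => by
        change toBilin E B u v = -toBilin E B v u
        rw [toBilin_apply, toBilin_apply, form_swap])
      ((toBilin E B e).toLinearMap.comp T.subtype) (fun a ha => by
        obtain ⟨c, hc⟩ := hker a (hT a) fun b hb => by
          have := LinearMap.congr_fun ha ⟨b, hb⟩
          rw [← toBilin_apply]
          exact this
        change toBilin E B e a = 0
        rw [toBilin_apply, form_swap, hc, ← toBilin_apply, map_smul, smul_apply, toBilin_apply, hn']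
        simp)
    have ha' : ∀ b, D b = 0 → B ![e - a, b] = 0 := fun b hb => by
      have := LinearMap.congr_fun ha ⟨b, hb⟩
      change toBilin E B a b = toBilin E B e b at this
      rw [← toBilin_apply, map_sub, sub_apply, this, sub_self]
    have hDea : D (e - a) = 1 := by rw [map_sub, he, hT a, sub_zero]
    refine ⟨e - a, fun v => ?_, hDea⟩
    obtain ⟨b, hb, hv⟩ := hsplit _ hDea v
    rw [hv, hadd, ha' b hb, hsmul, form_self]; simp
  · have hw : ∀ v, B ![(D k)⁻¹ • k, v] = 0 := fun v => by
      have := hk v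
      simp only [← toBilin_apply, map_smul, smul_apply, smul_eq_mul] at this ⊢
      rw [this, mul_zero]
    have hDw : D ((D k)⁻¹ • k) = 1 := by simp [hDk]
    refine ⟨fun v => ?_, (D k)⁻¹ • k, hw, hDw⟩
    obtain ⟨b, hb, hv⟩ := hsplit _ hDw v
    rw [hv, hadd, hnT b hb, hsmul, form_swap, hw]; simp

/-- The kernel of a two-form as in `exists_transverse_ker`. -/
theorem eq_add_of_mem_ker (B : E [⋀^Fin 2]→L[ℝ] ℝ) (D : E →L[ℝ] ℝ) {n w : E}
    (hker : ∀ a, D a = 0 → (∀ b, D b = 0 → B ![a, b] = 0) → ∃ c : ℝ, a = c • n)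
    (hw : ∀ v, B ![w, v] = 0) (hDw : D w ≠ 0) {k : E} (hk : ∀ v, B ![k, v] = 0) :
    ∃ c : ℝ, k = (D k / D w) • w + c • n := by
  obtain ⟨c, hc⟩ := hker (k - (D k / D w) • w) (by simp [hDw]) fun b _ => by
    have h1 := hk b
    have h2 := hw b
    simp only [← toBilin_apply, map_sub, map_smul, sub_apply, smul_apply] at *
    simp [h1, h2]
  exact ⟨c, by rw [← hc]; abel⟩

end Kernel

end

end FoldedSymplectic

namespace FoldedSymplectic

section

open Set Filter

/-! ### Differentials of immersions -/

section Immersion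

variable {E : Type*} [NormedAddCommGroup E] [NormedSpace ℝ E] {H : Type*} [TopologicalSpace H]
  {E' : Type*} [NormedAddCommGroup E'] [NormedSpace ℝ E'] {H' : Type*} [TopologicalSpace H']
  {I : ModelWithCorners ℝ E H} {I' : ModelWithCorners ℝ E' H'} [I.Boundaryless] [I'.Boundaryless]
  {M : Type*} [TopologicalSpace M] [ChartedSpace H M] [IsManifold I ∞ M]
  {N : Type*} [TopologicalSpace N] [ChartedSpace H' N] [IsManifold I' ∞ N]

/-- In immersion charts f is u ↦ (u, 0), so the first component of the target chart, composed with
f, is the source chart; the latter has injective differential. -/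
theorem mfderiv_eq_zero_of_isImmersionAt {f : M → N} {x : M}
    (h : Manifold.IsImmersionAt I I' ∞ f x) {u : TangentSpace I x} (hu : mfderiv I I' f x u = 0) :
    u = 0 := by
  set a := h.domChart.extend I with ha
  set b := h.codChart.extend I' with hb
  set g : N → E := fun y => (h.equiv.symm (b y)).1 with hg
  have hxs : x ∈ h.domChart.source := h.mem_domChart_source
  have hxt : a x ∈ a.target := a.map_source (by rwa [ha, OpenPartialHomeomorph.extend_source])
  have hgf : g ∘ f =ᶠ[𝓝 x] a := by
    filter_upwards [h.domChart.open_source.mem_nhds hxs] with y hy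
    have hy' : y ∈ a.source := by rwa [ha, OpenPartialHomeomorph.extend_source]
    have h1 := h.writtenInCharts (a.map_source hy')
    simp only [Function.comp_apply] at h1
    rw [← ha, ← hb, a.left_inv hy'] at h1
    simp [hg, h1]
  have hbd : MDifferentiableAt I' 𝓘(ℝ, E') b (f x) :=
    ((OpenPartialHomeomorph.contMDiffOn_extend h.codChart_mem_maximalAtlas).contMDiffAt
      (h.codChart.open_source.mem_nhds h.mem_codChart_source)).mdifferentiableAt (by simp)
  have hgd : MDifferentiableAt I' 𝓘(ℝ, E) g (f x) := by
    have h1 : MDifferentiableAt 𝓘(ℝ, E') 𝓘(ℝ, E) (fun v => (h.equiv.symm v).1) (b (f x)) :=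
      ((ContinuousLinearMap.fst ℝ _ _).comp
        (h.equiv.symm : E' →L[ℝ] E × h.complement)).differentiableAt.mdifferentiableAt
    exact h1.comp (f x) hbd
  have hfd : MDifferentiableAt I I' f x := (h.contMDiffAt).mdifferentiableAt (by simp)
  have had : MDifferentiableAt I 𝓘(ℝ, E) a x :=
    ((OpenPartialHomeomorph.contMDiffOn_extend h.domChart_mem_maximalAtlas).contMDiffAt
      (h.domChart.open_source.mem_nhds hxs)).mdifferentiableAt (by simp)
  have hto : IsOpen (I '' h.domChart.target) := by
    rw [I.image_eq, I.range_eq_univ, inter_univ]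
    exact h.domChart.open_target.preimage I.continuous_symm
  have hsd : MDifferentiableAt 𝓘(ℝ, E) I a.symm (a x) :=
    ((contMDiffOn_extend_symm h.domChart_mem_maximalAtlas).contMDiffAt
      (hto.mem_nhds ⟨_, h.domChart.map_source hxs, rfl⟩)).mdifferentiableAt (by simp)
  have h1 : mfderiv I 𝓘(ℝ, E) a x u = 0 := by
    have h2 : mfderiv I 𝓘(ℝ, E) a x u = mfderiv I 𝓘(ℝ, E) (g ∘ f) x u := by
      rw [hgf.mfderiv_eq]; rfl
    rw [h2, mfderiv_comp x hgd hfd]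
    change mfderiv I' 𝓘(ℝ, E) g (f x) (mfderiv I I' f x u) = 0
    rw [hu, map_zero]
  have h3 : a.symm ∘ a =ᶠ[𝓝 x] id := by
    filter_upwards [h.domChart.open_source.mem_nhds hxs] with y hy
    exact a.left_inv (by rwa [ha, OpenPartialHomeomorph.extend_source])
  have h4 : mfderiv I I (a.symm ∘ a) x u = mfderiv I I id x u := by rw [h3.mfderiv_eq]; rfl
  rw [mfderiv_comp x hsd had, mfderiv_id] at h4
  have h5 : mfderiv 𝓘(ℝ, E) I a.symm (a x) (mfderiv I 𝓘(ℝ, E) a x u) = u := h4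
  rw [h1, map_zero] at h5
  exact h5.symm

end Immersion

theorem contDiffAt_wedgePow {X E : Type*} [NormedAddCommGroup X] [NormedSpace ℝ X]
    [NormedAddCommGroup E] [NormedSpace ℝ E] {m : ℕ} {r : WithTop ℕ∞}
    {ψ : X → E [⋀^Fin 2]→L[ℝ] ℝ} {x : X} (h : ContDiffAt ℝ r ψ x) (e : Fin (2 * m) → E) :
    ContDiffAt ℝ r (fun x => wedgePow (ψ x) e) x := by
  have h1 : ContDiffAt ℝ r (fun x => (fun i j => ψ x ![e i, e j] :
      Fin (2 * m) → Fin (2 * m) → ℝ)) x := by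
    refine contDiffAt_pi.2 fun i => contDiffAt_pi.2 fun j => ?_
    have := ((contDiffAt_twoForm_iff.1 h).clm_apply (contDiffAt_const (c := e i))).clm_apply
      (contDiffAt_const (c := e j))
    simpa only [toBilin_apply] using this
  have h2 : ContDiffAt ℝ r (fun x => pfSum m (fun i j => ψ x ![e i, e j])) x :=
    ContDiffAt.comp (g := pfSum m) x (contDiff_pfSum m).contDiffAt h1
  simpa only [wedgePow_eq_pfSum] using h2

/-! ### The tangent space of the fold -/

section FoldGeometry

variable {m : ℕ} {M : Type*} [TopologicalSpace M] [ChartedSpace (EuclideanSpace ℝ (Fin (2 * m))) M]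
  [IsManifold (𝓡 (2 * m)) ∞ M] {σ : DForm (𝓡 (2 * m)) M 2}

/-- For m = 0 the zeroth power is the empty product 1, so the fold is empty. Positivity makes the
truncated differences 2m - 1 and 2m - 2 genuine. -/
theorem fold_dim_pos (z : fold σ) : 0 < m := by
  rcases Nat.eq_zero_or_pos m with rfl | h
  · exfalso
    have := z.2 (fun _ => 0)
    rw [wedgePow] at this
    simp at this
  · exact h

/-- The tangent space at x is identified with the model space through the preferred chart at x,
whose differential at x is therefore the identity. -/
theorem inChart_self {E : Type*} [NormedAddCommGroup E] [NormedSpace ℝ E] {H : Type*}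
    [TopologicalSpace H] {I : ModelWithCorners ℝ E H} [I.Boundaryless] {N : Type*}
    [TopologicalSpace N] [ChartedSpace H N] [IsManifold I ∞ N] {k : ℕ} (η : DForm I N k) (x : N)
    (v : Fin k → E) : inChart x η (extChartAt I x x) v = η x v := by
  have : IsManifold I 1 N := .of_le (n := ∞) (by simp)
  have h := congrArg (fun ψ => ψ v) (eq_inChart_comp η (mem_extChartAt_source (I := I) x))
  refine Eq.trans ?_ h.symm
  refine congrArg (inChart x η (extChartAt I x x)) (funext fun i => ?_)
  change v i = mfderiv I 𝓘(ℝ, E) (extChartAt I x) x (v i)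
  rw [mfderiv_extChartAt_self]
  rfl

theorem wedgePow_inChart_eq_zero {x₀ : M} {y : EuclideanSpace ℝ (Fin (2 * m))}
    (hy : (extChartAt (𝓡 (2 * m)) x₀).symm y ∈ fold σ)
    (v : Fin (2 * m) → EuclideanSpace ℝ (Fin (2 * m))) : wedgePow (inChart x₀ σ y) v = 0 := by
  rw [← hy (fun i => mfderiv 𝓘(ℝ, _) (𝓡 (2 * m)) (extChartAt (𝓡 (2 * m)) x₀).symm y (v i))]
  rw [wedgePow_eq_pfSum, wedgePow_eq_pfSum]
  congr 1
  funext i j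
  exact comp_form_apply (Q := EuclideanSpace ℝ (Fin (2 * m))) (Q' := EuclideanSpace ℝ (Fin (2 * m)))
    _ _ _ _

variable [ChartedSpace (EuclideanSpace ℝ (Fin (2 * m - 1))) (fold σ)]
  [IsManifold (𝓡 (2 * m - 1)) ∞ (fold σ)]

theorem dIncl_injective (hZ : Manifold.IsSmoothEmbedding (𝓡 (2 * m - 1)) (𝓡 (2 * m)) ∞
    (Subtype.val : fold σ → M)) (z : fold σ) : Function.Injective (dIncl σ z) :=
  (injective_iff_map_eq_zero (dIncl σ z)).2 fun _ hu =>
    mfderiv_eq_zero_of_isImmersionAt (hZ.isImmersion.isImmersionAt z) hu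

/-- The differential at `x` of the coefficient of `σ^m` in the chart around `x₀`. -/
def foldDiff (σ : DForm (𝓡 (2 * m)) M 2) (x₀ x : M) : TangentSpace (𝓡 (2 * m)) x →L[ℝ] ℝ :=
  (fderiv ℝ (topCoeff σ x₀) (extChartAt (𝓡 (2 * m)) x₀ x)).comp
    (mfderiv (𝓡 (2 * m)) 𝓘(ℝ, EuclideanSpace ℝ (Fin (2 * m))) (extChartAt (𝓡 (2 * m)) x₀) x)

theorem contDiffAt_topCoeff (hσ : IsSmooth σ) {x₀ : M} {y : EuclideanSpace ℝ (Fin (2 * m))}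
    (hy : y ∈ (extChartAt (𝓡 (2 * m)) x₀).target) : ContDiffAt ℝ ∞ (topCoeff σ x₀) y :=
  contDiffAt_wedgePow (hσ.contDiffAt hy) _

/-- The coefficient of σ^m vanishes identically along the fold, so its differential kills TZ. -/
theorem foldDiff_dIncl (hσ : IsSmooth σ) (hZ : Manifold.IsSmoothEmbedding (𝓡 (2 * m - 1))
    (𝓡 (2 * m)) ∞ (Subtype.val : fold σ → M)) {x₀ : M} {z : fold σ}
    (hz : (z : M) ∈ (extChartAt (𝓡 (2 * m)) x₀).source) (u : TangentSpace (𝓡 (2 * m - 1)) z) :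
    foldDiff σ x₀ z (dIncl σ z u) = 0 := by
  have hd : MDifferentiableAt (𝓡 (2 * m - 1)) (𝓡 (2 * m)) (Subtype.val : fold σ → M) z :=
    (hZ.contMDiff z).mdifferentiableAt (by simp)
  have hf : MDifferentiableAt 𝓘(ℝ, EuclideanSpace ℝ (Fin (2 * m))) 𝓘(ℝ, ℝ) (topCoeff σ x₀)
      (extChartAt (𝓡 (2 * m)) x₀ z) :=
    ((contDiffAt_topCoeff hσ ((extChartAt _ x₀).map_source hz)).differentiableAt
      (by simp)).mdifferentiableAt
  have he := mdifferentiableAt_extChartAt_of_mem hz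
  have h1 := hf.hasMFDerivAt.comp (z : M) he.hasMFDerivAt
  have h2 := h1.comp z hd.hasMFDerivAt
  have h3 : (fun z : fold σ => topCoeff σ x₀ (extChartAt (𝓡 (2 * m)) x₀ z)) =ᶠ[𝓝 z] fun _ => 0 := by
    have : ∀ᶠ z' : fold σ in 𝓝 z, (z' : M) ∈ (extChartAt (𝓡 (2 * m)) x₀).source :=
      continuous_subtype_val.continuousAt ((isOpen_extChartAt_source x₀).mem_nhds hz)
    filter_upwards [this] with z' hz'
    exact wedgePow_inChart_eq_zero (by rw [(extChartAt _ x₀).left_inv hz']; exact z'.2) _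
  have h4 := h2.mfderiv
  have h5 : mfderiv (𝓡 (2 * m - 1)) 𝓘(ℝ, ℝ)
      (fun z : fold σ => topCoeff σ x₀ (extChartAt (𝓡 (2 * m)) x₀ z)) z = 0 := by
    rw [h3.mfderiv_eq, mfderiv_const]; rfl
  have h6 := h4.symm.trans h5
  have h7 := DFunLike.congr_fun h6 u
  rw [mfderiv_eq_fderiv] at h7
  exact h7

theorem finrank_tangentFold (hZ : Manifold.IsSmoothEmbedding (𝓡 (2 * m - 1)) (𝓡 (2 * m)) ∞
    (Subtype.val : fold σ → M)) (z : fold σ) : Module.finrank ℝ (tangentFold σ z) = 2 * m - 1 := by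
  rw [tangentFold, LinearMap.finrank_range_of_inj (dIncl_injective hZ z)]
  exact finrank_euclideanSpace_fin

/-- The tangent space of the fold is the kernel of any non-zero functional vanishing on it. -/
theorem mem_tangentFold_iff (hZ : Manifold.IsSmoothEmbedding (𝓡 (2 * m - 1)) (𝓡 (2 * m)) ∞
    (Subtype.val : fold σ → M)) (z : fold σ) {D : TangentSpace (𝓡 (2 * m)) (z : M) →L[ℝ] ℝ}
    (hD0 : D ≠ 0) (hD : ∀ u, D (dIncl σ z u) = 0) (v : TangentSpace (𝓡 (2 * m)) (z : M)) :
    v ∈ tangentFold σ z ↔ D v = 0 := by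
  have : FiniteDimensional ℝ (TangentSpace (𝓡 (2 * m)) (z : M)) :=
    inferInstanceAs (FiniteDimensional ℝ (EuclideanSpace ℝ (Fin (2 * m))))
  have hle : tangentFold σ z ≤ LinearMap.ker D.toLinearMap := by
    rintro _ ⟨u, rfl⟩
    exact hD u
  have hr : LinearMap.range D.toLinearMap = ⊤ := by
    refine LinearMap.range_eq_top.2 (LinearMap.surjective fun h => hD0 ?_)
    exact ContinuousLinearMap.coe_injective h
  have hdim := LinearMap.finrank_range_add_finrank_ker D.toLinearMap
  rw [hr, finrank_top, Module.finrank_self] at hdim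
  have hE : Module.finrank ℝ (TangentSpace (𝓡 (2 * m)) (z : M)) = 2 * m :=
    finrank_euclideanSpace_fin
  have heq : tangentFold σ z = LinearMap.ker D.toLinearMap :=
    Submodule.eq_of_le_of_finrank_eq hle (by rw [finrank_tangentFold hZ]; omega)
  rw [heq]; rfl

end FoldGeometry

end

end FoldedSymplectic

namespace FoldedSymplectic

section

open Set Filter

/-! ### A frame of the kernel along the fold -/

section FoldFrame

variable {m : ℕ} {M : Type*} [TopologicalSpace M] [ChartedSpace (EuclideanSpace ℝ (Fin (2 * m))) M]
  [IsManifold (𝓡 (2 * m)) ∞ M] {σ : DForm (𝓡 (2 * m)) M 2}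
  [ChartedSpace (EuclideanSpace ℝ (Fin (2 * m - 1))) (fold σ)]
  [IsManifold (𝓡 (2 * m - 1)) ∞ (fold σ)]

theorem restrictFold_apply (z : fold σ) (a b : TangentSpace (𝓡 (2 * m - 1)) z) :
    restrictFold σ z ![a, b] = σ z ![dIncl σ z a, dIncl σ z b] := by
  rw [restrictFold, pullback_apply]
  congr 1
  funext i
  fin_cases i <;> rfl

/-- Rank and nullity: 2m - 1 - (2m - 2) = 1. -/
theorem exists_null_generator (hσ : IsFoldedSymplectic σ) (z : fold σ) :
    ∃ n : TangentSpace (𝓡 (2 * m - 1)) z, n ≠ 0 ∧ (∀ b, σ z ![dIncl σ z n, dIncl σ z b] = 0) ∧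
      ∀ a, (∀ b, σ z ![dIncl σ z a, dIncl σ z b] = 0) → ∃ c : ℝ, a = c • n := by
  have : FiniteDimensional ℝ (TangentSpace (𝓡 (2 * m - 1)) z) :=
    inferInstanceAs (FiniteDimensional ℝ (EuclideanSpace ℝ (Fin (2 * m - 1))))
  have hm := fold_dim_pos z
  set L := AlternatingMap.curryLeft (restrictFold σ z).toAlternatingMap with hL
  have hE : Module.finrank ℝ (TangentSpace (𝓡 (2 * m - 1)) z) = 2 * m - 1 :=
    finrank_euclideanSpace_fin
  have h1 := LinearMap.finrank_range_add_finrank_ker L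
  have h2 : Module.finrank ℝ (LinearMap.range L) = 2 * m - 2 := hσ.maximal_rank z
  rw [hE, h2] at h1
  have hk : ∀ a, a ∈ LinearMap.ker L ↔ ∀ b, σ z ![dIncl σ z a, dIncl σ z b] = 0 := by
    intro a
    rw [LinearMap.mem_ker]
    constructor
    · intro h b
      rw [← restrictFold_apply]
      exact congrArg (fun A : (TangentSpace (𝓡 (2 * m - 1)) z) [⋀^Fin 1]→ₗ[ℝ] ℝ => A ![b]) h
    · intro h
      ext v
      have hv : v = ![v 0] := by ext i; rw [Subsingleton.elim i 0]; rfl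
      rw [hv]
      refine Eq.trans ?_ (h (v 0))
      rw [← restrictFold_apply]
      rfl
  obtain ⟨⟨n, hn⟩, hn0, hn'⟩ := finrank_eq_one_iff'.1 (show Module.finrank ℝ (LinearMap.ker L) = 1 by
    omega)
  refine ⟨n, fun h => hn0 (Subtype.ext h), (hk n).1 hn, fun a ha => ?_⟩
  obtain ⟨c, hc⟩ := hn' ⟨a, (hk a).2 ha⟩
  exact ⟨c, (congrArg Subtype.val hc).symm⟩

theorem foldDiff_self (x : M) (v : TangentSpace (𝓡 (2 * m)) x) :
    foldDiff σ x x v = fderiv ℝ (topCoeff σ x) (extChartAt (𝓡 (2 * m)) x x) v := by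
  have : IsManifold (𝓡 (2 * m)) 1 M := .of_le (n := ∞) (by simp)
  rw [foldDiff, mfderiv_extChartAt_self]
  rfl

/-- The kernel of a folded-symplectic form at a point of the fold, and its derivative. -/
theorem exists_fold_frame (hσ : IsFoldedSymplectic σ)
    (hZ : Manifold.IsSmoothEmbedding (𝓡 (2 * m - 1)) (𝓡 (2 * m)) ∞ (Subtype.val : fold σ → M))
    (z : fold σ) :
    ∃ (n : TangentSpace (𝓡 (2 * m - 1)) z) (w : TangentSpace (𝓡 (2 * m)) (z : M)),
      n ≠ 0 ∧ (∀ a, (∀ b, σ z ![dIncl σ z a, dIncl σ z b] = 0) → ∃ c : ℝ, a = c • n) ∧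
      dIncl σ z n ∈ formKer σ (z : M) ∧ w ∈ formKer σ (z : M) ∧ foldDiff σ z z w = 1 ∧
      (∀ k ∈ formKer σ (z : M), ∃ c : ℝ, k = foldDiff σ z z k • w + c • dIncl σ z n) ∧
      ∃ c : ℝ, c ≠ 0 ∧ ∀ u : EuclideanSpace ℝ (Fin (2 * m)),
        fderiv ℝ (fun y => inChart (z : M) σ y ![w, dIncl σ z n]) (extChartAt (𝓡 (2 * m)) (z : M) z) u
          = c * foldDiff σ z z u := by
  obtain ⟨n, hn0, hnT, hker⟩ := exists_null_generator hσ z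
  set x : M := z.1 with hx
  set y := extChartAt (𝓡 (2 * m)) x x with hy
  have hyt : y ∈ (extChartAt (𝓡 (2 * m)) x).target := mem_extChartAt_target x
  set B : (EuclideanSpace ℝ (Fin (2 * m))) [⋀^Fin 2]→L[ℝ] ℝ := inChart x σ y with hB
  have hBσ : ∀ v : Fin 2 → EuclideanSpace ℝ (Fin (2 * m)), B v = σ x v := inChart_self σ x
  set D : EuclideanSpace ℝ (Fin (2 * m)) →L[ℝ] ℝ := fderiv ℝ (topCoeff σ x) y with hD
  have hDf : ∀ v, foldDiff σ x x v = D v := foldDiff_self x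
  have hD0 : D ≠ 0 := hσ.transverse x z.2
  have hfd0 : foldDiff σ x x ≠ 0 := by
    intro h
    apply hD0
    refine ContinuousLinearMap.ext fun v => ?_
    refine (hDf v).symm.trans ?_
    rw [h]; rfl
  have hDT : ∀ u, foldDiff σ x x (dIncl σ z u) = 0 :=
    foldDiff_dIncl hσ.smooth hZ (mem_extChartAt_source x)
  have hT : ∀ b, D b = 0 → ∃ b', dIncl σ z b' = b := fun b hb =>
    (mem_tangentFold_iff hZ z hfd0 hDT b).2 ((hDf b).trans hb)
  have hψ : DifferentiableAt ℝ (inChart x σ) y :=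
    (hσ.smooth.contDiffAt hyt).differentiableAt (by simp)
  have hw0 : ∀ v : Fin (2 * m) → EuclideanSpace ℝ (Fin (2 * m)), wedgePow (inChart x σ y) v = 0 :=
    wedgePow_inChart_eq_zero (by rw [hy, extChartAt_to_inv]; exact z.2)
  -- Were the kernel zero, every variation would vanish on it trivially, so the differential of σ^m
  -- would be zero, against transversality.
  obtain ⟨k, hk0, hk⟩ : ∃ k, k ≠ 0 ∧ ∀ v, B ![k, v] = 0 := by
    by_contra! hcon
    apply hD0
    refine ContinuousLinearMap.ext fun u => ?_
    refine fderiv_wedgePow_eq_zero hψ hw0 u (fun a b ha _ => ?_) _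
    have ha0 : a = 0 := by
      by_contra h0
      obtain ⟨v, hv⟩ := hcon a h0
      exact hv (ha v)
    have : (fun y => inChart x σ y ![a, b]) = fun _ => 0 := by
      funext y
      rw [← toBilin_apply, ha0, map_zero]; rfl
    rw [this]; simp
  obtain ⟨e, he⟩ : ∃ e, D e = 1 := by
    obtain ⟨v, hv⟩ : ∃ v, D v ≠ 0 := by
      by_contra! h
      exact hD0 (ContinuousLinearMap.ext h)
    exact ⟨(D v)⁻¹ • v, by simp [hv]⟩
  set n' : EuclideanSpace ℝ (Fin (2 * m)) := dIncl σ z n with hn'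
  have hker' : ∀ a, D a = 0 → (∀ b, D b = 0 → B ![a, b] = 0) → ∃ c : ℝ, a = c • n' := by
    intro a ha hab
    obtain ⟨a', rfl⟩ := hT a ha
    obtain ⟨c, hc⟩ := hker a' fun b => by
      have := hab (dIncl σ z b) ((hDf _).symm.trans (hDT b))
      rwa [hBσ] at this
    refine ⟨c, ?_⟩
    rw [hc]
    exact map_smul _ _ _
  obtain ⟨hn, w, hw, hDw⟩ := exists_transverse_ker B D (n := n') he (fun b hb => by
    obtain ⟨b', rfl⟩ := hT b hb
    rw [hBσ]
    exact hnT b') hker' hk0 hk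
  have hDn : D n' = 0 := (hDf _).symm.trans (hDT n)
  refine ⟨n, w, hn0, hker, fun v => (hBσ _).symm.trans (hn v), fun v => (hBσ _).symm.trans (hw v),
    (hDf w).trans hDw, fun k hk => ?_, ?_⟩
  · obtain ⟨c, hc⟩ := eq_add_of_mem_ker B D hker' hw (by rw [hDw]; simp)
      (fun v => (hBσ _).trans (hk v))
    refine ⟨c, hc.trans ?_⟩
    rw [hDw, div_one]
    exact congrArg (fun r : ℝ => r • w + c • n') (hDf k).symm
  set lam : EuclideanSpace ℝ (Fin (2 * m)) → ℝ := fun u =>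
    fderiv ℝ (fun y => inChart x σ y ![w, n']) y u with hlam
  -- The kernel is spanned by w and n', so a direction in which σ(w, n') is stationary gives a
  -- variation vanishing on the whole kernel, and σ^m is stationary too. Thus ker lam ⊆ ker D, and
  -- the two functionals are proportional.
  have hkey : ∀ u, lam u = 0 → D u = 0 := by
    intro u hu
    refine fderiv_wedgePow_eq_zero hψ hw0 u (fun a b ha hb => ?_) _
    obtain ⟨c, hc⟩ := eq_add_of_mem_ker B D hker' hw (by rw [hDw]; simp) ha
    obtain ⟨c', hc'⟩ := eq_add_of_mem_ker B D hker' hw (by rw [hDw]; simp) hb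
    have hlin : ∀ y, inChart x σ y ![a, b] =
        (D a / D w * c' - D b / D w * c) * inChart x σ y ![w, n'] := by
      intro y
      rw [hc, hc']
      simp only [← toBilin_apply, map_add, map_smul, add_apply, smul_apply, smul_eq_mul]
      have h1 := form_self (inChart x σ y) w
      have h2 := form_self (inChart x σ y) n'
      have h3 := form_swap (inChart x σ y) n' w
      simp only [← toBilin_apply] at h1 h2 h3
      rw [h1, h2, h3, hDw, hDn]
      simp
      ring
    have hd : DifferentiableAt ℝ (fun y => inChart x σ y ![w, n']) y := by
      have := (differentiableAt_toBilin hψ).clm_apply (differentiableAt_const w)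
        |>.clm_apply (differentiableAt_const n')
      simpa only [toBilin_apply] using this
    simp only [hlin]
    rw [fderiv_const_mul hd]
    change _ * lam u = 0
    rw [hu, mul_zero]
  have hlw : lam w ≠ 0 := fun h => by
    have := hkey w h
    rw [hDw] at this
    exact one_ne_zero this
  refine ⟨lam w, hlw, fun u => ?_⟩
  refine Eq.trans ?_ (congrArg (lam w * ·) (hDf u)).symm
  change lam u = lam w * D u
  -- Project u along w into ker lam and use D w = 1 to read off the factor lam w.
  have h1 : lam (u - (lam u / lam w) • w) = 0 := by
    simp only [hlam, map_sub, map_smul, smul_eq_mul]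
    change lam u - lam u / lam w * lam w = 0
    field_simp
    ring
  have h2 := hkey _ h1
  rw [map_sub, map_smul, hDw, smul_eq_mul, mul_one] at h2
  rw [sub_eq_zero.1 h2]
  field_simp

end FoldFrame

end

end FoldedSymplectic

namespace FoldedSymplectic

section

open Set Filter Bundle

/-! ### Vector fields along maps in coordinates -/

section Sections

variable {E : Type*} [NormedAddCommGroup E] [NormedSpace ℝ E] {H : Type*} [TopologicalSpace H]
  {E' : Type*} [NormedAddCommGroup E'] [NormedSpace ℝ E'] {H' : Type*} [TopologicalSpace H']
  {I : ModelWithCorners ℝ E H} {J : ModelWithCorners ℝ E' H'}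
  {M : Type*} [TopologicalSpace M] [ChartedSpace H M] [IsManifold I ∞ M]
  {N : Type*} [TopologicalSpace N] [ChartedSpace H' N]

/-- Smoothness of a vector field along a map, in coordinates. -/
theorem contMDiffWithinAt_lift_iff {f : N → M} {w : ∀ n, TangentSpace I (f n)} {s : Set N} {n₀ : N}
    {x₀ : M} (h : f n₀ ∈ (extChartAt I x₀).source) :
    ContMDiffWithinAt J I.tangent ∞ (fun n => (⟨f n, w n⟩ : TangentBundle I M)) s n₀ ↔
      ContMDiffWithinAt J I ∞ f s n₀ ∧ ContMDiffWithinAt J 𝓘(ℝ, E) ∞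
        (fun n => (mfderiv I 𝓘(ℝ, E) (extChartAt I x₀) (f n) (w n) : E)) s n₀ := by
  have : IsManifold I 1 M := .of_le (n := ∞) (by simp)
  have hs : f n₀ ∈ (chartAt H x₀).source := by rwa [extChartAt_source] at h
  set e := trivializationAt E (TangentSpace I : M → Type _) x₀ with he
  have hb : ∀ {x : M}, x ∈ (chartAt H x₀).source → x ∈ e.baseSet := fun hx => by
    rwa [he, TangentBundle.trivializationAt_baseSet]
  have key : ∀ n, f n ∈ (chartAt H x₀).source →
      (e (⟨f n, w n⟩ : TangentBundle I M)).2 =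
        (mfderiv I 𝓘(ℝ, E) (extChartAt I x₀) (f n) (w n) : E) := by
    intro n hn
    refine Eq.trans ?_ (DFunLike.congr_fun
      (TangentBundle.continuousLinearMapAt_trivializationAt (I := I) hn) (w n))
    refine Eq.trans ?_ (congrFun (Trivialization.continuousLinearMapAt_apply ℝ e (f n)) (w n)).symm
    rw [Trivialization.coe_linearMapAt_of_mem _ (hb hn)]
  rw [e.contMDiffWithinAt_iff (e.mem_source.2 (hb hs))]
  refine and_congr_right fun hf => ?_
  have hev : ∀ᶠ n in 𝓝[s] n₀, f n ∈ (chartAt H x₀).source :=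
    hf.continuousWithinAt.preimage_mem_nhdsWithin ((chartAt H x₀).open_source.mem_nhds hs)
  have hee : (fun n => (e (⟨f n, w n⟩ : TangentBundle I M)).2) =ᶠ[𝓝[s] n₀] fun n =>
      (mfderiv I 𝓘(ℝ, E) (extChartAt I x₀) (f n) (w n) : E) := by
    filter_upwards [hev] with n hn using key n hn
  exact ⟨fun h => h.congr_of_eventuallyEq hee.symm (key n₀ hs).symm,
    fun h => h.congr_of_eventuallyEq hee (key n₀ hs)⟩

theorem contMDiffAt_lift_iff {f : N → M} {w : ∀ n, TangentSpace I (f n)} {n₀ : N}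
    {x₀ : M} (h : f n₀ ∈ (extChartAt I x₀).source) :
    ContMDiffAt J I.tangent ∞ (fun n => (⟨f n, w n⟩ : TangentBundle I M)) n₀ ↔
      ContMDiffAt J I ∞ f n₀ ∧ ContMDiffAt J 𝓘(ℝ, E) ∞
        (fun n => (mfderiv I 𝓘(ℝ, E) (extChartAt I x₀) (f n) (w n) : E)) n₀ := by
  simp only [← contMDiffWithinAt_univ]
  exact contMDiffWithinAt_lift_iff h

theorem mfderiv_section_congr {f : M → E'} {W : ∀ x : M, TangentSpace I x} {x x' : M}
    (h : x = x') : (mfderiv I 𝓘(ℝ, E') f x (W x) : E') = (mfderiv I 𝓘(ℝ, E') f x' (W x') : E') := by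
  rw [h]

theorem mfderiv_congr_base {f : M → E'} {x x' : M} (h : x = x') (v : E) :
    (mfderiv I 𝓘(ℝ, E') f x v : E') = (mfderiv I 𝓘(ℝ, E') f x' v : E') := by rw [h]

variable [I.Boundaryless]

theorem contMDiffAt_field_iff {W : ∀ x : M, TangentSpace I x} {x x₀ : M}
    (h : x ∈ (extChartAt I x₀).source) :
    ContMDiffAt I I.tangent ∞ (fun x => (⟨x, W x⟩ : TangentBundle I M)) x ↔
      ContDiffAt ℝ ∞ (fun y => (mfderiv I 𝓘(ℝ, E) (extChartAt I x₀) ((extChartAt I x₀).symm y)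
        (W ((extChartAt I x₀).symm y)) : E)) (extChartAt I x₀ x) := by
  rw [contMDiffAt_lift_iff (f := fun x : M => x) h]
  have hs : x ∈ (chartAt H x₀).source := by rwa [extChartAt_source] at h
  have h1 : ContMDiffAt I 𝓘(ℝ, E) ∞ (extChartAt I x₀) x := contMDiffAt_extChartAt' hs
  have h2 : ContMDiffAt 𝓘(ℝ, E) I ∞ (extChartAt I x₀).symm (extChartAt I x₀ x) :=
    (contMDiffOn_extChartAt_symm (I := I) (n := ∞) x₀ _ ((extChartAt I x₀).map_source h)).contMDiffAt
      ((isOpen_extChartAt_target x₀).mem_nhds ((extChartAt I x₀).map_source h))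
  constructor
  · rintro ⟨-, h3⟩
    refine ContMDiffAt.contDiffAt ?_
    have h4 : ContMDiffAt I 𝓘(ℝ, E) ∞
      (fun x => (mfderiv I 𝓘(ℝ, E) (extChartAt I x₀) x (W x) : E))
      ((extChartAt I x₀).symm (extChartAt I x₀ x)) := by rwa [(extChartAt I x₀).left_inv h]
    exact h4.comp _ h2
  · intro h3
    refine ⟨contMDiffAt_id, ?_⟩
    have h4 := ContMDiffAt.comp x h3.contMDiffAt h1
    refine h4.congr_of_eventuallyEq ?_
    filter_upwards [(isOpen_extChartAt_source (I := I) x₀).mem_nhds h] with x' hx'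
    exact mfderiv_section_congr ((extChartAt I x₀).left_inv hx').symm

end Sections

/-! ### Local transverse fields with values in the kernel -/

section TransverseField

theorem toBilin_add_wedge_apply {E : Type*} [NormedAddCommGroup E] [NormedSpace ℝ E]
    (B : E [⋀^Fin 2]→L[ℝ] ℝ) (D κ : E →L[ℝ] ℝ) (u v : E) :
    (toBilin E B + D.smulRight κ - κ.smulRight D) u v = B ![u, v] + D u * κ v - κ u * D v := by
  rw [← toBilin_apply]
  rfl

/-- D ∧ κ is nondegenerate on ker B, the span of n and w, so adding it to B removes the kernel. -/
theorem isInvertible_of_ker_span {E : Type*} [NormedAddCommGroup E] [NormedSpace ℝ E]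
    [FiniteDimensional ℝ E] (B : E [⋀^Fin 2]→L[ℝ] ℝ) (D κ : E →L[ℝ] ℝ) {n w : E}
    (hn : ∀ v, B ![n, v] = 0) (hw : ∀ v, B ![w, v] = 0) (hDn : D n = 0) (hκ : κ n = 1)
    (hDw : D w = 1) (hker : ∀ k, (∀ v, B ![k, v] = 0) → ∃ c : ℝ, k = D k • w + c • n) :
    (toBilin E B + D.smulRight κ - κ.smulRight D).IsInvertible := by
  refine isInvertible_of_injective _ fun u hu => ?_
  have h : ∀ v, B ![u, v] + D u * κ v - κ u * D v = 0 := fun v => by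
    rw [← toBilin_add_wedge_apply, hu]
    rfl
  have h1 := h n
  have h2 := h w
  rw [form_swap, hn, hDn, hκ] at h1
  rw [form_swap, hw, hDw] at h2
  have hDu : D u = 0 := by linarith
  have hκu : κ u = 0 := by rw [hDu] at h2; linarith
  obtain ⟨c, hc⟩ := hker u fun v => by have := h v; rw [hDu, hκu] at this; linarith
  rw [hDu, zero_smul, zero_add] at hc
  rw [hc, map_smul, hκ, smul_eq_mul, mul_one] at hκu
  rw [hc, hκu, zero_smul]

/-- The kernel vector u with D u = 1 and κ u = 0 satisfies (B + D ∧ κ)(u, ·) = κ. Solving this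
equation is a smooth way of extending the choice of u to points off the fold, where B has no kernel.
-/
theorem inverse_mem_ker {E : Type*} [NormedAddCommGroup E] [NormedSpace ℝ E]
    (B : E [⋀^Fin 2]→L[ℝ] ℝ) (D κ : E →L[ℝ] ℝ) {n w : E}
    (hn : ∀ v, B ![n, v] = 0) (hw : ∀ v, B ![w, v] = 0) (hDn : D n = 0) (hn0 : n ≠ 0)
    (hDw : D w ≠ 0) (hi : (toBilin E B + D.smulRight κ - κ.smulRight D).IsInvertible) :
    (∀ v, B ![(toBilin E B + D.smulRight κ - κ.smulRight D).inverse κ, v] = 0) ∧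
      D ((toBilin E B + D.smulRight κ - κ.smulRight D).inverse κ) = 1 := by
  set A := toBilin E B + D.smulRight κ - κ.smulRight D with hA
  have hAa : ∀ u v, A u v = B ![u, v] + D u * κ v - κ u * D v := toBilin_add_wedge_apply B D κ
  have hκn : κ n ≠ 0 := by
    intro h
    apply hn0
    apply hi.injective
    refine ContinuousLinearMap.ext fun v => ?_
    rw [hAa, hn, hDn, h]
    simp
  have h1 : A.inverse κ = (D w)⁻¹ • (w - (κ w / κ n) • n) := by
    rw [hi.inverse_apply_eq]
    refine ContinuousLinearMap.ext fun v => ?_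
    rw [map_smul, map_sub, map_smul]
    simp only [smul_apply, sub_apply, hAa, hn, hw, hDn, smul_eq_mul]
    field_simp
    ring
  rw [h1]
  refine ⟨fun v => ?_, ?_⟩
  · have e1 := hn v
    have e2 := hw v
    rw [← toBilin_apply] at e1 e2 ⊢
    simp [map_smul, map_sub, e1, e2]
  · simp [hDn, hDw]

variable {m : ℕ} {M : Type*} [TopologicalSpace M] [ChartedSpace (EuclideanSpace ℝ (Fin (2 * m))) M]
  [IsManifold (𝓡 (2 * m)) ∞ M] {σ : DForm (𝓡 (2 * m)) M 2}
  [ChartedSpace (EuclideanSpace ℝ (Fin (2 * m - 1))) (fold σ)]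
  [IsManifold (𝓡 (2 * m - 1)) ∞ (fold σ)]

theorem inChart_eq_zero_of_mem_formKer {x₀ x : M} (hx : x ∈ (extChartAt (𝓡 (2 * m)) x₀).source)
    {k : TangentSpace (𝓡 (2 * m)) x} (hk : k ∈ formKer σ x) (v : EuclideanSpace ℝ (Fin (2 * m))) :
    inChart x₀ σ (extChartAt (𝓡 (2 * m)) x₀ x)
      ![mfderiv (𝓡 (2 * m)) 𝓘(ℝ, EuclideanSpace ℝ (Fin (2 * m))) (extChartAt (𝓡 (2 * m)) x₀) x k, v]
      = 0 := by
  rw [inChart_apply]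
  have h := hk (mfderiv 𝓘(ℝ, EuclideanSpace ℝ (Fin (2 * m))) (𝓡 (2 * m))
    (extChartAt (𝓡 (2 * m)) x₀).symm (extChartAt (𝓡 (2 * m)) x₀ x) v)
  refine (form_congr ((extChartAt (𝓡 (2 * m)) x₀).left_inv hx) _).trans (Eq.trans ?_ h)
  congr 1
  funext i
  fin_cases i
  · exact mfderiv_symm_extChartAt_apply hx k
  · rfl

theorem mem_formKer_of_inChart {x₀ x : M} (hx : x ∈ (extChartAt (𝓡 (2 * m)) x₀).source)
    {k : EuclideanSpace ℝ (Fin (2 * m))}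
    (hk : ∀ v, inChart x₀ σ (extChartAt (𝓡 (2 * m)) x₀ x) ![k, v] = 0) :
    (mfderiv 𝓘(ℝ, EuclideanSpace ℝ (Fin (2 * m))) (𝓡 (2 * m))
      (extChartAt (𝓡 (2 * m)) x₀).symm (extChartAt (𝓡 (2 * m)) x₀ x) k :
        EuclideanSpace ℝ (Fin (2 * m))) ∈ (formKer σ x : Set (EuclideanSpace ℝ (Fin (2 * m)))) := by
  intro v
  have h := hk (mfderiv (𝓡 (2 * m)) 𝓘(ℝ, EuclideanSpace ℝ (Fin (2 * m)))
    (extChartAt (𝓡 (2 * m)) x₀) x v)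
  rw [inChart_apply] at h
  refine Eq.trans ?_ ((form_congr ((extChartAt (𝓡 (2 * m)) x₀).left_inv hx) _).symm.trans h)
  congr 1
  funext i
  fin_cases i
  · rfl
  · exact (mfderiv_symm_extChartAt_apply hx v).symm

/-- In the chart the field is y ↦ (σ_y + D_y ∧ κ)⁻¹ κ, with D the differential of the coefficient of
σ^m and κ a fixed functional. It is smooth where the perturbed form is invertible, and along the
fold it lies in ker σ. -/
theorem exists_local_transverse_field (hσ : IsFoldedSymplectic σ)
    (hZ : Manifold.IsSmoothEmbedding (𝓡 (2 * m - 1)) (𝓡 (2 * m)) ∞ (Subtype.val : fold σ → M))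
    (z₀ : fold σ) : ∃ (O : Set M) (W : ∀ x : M, TangentSpace (𝓡 (2 * m)) x), IsOpen O ∧
      (z₀ : M) ∈ O ∧ O ⊆ (extChartAt (𝓡 (2 * m)) (z₀ : M)).source ∧
      ContMDiffOn (𝓡 (2 * m)) (𝓡 (2 * m)).tangent ∞
        (fun x => (⟨x, W x⟩ : TangentBundle (𝓡 (2 * m)) M)) O ∧
      ∀ z : fold σ, (z : M) ∈ O → W z ∈ formKer σ (z : M) ∧ foldDiff σ z₀ z (W z) = 1 := by
  set x₀ : M := z₀.1 with hx₀
  set e := extChartAt (𝓡 (2 * m)) x₀ with he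
  obtain ⟨n, w, hn0, -, hn, hw, hDw, hkers, -⟩ := exists_fold_frame hσ hZ z₀
  set ψ := inChart x₀ σ with hψ
  have hψ0 : ∀ v : Fin 2 → EuclideanSpace ℝ (Fin (2 * m)), ψ (e x₀) v = σ x₀ v := inChart_self σ x₀
  set D : EuclideanSpace ℝ (Fin (2 * m)) → EuclideanSpace ℝ (Fin (2 * m)) →L[ℝ] ℝ :=
    fderiv ℝ (topCoeff σ x₀) with hD
  have hDf : ∀ v, foldDiff σ x₀ x₀ v = D (e x₀) v := foldDiff_self x₀
  set n' : EuclideanSpace ℝ (Fin (2 * m)) := dIncl σ z₀ n with hn'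
  have hn'0 : n' ≠ 0 := fun h => hn0 (dIncl_injective hZ z₀ (h.trans (map_zero _).symm))
  obtain ⟨κ, hκ⟩ : ∃ κ : EuclideanSpace ℝ (Fin (2 * m)) →L[ℝ] ℝ, κ n' = 1 :=
    SeparatingDual.exists_eq_one hn'0
  set A : EuclideanSpace ℝ (Fin (2 * m)) → EuclideanSpace ℝ (Fin (2 * m)) →L[ℝ]
      EuclideanSpace ℝ (Fin (2 * m)) →L[ℝ] ℝ := fun y =>
    toBilin _ (ψ y) + (D y).smulRight κ - κ.smulRight (D y) with hA
  have hAi : (A (e x₀)).IsInvertible := by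
    refine isInvertible_of_ker_span (ψ (e x₀)) (D (e x₀)) κ (n := n') (w := w)
      (fun v => (hψ0 _).trans (hn v)) (fun v => (hψ0 _).trans (hw v)) ?_ hκ
      ((hDf w).symm.trans hDw) fun k hk => ?_
    · exact (hDf _).symm.trans (foldDiff_dIncl hσ.smooth hZ (mem_extChartAt_source x₀) n)
    · obtain ⟨c, hc⟩ := hkers k fun v => (hψ0 _).symm.trans (hk v)
      refine ⟨c, hc.trans ?_⟩
      let w' : EuclideanSpace ℝ (Fin (2 * m)) := w
      exact congrArg (fun r : ℝ => r • w' + c • n') (hDf k)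
  have hto := isOpen_extChartAt_target (I := 𝓡 (2 * m)) x₀
  have hDs : ContDiffOn ℝ ∞ D e.target := fun y hy =>
    ((contDiffAt_topCoeff hσ.smooth hy).fderiv_right (by simp)).contDiffWithinAt
  have hψs : ContDiffOn ℝ ∞ (fun y => toBilin _ (ψ y)) e.target :=
    contDiff_toBilin.comp_contDiffOn (hσ.smooth x₀)
  have hAs : ContDiffOn ℝ ∞ A e.target :=
    (hψs.add (hDs.smulRight contDiffOn_const)).sub (contDiffOn_const.smulRight hDs)
  set T : Set (EuclideanSpace ℝ (Fin (2 * m))) := e.target ∩ A ⁻¹' range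
    ((↑) : (EuclideanSpace ℝ (Fin (2 * m)) ≃L[ℝ] (EuclideanSpace ℝ (Fin (2 * m)) →L[ℝ] ℝ)) →
      EuclideanSpace ℝ (Fin (2 * m)) →L[ℝ] (EuclideanSpace ℝ (Fin (2 * m)) →L[ℝ] ℝ)) with hT
  have hTo : IsOpen T := hAs.continuousOn.isOpen_inter_preimage hto ContinuousLinearEquiv.isOpen
  set wh : EuclideanSpace ℝ (Fin (2 * m)) → EuclideanSpace ℝ (Fin (2 * m)) := fun y =>
    (A y).inverse κ with hwh
  have hwhs : ∀ y ∈ T, ContDiffAt ℝ ∞ wh y := by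
    intro y hy
    obtain ⟨f, hf⟩ := hy.2
    have h1 : ContDiffAt ℝ ∞ ContinuousLinearMap.inverse (A y) := by
      rw [← hf]; exact contDiffAt_map_inverse f
    exact (h1.comp y (hAs.contDiffAt (hto.mem_nhds hy.1))).clm_apply contDiffAt_const
  have hDc : ContinuousOn D e.target := hDs.continuousOn
  -- The field needs invertibility of the perturbed form; D ≠ 0 makes the kernel of D the tangent
  -- space of the fold at all nearby fold points.
  set O : Set M := e.source ∩ e ⁻¹' (T ∩ (e.target ∩ D ⁻¹' {0}ᶜ)) with hO
  have hOo : IsOpen O :=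
    (continuousOn_extChartAt x₀).isOpen_inter_preimage (isOpen_extChartAt_source x₀)
      (hTo.inter (hDc.isOpen_inter_preimage hto isOpen_compl_singleton))
  have hx₀t : e x₀ ∈ e.target := mem_extChartAt_target x₀
  refine ⟨O, fun x => (mfderiv 𝓘(ℝ, EuclideanSpace ℝ (Fin (2 * m))) (𝓡 (2 * m)) e.symm (e x)
    (wh (e x)) : EuclideanSpace ℝ (Fin (2 * m))), hOo,
    ⟨mem_extChartAt_source x₀, ⟨hx₀t, hAi⟩, hx₀t, hσ.transverse x₀ z₀.2⟩, inter_subset_left, ?_, ?_⟩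
  · intro x hx
    refine ContMDiffAt.contMDiffWithinAt ?_
    refine (contMDiffAt_field_iff (W := fun x => (mfderiv 𝓘(ℝ, EuclideanSpace ℝ (Fin (2 * m)))
      (𝓡 (2 * m)) e.symm (e x) (wh (e x)) : EuclideanSpace ℝ (Fin (2 * m)))) (x₀ := x₀) hx.1).2 ?_
    refine (hwhs _ hx.2.1).congr_of_eventuallyEq ?_
    filter_upwards [hto.mem_nhds hx.2.1.1] with y hy
    have h1 := mfderiv_extChartAt_symm_apply hy (wh y)
    rw [← he] at h1 ⊢
    rw [e.right_inv hy]
    exact h1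
  · intro z hz
    have hzs : (z : M) ∈ e.source := hz.1
    obtain ⟨n₁, w₁, hn₁0, -, hn₁, hw₁, hDw₁, -, -⟩ := exists_fold_frame hσ hZ z
    have hdn := foldDiff_dIncl hσ.smooth hZ hzs
    have hf0 : foldDiff σ x₀ z ≠ 0 := by
      intro h
      apply hz.2.2.2
      refine ContinuousLinearMap.ext fun v => ?_
      have h1 := congrArg (fun L : TangentSpace (𝓡 (2 * m)) (z : M) →L[ℝ] ℝ =>
        L ((mfderiv 𝓘(ℝ, EuclideanSpace ℝ (Fin (2 * m))) (𝓡 (2 * m)) e.symm (e z) v :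
          EuclideanSpace ℝ (Fin (2 * m))))) h
      have h2 := mfderiv_extChartAt_symm_apply (e.map_source hzs) v
      refine Eq.trans ?_ h1
      refine congrArg (D (e z)) (h2.symm.trans ?_)
      exact mfderiv_congr_base (e.left_inv hzs) _
    -- Transversality of w₁, known in the chart centred at z, is transferred to the chart at x₀:
    -- both differentials have TZ as kernel.
    have hw₁T : foldDiff σ x₀ z w₁ ≠ 0 := by
      intro h
      have h1 := (mem_tangentFold_iff hZ z hf0 hdn w₁).2 h
      obtain ⟨u, hu⟩ := h1
      have h2 := foldDiff_dIncl hσ.smooth hZ (mem_extChartAt_source (z : M)) u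
      have h3 : foldDiff σ z z w₁ = 0 := by rw [← hu]; exact h2
      rw [h3] at hDw₁
      exact zero_ne_one hDw₁
    have hde : ∀ v : TangentSpace (𝓡 (2 * m)) (z : M), mfderiv (𝓡 (2 * m))
        𝓘(ℝ, EuclideanSpace ℝ (Fin (2 * m))) e z v = 0 → v = 0 := fun v hv => by
      have := mfderiv_symm_extChartAt_apply hzs v
      rw [← he, hv, map_zero] at this
      exact this.symm
    obtain ⟨h1, h2⟩ := inverse_mem_ker (ψ (e z)) (D (e z)) κ
      (inChart_eq_zero_of_mem_formKer hzs hn₁) (inChart_eq_zero_of_mem_formKer hzs hw₁) (hdn n₁)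
      (fun h => hn₁0 (dIncl_injective hZ z ((hde _ h).trans (map_zero _).symm))) hw₁T hz.2.1.2
    refine ⟨mem_formKer_of_inChart hzs h1, ?_⟩
    refine Eq.trans ?_ h2
    refine congrArg (D (e z)) ?_
    have h3 := mfderiv_extChartAt_symm_apply (e.map_source hzs) (wh (e z))
    rw [← he, e.left_inv hzs] at h3
    exact h3

end TransverseField

end

end FoldedSymplectic

namespace FoldedSymplectic

section

open Set Filter Bundle

/-! ### The canonical orientation of the null line -/

section Positivity

variable {m : ℕ} {M : Type*} [TopologicalSpace M] [ChartedSpace (EuclideanSpace ℝ (Fin (2 * m))) M]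
  [IsManifold (𝓡 (2 * m)) ∞ M] {σ : DForm (𝓡 (2 * m)) M 2}

/-- The derivative of `σ` at `x` in the direction `w`, in the preferred chart at `x`. -/
def formDiff (σ : DForm (𝓡 (2 * m)) M 2) (x : M)
    (a b w : EuclideanSpace ℝ (Fin (2 * m))) : ℝ :=
  fderiv ℝ (fun y => inChart x σ y ![a, b]) (extChartAt (𝓡 (2 * m)) x x) w

theorem formDiff_eq (hσ : IsSmooth σ) (x : M) (a b w : EuclideanSpace ℝ (Fin (2 * m))) :
    formDiff σ x a b w =
      fderiv ℝ (fun y => toBilin _ (inChart x σ y)) (extChartAt (𝓡 (2 * m)) x x) w a b := by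
  have h : DifferentiableAt ℝ (fun y => toBilin _ (inChart x σ y)) (extChartAt (𝓡 (2 * m)) x x) :=
    ((contDiffAt_twoForm_iff.1 (hσ.contDiffAt (mem_extChartAt_target x))).differentiableAt
      (by simp))
  have h1 := ((h.hasFDerivAt.clm_apply (hasFDerivAt_const a _)).clm_apply (hasFDerivAt_const b _))
  have h2 : (fun y => toBilin _ (inChart x σ y) a b) = fun y => inChart x σ y ![a, b] := by
    funext y; rw [toBilin_apply]
  rw [h2] at h1
  rw [formDiff, h1.fderiv]
  simp

/-- At a point where both fields lie in ker σ, the product-rule terms that differentiate the fields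
vanish. Only the coefficients of σ are differentiated, so the result depends on the values of the
fields at the point alone. -/
theorem mfderiv_form_apply (hσ : IsSmooth σ) {x : M} {W V : ∀ x : M, TangentSpace (𝓡 (2 * m)) x}
    (hW : ContMDiffAt (𝓡 (2 * m)) (𝓡 (2 * m)).tangent ∞
      (fun x => (⟨x, W x⟩ : TangentBundle (𝓡 (2 * m)) M)) x)
    (hV : ContMDiffAt (𝓡 (2 * m)) (𝓡 (2 * m)).tangent ∞
      (fun x => (⟨x, V x⟩ : TangentBundle (𝓡 (2 * m)) M)) x)
    (hWk : W x ∈ formKer σ x) (hVk : V x ∈ formKer σ x) (w : TangentSpace (𝓡 (2 * m)) x) :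
    (mfderiv (𝓡 (2 * m)) 𝓘(ℝ, ℝ) (fun x => σ x ![W x, V x]) x w : ℝ) =
      formDiff σ x (W x) (V x) w := by
  set e := extChartAt (𝓡 (2 * m)) x with he
  have hs : x ∈ e.source := mem_extChartAt_source x
  set Wh : EuclideanSpace ℝ (Fin (2 * m)) → EuclideanSpace ℝ (Fin (2 * m)) := fun y =>
    mfderiv (𝓡 (2 * m)) 𝓘(ℝ, EuclideanSpace ℝ (Fin (2 * m))) e (e.symm y) (W (e.symm y)) with hWh
  set Vh : EuclideanSpace ℝ (Fin (2 * m)) → EuclideanSpace ℝ (Fin (2 * m)) := fun y =>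
    mfderiv (𝓡 (2 * m)) 𝓘(ℝ, EuclideanSpace ℝ (Fin (2 * m))) e (e.symm y) (V (e.symm y)) with hVh
  have hWd : DifferentiableAt ℝ Wh (e x) :=
    ((contMDiffAt_field_iff hs).1 hW).differentiableAt (by simp)
  have hVd : DifferentiableAt ℝ Vh (e x) :=
    ((contMDiffAt_field_iff hs).1 hV).differentiableAt (by simp)
  have hid : ∀ v : TangentSpace (𝓡 (2 * m)) x, (mfderiv (𝓡 (2 * m))
      𝓘(ℝ, EuclideanSpace ℝ (Fin (2 * m))) e x v : EuclideanSpace ℝ (Fin (2 * m))) = v := fun v =>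
    DFunLike.congr_fun (mfderiv_extChartAt_self (I := 𝓡 (2 * m)) (x := x)) v
  have hW0 : Wh (e x) = W x := (mfderiv_section_congr (e.left_inv hs)).trans (hid _)
  have hV0 : Vh (e x) = V x := (mfderiv_section_congr (e.left_inv hs)).trans (hid _)
  have hB : DifferentiableAt ℝ (fun y => toBilin _ (inChart x σ y)) (e x) :=
    ((contDiffAt_twoForm_iff.1 (hσ.contDiffAt (mem_extChartAt_target x))).differentiableAt
      (by simp))
  set F : EuclideanSpace ℝ (Fin (2 * m)) → ℝ := fun y => toBilin _ (inChart x σ y) (Wh y) (Vh y)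
    with hF
  have hFd := (hB.hasFDerivAt.clm_apply hWd.hasFDerivAt).clm_apply hVd.hasFDerivAt
  have hk : ∀ k : EuclideanSpace ℝ (Fin (2 * m)), (∀ v : EuclideanSpace ℝ (Fin (2 * m)),
      (σ x ![k, v] : ℝ) = 0) → ∀ v, toBilin _ (inChart x σ (e x)) k v = 0 := fun k hk v => by
    rw [toBilin_apply]; exact (inChart_self σ x _).trans (hk v)
  have hk' : ∀ k : EuclideanSpace ℝ (Fin (2 * m)), (∀ v : EuclideanSpace ℝ (Fin (2 * m)),
      (σ x ![k, v] : ℝ) = 0) → ∀ v, toBilin _ (inChart x σ (e x)) v k = 0 := fun k hk v => by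
    rw [toBilin_apply, form_swap, neg_eq_zero]; exact (inChart_self σ x _).trans (hk v)
  have hfe : (fun x' => σ x' ![W x', V x']) =ᶠ[𝓝 x] F ∘ e := by
    filter_upwards [(isOpen_extChartAt_source (I := 𝓡 (2 * m)) x).mem_nhds hs] with x' hx'
    simp only [Function.comp_apply, hF, toBilin_apply]
    have h1 := eq_inChart_comp (I := 𝓡 (2 * m)) (x₀ := x) σ hx'
    refine (DFunLike.congr_fun h1 _).trans ?_
    change inChart x σ (e x') (fun i => mfderiv (𝓡 (2 * m))
      𝓘(ℝ, EuclideanSpace ℝ (Fin (2 * m))) e x' (![W x', V x'] i)) = _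
    congr 1
    funext i
    fin_cases i
    · exact mfderiv_section_congr (e.left_inv hx').symm
    · exact mfderiv_section_congr (e.left_inv hx').symm
  have h1 : HasMFDerivAt 𝓘(ℝ, EuclideanSpace ℝ (Fin (2 * m))) 𝓘(ℝ, ℝ) F (e x) (fderiv ℝ F (e x)) :=
    hFd.differentiableAt.hasFDerivAt.hasMFDerivAt
  have h2 := h1.comp x (mdifferentiableAt_extChartAt (mem_chart_source _ x)).hasMFDerivAt
  refine Eq.trans (DFunLike.congr_fun (hfe.mfderiv_eq.trans h2.mfderiv) w) ?_
  refine Eq.trans (congrArg (fderiv ℝ F (e x)) (hid w)) ?_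
  refine Eq.trans (DFunLike.congr_fun hFd.fderiv _) (Eq.trans ?_ (formDiff_eq hσ x _ _ _).symm)
  have e1 := hk (Wh (e x)) (by rw [hW0]; exact hWk) (fderiv ℝ Vh (e x) w)
  have e2 := hk' (Vh (e x)) (by rw [hV0]; exact hVk) (fderiv ℝ Wh (e x) w)
  rw [← hW0, ← hV0]
  change toBilin _ (inChart x σ (e x)) (Wh (e x)) (fderiv ℝ Vh (e x) w) +
    (toBilin _ (inChart x σ (e x)) (fderiv ℝ Wh (e x) w) (Vh (e x)) + _) = _
  rw [e1, e2, zero_add, zero_add]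
  rfl

variable [ChartedSpace (EuclideanSpace ℝ (Fin (2 * m - 1))) (fold σ)]
  [IsManifold (𝓡 (2 * m - 1)) ∞ (fold σ)]

theorem mem_tangentFold_iff_foldDiff (hσ : IsFoldedSymplectic σ)
    (hZ : Manifold.IsSmoothEmbedding (𝓡 (2 * m - 1)) (𝓡 (2 * m)) ∞ (Subtype.val : fold σ → M))
    (z : fold σ) (v : TangentSpace (𝓡 (2 * m)) (z : M)) :
    v ∈ tangentFold σ z ↔ foldDiff σ z z v = 0 := by
  obtain ⟨n, w, -, -, -, -, hw, -⟩ := exists_fold_frame hσ hZ z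
  refine mem_tangentFold_iff hZ z (fun h => ?_)
    (foldDiff_dIncl hσ.smooth hZ (mem_extChartAt_source (z : M))) v
  rw [h] at hw
  exact zero_ne_one hw

/-- Write W = r w + a n'. One factor r comes from W as an argument of the form, as the n'-part pairs
to zero with the null vector; the other comes from W as the direction of differentiation. The square
r² is why the sign does not depend on W. -/
theorem exists_formDiff_eq (hσ : IsFoldedSymplectic σ)
    (hZ : Manifold.IsSmoothEmbedding (𝓡 (2 * m - 1)) (𝓡 (2 * m)) ∞ (Subtype.val : fold σ → M))
    (z : fold σ) : ∃ n : TangentSpace (𝓡 (2 * m - 1)) z, ∃ c : ℝ, n ≠ 0 ∧ c ≠ 0 ∧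
      (∀ u ∈ nullFibre σ z, ∃ b : ℝ, u = b • n) ∧
      ∀ W ∈ formKer σ (z : M), ∀ b : ℝ,
        formDiff σ (z : M) W (dIncl σ z (b • n)) W = foldDiff σ z z W ^ 2 * (b * c) := by
  obtain ⟨n, w, hn0, hnull, hn, hw, hw1, hker, c, hc, hfd⟩ := exists_fold_frame hσ hZ z
  refine ⟨n, c, hn0, hc, fun u hu => hnull u fun b => hu _, fun W hW b => ?_⟩
  obtain ⟨a, ha⟩ := hker W hW
  set r : ℝ := foldDiff σ z z W with hr
  set n' : EuclideanSpace ℝ (Fin (2 * m)) := dIncl σ z n with hn'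
  let w' : EuclideanSpace ℝ (Fin (2 * m)) := w
  have hWe : (W : EuclideanSpace ℝ (Fin (2 * m))) = r • w' + a • n' := ha
  have hbn : (dIncl σ z (b • n) : EuclideanSpace ℝ (Fin (2 * m))) = b • n' := map_smul _ _ _
  let W' : EuclideanSpace ℝ (Fin (2 * m)) := W
  set T : EuclideanSpace ℝ (Fin (2 * m)) →L[ℝ] EuclideanSpace ℝ (Fin (2 * m)) →L[ℝ] ℝ :=
    fderiv ℝ (fun y => toBilin _ (inChart (z : M) σ y)) (extChartAt (𝓡 (2 * m)) (z : M) z) W' with hT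
  have hfd' : T w' n' = c * r := (formDiff_eq hσ.smooth (z : M) w' n' W').symm.trans (hfd W)
  have hTn : T n' n' = 0 := by
    refine (formDiff_eq hσ.smooth (z : M) n' n' W').symm.trans ?_
    rw [formDiff]
    have : (fun y => inChart (z : M) σ y ![n', n']) = fun _ => 0 := by
      funext y; exact form_self _ _
    rw [this]; simp
  refine (formDiff_eq hσ.smooth (z : M) W' _ W').trans ?_
  have e0 : T W' (b • n') = r * (b * (c * r)) := by
    refine Eq.trans (congrArg (fun k => T k (b • n')) hWe) ?_
    simp only [map_add, map_smul, add_apply, smul_apply, smul_eq_mul, hTn, hfd']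
    ring
  refine Eq.trans (congrArg (T W') hbn) (e0.trans ?_)
  ring

/-- For a null vector b n the quantity is a positive square times b c, where c depends only on the
point; hence one global field W decides positivity for all admissible choices of fields. -/
theorem isPositiveNull_iff (hσ : IsFoldedSymplectic σ)
    (hZ : Manifold.IsSmoothEmbedding (𝓡 (2 * m - 1)) (𝓡 (2 * m)) ∞ (Subtype.val : fold σ → M))
    {W : ∀ x : M, TangentSpace (𝓡 (2 * m)) x}
    (hW : ContMDiff (𝓡 (2 * m)) (𝓡 (2 * m)).tangent ∞
      (fun x => (⟨x, W x⟩ : TangentBundle (𝓡 (2 * m)) M)))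
    (hWk : ∀ z : fold σ, W z ∈ formKer σ (z : M)) (hWt : ∀ z : fold σ, W z ∉ tangentFold σ z)
    (z : fold σ) {u : TangentSpace (𝓡 (2 * m - 1)) z} (hu : u ∈ nullFibre σ z) :
    (u ≠ 0 → formDiff σ (z : M) (W z) (dIncl σ z u) (W z) ≠ 0) ∧
    (0 < formDiff σ (z : M) (W z) (dIncl σ z u) (W z) ↔ IsPositiveNull σ z u) := by
  obtain ⟨n, c, hn0, hc, hnull, hQ⟩ := exists_formDiff_eq hσ hZ z
  obtain ⟨b, rfl⟩ := hnull u hu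
  have hne : ∀ k : TangentSpace (𝓡 (2 * m)) (z : M), k ∉ tangentFold σ z →
      0 < foldDiff σ z z k ^ 2 := fun k hk =>
    sq_pos_of_ne_zero fun h => hk ((mem_tangentFold_iff_foldDiff hσ hZ z k).2 h)
  rw [hQ _ (hWk z)]
  refine ⟨fun h => mul_ne_zero (hne _ (hWt z)).ne' (mul_ne_zero (fun hb => h ?_) hc), ?_⟩
  · rw [hb]; exact zero_smul _ _
  rw [mul_pos_iff_of_pos_left (hne _ (hWt z))]
  constructor
  · intro h
    set e := extChartAt (𝓡 (2 * m)) (z : M) with he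
    let v : EuclideanSpace ℝ (Fin (2 * m)) := dIncl σ z (b • n)
    -- The extension of the null vector with constant coefficients in the chart.
    let V : ∀ x : M, TangentSpace (𝓡 (2 * m)) x := fun x =>
      (mfderiv 𝓘(ℝ, EuclideanSpace ℝ (Fin (2 * m))) (𝓡 (2 * m)) e.symm (e x) v :
        EuclideanSpace ℝ (Fin (2 * m)))
    have hV : ContMDiffOn (𝓡 (2 * m)) (𝓡 (2 * m)).tangent ∞
        (fun x => (⟨x, V x⟩ : TangentBundle (𝓡 (2 * m)) M)) e.source := by
      intro x hx
      refine ContMDiffAt.contMDiffWithinAt ((contMDiffAt_field_iff hx).2 ?_)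
      refine (contDiffAt_const (c := v)).congr_of_eventuallyEq ?_
      filter_upwards [(isOpen_extChartAt_target (I := 𝓡 (2 * m)) (z : M)).mem_nhds
        (e.map_source hx)] with y hy
      have h1 := mfderiv_extChartAt_symm_apply hy v
      rw [← he] at h1
      refine Eq.trans ?_ h1
      simp only [V]
      rw [e.right_inv hy]
    have hz := mem_extChartAt_source (I := 𝓡 (2 * m)) (z : M)
    have hVz : V z = dIncl σ z (b • n) := by
      have h1 := mfderiv_symm_extChartAt_apply hz v
      refine Eq.trans ?_ h1
      refine congrArg (mfderiv 𝓘(ℝ, EuclideanSpace ℝ (Fin (2 * m))) (𝓡 (2 * m)) e.symm (e z)) ?_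
      exact (DFunLike.congr_fun (mfderiv_extChartAt_self (I := 𝓡 (2 * m)) (x := (z : M))) v).symm
    refine ⟨hu, e.source, W, V, isOpen_extChartAt_source _, hz, hW.contMDiffOn, hV,
      fun z' _ => ⟨hWk z', hWt z'⟩, hVz, ?_⟩
    have h2 := mfderiv_form_apply hσ.smooth (hW.contMDiffAt (x := (z : M))) (hV.contMDiffAt
      ((isOpen_extChartAt_source (I := 𝓡 (2 * m)) (z : M)).mem_nhds hz)) (hWk z)
      (by rw [hVz]; exact hu) (W z)
    refine lt_of_lt_of_eq ?_ h2.symm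
    rw [hVz, hQ _ (hWk z)]
    exact mul_pos (hne _ (hWt z)) h
  · rintro ⟨-, O, W', V, hO, hz, hW', hV, hWk', hVz, hpos⟩
    have h2 := mfderiv_form_apply hσ.smooth (hW'.contMDiffAt (hO.mem_nhds hz))
      (hV.contMDiffAt (hO.mem_nhds hz)) (hWk' z hz).1 (by rw [hVz]; exact hu) (W' z)
    have h3 := lt_of_lt_of_eq hpos h2
    rw [hVz, hQ _ (hWk' z hz).1] at h3
    exact (mul_pos_iff_of_pos_left (hne _ (hWk' z hz).2)).1 h3

end Positivity

end

end FoldedSymplectic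

namespace FoldedSymplectic

section

open Set Filter Bundle MeasureTheory

/-! ### Smoothness of integrals over a compact manifold -/

section ParametricIntegral

variable {n : ℕ} {K : Type*} [TopologicalSpace K] [ChartedSpace (EuclideanSpace ℝ (Fin n)) K]
  [IsManifold (𝓡 n) ∞ K] [CompactSpace K] [T2Space K]
  {X : Type} [NormedAddCommGroup X] [NormedSpace ℝ X]

/-- The partial derivative of a smooth function on `K × X` in the direction of the vector space `X`
is smooth. -/
theorem contMDiff_partial_fderiv {Y : Type} [NormedAddCommGroup Y] [NormedSpace ℝ Y]
    {F : K × X → Y} (hF : ContMDiff ((𝓡 n).prod 𝓘(ℝ, X)) 𝓘(ℝ, Y) ∞ F) :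
    ContMDiff ((𝓡 n).prod 𝓘(ℝ, X)) 𝓘(ℝ, X →L[ℝ] Y) ∞
      (fun p : K × X => fderiv ℝ (fun x => F (p.1, x)) p.2) := by
  intro p
  have h1 : ContMDiffAt (((𝓡 n).prod 𝓘(ℝ, X)).prod 𝓘(ℝ, X)) 𝓘(ℝ, Y) ∞
      (Function.uncurry fun (q : K × X) (x : X) => F (q.1, x)) (p, p.2) :=
    (hF.comp ((contMDiff_fst.comp contMDiff_fst).prodMk contMDiff_snd)).contMDiffAt
  have h2 := ContMDiffAt.mfderiv (m := ∞) (fun (q : K × X) (x : X) => F (q.1, x)) Prod.snd h1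
    contMDiffAt_snd le_rfl
  refine (h2.congr_of_eventuallyEq (Eventually.of_forall fun q => ?_))
  refine Eq.trans ?_ (congrFun (inTangentCoordinates_model_space (I := 𝓘(ℝ, X)) (I' := 𝓘(ℝ, Y))
    (fun q : K × X => q.2) (fun q => F (q.1, q.2))
    (fun q => mfderiv 𝓘(ℝ, X) 𝓘(ℝ, Y) (fun x => F (q.1, x)) q.2) p) q).symm
  exact mfderiv_eq_fderiv.symm

/-- Induction on the order, since the partial derivative of a jointly smooth function is again
jointly smooth on K × X. -/
theorem contDiffFamily_of_contMDiff (k : ℕ) : ∀ {Y : Type} [NormedAddCommGroup Y]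
    [NormedSpace ℝ Y] {F : K × X → Y} (_ : ContMDiff ((𝓡 n).prod 𝓘(ℝ, X)) 𝓘(ℝ, Y) ∞ F),
    ContDiffFamily k (fun g x => F (g, x)) := by
  induction k with
  | zero => exact fun hF => hF.continuous
  | succ k ih =>
    intro Y _ _ F hF
    refine ⟨hF.continuous, fun g => ?_, ih (contMDiff_partial_fderiv hF)⟩
    have h : ContMDiff 𝓘(ℝ, X) 𝓘(ℝ, Y) ∞ (fun x => F (g, x)) :=
      hF.comp (contMDiff_const.prodMk contMDiff_id)
    exact h.contDiff.differentiable (by simp)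

/-- Integration of continuous functions on a compact space as a continuous linear map. -/
def integralContinuousMap [MeasurableSpace K] [BorelSpace K] (ν : Measure K) [IsFiniteMeasure ν]
    (Y : Type) [NormedAddCommGroup Y] [NormedSpace ℝ Y] [FiniteDimensional ℝ Y] : C(K, Y) →L[ℝ] Y :=
  LinearMap.mkContinuous
    { toFun := fun γ => ∫ g, γ g ∂ν
      map_add' := fun γ γ' => integral_add
        (γ.continuous.integrable_of_hasCompactSupport (HasCompactSupport.of_compactSpace _))
        (γ'.continuous.integrable_of_hasCompactSupport (HasCompactSupport.of_compactSpace _))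
      map_smul' := fun c γ => integral_smul c _ } (ν.real univ) (fun γ => by
        have := norm_integral_le_of_norm_le_const (μ := ν) (f := γ)
          (Eventually.of_forall fun g => γ.norm_coe_le_norm g)
        simpa [mul_comm] using this)

theorem contDiff_integral_of_contMDiff [MeasurableSpace K] [BorelSpace K] (ν : Measure K)
    [IsFiniteMeasure ν] {Y : Type} [NormedAddCommGroup Y] [NormedSpace ℝ Y] [FiniteDimensional ℝ Y]
    {F : K × X → Y} (hF : ContMDiff ((𝓡 n).prod 𝓘(ℝ, X)) 𝓘(ℝ, Y) ∞ F) :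
    ContDiff ℝ ∞ (fun x => ∫ g, F (g, x) ∂ν) := by
  have h1 := contDiff_superposition (fun k => contDiffFamily_of_contMDiff k hF)
  have h2 := (integralContinuousMap ν Y).contDiff.comp
    (h1.comp (ContinuousLinearMap.const ℝ K : X →L[ℝ] C(K, X)).contDiff)
  exact h2

/-- Integrals over a compact manifold depend smoothly on parameters. -/
theorem contDiffOn_integral_of_contMDiffOn [FiniteDimensional ℝ X] [MeasurableSpace K]
    [BorelSpace K] (ν : Measure K)
    [IsFiniteMeasure ν] {Y : Type} [NormedAddCommGroup Y] [NormedSpace ℝ Y] [FiniteDimensional ℝ Y]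
    {F : K × X → Y} {Ω : Set X} (hΩ : IsOpen Ω)
    (hF : ContMDiffOn ((𝓡 n).prod 𝓘(ℝ, X)) 𝓘(ℝ, Y) ∞ F (univ ×ˢ Ω)) :
    ContDiffOn ℝ ∞ (fun x => ∫ g, F (g, x) ∂ν) Ω := by
  intro x₀ hx₀
  refine ContDiffAt.contDiffWithinAt ?_
  obtain ⟨r, hr, hrΩ⟩ := Metric.isOpen_iff.1 hΩ x₀ hx₀
  -- Multiplying by a bump function reduces to an integrand smooth on all of K × X, without changing
  -- it for x near x₀.
  let χ : ContDiffBump x₀ := ⟨r / 4, r / 2, by positivity, by linarith⟩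
  have hχt : tsupport χ ⊆ Ω := by
    rw [χ.tsupport_eq]
    exact (Metric.closedBall_subset_ball (by change r / 2 < r; linarith)).trans hrΩ
  have hG : ContMDiff ((𝓡 n).prod 𝓘(ℝ, X)) 𝓘(ℝ, Y) ∞ (fun p : K × X => χ p.2 • F p) := by
    intro p
    by_cases hp : p.2 ∈ Ω
    · have h1 : ContMDiff ((𝓡 n).prod 𝓘(ℝ, X)) 𝓘(ℝ, ℝ) ∞ (fun p : K × X => χ p.2) :=
        (χ.contDiff (n := (⊤ : ℕ∞))).contMDiff.comp contMDiff_snd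
      exact h1.contMDiffAt.smul (hF.contMDiffAt ((isOpen_univ.prod hΩ).mem_nhds ⟨mem_univ _, hp⟩))
    · refine (contMDiffAt_const (c := (0 : Y))).congr_of_eventuallyEq ?_
      have : {q : K × X | q.2 ∈ (tsupport χ)ᶜ} ∈ 𝓝 p :=
        ((isClosed_tsupport _).isOpen_compl.preimage continuous_snd).mem_nhds fun h => hp (hχt h)
      filter_upwards [this] with q hq
      rw [image_eq_zero_of_notMem_tsupport hq, zero_smul]
  refine (contDiff_integral_of_contMDiff ν hG).contDiffAt.congr_of_eventuallyEq ?_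
  filter_upwards [χ.eventuallyEq_one] with x hx
  simp only [hx, Pi.one_apply, one_smul]

end ParametricIntegral

/-! ### The differential of the group action -/

section Actions

variable {m : ℕ} {M : Type*} [TopologicalSpace M] [ChartedSpace (EuclideanSpace ℝ (Fin (2 * m))) M]
  [IsManifold (𝓡 (2 * m)) ∞ M] {G : Type*} [Group G] [MulAction G M] {σ : DForm (𝓡 (2 * m)) M 2}

theorem mfderiv_smul_smul (hs : ∀ g : G, ContMDiff (𝓡 (2 * m)) (𝓡 (2 * m)) ∞ (fun x : M => g • x))
    (g h : G) {x y : M} (hxy : h • x = y) (v : TangentSpace (𝓡 (2 * m)) x) :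
    (mfderiv (𝓡 (2 * m)) (𝓡 (2 * m)) (fun x : M => g • x) y
      (mfderiv (𝓡 (2 * m)) (𝓡 (2 * m)) (fun x : M => h • x) x v : EuclideanSpace ℝ (Fin (2 * m))) :
        EuclideanSpace ℝ (Fin (2 * m))) =
      mfderiv (𝓡 (2 * m)) (𝓡 (2 * m)) (fun x : M => (g * h) • x) x v := by
  subst hxy
  have h1 := mfderiv_comp x ((hs g).mdifferentiableAt (x := h • x) (by simp))
    ((hs h).mdifferentiableAt (x := x) (by simp))
  have h2 : (fun x : M => g • x) ∘ (fun x : M => h • x) = fun x => (g * h) • x :=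
    funext fun x => (mul_smul g h x).symm
  rw [h2] at h1
  exact (DFunLike.congr_fun h1 v).symm

theorem mfderiv_one_smul (x : M) (v : TangentSpace (𝓡 (2 * m)) x) :
    (mfderiv (𝓡 (2 * m)) (𝓡 (2 * m)) (fun x : M => (1 : G) • x) x v :
      EuclideanSpace ℝ (Fin (2 * m))) = v := by
  have h : (fun x : M => (1 : G) • x) = id := funext fun x => one_smul G x
  rw [h, mfderiv_id]
  rfl

/-- The action preserves σ, and every vector at the image point is the image of one at x under the
differential of the action. -/
theorem smul_mem_formKer
    (hs : ∀ g : G, ContMDiff (𝓡 (2 * m)) (𝓡 (2 * m)) ∞ (fun x : M => g • x))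
    (h : IsInvariant G σ) (g : G) {x y : M} (hxy : g • x = y) {k : TangentSpace (𝓡 (2 * m)) x}
    (hk : k ∈ formKer σ x) :
    (mfderiv (𝓡 (2 * m)) (𝓡 (2 * m)) (fun x : M => g • x) x k : EuclideanSpace ℝ (Fin (2 * m))) ∈
      (formKer σ y : Set (EuclideanSpace ℝ (Fin (2 * m)))) := by
  subst hxy
  intro v
  let v' : EuclideanSpace ℝ (Fin (2 * m)) :=
    mfderiv (𝓡 (2 * m)) (𝓡 (2 * m)) (fun x : M => g⁻¹ • x) (g • x) v
  have hv : (mfderiv (𝓡 (2 * m)) (𝓡 (2 * m)) (fun x : M => g • x) x v' :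
      EuclideanSpace ℝ (Fin (2 * m))) = v := by
    have h1 := mfderiv_smul_smul hs g g⁻¹ (inv_smul_smul g x) v
    rw [mul_inv_cancel] at h1
    exact h1.trans (mfderiv_one_smul _ v)
  refine Eq.trans ?_ ((DFunLike.congr_fun (congrFun (h g) x) ![k, v']).trans (hk v'))
  refine congrArg (σ (g • x)) (funext fun i => ?_)
  fin_cases i
  · rfl
  · exact hv.symm

variable [ChartedSpace (EuclideanSpace ℝ (Fin (2 * m - 1))) (fold σ)]
  [IsManifold (𝓡 (2 * m - 1)) ∞ (fold σ)]

/-- Smoothness of a continuous map into the fold may be tested after the inclusion, which is an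
immersion. -/
theorem contMDiff_foldAct
    (hs : ∀ g : G, ContMDiff (𝓡 (2 * m)) (𝓡 (2 * m)) ∞ (fun x : M => g • x))
    (hZ : Manifold.IsSmoothEmbedding (𝓡 (2 * m - 1)) (𝓡 (2 * m)) ∞ (Subtype.val : fold σ → M))
    (h : IsInvariant G σ) (g : G) :
    ContMDiff (𝓡 (2 * m - 1)) (𝓡 (2 * m - 1)) ∞ (foldAct h g) := by
  refine (ContMDiff.iff_comp_isImmersion hZ.isImmersion).2 ⟨?_, (hs g).comp hZ.contMDiff⟩
  exact ((hs g).continuous.comp continuous_subtype_val).subtype_mk _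

theorem mfderiv_smul_dIncl
    (hs : ∀ g : G, ContMDiff (𝓡 (2 * m)) (𝓡 (2 * m)) ∞ (fun x : M => g • x))
    (hZ : Manifold.IsSmoothEmbedding (𝓡 (2 * m - 1)) (𝓡 (2 * m)) ∞ (Subtype.val : fold σ → M))
    (h : IsInvariant G σ) (g : G) (z : fold σ) (u : TangentSpace (𝓡 (2 * m - 1)) z) :
    mfderiv (𝓡 (2 * m)) (𝓡 (2 * m)) (fun x : M => g • x) z (dIncl σ z u) =
      dIncl σ (foldAct h g z)
        (mfderiv (𝓡 (2 * m - 1)) (𝓡 (2 * m - 1)) (foldAct h g) z u) := by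
  have h1 := mfderiv_comp z ((hs g).mdifferentiableAt (x := (z : M)) (by simp))
    (hZ.contMDiff.mdifferentiableAt (x := z) (by simp))
  have h2 := mfderiv_comp z (hZ.contMDiff.mdifferentiableAt (x := foldAct h g z) (by simp))
    ((contMDiff_foldAct hs hZ h g).mdifferentiableAt (x := z) (by simp))
  exact (DFunLike.congr_fun h1 u).symm.trans (DFunLike.congr_fun h2 u)

/-- Otherwise the differential of the inverse translation, which preserves tangency to the fold,
would make k tangent. -/
theorem smul_notMem_tangentFold
    (hs : ∀ g : G, ContMDiff (𝓡 (2 * m)) (𝓡 (2 * m)) ∞ (fun x : M => g • x))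
    (hZ : Manifold.IsSmoothEmbedding (𝓡 (2 * m - 1)) (𝓡 (2 * m)) ∞ (Subtype.val : fold σ → M))
    (h : IsInvariant G σ) (g : G) {z z' : fold σ} (hz : foldAct h g z = z')
    {k : TangentSpace (𝓡 (2 * m)) (z : M)} (hk : k ∉ tangentFold σ z) :
    (mfderiv (𝓡 (2 * m)) (𝓡 (2 * m)) (fun x : M => g • x) z k : EuclideanSpace ℝ (Fin (2 * m))) ∉
      ((tangentFold σ z' : Set (TangentSpace (𝓡 (2 * m)) (z' : M))) :
        Set (EuclideanSpace ℝ (Fin (2 * m)))) := by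
  subst hz
  rintro ⟨u, hu⟩
  refine hk ?_
  have hz : foldAct h g⁻¹ (foldAct h g z) = z := Subtype.ext (inv_smul_smul g (z : M))
  have h1 := mfderiv_smul_smul hs g⁻¹ g rfl k
  rw [inv_mul_cancel] at h1
  have h2 := h1.trans (mfderiv_one_smul _ k)
  have h3 : (mfderiv (𝓡 (2 * m)) (𝓡 (2 * m)) (fun x : M => g⁻¹ • x) (g • (z : M))
      (dIncl σ (foldAct h g z) u) : EuclideanSpace ℝ (Fin (2 * m))) = k :=
    (congrArg (mfderiv (𝓡 (2 * m)) (𝓡 (2 * m)) (fun x : M => g⁻¹ • x) (g • (z : M))) hu).trans h2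
  have h4 := mfderiv_smul_dIncl hs hZ h g⁻¹ (foldAct h g z) u
  have h5 : (k : EuclideanSpace ℝ (Fin (2 * m))) ∈
      ((tangentFold σ (foldAct h g⁻¹ (foldAct h g z)) : Set (TangentSpace (𝓡 (2 * m))
        ((foldAct h g⁻¹ (foldAct h g z) : fold σ) : M))) : Set (EuclideanSpace ℝ (Fin (2 * m)))) :=
    ⟨_, h4.symm.trans h3⟩
  rw [hz] at h5
  exact h5

end Actions

end

end FoldedSymplectic

namespace FoldedSymplectic

section

open Set Filter Bundle MeasureTheory

/-! ### A global transverse field from a co-orientation -/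

section Coorientation

variable {m : ℕ} {M : Type*} [TopologicalSpace M] [ChartedSpace (EuclideanSpace ℝ (Fin (2 * m))) M]
  [IsManifold (𝓡 (2 * m)) ∞ M] {σ : DForm (𝓡 (2 * m)) M 2}

theorem isClosed_fold (hσ : IsSmooth σ) : IsClosed (fold σ) := by
  rw [← isOpen_compl_iff, isOpen_iff_mem_nhds]
  intro x hx
  set e := extChartAt (𝓡 (2 * m)) x with he
  obtain ⟨v, hv⟩ : ∃ v : Fin (2 * m) → EuclideanSpace ℝ (Fin (2 * m)),
      wedgePow (inChart x σ (e x)) v ≠ 0 := by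
    by_contra! h
    refine hx fun v => Eq.trans (wedgePow_eq_pfSum _ _) (Eq.trans ?_
      ((wedgePow_eq_pfSum (inChart x σ (e x)) v).symm.trans (h v)))
    refine congrArg (pfSum m) (funext fun i => funext fun j => ?_)
    exact (inChart_self σ x _).symm
  have hc : ContinuousAt (fun y => wedgePow (inChart x σ y) v) (e x) :=
    (contDiffAt_wedgePow (hσ.contDiffAt (mem_extChartAt_target x)) v).continuousAt
  have h1 := (hc.comp (continuousAt_extChartAt (I := 𝓡 (2 * m)) x)).eventually_ne hv
  filter_upwards [h1, (isOpen_extChartAt_source (I := 𝓡 (2 * m)) x).mem_nhds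
    (mem_extChartAt_source x)] with x' hx' hs hf
  refine hx' (wedgePow_inChart_eq_zero ?_ v)
  rwa [(extChartAt (𝓡 (2 * m)) x).left_inv hs]

variable [ChartedSpace (EuclideanSpace ℝ (Fin (2 * m - 1))) (fold σ)]
  [IsManifold (𝓡 (2 * m - 1)) ∞ (fold σ)]

/-- Equal rays in TM/TZ mean that r a - s b is tangent for some r, s > 0, and D kills tangent
vectors. -/
theorem mul_pos_of_ray_eq
    (hZ : Manifold.IsSmoothEmbedding (𝓡 (2 * m - 1)) (𝓡 (2 * m)) ∞ (Subtype.val : fold σ → M))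
    (z : fold σ) {D : TangentSpace (𝓡 (2 * m)) (z : M) →L[ℝ] ℝ} (hD0 : D ≠ 0)
    (hD : ∀ u, D (dIncl σ z u) = 0) {a b : TangentSpace (𝓡 (2 * m)) (z : M)}
    (ha : (tangentFold σ z).mkQ a ≠ 0) (hb : (tangentFold σ z).mkQ b ≠ 0)
    (h : rayOfNeZero ℝ ((tangentFold σ z).mkQ a) ha = rayOfNeZero ℝ ((tangentFold σ z).mkQ b) hb) :
    0 < D a * D b := by
  obtain ⟨r, s, hr, hs, hrs⟩ := ((ray_eq_iff ha hb).1 h).exists_pos ha hb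
  rw [← map_smul, ← map_smul, ← sub_eq_zero, ← map_sub] at hrs
  have h1 : r • a - s • b ∈ tangentFold σ z := (Submodule.Quotient.mk_eq_zero _).1 hrs
  rw [mem_tangentFold_iff hZ z hD0 hD, map_sub, map_smul, map_smul, sub_eq_zero, smul_eq_mul,
    smul_eq_mul] at h1
  have hDa : D a ≠ 0 := fun h0 => ha ((Submodule.Quotient.mk_eq_zero _).2
    ((mem_tangentFold_iff hZ z hD0 hD a).2 h0))
  have h2 : D b = r / s * D a := by field_simp; linarith
  rw [h2]
  have : 0 < D a ^ 2 := sq_pos_of_ne_zero hDa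
  have h3 : D a * (r / s * D a) = r / s * D a ^ 2 := by ring
  rw [h3]
  positivity

/-- Two nonzero functionals with kernel TZ are proportional, so whether two vectors lie on the same
side of the fold does not depend on the functional. -/
theorem mul_pos_of_mul_pos
    (hZ : Manifold.IsSmoothEmbedding (𝓡 (2 * m - 1)) (𝓡 (2 * m)) ∞ (Subtype.val : fold σ → M))
    (z : fold σ) {D D' : TangentSpace (𝓡 (2 * m)) (z : M) →L[ℝ] ℝ} (hD0 : D ≠ 0)
    (hD : ∀ u, D (dIncl σ z u) = 0) (hD0' : D' ≠ 0)
    (hD' : ∀ u, D' (dIncl σ z u) = 0) {a b : TangentSpace (𝓡 (2 * m)) (z : M)}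
    (h : 0 < D a * D b) : 0 < D' a * D' b := by
  have h1 : D b • a - D a • b ∈ tangentFold σ z := by
    rw [mem_tangentFold_iff hZ z hD0 hD, map_sub, map_smul, map_smul, smul_eq_mul, smul_eq_mul]
    ring
  rw [mem_tangentFold_iff hZ z hD0' hD', map_sub, map_smul, map_smul, smul_eq_mul, smul_eq_mul,
    sub_eq_zero] at h1
  have hb : D b ≠ 0 := right_ne_zero_of_mul h.ne'
  have hb' : D' b ≠ 0 := fun h0 => hb ((mem_tangentFold_iff hZ z hD0 hD b).1
    ((mem_tangentFold_iff hZ z hD0' hD' b).2 h0))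
  have h2 : D' a * D' b * D b ^ 2 = D a * D b * D' b ^ 2 := by linear_combination D' b * D b * h1
  have h3 : 0 < D' a * D' b * D b ^ 2 := by rw [h2]; positivity
  exact (mul_pos_iff_of_pos_right (sq_pos_of_ne_zero hb)).1 h3

theorem foldDiff_self_ne_zero (hσ : IsFoldedSymplectic σ)
    (hZ : Manifold.IsSmoothEmbedding (𝓡 (2 * m - 1)) (𝓡 (2 * m)) ∞ (Subtype.val : fold σ → M))
    (z : fold σ) : foldDiff σ z z ≠ 0 := by
  obtain ⟨n, w, -, -, -, -, hw, -⟩ := exists_fold_frame hσ hZ z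
  intro h
  rw [h] at hw
  exact zero_ne_one hw

/-- Lying in ker σ and on the positive side of the fold is a convex condition on tangent vectors
along Z, and no condition is imposed off Z. Local solutions are therefore glued by a partition of
unity. -/
theorem exists_transverse_field [T2Space M] [SecondCountableTopology M]
    (hσ : IsFoldedSymplectic σ)
    (hZ : Manifold.IsSmoothEmbedding (𝓡 (2 * m - 1)) (𝓡 (2 * m)) ∞ (Subtype.val : fold σ → M))
    (hco : IsCoorientable σ) : ∃ W : ∀ x : M, TangentSpace (𝓡 (2 * m)) x,
      ContMDiff (𝓡 (2 * m)) (𝓡 (2 * m)).tangent ∞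
        (fun x => (⟨x, W x⟩ : TangentBundle (𝓡 (2 * m)) M)) ∧
      ∀ z : fold σ, W z ∈ formKer σ (z : M) ∧ W z ∉ tangentFold σ z := by
  have : LocallyCompactSpace M := ChartedSpace.locallyCompactSpace (EuclideanSpace ℝ (Fin (2 * m))) M
  have : IsManifold (𝓡 (2 * m)) 1 M := .of_le (n := ∞) (by simp)
  obtain ⟨o, ho⟩ := hco
  choose Ow hOw w hws hwo using ho
  -- A representative of the orientation of the normal line at each point. It need not be
  -- continuous; only the side of the fold to which it points is used.
  let rep : ∀ z : fold σ, TangentSpace (𝓡 (2 * m)) (z : M) := fun z => w z z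
  have hrep : ∀ z₀ z : fold σ, z ∈ Ow z₀ → ∀ D : TangentSpace (𝓡 (2 * m)) (z : M) →L[ℝ] ℝ, D ≠ 0 →
      (∀ u, D (dIncl σ z u) = 0) → 0 < D (w z₀ z) * D (rep z) := fun z₀ z hz D hD0 hD => by
    obtain ⟨h1, h2⟩ := hwo z₀ z hz
    obtain ⟨h3, h4⟩ := hwo z z (mem_of_mem_nhds (hOw z))
    exact mul_pos_of_ray_eq hZ z hD0 hD h1 h3 (h2.symm.trans h4)
  let t : ∀ x : M, Set (TangentSpace (𝓡 (2 * m)) x) := fun x => {v | ∀ h : x ∈ fold σ,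
    v ∈ formKer σ x ∧ 0 < foldDiff σ x x v * foldDiff σ x x (rep ⟨x, h⟩)}
  have hconv : ∀ x, Convex ℝ (t x) := by
    intro x a ha b hb r t hr ht hrt h
    obtain ⟨a1, a2⟩ := ha h
    obtain ⟨b1, b2⟩ := hb h
    refine ⟨fun v => ?_, ?_⟩
    · have e1 := a1 v
      have e2 := b1 v
      have h1 : (toBilin (EuclideanSpace ℝ (Fin (2 * m))) (σ x)) (r • a + t • b) v = r * σ x ![a, v] +
          t * σ x ![b, v] := by
        refine Eq.trans (congrArg (fun L : EuclideanSpace ℝ (Fin (2 * m)) →L[ℝ] ℝ => L v)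
          (((toBilin (EuclideanSpace ℝ (Fin (2 * m))) (σ x)).map_add _ _).trans
            (congrArg₂ (· + ·) (map_smul _ _ _) (map_smul _ _ _)))) ?_
        exact congrArg₂ (· + ·) (congrArg (r * ·) (toBilin_apply _ _ _))
          (congrArg (t * ·) (toBilin_apply _ _ _))
      refine (toBilin_apply (Q := EuclideanSpace ℝ (Fin (2 * m))) (σ x) _ _).symm.trans (h1.trans ?_)
      rw [e1, e2, mul_zero, mul_zero, add_zero]
    · rw [map_add, map_smul, map_smul, smul_eq_mul, smul_eq_mul]
      have h1 : (r * foldDiff σ x x a + t * foldDiff σ x x b) * foldDiff σ x x (rep ⟨x, h⟩) =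
        r * (foldDiff σ x x a * foldDiff σ x x (rep ⟨x, h⟩)) +
        t * (foldDiff σ x x b * foldDiff σ x x (rep ⟨x, h⟩)) := by ring
      rw [h1]
      rcases hr.eq_or_lt with rfl | hr
      · rw [zero_add] at hrt
        rw [hrt]; linarith
      · have := mul_pos hr a2
        have := mul_nonneg ht b2.le
        linarith
  have hloc : ∀ x₀ : M, ∃ U ∈ 𝓝 x₀, ∃ s : ∀ x : M, TangentSpace (𝓡 (2 * m)) x,
      ContMDiffOn (𝓡 (2 * m)) (𝓡 (2 * m)).tangent ∞
        (fun x => (⟨x, s x⟩ : TangentBundle (𝓡 (2 * m)) M)) U ∧ ∀ y ∈ U, s y ∈ t y := by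
    intro x
    by_cases hx : x ∈ fold σ
    · obtain ⟨O, W, hO, hxO, hOs, hW, hWk⟩ := exists_local_transverse_field hσ hZ ⟨x, hx⟩
      set z₀ : fold σ := ⟨x, hx⟩ with hz₀
      -- The local field has D-value 1, so multiplying it by the constant c puts it on the chosen
      -- side, first at z₀ and then nearby by continuity of the local section representing the
      -- orientation.
      set c : ℝ := foldDiff σ x x (rep z₀) with hc
      have hD0 : ∀ z : fold σ, (z : M) ∈ O → foldDiff σ x z ≠ 0 := fun z hz h => by
        have := (hWk z hz).2
        rw [h] at this
        exact zero_ne_one this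
      have hDd : ∀ z : fold σ, (z : M) ∈ O → ∀ u, foldDiff σ x z (dIncl σ z u) = 0 := fun z hz =>
        foldDiff_dIncl hσ.smooth hZ (hOs hz)
      have hc0 : c ≠ 0 := fun h0 => by
        have := hrep z₀ z₀ (mem_of_mem_nhds (hOw z₀)) _ (hD0 z₀ hxO) (hDd z₀ hxO)
        have h1 : foldDiff σ x z₀ (rep z₀) = 0 := h0
        rw [h1, mul_zero] at this
        exact lt_irrefl _ this
      have hcont : ContinuousAt (fun z : fold σ => foldDiff σ x z (w z₀ z)) z₀ := by
        have h1 := ((contMDiffAt_lift_iff (J := 𝓡 (2 * m - 1)) (f := (Subtype.val : fold σ → M))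
          (w := w z₀) (n₀ := z₀) (x₀ := x) (mem_extChartAt_source x)).1
          ((hws z₀).contMDiffAt (hOw z₀))).2.continuousAt
        have h2 : ContinuousAt (fun z : fold σ => fderiv ℝ (topCoeff σ x)
            (extChartAt (𝓡 (2 * m)) x (z : M))) z₀ := by
          have h3 : ContinuousAt (fderiv ℝ (topCoeff σ x)) (extChartAt (𝓡 (2 * m)) x x) :=
            ((contDiffAt_topCoeff hσ.smooth (mem_extChartAt_target x)).fderiv_right
              (m := ∞) (by simp)).continuousAt
          have h4 : ContinuousAt (fun z : fold σ => extChartAt (𝓡 (2 * m)) x (z : M)) z₀ :=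
            (continuousAt_extChartAt (I := 𝓡 (2 * m)) x).comp
              (f := (Subtype.val : fold σ → M)) (x := z₀) continuous_subtype_val.continuousAt
          exact h3.comp (f := fun z : fold σ => extChartAt (𝓡 (2 * m)) x (z : M)) (x := z₀) h4
        exact h2.clm_apply h1
      have hev : ∀ᶠ z : fold σ in 𝓝 z₀, 0 < c * foldDiff σ x z (w z₀ z) := by
        have h1 : 0 < c * foldDiff σ x z₀ (w z₀ z₀) := mul_self_pos.2 hc0
        exact (continuousAt_const.mul hcont).eventually (lt_mem_nhds h1)
      obtain ⟨u, hu, huO⟩ := mem_nhds_subtype _ _ _ |>.1 (inter_mem hev (hOw z₀))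
      refine ⟨O ∩ u, inter_mem (hO.mem_nhds hxO) hu, fun y => c • W y, ?_, ?_⟩
      · intro y hy
        refine ContMDiffAt.contMDiffWithinAt ?_
        have h1 := (contMDiffAt_field_iff (hOs hy.1)).1 (hW.contMDiffAt (hO.mem_nhds hy.1))
        refine (contMDiffAt_field_iff (x₀ := x) (hOs hy.1)).2 ?_
        refine (h1.const_smul c).congr_of_eventuallyEq (Eventually.of_forall fun q => ?_)
        exact map_smul _ _ _
      · intro y hy h
        have h1 := hWk ⟨y, h⟩ hy.1
        refine ⟨fun v => ?_, ?_⟩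
        · have h2 : (toBilin (EuclideanSpace ℝ (Fin (2 * m))) (σ y)) (c • W y) v =
              c * σ y ![W y, v] :=
            Eq.trans (congrArg (fun L : EuclideanSpace ℝ (Fin (2 * m)) →L[ℝ] ℝ => L v)
              (map_smul _ _ _)) (congrArg (c * ·) (toBilin_apply _ _ _))
          refine (toBilin_apply (Q := EuclideanSpace ℝ (Fin (2 * m))) (σ y) _ _).symm.trans
            (h2.trans ?_)
          rw [h1.1 v, mul_zero]
        · have hy' : (⟨y, h⟩ : fold σ) ∈ _ ∩ Ow z₀ := huO (show (⟨y, h⟩ : fold σ) ∈ Subtype.val ⁻¹' u from hy.2)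
          have h2 := hrep z₀ ⟨y, h⟩ hy'.2 _ (hD0 ⟨y, h⟩ hy.1) (hDd ⟨y, h⟩ hy.1)
          have h3 : 0 < c * foldDiff σ x y (w z₀ ⟨y, h⟩) := hy'.1
          refine mul_pos_of_mul_pos hZ ⟨y, h⟩ (hD0 ⟨y, h⟩ hy.1) (hDd ⟨y, h⟩ hy.1)
            (foldDiff_self_ne_zero hσ hZ ⟨y, h⟩)
            (foldDiff_dIncl hσ.smooth hZ (mem_extChartAt_source y)) ?_
          have h4 : foldDiff σ x y (c • W y) = c := by
            rw [map_smul]; exact (congrArg (c * ·) h1.2).trans (mul_one c)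
          refine lt_of_lt_of_eq ?_ (congrArg (· * foldDiff σ x y (rep ⟨y, h⟩)) h4.symm)
          have h5 := mul_pos h3 h2
          have h6 : foldDiff σ x y (w z₀ ⟨y, h⟩) ≠ 0 := right_ne_zero_of_mul h3.ne'
          have h7 : c * foldDiff σ x y (w z₀ ⟨y, h⟩) * (foldDiff σ x y (w z₀ ⟨y, h⟩) *
            foldDiff σ x y (rep ⟨y, h⟩)) = c * foldDiff σ x y (rep ⟨y, h⟩) *
              foldDiff σ x y (w z₀ ⟨y, h⟩) ^ 2 := by ring
          exact (mul_pos_iff_of_pos_right (sq_pos_of_ne_zero h6)).1 (h7 ▸ h5)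
    · refine ⟨(fold σ)ᶜ, (isClosed_fold hσ.smooth).isOpen_compl.mem_nhds hx, fun _ => 0,
        (contMDiff_zeroSection ℝ (TangentSpace (𝓡 (2 * m)) : M → Type)).contMDiffOn, fun y hy h => absurd h hy⟩
  obtain ⟨s, hs⟩ := exists_contMDiffSection_forall_mem_convex_of_local (n := ⊤) (𝓡 (2 * m))
    (F_fiber := EuclideanSpace ℝ (Fin (2 * m))) (TangentSpace (𝓡 (2 * m)) : M → Type) t hconv hloc
  refine ⟨s, s.contMDiff, fun z => ⟨(hs z z.2).1, fun hz => ?_⟩⟩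
  have h1 := (hs z z.2).2
  rw [(mem_tangentFold_iff_foldDiff hσ hZ z _).1 hz, zero_mul] at h1
  exact lt_irrefl _ h1

end Coorientation

end

end FoldedSymplectic

namespace FoldedSymplectic

section

open Set Filter Bundle MeasureTheory

/-! ### Averaging the transverse field over the group -/

section Averaging

variable {m : ℕ} {M : Type*} [TopologicalSpace M] [ChartedSpace (EuclideanSpace ℝ (Fin (2 * m))) M]
  [IsManifold (𝓡 (2 * m)) ∞ M] {σ : DForm (𝓡 (2 * m)) M 2}

/-- The translate `x ↦ dτ_g W(g⁻¹ x)` of a vector field. -/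
def translateField {G : Type*} [Group G] [MulAction G M] (W : ∀ x : M, TangentSpace (𝓡 (2 * m)) x)
    (g : G) (x : M) : EuclideanSpace ℝ (Fin (2 * m)) :=
  mfderiv (𝓡 (2 * m)) (𝓡 (2 * m)) (fun x : M => g • x) (g⁻¹ • x) (W (g⁻¹ • x))

/-- The translate is the tangent map of the action G × M → M applied to (0, W) at (g, g⁻¹x), which
gives joint smoothness in (g, x). -/
theorem contMDiff_translateField {n : ℕ} {G : Type*} [TopologicalSpace G]
    [ChartedSpace (EuclideanSpace ℝ (Fin n)) G] [Group G] [LieGroup (𝓡 n) ∞ G]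
    [MulAction G M] [ContMDiffSMul (𝓡 n) (𝓡 (2 * m)) ∞ G M]
    {W : ∀ x : M, TangentSpace (𝓡 (2 * m)) x}
    (hW : ContMDiff (𝓡 (2 * m)) (𝓡 (2 * m)).tangent ∞
        (fun x => (⟨x, W x⟩ : TangentBundle (𝓡 (2 * m)) M))) :
    ContMDiff ((𝓡 n).prod (𝓡 (2 * m))) (𝓡 (2 * m)).tangent ∞
      (fun p : G × M => (⟨p.2, translateField W p.1 p.2⟩ : TangentBundle (𝓡 (2 * m)) M)) := by
  have : IsManifold (𝓡 n) 1 G := .of_le (n := ∞) (by simp)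
  have : IsManifold (𝓡 (2 * m)) 1 M := .of_le (n := ∞) (by simp)
  have hact : ContMDiff ((𝓡 n).prod (𝓡 (2 * m))) (𝓡 (2 * m)) ∞ (fun p : G × M => p.1 • p.2) :=
    contMDiff_smul
  have h1 : ContMDiff ((𝓡 n).prod (𝓡 (2 * m))) (𝓡 n).tangent ∞
      (fun p : G × M => (⟨p.1, 0⟩ : TangentBundle (𝓡 n) G)) :=
    (contMDiff_zeroSection ℝ (TangentSpace (𝓡 n) : G → Type)).comp contMDiff_fst
  have h2 : ContMDiff ((𝓡 n).prod (𝓡 (2 * m))) (𝓡 (2 * m)) ∞ (fun p : G × M => p.1⁻¹ • p.2) :=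
    hact.comp (((contMDiff_inv (𝓡 n) ∞).comp contMDiff_fst).prodMk contMDiff_snd)
  have h3 := hW.comp h2
  have h4 : ContMDiff _ _ ∞ (equivTangentBundleProd (𝓡 n) G (𝓡 (2 * m)) M).symm :=
    contMDiff_equivTangentBundleProd_symm
  have h5 : ContMDiff ((𝓡 n).prod (𝓡 (2 * m))).tangent (𝓡 (2 * m)).tangent ∞
      (tangentMap ((𝓡 n).prod (𝓡 (2 * m))) (𝓡 (2 * m)) (fun p : G × M => p.1 • p.2)) :=
    hact.contMDiff_tangentMap le_rfl
  refine ((h5.comp h4).comp (h1.prodMk h3)).congr fun p => ?_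
  have key : ∀ (a b : M) (hab : a = b) (u v : EuclideanSpace ℝ (Fin (2 * m))) (_ : u = v),
      (⟨a, u⟩ : TangentBundle (𝓡 (2 * m)) M) = ⟨b, v⟩ := by
    rintro a _ rfl u _ rfl; rfl
  refine key _ _ (smul_inv_smul p.1 p.2).symm _ _ ?_
  have h6 := mfderiv_prod_eq_add_apply (I := 𝓡 n) (I' := 𝓡 (2 * m)) (I'' := 𝓡 (2 * m))
    (p := (p.1, p.1⁻¹ • p.2))
    (v := ((0 : EuclideanSpace ℝ (Fin n)), (W (p.1⁻¹ • p.2) : EuclideanSpace ℝ (Fin (2 * m)))))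
    (hact.mdifferentiableAt (x := (p.1, p.1⁻¹ • p.2)) (by simp))
  refine Eq.trans ?_ h6.symm
  exact ((congrArg (· + translateField W p.1 p.2) (map_zero _)).trans (zero_add _)).symm

/-- Average the translates against Haar measure. Membership in ker σ is a linear condition and
survives averaging; transversality survives because all translates at a given z lie on the same side
of the fold. -/
theorem exists_invariant_transverse_field [T2Space M] [SecondCountableTopology M]
    {n : ℕ} {G : Type*} [TopologicalSpace G] [T2Space G]
    [ChartedSpace (EuclideanSpace ℝ (Fin n)) G] [Group G] [LieGroup (𝓡 n) ∞ G]
    [CompactSpace G] [ConnectedSpace G]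
    [MulAction G M] [ContMDiffSMul (𝓡 n) (𝓡 (2 * m)) ∞ G M]
    [ChartedSpace (EuclideanSpace ℝ (Fin (2 * m - 1))) (fold σ)]
    [IsManifold (𝓡 (2 * m - 1)) ∞ (fold σ)]
    (hs : ∀ g : G, ContMDiff (𝓡 (2 * m)) (𝓡 (2 * m)) ∞ (fun x : M => g • x))
    (hinv : IsInvariant G σ)
    (hσ : IsFoldedSymplectic σ)
    (hZ : Manifold.IsSmoothEmbedding (𝓡 (2 * m - 1)) (𝓡 (2 * m)) ∞ (Subtype.val : fold σ → M))
    (hco : IsCoorientable σ) : ∃ W : ∀ x : M, TangentSpace (𝓡 (2 * m)) x,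
      ContMDiff (𝓡 (2 * m)) (𝓡 (2 * m)).tangent ∞
        (fun x => (⟨x, W x⟩ : TangentBundle (𝓡 (2 * m)) M)) ∧
      (∀ z : fold σ, W z ∈ formKer σ (z : M) ∧ W z ∉ tangentFold σ z) ∧
      ∀ (g : G) (x : M), (mfderiv (𝓡 (2 * m)) (𝓡 (2 * m)) (fun x : M => g • x) x (W x) :
        EuclideanSpace ℝ (Fin (2 * m))) = W (g • x) := by
  obtain ⟨W, hW, hWk⟩ := exists_transverse_field hσ hZ hco
  have : IsTopologicalGroup G := topologicalGroup_of_lieGroup (𝓡 n) ∞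
  have : LocallyCompactSpace G := ChartedSpace.locallyCompactSpace (EuclideanSpace ℝ (Fin n)) G
  have : IsManifold (𝓡 (2 * m)) 1 M := .of_le (n := ∞) (by simp)
  let _ : MeasurableSpace G := borel G
  have : BorelSpace G := ⟨rfl⟩
  let ν : Measure G := Measure.haar
  have hF := contMDiff_translateField (n := n) (G := G) hW
  set F := translateField (G := G) W with hFdef
  have hFc : ∀ x₀ : M, ∀ p : G × M, p.2 ∈ (extChartAt (𝓡 (2 * m)) x₀).source →
      ContMDiffAt ((𝓡 n).prod (𝓡 (2 * m))) 𝓘(ℝ, EuclideanSpace ℝ (Fin (2 * m))) ∞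
      (fun p : G × M => (mfderiv (𝓡 (2 * m)) 𝓘(ℝ, EuclideanSpace ℝ (Fin (2 * m)))
        (extChartAt (𝓡 (2 * m)) x₀) p.2 (F p.1 p.2) : EuclideanSpace ℝ (Fin (2 * m)))) p :=
    fun x₀ p hp => ((contMDiffAt_lift_iff (f := fun p : G × M => p.2) hp).1 hF.contMDiffAt).2
  have hcont : ∀ x, Continuous fun g => F g x := fun x => by
    refine continuous_iff_continuousAt.2 fun g => ?_
    have h1 := (hFc x (g, x) (mem_extChartAt_source x)).continuousAt
    have h2 : ContinuousAt (fun g : G => (g, x)) g := by fun_prop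
    have h3 := h1.comp (f := fun g : G => (g, x)) h2
    refine h3.congr (Eventually.of_forall fun g' => ?_)
    exact DFunLike.congr_fun (mfderiv_extChartAt_self (I := 𝓡 (2 * m)) (x := x)) (F g' x)
  have hint : ∀ x, Integrable (fun g => F g x) ν := fun x =>
    (hcont x).integrable_of_hasCompactSupport (HasCompactSupport.of_compactSpace _)
  have hlin : ∀ (x : M) {Y : Type} [NormedAddCommGroup Y] [NormedSpace ℝ Y] [FiniteDimensional ℝ Y]
      (L : EuclideanSpace ℝ (Fin (2 * m)) →L[ℝ] Y), L (∫ g, F g x ∂ν) = ∫ g, L (F g x) ∂ν :=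
    fun x Y _ _ _ L => (L.integral_comp_comm (hint x)).symm
  refine ⟨fun x => (∫ g, F g x ∂ν : EuclideanSpace ℝ (Fin (2 * m))), fun x₀ => ?_, fun z => ⟨fun v => ?_, ?_⟩, fun h x => ?_⟩
  · refine (contMDiffAt_field_iff (x₀ := x₀) (mem_extChartAt_source x₀)).2 ?_
    set e := extChartAt (𝓡 (2 * m)) x₀ with he
    have h1 : ContMDiffOn ((𝓡 n).prod 𝓘(ℝ, EuclideanSpace ℝ (Fin (2 * m))))
        𝓘(ℝ, EuclideanSpace ℝ (Fin (2 * m))) ∞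
        (fun p : G × EuclideanSpace ℝ (Fin (2 * m)) =>
          (mfderiv (𝓡 (2 * m)) 𝓘(ℝ, EuclideanSpace ℝ (Fin (2 * m))) e (e.symm p.2)
            (F p.1 (e.symm p.2)) : EuclideanSpace ℝ (Fin (2 * m)))) (univ ×ˢ e.target) := by
      rintro ⟨g, y⟩ ⟨-, hy⟩
      have h2 := hFc x₀ (g, e.symm y) (e.map_target hy)
      have h3 : ContMDiffAt 𝓘(ℝ, EuclideanSpace ℝ (Fin (2 * m))) (𝓡 (2 * m)) ∞ e.symm y :=
        (contMDiffOn_extChartAt_symm (I := 𝓡 (2 * m)) (n := ∞) x₀ y hy).contMDiffAt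
          ((isOpen_extChartAt_target x₀).mem_nhds hy)
      have h4 : ContMDiffAt ((𝓡 n).prod 𝓘(ℝ, EuclideanSpace ℝ (Fin (2 * m))))
          ((𝓡 n).prod (𝓡 (2 * m))) ∞
          (fun p : G × EuclideanSpace ℝ (Fin (2 * m)) => (p.1, e.symm p.2)) (g, y) :=
        contMDiffAt_fst.prodMk (h3.comp (f := Prod.snd) (g, y) contMDiffAt_snd)
      exact (h2.comp (g, y) h4).contMDiffWithinAt
    have h2 := (contDiffOn_integral_of_contMDiffOn ν (isOpen_extChartAt_target x₀) h1).contDiffAt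
      ((isOpen_extChartAt_target (I := 𝓡 (2 * m)) x₀).mem_nhds (mem_extChartAt_target x₀))
    refine h2.congr_of_eventuallyEq (Eventually.of_forall fun y => ?_)
    let L : EuclideanSpace ℝ (Fin (2 * m)) →L[ℝ] EuclideanSpace ℝ (Fin (2 * m)) :=
      mfderiv (𝓡 (2 * m)) 𝓘(ℝ, EuclideanSpace ℝ (Fin (2 * m))) e (e.symm y)
    exact hlin (e.symm y) L
  · have h1 := hlin (z : M) ((toBilin (EuclideanSpace ℝ (Fin (2 * m))) (σ z)).flip v)
    have h2 : ∀ w : EuclideanSpace ℝ (Fin (2 * m)),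
        (toBilin (EuclideanSpace ℝ (Fin (2 * m))) (σ z)).flip v w = σ z ![w, v] := fun w =>
      toBilin_apply (Q := EuclideanSpace ℝ (Fin (2 * m))) (σ z) w v
    refine (h2 _).symm.trans (h1.trans ?_)
    refine (integral_congr_ae (Eventually.of_forall fun g => ?_)).trans (integral_zero _ _)
    refine (h2 _).trans ?_
    exact smul_mem_formKer hs hinv g (smul_inv_smul g (z : M))
      (hWk (foldAct hinv g⁻¹ z)).1 v
  · let D : EuclideanSpace ℝ (Fin (2 * m)) →L[ℝ] ℝ := foldDiff σ z z
    have hne : ∀ g, D (F g z) ≠ 0 := fun g h => by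
      refine smul_notMem_tangentFold hs hZ hinv g (z := foldAct hinv g⁻¹ z) (z' := z)
        (Subtype.ext (smul_inv_smul g (z : M))) (hWk (foldAct hinv g⁻¹ z)).2 ?_
      exact (mem_tangentFold_iff_foldDiff hσ hZ z (F g z)).2 h
    have hfc : Continuous fun g => D (F g z) * D (F 1 z) :=
      (D.continuous.comp (hcont z)).mul continuous_const
    -- A sign change in g would produce a zero by connectedness of G, but every translate is
    -- transverse.
    have hpos : ∀ g, 0 < D (F g z) * D (F 1 z) := fun g => by
      by_contra! hg
      obtain ⟨g', hg'⟩ := mem_range_of_exists_le_of_exists_ge hfc ⟨g, hg⟩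
        ⟨1, (mul_self_pos.2 (hne 1)).le⟩
      exact mul_ne_zero (hne g') (hne 1) hg'
    have hi : 0 < ∫ g, D (F g z) * D (F 1 z) ∂ν := by
      rw [integral_pos_iff_support_of_nonneg (fun g => (hpos g).le)
        (hfc.integrable_of_hasCompactSupport (HasCompactSupport.of_compactSpace _))]
      have : Function.support (fun g => D (F g z) * D (F 1 z)) = univ :=
        eq_univ_of_forall fun g => (hpos g).ne'
      rw [this]
      exact isOpen_univ.measure_pos ν univ_nonempty
    rw [integral_mul_const, ← hlin] at hi
    intro h
    have h1 : D (∫ g, F g z ∂ν) = 0 := (mem_tangentFold_iff_foldDiff hσ hZ z _).1 h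
    rw [h1, zero_mul] at hi
    exact lt_irrefl _ hi
  · let L : EuclideanSpace ℝ (Fin (2 * m)) →L[ℝ] EuclideanSpace ℝ (Fin (2 * m)) :=
      mfderiv (𝓡 (2 * m)) (𝓡 (2 * m)) (fun x : M => h • x) x
    refine (hlin x L).trans ?_
    -- The differential of translation by h turns the translate by g into the translate by h g, and
    -- Haar measure is left invariant.
    refine Eq.trans ?_ (integral_mul_left_eq_self (μ := ν) (fun g => F g (h • x)) h)
    refine integral_congr_ae (Eventually.of_forall fun g => ?_)
    refine (mfderiv_smul_smul hs h g (smul_inv_smul g x) (W (g⁻¹ • x))).trans ?_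
    have h1 : g⁻¹ • x = (h * g)⁻¹ • h • x := by rw [mul_inv_rev, mul_smul, inv_smul_smul]
    have h2 : ∀ a b : M, a = b →
        (mfderiv (𝓡 (2 * m)) (𝓡 (2 * m)) (fun x : M => (h * g) • x) a (W a) :
          EuclideanSpace ℝ (Fin (2 * m))) =
        mfderiv (𝓡 (2 * m)) (𝓡 (2 * m)) (fun x : M => (h * g) • x) b (W b) := by
      rintro a _ rfl; rfl
    exact h2 _ _ h1

end Averaging

end

end FoldedSymplectic

namespace FoldedSymplectic

section

open Set Filter Bundle

/-! ### Trajectories of time-dependent fields and their uniqueness -/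

section Trajectories

variable {E : Type*} [NormedAddCommGroup E] [NormedSpace ℝ E] {H : Type*} [TopologicalSpace H]
  {E' : Type*} [NormedAddCommGroup E'] [NormedSpace ℝ E'] {H' : Type*} [TopologicalSpace H']
  {I : ModelWithCorners ℝ E H} {I' : ModelWithCorners ℝ E' H'}
  {N : Type*} [TopologicalSpace N] [ChartedSpace H N]
  {N' : Type*} [TopologicalSpace N'] [ChartedSpace H' N']

/-- `c : [0, 1] → N` is a trajectory of the time-dependent vector field `X`. -/
def IsTraj (I : ModelWithCorners ℝ E H) {N : Type*} [TopologicalSpace N] [ChartedSpace H N]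
    (X : ℝ → ∀ x : N, TangentSpace I x) (c : ℝ → N) : Prop :=
  ∀ s ∈ Icc (0 : ℝ) 1, HasMFDerivWithinAt 𝓘(ℝ, ℝ) I c (Icc 0 1) s
    (ContinuousLinearMap.toSpanSingleton ℝ (X s (c s)))

open Classical in
/-- The end point of a trajectory of `X` on `[0, 1]` starting at `x`, if there is one. -/
def flowMap (I : ModelWithCorners ℝ E H) {N : Type*} [TopologicalSpace N] [ChartedSpace H N]
    (X : ℝ → ∀ x : N, TangentSpace I x) (x : N) : N :=
  if h : ∃ c : ℝ → N, c 0 = x ∧ IsTraj I X c then h.choose 1 else x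

/-- The expression of `X` in the chart around `x₀`. -/
def chartField (I : ModelWithCorners ℝ E H) {N : Type*} [TopologicalSpace N] [ChartedSpace H N]
    (X : ℝ → ∀ x : N, TangentSpace I x) (x₀ : N) (p : ℝ × E) : E :=
  mfderiv I 𝓘(ℝ, E) (extChartAt I x₀) ((extChartAt I x₀).symm p.2)
    (X p.1 ((extChartAt I x₀).symm p.2))

/-- Maps relating two fields along a trajectory carry it to a trajectory; used for the group action.
-/
theorem IsTraj.comp {X : ℝ → ∀ x : N, TangentSpace I x} {X' : ℝ → ∀ x : N', TangentSpace I' x}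
    {c : ℝ → N} (hc : IsTraj I X c) {f : N → N'}
    (hf : ∀ s ∈ Icc (0 : ℝ) 1, MDifferentiableAt I I' f (c s))
    (hX : ∀ s ∈ Icc (0 : ℝ) 1, mfderiv I I' f (c s) (X s (c s)) = X' s (f (c s))) :
    IsTraj I' X' (f ∘ c) := by
  intro s hs
  refine ((hf s hs).hasMFDerivAt.comp_hasMFDerivWithinAt s (hc s hs)).congr_mfderiv ?_
  refine ContinuousLinearMap.ext fun r => ?_
  let r' : ℝ := r
  refine (map_smul (mfderiv I I' f (c s)) r' (X s (c s))).trans ?_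
  exact congrArg (r' • ·) (hX s hs)

theorem IsTraj.continuousOn {X : ℝ → ∀ x : N, TangentSpace I x} {c : ℝ → N} (hc : IsTraj I X c) :
    ContinuousOn c (Icc 0 1) := fun s hs => (hc s hs).continuousWithinAt

theorem isTraj_const {X : ℝ → ∀ x : N, TangentSpace I x} {x : N} (h : ∀ s, X s x = 0) :
    IsTraj I X (fun _ => x) := by
  intro s _
  refine (hasMFDerivWithinAt_const x _ s).congr_mfderiv ?_
  rw [h]
  exact (ContinuousLinearMap.ext fun r => smul_zero (M := ℝ) r).symm

variable [IsManifold I ∞ N] [I.Boundaryless]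

theorem IsTraj.hasDerivWithinAt {X : ℝ → ∀ x : N, TangentSpace I x} {c : ℝ → N}
    (hc : IsTraj I X c) {x₀ : N} {s : ℝ} (hs : s ∈ Icc (0 : ℝ) 1)
    (h : c s ∈ (extChartAt I x₀).source) :
    HasDerivWithinAt (fun s => extChartAt I x₀ (c s)) (chartField I X x₀ (s, extChartAt I x₀ (c s)))
      (Icc 0 1) s := by
  have h1 := (mdifferentiableAt_extChartAt_of_mem h).hasMFDerivAt.comp_hasMFDerivWithinAt s (hc s hs)
  have h4 : (mfderiv I 𝓘(ℝ, E) (extChartAt I x₀) (c s) (X s (c s)) : E) =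
      chartField I X x₀ (s, extChartAt I x₀ (c s)) :=
    mfderiv_section_congr ((extChartAt I x₀).left_inv h).symm
  have h2 : HasMFDerivWithinAt 𝓘(ℝ, ℝ) 𝓘(ℝ, E) (fun s => extChartAt I x₀ (c s)) (Icc 0 1) s
      (ContinuousLinearMap.toSpanSingleton ℝ (chartField I X x₀ (s, extChartAt I x₀ (c s))) :
        ℝ →L[ℝ] E) := by
    refine h1.congr_mfderiv (ContinuousLinearMap.ext fun r => ?_)
    let r' : ℝ := r
    refine (map_smul (mfderiv I 𝓘(ℝ, E) (extChartAt I x₀) (c s)) r' (X s (c s))).trans ?_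
    exact congrArg (r' • ·) h4
  exact (hasMFDerivWithinAt_iff_hasFDerivWithinAt.1 h2 : HasFDerivWithinAt (E := ℝ) (F := E) _ _ _ _)

/-- A solution in a chart is a trajectory. -/
theorem isTraj_of_hasDerivWithinAt {X : ℝ → ∀ x : N, TangentSpace I x} {x₀ : N} {c : ℝ → E}
    (hc : ∀ s ∈ Icc (0 : ℝ) 1, c s ∈ (extChartAt I x₀).target ∧
      HasDerivWithinAt c (chartField I X x₀ (s, c s)) (Icc 0 1) s) :
    IsTraj I X (fun s => (extChartAt I x₀).symm (c s)) := by
  intro s hs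
  have h1 : HasMFDerivWithinAt 𝓘(ℝ, ℝ) 𝓘(ℝ, E) c (Icc 0 1) s _ :=
    (hc s hs).2.hasFDerivWithinAt.hasMFDerivWithinAt
  have h2 := (mdifferentiableAt_extChartAt_symm (hc s hs).1).hasMFDerivAt.comp_hasMFDerivWithinAt s h1
  refine h2.congr_mfderiv ?_
  refine ContinuousLinearMap.ext fun r => ?_
  let r' : ℝ := r
  refine (map_smul (mfderiv 𝓘(ℝ, E) I (extChartAt I x₀).symm (c s)) r'
    (chartField I X x₀ (s, c s))).trans ?_
  exact congrArg (r' • ·) (mfderiv_symm_extChartAt_symm_apply (hc s hs).1 _)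

variable [T2Space N]

/-- Uniqueness of trajectories. -/
theorem IsTraj.eqOn {X : ℝ → ∀ x : N, TangentSpace I x} {c c' : ℝ → N} (hc : IsTraj I X c)
    (hc' : IsTraj I X c') (h0 : c 0 = c' 0)
    (hX : ∀ s ∈ Icc (0 : ℝ) 1, ∃ x₀ : N, c s ∈ (extChartAt I x₀).source ∧
      ContDiffAt ℝ 1 (chartField I X x₀) (s, extChartAt I x₀ (c s))) :
    EqOn c c' (Icc 0 1) := by
  have hcl : IsClosed ({s | c s = c' s} ∩ Icc (0 : ℝ) 1) := by
    have h1 : {s | c s = c' s} ∩ Icc (0 : ℝ) 1 =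
        Icc (0 : ℝ) 1 ∩ (fun s => (c s, c' s)) ⁻¹' diagonal N := by
      ext s; simp [and_comm]
    rw [h1]
    exact (hc.continuousOn.prodMk hc'.continuousOn).preimage_isClosed_of_isClosed isClosed_Icc
      isClosed_diagonal
  -- Continuous induction: the set of coincidence is closed, and the local uniqueness theorem in a
  -- chart extends it to the right.
  refine hcl.Icc_subset_of_forall_exists_gt h0 ?_
  rintro x ⟨hx, hx01⟩ y hy
  have hxI : x ∈ Icc (0 : ℝ) 1 := Ico_subset_Icc_self hx01
  obtain ⟨x₀, hxs, hXx⟩ := hX x hxI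
  obtain ⟨K, T, hT, hK⟩ := hXx.exists_lipschitzOnWith
  set e := extChartAt I x₀ with he
  have hgood : ∀ {c : ℝ → N}, IsTraj I X c → c x ∈ e.source → (x, e (c x)) ∈ interior T →
      ∀ᶠ s in 𝓝[≥] x, c s ∈ e.source ∧ (s, e (c s)) ∈ T := by
    intro c hc hs hT
    have h1 : ContinuousWithinAt c (Ici x) x :=
      (hc.continuousOn x hxI).mono_of_mem_nhdsWithin (Icc_mem_nhdsGE_of_mem hx01)
    have h2 : ContinuousWithinAt (fun s => (s, e (c s))) (Ici x) x :=
      continuousWithinAt_id.prodMk ((continuousAt_extChartAt' hs).comp_continuousWithinAt h1)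
    exact (h1.eventually ((isOpen_extChartAt_source x₀).mem_nhds hs)).and
      (h2.eventually (mem_interior_iff_mem_nhds.1 hT))
  have hxT := mem_interior_iff_mem_nhds.2 hT
  have hx' : c x = c' x := hx
  have h01 : ∀ᶠ s in 𝓝[≥] x, s ∈ Icc (0 : ℝ) 1 := Icc_mem_nhdsGE_of_mem hx01
  have hxy : ∀ᶠ s in 𝓝[≥] x, s ∈ Ico x y := Ico_mem_nhdsGE hy
  have hev := ((hgood hc hxs hxT).and (hgood hc' (hx' ▸ hxs) (hx' ▸ hxT))).and (h01.and hxy)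
  obtain ⟨b, hb, hbs⟩ := (mem_nhdsGE_iff_exists_Icc_subset).1 hev
  have hb' : x < b := hb
  have hder : ∀ {c : ℝ → N}, IsTraj I X c → (∀ s ∈ Icc x b, c s ∈ e.source) →
      ∀ t ∈ Ico x b, HasDerivWithinAt (fun s => e (c s)) (chartField I X x₀ (t, e (c t))) (Ici t) t := by
    intro c hc hs t ht
    have htI := Ico_subset_Icc_self ht
    refine (hc.hasDerivWithinAt (hbs htI).2.1 (hs t htI)).mono_of_mem_nhdsWithin ?_
    refine Icc_mem_nhdsGE_of_mem ⟨(hbs htI).2.1.1, ht.2.trans_le (hbs ⟨hb'.le, le_rfl⟩).2.1.2⟩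
  have hcont : ∀ {c : ℝ → N}, IsTraj I X c → (∀ s ∈ Icc x b, c s ∈ e.source) →
      ContinuousOn (fun s => e (c s)) (Icc x b) := fun hc hs s hsb =>
    ((hc.hasDerivWithinAt (hbs hsb).2.1 (hs s hsb)).continuousWithinAt).mono
      fun r hr => (hbs hr).2.1
  have heq := ODE_solution_unique_of_mem_Icc_right (a := x) (b := b) (K := K)
    (v := fun t u => chartField I X x₀ (t, u)) (s := fun t => {u | (t, u) ∈ T})
    (f := fun s => e (c s)) (g := fun s => e (c' s))
    (fun t _ => by
      have h1 : LipschitzOnWith (K * 1) (fun u => chartField I X x₀ (t, u)) {u | (t, u) ∈ T} :=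
        hK.comp (LipschitzWith.prodMk_left t).lipschitzOnWith fun u hu => hu
      rwa [mul_one] at h1)
    (hcont hc fun s hs => (hbs hs).1.1.1) (hder hc fun s hs => (hbs hs).1.1.1)
    (fun t ht => (hbs (Ico_subset_Icc_self ht)).1.1.2)
    (hcont hc' fun s hs => (hbs hs).1.2.1) (hder hc' fun s hs => (hbs hs).1.2.1)
    (fun t ht => (hbs (Ico_subset_Icc_self ht)).1.2.2) (congrArg e hx')
  have hbI : b ∈ Icc x b := ⟨hb'.le, le_rfl⟩
  exact ⟨b, e.injOn (hbs hbI).1.1.1 (hbs hbI).1.2.1 (heq hbI), hb', (hbs hbI).2.2.2.le⟩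

/-- The flow is given by any trajectory along which the vector field is regular. -/
theorem flowMap_eq {X : ℝ → ∀ x : N, TangentSpace I x} {c : ℝ → N} (hc : IsTraj I X c)
    (hX : ∀ s ∈ Icc (0 : ℝ) 1, ∃ x₀ : N, c s ∈ (extChartAt I x₀).source ∧
      ContDiffAt ℝ 1 (chartField I X x₀) (s, extChartAt I x₀ (c s))) :
    flowMap I X (c 0) = c 1 := by
  have h : ∃ c' : ℝ → N, c' 0 = c 0 ∧ IsTraj I X c' := ⟨c, rfl, hc⟩
  rw [flowMap, dif_pos h]
  exact (hc.eqOn h.choose_spec.2 h.choose_spec.1.symm hX ⟨zero_le_one, le_rfl⟩).symm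

end Trajectories

end

end FoldedSymplectic

namespace FoldedSymplectic

section

open Set Filter Bundle

/-! ### Naturality of the Moser construction -/

section Covariance

variable {V : Type} [NormedAddCommGroup V] [NormedSpace ℝ V] {B B' : Type*}

/-- Precomposition with `A × id`. -/
def liftEquiv (A : V ≃L[ℝ] V) : (V × ℝ) ≃L[ℝ] (V × ℝ) := A.prodCongr (.refl ℝ ℝ)

@[simp] theorem liftEquiv_apply (A : V ≃L[ℝ] V) (v : V × ℝ) : liftEquiv A v = (A v.1, v.2) := rfl

/-- Precomposition of functionals with an equivalence. -/
def precompEquiv (P : (V × ℝ) ≃L[ℝ] (V × ℝ)) : (V × ℝ →L[ℝ] ℝ) ≃L[ℝ] (V × ℝ →L[ℝ] ℝ) :=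
  P.symm.arrowCongr (.refl ℝ ℝ)

theorem precompEquiv_apply (P : (V × ℝ) ≃L[ℝ] (V × ℝ)) (l : V × ℝ →L[ℝ] ℝ) :
    precompEquiv P l = l.comp (P : V × ℝ →L[ℝ] V × ℝ) := by
  refine ContinuousLinearMap.ext fun v => ?_
  simp [precompEquiv]

variable {ψ ψ₀ ψ₁ : B × ℝ → (V × ℝ) [⋀^Fin 2]→L[ℝ] ℝ}
  {ψ' ψ₀' ψ₁' : B' × ℝ → (V × ℝ) [⋀^Fin 2]→L[ℝ] ℝ} {b : B} {b' : B'} {A : V ≃L[ℝ] V}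

theorem tContract_covariant
    (h : ∀ t u v, ψ' (b', t) ![u, v] = ψ (b, t) ![liftEquiv A u, liftEquiv A v]) (t : ℝ) :
    tContract ψ' (b', t) = precompEquiv (liftEquiv A) (tContract ψ (b, t)) := by
  refine ContinuousLinearMap.ext fun v => ?_
  rw [precompEquiv_apply, tContract, toBilin_apply, h, ContinuousLinearMap.comp_apply, tContract,
    toBilin_apply]
  simp

/-- No differentiability is needed: composition with a linear equivalence commutes with `deriv` also
at its default value. -/
theorem nullOneForm_covariant
    (h : ∀ t u v, ψ' (b', t) ![u, v] = ψ (b, t) ![liftEquiv A u, liftEquiv A v]) :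
    nullOneForm ψ' b' = precompEquiv (liftEquiv A) (nullOneForm ψ b) := by
  rw [nullOneForm, nullOneForm, map_smul]
  congr 1
  have h1 : (fun t : ℝ => tContract ψ' (b', t)) =
      precompEquiv (liftEquiv A) ∘ fun t : ℝ => tContract ψ (b, t) :=
    funext fun t => tContract_covariant h t
  rw [h1, ← fderiv_apply_one_eq_deriv, ContinuousLinearEquiv.comp_fderiv]
  simp

/-- Likewise linear equivalences commute with the integral without integrability, so the identity
holds at every point. -/
theorem moserForm_covariant
    (h : ∀ t u v, ψ' (b', t) ![u, v] = ψ (b, t) ![liftEquiv A u, liftEquiv A v]) (t : ℝ) :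
    moserForm ψ' (b', t) = precompEquiv (liftEquiv A) (moserForm ψ (b, t)) := by
  have h1 : tPrimitive ψ' (b', t) = precompEquiv (liftEquiv A) (tPrimitive ψ (b, t)) := by
    simp only [tPrimitive, intervalIntegral, tContract_covariant h, map_sub]
    rw [ContinuousLinearEquiv.integral_comp_comm, ContinuousLinearEquiv.integral_comp_comm]
  rw [moserForm, moserForm, h1, map_sub, map_smul, nullOneForm_covariant h]

/-- Valid also when T is not invertible, since both inverses are then zero by default. -/
theorem inverse_conj_apply {Q Q' : Type*} [NormedAddCommGroup Q] [NormedSpace ℝ Q]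
    [NormedAddCommGroup Q'] [NormedSpace ℝ Q'] (P : Q ≃L[ℝ] Q) (R : Q' ≃L[ℝ] Q') (T : Q →L[ℝ] Q')
    (β : Q') : P (((R : Q' →L[ℝ] Q').comp (T.comp (P : Q →L[ℝ] Q))).inverse (-(R β))) =
      T.inverse (-β) := by
  rw [ContinuousLinearMap.inverse_equiv_comp, ContinuousLinearMap.inverse_comp_equiv, ← map_neg]
  simp

/-- The field is assembled from operations natural under A × id, which leave the coordinate t alone.
With A the differential of a chart this identifies the global field with its local form; with A the
differential of the action it gives invariance. -/
theorem moserField_covariant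
    (h₀ : ∀ t u v, ψ₀' (b', t) ![u, v] = ψ₀ (b, t) ![liftEquiv A u, liftEquiv A v])
    (h₁ : ∀ t u v, ψ₁' (b', t) ![u, v] = ψ₁ (b, t) ![liftEquiv A u, liftEquiv A v]) (s t : ℝ) :
    liftEquiv A (moserField ψ₀' ψ₁' s (b', t)) = moserField ψ₀ ψ₁ s (b, t) := by
  have h2 : toBilin (V × ℝ) (ψ₀' (b', t) + s • (ψ₁' (b', t) - ψ₀' (b', t))) =
      (precompEquiv (liftEquiv A) : (V × ℝ →L[ℝ] ℝ) →L[ℝ] (V × ℝ →L[ℝ] ℝ)).comp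
        ((toBilin (V × ℝ) (ψ₀ (b, t) + s • (ψ₁ (b, t) - ψ₀ (b, t)))).comp
          (liftEquiv A : V × ℝ →L[ℝ] V × ℝ)) := by
    refine ContinuousLinearMap.ext fun u => ContinuousLinearMap.ext fun v => ?_
    rw [toBilin_apply]
    change ψ₀' (b', t) ![u, v] + s * (ψ₁' (b', t) ![u, v] - ψ₀' (b', t) ![u, v]) = _
    rw [ContinuousLinearMap.comp_apply, ContinuousLinearMap.comp_apply]
    refine Eq.trans ?_ (DFunLike.congr_fun (precompEquiv_apply (liftEquiv A) _) v).symm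
    rw [ContinuousLinearMap.comp_apply]
    refine Eq.trans ?_ (toBilin_apply _ _ _).symm
    change _ = ψ₀ (b, t) ![liftEquiv A u, liftEquiv A v] + s * (ψ₁ (b, t) ![liftEquiv A u, liftEquiv A v]
      - ψ₀ (b, t) ![liftEquiv A u, liftEquiv A v])
    rw [h₀, h₁]
  rw [moserField, moserField, h2, moserForm_covariant h₁]
  exact inverse_conj_apply _ _ _ _

end Covariance

/-! ### Product charts on Z × ℝ -/

section ProductChart

variable {V : Type} [NormedAddCommGroup V] [NormedSpace ℝ V] {H : Type} [TopologicalSpace H]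
  {I : ModelWithCorners ℝ V H} [I.Boundaryless]
  {Z : Type*} [TopologicalSpace Z] [ChartedSpace H Z] [IsManifold I ∞ Z]

theorem extChartAt_prod_target (z₀ : Z) (t₀ : ℝ) :
    (extChartAt (I.prod 𝓘(ℝ, ℝ)) ((z₀, t₀) : Z × ℝ)).target = (extChartAt I z₀).target ×ˢ univ := by
  rw [extChartAt_prod, PartialEquiv.prod_target, extChartAt_model_space_eq_id]
  rfl

theorem extChartAt_prod_source (z₀ : Z) (t₀ : ℝ) :
    (extChartAt (I.prod 𝓘(ℝ, ℝ)) ((z₀, t₀) : Z × ℝ)).source = (extChartAt I z₀).source ×ˢ univ := by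
  rw [extChartAt_prod, PartialEquiv.prod_source, extChartAt_model_space_eq_id]
  rfl

theorem extChartAt_prod_apply (z₀ : Z) (t₀ : ℝ) (q : Z × ℝ) :
    extChartAt (I.prod 𝓘(ℝ, ℝ)) ((z₀, t₀) : Z × ℝ) q = (extChartAt I z₀ q.1, q.2) := by
  rw [extChartAt_prod]
  rfl

theorem extChartAt_prod_symm_apply (z₀ : Z) (t₀ : ℝ) (p : V × ℝ) :
    (extChartAt (I.prod 𝓘(ℝ, ℝ)) ((z₀, t₀) : Z × ℝ)).symm p = ((extChartAt I z₀).symm p.1, p.2) := by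
  rw [extChartAt_prod]
  rfl

theorem mfderiv_extChartAt_prod_symm (z₀ : Z) (t₀ : ℝ) {p : V × ℝ} (hp : p.1 ∈ (extChartAt I z₀).target)
    (v : V × ℝ) :
    (mfderiv 𝓘(ℝ, V × ℝ) (I.prod 𝓘(ℝ, ℝ)) (extChartAt (I.prod 𝓘(ℝ, ℝ)) ((z₀, t₀) : Z × ℝ)).symm p v :
      V × ℝ) = ((mfderiv 𝓘(ℝ, V) I (extChartAt I z₀).symm p.1 v.1 : V), v.2) := by
  have h : (⇑(extChartAt (I.prod 𝓘(ℝ, ℝ)) ((z₀, t₀) : Z × ℝ)).symm : V × ℝ → Z × ℝ) =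
      fun p => ((extChartAt I z₀).symm p.1, p.2) :=
    funext fun p => extChartAt_prod_symm_apply z₀ t₀ p
  have h1 : HasMFDerivAt 𝓘(ℝ, V × ℝ) 𝓘(ℝ, V) (Prod.fst : V × ℝ → V) p
      (ContinuousLinearMap.fst ℝ V ℝ) := hasFDerivAt_fst.hasMFDerivAt
  have h2 : HasMFDerivAt 𝓘(ℝ, V × ℝ) 𝓘(ℝ, ℝ) (Prod.snd : V × ℝ → ℝ) p
      (ContinuousLinearMap.snd ℝ V ℝ) := hasFDerivAt_snd.hasMFDerivAt
  have h3 := ((mdifferentiableAt_extChartAt_symm hp).hasMFDerivAt.comp p h1).prodMk h2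
  rw [h]
  exact DFunLike.congr_fun h3.mfderiv v

/-- The differential of the inverse of a chart as an equivalence. -/
def chartEquiv (I : ModelWithCorners ℝ V H) [I.Boundaryless] {Z : Type*} [TopologicalSpace Z]
    [ChartedSpace H Z] [IsManifold I ∞ Z] (z₀ : Z) {y : V}
    (hy : y ∈ (extChartAt I z₀).target) : V ≃L[ℝ] V :=
  ContinuousLinearEquiv.equivOfInverse
    (mfderiv 𝓘(ℝ, V) I (extChartAt I z₀).symm y : V →L[ℝ] V)
    (mfderiv I 𝓘(ℝ, V) (extChartAt I z₀) ((extChartAt I z₀).symm y) : V →L[ℝ] V)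
    (mfderiv_extChartAt_symm_apply hy) (mfderiv_symm_extChartAt_symm_apply hy)

/-- Product charts keep t and act on tangent vectors by an equivalence times the identity, so the
covariance results apply to them. -/
theorem inChart_prod_apply {k : ℕ} (η : DForm (I.prod 𝓘(ℝ, ℝ)) (Z × ℝ) k) (z₀ : Z) (t₀ : ℝ) {y : V}
    (hy : y ∈ (extChartAt I z₀).target) (t : ℝ) (v : Fin k → V × ℝ) :
    inChart ((z₀, t₀) : Z × ℝ) η (y, t) v =
      (η ((extChartAt I z₀).symm y, t) : (V × ℝ) [⋀^Fin k]→L[ℝ] ℝ)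
        (fun i => liftEquiv (chartEquiv I z₀ hy) (v i)) := by
  refine (inChart_apply _ _ _ _).trans ?_
  refine (form_congr (extChartAt_prod_symm_apply z₀ t₀ (y, t)) _).trans ?_
  refine congrArg (η ((extChartAt I z₀).symm y, t) : (V × ℝ) [⋀^Fin k]→L[ℝ] ℝ) (funext fun i => ?_)
  exact mfderiv_extChartAt_prod_symm z₀ t₀ hy (v i)

theorem inChart_prod_apply₂ (η : DForm (I.prod 𝓘(ℝ, ℝ)) (Z × ℝ) 2) (z₀ : Z) (t₀ : ℝ) {y : V}
    (hy : y ∈ (extChartAt I z₀).target) (t : ℝ) (u v : V × ℝ) :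
    inChart ((z₀, t₀) : Z × ℝ) η (y, t) ![u, v] =
      (η ((extChartAt I z₀).symm y, t) : (V × ℝ) [⋀^Fin 2]→L[ℝ] ℝ)
        ![liftEquiv (chartEquiv I z₀ hy) u, liftEquiv (chartEquiv I z₀ hy) v] := by
  refine (inChart_prod_apply η z₀ t₀ hy t _).trans ?_
  refine congrArg (η ((extChartAt I z₀).symm y, t) : (V × ℝ) [⋀^Fin 2]→L[ℝ] ℝ) (funext fun i => ?_)
  fin_cases i <;> rfl

end ProductChart

end

end FoldedSymplectic

namespace FoldedSymplectic

section

open Set Filter Bundle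

/-! ### The collar map -/

section Collar

variable {V : Type} [NormedAddCommGroup V] [NormedSpace ℝ V] [FiniteDimensional ℝ V]
  {H : Type} [TopologicalSpace H] {I : ModelWithCorners ℝ V H} [I.Boundaryless]
  {Z : Type*} [TopologicalSpace Z] [ChartedSpace H Z] [IsManifold I ∞ Z]
  {E : Type} [NormedAddCommGroup E] [NormedSpace ℝ E] [FiniteDimensional ℝ E]
  {H' : Type} [TopologicalSpace H'] {I' : ModelWithCorners ℝ E H'} [I'.Boundaryless]
  {M : Type*} [TopologicalSpace M] [ChartedSpace H' M] [IsManifold I' ∞ M]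

/-- The flow at time `t` of the vector field `W`, starting at `j z`. -/
def collarMap (I' : ModelWithCorners ℝ E H') {M : Type*} [TopologicalSpace M] [ChartedSpace H' M]
    {Z : Type*} (j : Z → M) (W : ∀ x : M, TangentSpace I' x) (q : Z × ℝ) : M :=
  flowMap I' (fun _ x => q.2 • W x) (j q.1)

theorem contDiffAt_chartField_smul {W : ∀ x : M, TangentSpace I' x}
    (hW : ContMDiff I' I'.tangent ∞ (fun x => (⟨x, W x⟩ : TangentBundle I' M))) {x₀ : M} {y : E}
    (hy : y ∈ (extChartAt I' x₀).target) (t s : ℝ) :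
    ContDiffAt ℝ ∞ (chartField I' (fun _ x => t • W x) x₀) (s, y) := by
  have h1 := (contMDiffAt_field_iff ((extChartAt I' x₀).map_target hy)).1 hW.contMDiffAt
  rw [(extChartAt I' x₀).right_inv hy] at h1
  have h2 := (ContDiffAt.comp (s, y) (g := fun y => (mfderiv I' 𝓘(ℝ, E) (extChartAt I' x₀)
    ((extChartAt I' x₀).symm y) (W ((extChartAt I' x₀).symm y)) : E)) h1
    (contDiffAt_snd : ContDiffAt ℝ ∞ (Prod.snd : ℝ × E → E) (s, y))).const_smul t
  refine h2.congr_of_eventuallyEq (Eventually.of_forall fun q => ?_)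
  exact map_smul _ _ _

variable [T2Space M]

theorem collarMap_eq {W : ∀ x : M, TangentSpace I' x}
    (hW : ContMDiff I' I'.tangent ∞ (fun x => (⟨x, W x⟩ : TangentBundle I' M))) {j : Z → M}
    {q : Z × ℝ} {c : ℝ → M} (hc : IsTraj I' (fun _ x => q.2 • W x) c) (h0 : c 0 = j q.1) :
    collarMap I' j W q = c 1 := by
  rw [collarMap, ← h0]
  refine flowMap_eq hc fun s _ => ⟨c s, mem_extChartAt_source _, ?_⟩
  exact (contDiffAt_chartField_smul hW (mem_extChartAt_target _) _ _).of_le (by simp)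

theorem collarMap_zero {W : ∀ x : M, TangentSpace I' x}
    (hW : ContMDiff I' I'.tangent ∞ (fun x => (⟨x, W x⟩ : TangentBundle I' M))) {j : Z → M} (z : Z) :
    collarMap I' j W (z, 0) = j z :=
  collarMap_eq (q := (z, 0)) (c := fun _ => j z) hW (isTraj_const fun _ => zero_smul ℝ (W (j z))) rfl

/-- T carries trajectories from j z to trajectories from j z', and T' carries them back. If no
trajectory exists, both sides take the default value, the starting point, and these correspond as
well. -/
theorem collarMap_comp {W : ∀ x : M, TangentSpace I' x}
    (hW : ContMDiff I' I'.tangent ∞ (fun x => (⟨x, W x⟩ : TangentBundle I' M))) {j : Z → M}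
    {T T' : M → M} (hT : ContMDiff I' I' ∞ T) (hT' : ContMDiff I' I' ∞ T')
    (hTT' : ∀ x, T' (T x) = x)
    (hTW : ∀ x, mfderiv I' I' T x (W x) = W (T x)) (hTW' : ∀ x, mfderiv I' I' T' x (W x) = W (T' x))
    {z z' : Z} (hz : T (j z) = j z') (t : ℝ) :
    collarMap I' j W (z', t) = T (collarMap I' j W (z, t)) := by
  have htr : ∀ {T : M → M} (_ : ContMDiff I' I' ∞ T) (_ : ∀ x, mfderiv I' I' T x (W x) = W (T x))
      {c : ℝ → M} (_ : IsTraj I' (fun _ x => t • W x) c), IsTraj I' (fun _ x => t • W x) (T ∘ c) :=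
    fun {T} hT hTW {c} hc => hc.comp (fun s _ => hT.mdifferentiableAt (by simp)) fun s _ =>
      (map_smul (mfderiv I' I' T (c s)) t (W (c s))).trans (congrArg (t • ·) (hTW (c s)))
  by_cases h : ∃ c : ℝ → M, c 0 = j z ∧ IsTraj I' (fun _ x => t • W x) c
  · obtain ⟨c, hc0, hc⟩ := h
    rw [collarMap_eq (q := (z, t)) hW hc hc0,
      collarMap_eq (q := (z', t)) (c := T ∘ c) hW (htr hT hTW hc)
        (by rw [Function.comp_apply, hc0, hz]), Function.comp_apply]
  · have h' : ¬ ∃ c : ℝ → M, c 0 = j z' ∧ IsTraj I' (fun _ x => t • W x) c := by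
      rintro ⟨c, hc0, hc⟩
      exact h ⟨T' ∘ c, by rw [Function.comp_apply, hc0, ← hz, hTT'], htr hT' hTW' hc⟩
    rw [collarMap, collarMap, flowMap, flowMap, dif_neg h, dif_neg h', hz]

/-- In a chart, the displacement from j z solves an equation whose right-hand side carries the
factor t. At t = 0 it vanishes together with its space derivative, as the existence theorem
requires. Differentiating in t at t = 0 yields W. -/
theorem exists_contMDiffOn_collarMap {W : ∀ x : M, TangentSpace I' x}
    (hW : ContMDiff I' I'.tangent ∞ (fun x => (⟨x, W x⟩ : TangentBundle I' M))) {j : Z → M}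
    (hj : ContMDiff I I' ∞ j) (z₀ : Z) :
    (∃ O : Set (Z × ℝ), IsOpen O ∧ (z₀, 0) ∈ O ∧
      ContMDiffOn (I.prod 𝓘(ℝ, ℝ)) I' ∞ (collarMap I' j W) O) ∧
    ∀ (u : V) (τ : ℝ), (mfderiv (I.prod 𝓘(ℝ, ℝ)) I' (collarMap I' j W) (z₀, 0) (u, τ) : E) =
      (mfderiv I I' j z₀ u : E) + τ • (W (j z₀) : E) := by
  set x₀ : M := j z₀ with hx₀
  set e := extChartAt I' x₀ with he
  set eZ := extChartAt I z₀ with heZ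
  set jh : V → E := inCharts I I' z₀ x₀ j with hjh
  set Wh : E → E := fun y => mfderiv I' 𝓘(ℝ, E) e (e.symm y) (W (e.symm y)) with hWh
  have hto := isOpen_extChartAt_target (I := I') x₀
  have hZo := isOpen_extChartAt_target (I := I) z₀
  have hWs : ContDiffOn ℝ ∞ Wh e.target := fun y hy => by
    have h1 := (contMDiffAt_field_iff (e.map_target hy)).1 (hW.contMDiffAt (x := e.symm y))
    rw [e.right_inv hy] at h1
    exact h1.contDiffWithinAt
  set V' : Set V := eZ.target ∩ (fun y => j (eZ.symm y)) ⁻¹' e.source with hV'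
  have hV'o : IsOpen V' :=
    (hj.continuous.comp_continuousOn (continuousOn_extChartAt_symm (I := I) z₀)).isOpen_inter_preimage
      hZo (isOpen_extChartAt_source x₀)
  have hz0 : eZ.symm (eZ z₀) = z₀ := eZ.left_inv (mem_extChartAt_source z₀)
  have hy₀ : eZ z₀ ∈ V' := ⟨mem_extChartAt_target z₀, by
    change j (eZ.symm (eZ z₀)) ∈ e.source
    rw [hz0]; exact mem_extChartAt_source x₀⟩
  have hjs : ContDiffOn ℝ ∞ jh V' := fun y hy =>
    (contDiffAt_inCharts hy.1 hj.contMDiffAt hy.2).contDiffWithinAt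
  have hjt : ∀ y ∈ V', jh y ∈ e.target := fun y hy => e.map_source hy.2
  -- The parameter is p = (y, t) and the unknown is the displacement from jh y, so that the initial
  -- value is zero.
  set Ω : Set (ℝ × (V × ℝ) × E) := (univ ×ˢ (V' ×ˢ univ) ×ˢ univ) ∩
    (fun x : ℝ × (V × ℝ) × E => jh x.2.1.1 + x.2.2) ⁻¹' e.target with hΩ
  have hg : ContDiffOn ℝ ∞ (fun x : ℝ × (V × ℝ) × E => jh x.2.1.1 + x.2.2)
      (univ ×ˢ (V' ×ˢ univ) ×ˢ univ) :=
    (hjs.comp (t := V') (f := fun x : ℝ × (V × ℝ) × E => x.2.1.1) (by fun_prop)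
      fun x hx => hx.2.1.1).add (by fun_prop)
  have hΩo : IsOpen Ω := hg.continuousOn.isOpen_inter_preimage
    (isOpen_univ.prod ((hV'o.prod isOpen_univ).prod isOpen_univ)) hto
  set g : ℝ × (V × ℝ) × E → E := fun x => Wh (jh x.2.1.1 + x.2.2) with hgdef
  have hgs : ContDiffOn ℝ ∞ g Ω := hWs.comp (hg.mono inter_subset_left) fun x hx => hx.2
  set f : ℝ × (V × ℝ) × E → E := fun x => x.2.1.2 • g x with hf
  have hfs : ContDiffOn ℝ ∞ f Ω := ContDiffOn.smul (by fun_prop) hgs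
  set a : ℝ × (V × ℝ) × E →L[ℝ] ℝ := (ContinuousLinearMap.snd ℝ V ℝ).comp
    ((ContinuousLinearMap.fst ℝ (V × ℝ) E).comp (ContinuousLinearMap.snd ℝ ℝ ((V × ℝ) × E))) with ha
  -- At t = 0 only the derivative of the prefactor t survives.
  have hfd : ∀ x ∈ Ω, x.2.1.2 = 0 → ∀ u, fderiv ℝ f x u = u.2.1.2 • g x := fun x hx h0 u => by
    have h1 : HasFDerivAt f _ x := a.hasFDerivAt.smul
      ((hgs.contDiffAt (hΩo.mem_nhds hx)).differentiableAt (by simp)).hasFDerivAt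
    have h2 : a x = 0 := h0
    rw [h1.fderiv, h2, zero_smul, zero_add]
    rfl
  set p₀ : V × ℝ := (eZ z₀, 0) with hp₀
  have hΩ0 : ∀ s ∈ Icc (0 : ℝ) 1, (s, p₀, (0 : V × ℝ →L[ℝ] E) p₀) ∈ Ω := fun s _ =>
    ⟨⟨mem_univ _, ⟨hy₀, mem_univ _⟩, mem_univ _⟩, by
      change jh (eZ z₀) + (0 : E) ∈ e.target
      rw [add_zero]; exact hjt _ hy₀⟩
  obtain ⟨O, hO, hp₀O, Γ, hΓ, hΓ0, hΓp⟩ := exists_smooth_solution (0 : V × ℝ →L[ℝ] E) p₀ hΩo hΩ0 hfs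
    (fun s _ => zero_smul ℝ _) (fun s hs v => (hfd _ (hΩ0 s hs) rfl _).trans (zero_smul ℝ _))
  set ev : C(Icc (0 : ℝ) 1, E) →L[ℝ] E := evalCurve E ⟨1, by simp⟩ with hev
  have hev1 : ∀ γ, ev γ = extendCurve γ 1 := fun γ => (extendCurve_of_mem γ (by simp)).symm
  set F : V × ℝ → E := fun p => jh p.1 + ev (Γ p) with hF
  set O' : Set (V × ℝ) := O ∩ V' ×ˢ univ with hO'
  have hO'o : IsOpen O' := hO.inter (hV'o.prod isOpen_univ)
  have hp₀O' : p₀ ∈ O' := ⟨hp₀O, hy₀, mem_univ _⟩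
  have hFs : ContDiffOn ℝ ∞ F O' :=
    (hjs.comp (t := V') (f := fun p : V × ℝ => p.1) (by fun_prop) fun p hp => hp.2.1).add
      (ev.contDiff.comp_contDiffOn (hΓ.mono inter_subset_left))
  have hFt : ∀ p ∈ O', F p ∈ e.target := fun p hp => by
    rw [hF]; simp only [hev1]
    exact ((hΓp p hp.1).2.1 1 (by simp)).1.2
  have hcol : ∀ p ∈ O', collarMap I' j W (eZ.symm p.1, p.2) = e.symm (F p) := by
    intro p hp
    obtain ⟨h0, h1, -⟩ := hΓp p hp.1
    rw [hF]; simp only [hev1]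
    refine collarMap_eq (q := (eZ.symm p.1, p.2))
      (c := fun s => e.symm (jh p.1 + extendCurve (Γ p) s)) hW ?_ ?_
    · refine isTraj_of_hasDerivWithinAt fun s hs => ⟨(h1 s hs).1.2, ?_⟩
      refine ((h1 s hs).2.const_add (jh p.1)).congr_deriv ?_
      exact (map_smul (mfderiv I' 𝓘(ℝ, E) e (e.symm (jh p.1 + extendCurve (Γ p) s))) p.2
        (W (e.symm (jh p.1 + extendCurve (Γ p) s)))).symm
    · change e.symm (jh p.1 + extendCurve (Γ p) 0) = j (eZ.symm p.1)
      rw [h0]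
      change e.symm (e (j (eZ.symm p.1)) + 0) = _
      rw [add_zero]
      exact e.left_inv hp.2.1.2
  set ch := extChartAt (I.prod 𝓘(ℝ, ℝ)) ((z₀, (0 : ℝ)) : Z × ℝ) with hch
  have hcha : ∀ q, ch q = (eZ q.1, q.2) := extChartAt_prod_apply z₀ 0
  have hcs : ch (z₀, 0) = p₀ := hcha _
  set Oq : Set (Z × ℝ) := ch.source ∩ ch ⁻¹' O' with hOq
  have hOqo : IsOpen Oq := (continuousOn_extChartAt _).isOpen_inter_preimage
    (isOpen_extChartAt_source _) hO'o
  have hzq : ((z₀, 0) : Z × ℝ) ∈ Oq := ⟨mem_extChartAt_source _, by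
    change ch (z₀, 0) ∈ O'
    rw [hcs]; exact hp₀O'⟩
  have hloc : EqOn (collarMap I' j W) (fun q => e.symm (F (ch q))) Oq := by
    rintro q ⟨hqs, hq⟩
    change _ = e.symm (F (ch q))
    rw [← hcol _ hq, hcha]
    rw [hch, extChartAt_prod_source] at hqs
    rw [eZ.left_inv hqs.1]
  have hsmooth : ContMDiffOn (I.prod 𝓘(ℝ, ℝ)) I' ∞ (collarMap I' j W) Oq := by
    intro q hq
    have hFp : F (ch q) ∈ e.target := hFt _ hq.2
    have hsm : ContMDiffAt 𝓘(ℝ, E) I' ∞ e.symm (F (ch q)) :=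
      (contMDiffOn_extChartAt_symm (I := I') (n := ∞) x₀ _ hFp).contMDiffAt (hto.mem_nhds hFp)
    have hFm : ContMDiffAt 𝓘(ℝ, V × ℝ) 𝓘(ℝ, E) ∞ F (ch q) :=
      (hFs.contDiffAt (hO'o.mem_nhds hq.2)).contMDiffAt
    have hcm : ContMDiffAt (I.prod 𝓘(ℝ, ℝ)) 𝓘(ℝ, V × ℝ) ∞ ch q :=
      contMDiffAt_extChartAt' (by have := hq.1; rwa [hch, extChartAt_source] at this)
    refine ContMDiffAt.contMDiffWithinAt (ContMDiffAt.congr_of_eventuallyEq ?_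
      (hloc.eventuallyEq_of_mem (hOqo.mem_nhds hq)))
    have h1 : ContMDiffAt (I.prod 𝓘(ℝ, ℝ)) 𝓘(ℝ, E) ∞ (fun q => F (ch q)) q :=
      ContMDiffAt.comp q (g := F) hFm hcm
    exact ContMDiffAt.comp q (g := e.symm) (f := fun q => F (ch q)) hsm h1
  have hFp : F p₀ ∈ e.target := hFt p₀ hp₀O'
  refine ⟨⟨Oq, hOqo, hzq, hsmooth⟩, fun u τ => ?_⟩
  have hΓz : ev (Γ p₀) = 0 := by
    rw [hev1]; exact hΓ0 1 (by simp)
  have hFz : F p₀ = e x₀ := by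
    change jh (eZ z₀) + ev (Γ p₀) = _
    rw [hΓz, add_zero]
    change e (j (eZ.symm (eZ z₀))) = _
    rw [hz0]
  have hmd := (hsmooth.contMDiffAt (hOqo.mem_nhds hzq)).mdifferentiableAt (by simp)
  refine (mfderiv_prod_eq_add_apply (p := ((z₀, 0) : Z × ℝ)) (v := (u, τ)) hmd).trans ?_
  have hpart1 : (fun z => collarMap I' j W (z, (0 : ℝ))) = j := funext fun z => collarMap_zero hW z
  have hpart2 : HasMFDerivAt 𝓘(ℝ, ℝ) I' (fun t : ℝ => collarMap I' j W (z₀, t)) 0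
      (ContinuousLinearMap.toSpanSingleton ℝ (W (j z₀))) := by
    have hΓd : HasDerivAt (fun t : ℝ => F (eZ z₀, t)) (Wh (e x₀)) 0 := by
      have h1 : HasFDerivAt (fun p => ev (Γ p)) (ev.comp (fderiv ℝ Γ p₀)) p₀ :=
        ev.hasFDerivAt.comp p₀ ((hΓ.contDiffAt (hO.mem_nhds hp₀O)).differentiableAt
          (by simp)).hasFDerivAt
      have h2 : HasDerivAt (fun t : ℝ => ((eZ z₀, t) : V × ℝ)) (0, 1) 0 :=
        (hasDerivAt_const _ _).prodMk (hasDerivAt_id _)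
      have h3 : HasDerivAt (fun t : ℝ => ev (Γ (eZ z₀, t))) (ev (fderiv ℝ Γ p₀ (0, 1))) 0 :=
        HasFDerivAt.comp_hasDerivAt (l := fun p => ev (Γ p)) (f := fun t : ℝ => ((eZ z₀, t) : V × ℝ))
          0 h1 h2
      -- In the t-direction the variational equation has the constant right-hand side Wh (e x₀), so
      -- its solution is s Wh (e x₀).
      have h4 : ev (fderiv ℝ Γ p₀ (0, 1)) = Wh (e x₀) := by
        rw [hev1]
        obtain ⟨-, -, h5⟩ := hΓp p₀ hp₀O
        obtain ⟨h6, h7⟩ := h5 (0, 1)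
        have h8 : ∀ s ∈ Icc (0 : ℝ) 1, HasDerivWithinAt (fun s =>
            extendCurve (fderiv ℝ Γ p₀ (0, 1)) s - s • Wh (e x₀)) 0 (Icc 0 1) s := by
          intro s hs
          have h9 : g (s, p₀, extendCurve (Γ p₀) s) = Wh (e x₀) := by
            rw [hΓ0 s hs]
            change Wh (e (j (eZ.symm (eZ z₀))) + 0) = _
            rw [add_zero, hz0]
          have h10 := hfd (s, p₀, extendCurve (Γ p₀) s) (by rw [hΓ0 s hs]; exact hΩ0 s hs) rfl
            (0, (0, 1), extendCurve (fderiv ℝ Γ p₀ (0, 1)) s)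
          have h11 := (h7 s hs).sub ((hasDerivAt_id s).hasDerivWithinAt.smul_const (Wh (e x₀)))
          refine h11.congr_deriv ?_
          rw [h10, h9]
          simp
        have h9 := constant_of_derivWithin_zero (fun s hs => (h8 s hs).differentiableWithinAt)
          (fun s hs => (h8 s (Ico_subset_Icc_self hs)).derivWithin
            (uniqueDiffOn_Icc_zero_one s (Ico_subset_Icc_self hs))) 1 (by simp)
        rw [h6] at h9
        simpa [sub_eq_zero] using h9
      rw [h4] at h3
      exact h3.const_add (jh (eZ z₀))
    have hm1 : HasMFDerivAt 𝓘(ℝ, ℝ) 𝓘(ℝ, E) (fun t : ℝ => F (eZ z₀, t)) 0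
        (ContinuousLinearMap.toSpanSingleton ℝ (Wh (e x₀)) : ℝ →L[ℝ] E) :=
      hΓd.hasFDerivAt.hasMFDerivAt
    have hm2 := HasMFDerivAt.comp (0 : ℝ) (g := e.symm)
      (mdifferentiableAt_extChartAt_symm (I := I') (x₀ := x₀) (y := F (eZ z₀, 0))
        hFp).hasMFDerivAt hm1
    have hev2 : (fun t : ℝ => collarMap I' j W (z₀, t)) =ᶠ[𝓝 0] (e.symm ∘ fun t : ℝ => F (eZ z₀, t)) := by
      have h1 : ∀ᶠ t : ℝ in 𝓝 0, ((eZ z₀, t) : V × ℝ) ∈ O' := by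
        have : ContinuousAt (fun t : ℝ => ((eZ z₀, t) : V × ℝ)) 0 := by fun_prop
        exact this.eventually (hO'o.mem_nhds hp₀O')
      filter_upwards [h1] with t ht
      have := hcol _ ht
      rwa [hz0] at this
    refine (hm2.congr_of_eventuallyEq hev2).congr_mfderiv ?_
    refine ContinuousLinearMap.ext fun r => ?_
    let r' : ℝ := r
    refine (map_smul (mfderiv 𝓘(ℝ, E) I' e.symm (F (eZ z₀, 0))) r' (Wh (e x₀))).trans ?_
    refine congrArg (r' • ·) ?_
    have h1 := mfderiv_symm_extChartAt_symm_apply (I := I') (x₀ := x₀) (y := e x₀)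
      (mem_extChartAt_target x₀) (W (e.symm (e x₀)))
    have h2 : (mfderiv 𝓘(ℝ, E) I' e.symm (F (eZ z₀, 0)) (Wh (e x₀)) : E) =
        (W (e.symm (e x₀)) : E) := by
      have h3 : ∀ y, y = e x₀ → (mfderiv 𝓘(ℝ, E) I' e.symm y (Wh (e x₀)) : E) =
        (mfderiv 𝓘(ℝ, E) I' e.symm (e x₀) (Wh (e x₀)) : E) := by rintro _ rfl; rfl
      exact (h3 _ hFz).trans h1
    refine h2.trans ?_
    have h3 : ∀ x, x = x₀ → (W x : E) = W x₀ := by rintro _ rfl; rfl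
    exact h3 _ (e.left_inv (mem_extChartAt_source x₀))
  refine congrArg₂ (fun a b : E => a + b) ?_ ?_
  · refine DFunLike.congr_fun (?_ : (mfderiv I I' (fun z => collarMap I' j W (z, (0 : ℝ))) z₀ : V →L[ℝ] E)
      = (mfderiv I I' j z₀ : V →L[ℝ] E)) u
    rw [hpart1]
  · exact DFunLike.congr_fun hpart2.mfderiv τ

end Collar

end

end FoldedSymplectic

namespace FoldedSymplectic

section

open Set Filter Bundle

/-! ### The collar form and its Moser data -/

theorem deriv_apply_eq_zero {Q : Type*} [NormedAddCommGroup Q] [NormedSpace ℝ Q]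
    {F : ℝ → Q →L[ℝ] ℝ} {q : Q} (h : ∀ t, F t q = 0) (t : ℝ) : deriv F t q = 0 := by
  by_cases hF : DifferentiableAt ℝ F t
  · have h2 := ((ContinuousLinearMap.apply ℝ ℝ q).hasFDerivAt (x := F t)).comp_hasDerivAt t
      hF.hasDerivAt
    have h3 : ((ContinuousLinearMap.apply ℝ ℝ q) ∘ F) = fun _ => 0 := funext h
    rw [h3] at h2
    exact h2.unique (hasDerivAt_const _ _)
  · rw [deriv_zero_of_not_differentiableAt hF]; rfl

/-- Holds without regularity assumptions, because a missing derivative has the default value zero.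
-/
theorem nullOneForm_vert {B V : Type*} [NormedAddCommGroup V] [NormedSpace ℝ V]
    (ψ : B × ℝ → (V × ℝ) [⋀^Fin 2]→L[ℝ] ℝ) (b : B) (τ : ℝ) : nullOneForm ψ b (0, τ) = 0 := by
  have h1 : deriv (fun t : ℝ => tContract ψ (b, t)) 0 (0, 1) = 0 :=
    deriv_apply_eq_zero (fun t => by
      change toBilin (V × ℝ) (ψ (b, t)) (0, 1) (0, 1) = 0
      rw [toBilin_apply, form_self]) 0
  have h2 : ((0, τ) : V × ℝ) = τ • ((0, 1) : V × ℝ) := by simp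
  have h3 : nullOneForm ψ b (0, 1) = (2⁻¹ : ℝ) * deriv (fun t : ℝ => tContract ψ (b, t)) 0 (0, 1) :=
    rfl
  rw [h2, map_smul, h3, h1, mul_zero, smul_zero]

section CollarForm

variable {m : ℕ} {M : Type*} [TopologicalSpace M] [ChartedSpace (EuclideanSpace ℝ (Fin (2 * m))) M]
  [IsManifold (𝓡 (2 * m)) ∞ M] {σ : DForm (𝓡 (2 * m)) M 2}
  [ChartedSpace (EuclideanSpace ℝ (Fin (2 * m - 1))) (fold σ)]
  [IsManifold (𝓡 (2 * m - 1)) ∞ (fold σ)]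

/-- The pullback of `σ` to `Z × ℝ` along the flow of a vector field. -/
def collarForm (σ : DForm (𝓡 (2 * m)) M 2)
    [ChartedSpace (EuclideanSpace ℝ (Fin (2 * m - 1))) (fold σ)]
    (W : ∀ x : M, TangentSpace (𝓡 (2 * m)) x) :
    DForm ((𝓡 (2 * m - 1)).prod 𝓘(ℝ, ℝ)) (fold σ × ℝ) 2 :=
  pullback ((𝓡 (2 * m - 1)).prod 𝓘(ℝ, ℝ))
    (collarMap (𝓡 (2 * m)) (Subtype.val : fold σ → M) W) σ

/-- A form on `Z × ℝ`, with tangent spaces identified with the model vector space. -/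
def asFamily {m k : ℕ} {Z : Type*} [TopologicalSpace Z]
    [ChartedSpace (EuclideanSpace ℝ (Fin m)) Z]
    (η : DForm ((𝓡 m).prod 𝓘(ℝ, ℝ)) (Z × ℝ) k) (q : Z × ℝ) :
    (EuclideanSpace ℝ (Fin m) × ℝ) [⋀^Fin k]→L[ℝ] ℝ := η q

theorem inChart_asFamily {m : ℕ} {Z : Type*} [TopologicalSpace Z]
    [ChartedSpace (EuclideanSpace ℝ (Fin m)) Z] [IsManifold (𝓡 m) ∞ Z]
    (η : DForm ((𝓡 m).prod 𝓘(ℝ, ℝ)) (Z × ℝ) 2) (z₀ : Z)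
    {y : EuclideanSpace ℝ (Fin m)}
    (hy : y ∈ (extChartAt (𝓡 m) z₀).target) (t : ℝ) (u v : EuclideanSpace ℝ (Fin m) × ℝ) :
    inChart ((z₀, (0 : ℝ)) : Z × ℝ) η (y, t) ![u, v] =
      asFamily η ((extChartAt (𝓡 m) z₀).symm y, t)
        ![liftEquiv (chartEquiv (𝓡 m) z₀ hy) u, liftEquiv (chartEquiv (𝓡 m) z₀ hy) v] :=
  inChart_prod_apply₂ η z₀ 0 hy t u v

/-- The one-form `α` on the fold: half of the `t`-derivative of `i_{∂/∂t}` of the collar form. -/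
def foldOneForm (σ : DForm (𝓡 (2 * m)) M 2)
    [ChartedSpace (EuclideanSpace ℝ (Fin (2 * m - 1))) (fold σ)]
    (W : ∀ x : M, TangentSpace (𝓡 (2 * m)) x) : DForm (𝓡 (2 * m - 1)) (fold σ) 1 :=
  fun z => oneForm (EuclideanSpace ℝ (Fin (2 * m - 1))) ((nullOneForm (asFamily (collarForm σ W)) z).comp
    (ContinuousLinearMap.inl ℝ (EuclideanSpace ℝ (Fin (2 * m - 1))) ℝ))

variable [T2Space M] {W : ∀ x : M, TangentSpace (𝓡 (2 * m)) x}

/-- At t = 0 the differential of the collar map sends (u, τ) to u + τW, and the W-parts drop out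
since W lies in ker σ. -/
theorem collarForm_zero
    (hZ : Manifold.IsSmoothEmbedding (𝓡 (2 * m - 1)) (𝓡 (2 * m)) ∞ (Subtype.val : fold σ → M))
    (hW : ContMDiff (𝓡 (2 * m)) (𝓡 (2 * m)).tangent ∞
      (fun x => (⟨x, W x⟩ : TangentBundle (𝓡 (2 * m)) M)))
    (hWk : ∀ z : fold σ, W z ∈ formKer σ (z : M)) (z : fold σ)
    (u v : EuclideanSpace ℝ (Fin (2 * m - 1)) × ℝ) :
    asFamily (collarForm σ W) (z, 0) ![u, v] = restrictFold σ z ![u.1, v.1] := by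
  obtain ⟨-, hd⟩ := exists_contMDiffOn_collarMap (I := 𝓡 (2 * m - 1)) hW hZ.contMDiff z
  have h0 := collarMap_zero hW (j := (Subtype.val : fold σ → M)) z
  let a : EuclideanSpace ℝ (Fin (2 * m)) := dIncl σ z u.1
  let b : EuclideanSpace ℝ (Fin (2 * m)) := dIncl σ z v.1
  let w : EuclideanSpace ℝ (Fin (2 * m)) := W z
  let s : EuclideanSpace ℝ (Fin (2 * m)) [⋀^Fin 2]→L[ℝ] ℝ := σ z
  have h1 : asFamily (collarForm σ W) (z, 0) ![u, v] = s ![a + u.2 • w, b + v.2 • w] := by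
    refine (pullback_apply _ _ _ _).trans ((form_congr h0 _).trans ?_)
    refine congrArg s (funext fun i => ?_)
    fin_cases i
    · exact hd u.1 u.2
    · exact hd v.1 v.2
  have hk : ∀ c, s ![w, c] = 0 := fun c => hWk z c
  have hk' : ∀ c, s ![c, w] = 0 := fun c => by rw [form_swap, hk, neg_zero]
  refine h1.trans (Eq.trans ?_ (restrictFold_apply _ _ _).symm)
  change _ = s ![a, b]
  rw [← toBilin_apply, ← toBilin_apply]
  have hk2 : ∀ c, toBilin _ s w c = 0 := fun c => by rw [toBilin_apply, hk]
  have hk2' : ∀ c, toBilin _ s c w = 0 := fun c => by rw [toBilin_apply, hk']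
  simp only [map_add, map_smul, add_apply, smul_apply, hk2, hk2', smul_zero, add_zero]

theorem inChart_foldOneForm (z₀ : fold σ) {y : EuclideanSpace ℝ (Fin (2 * m - 1))}
    (hy : y ∈ (extChartAt (𝓡 (2 * m - 1)) z₀).target) :
    inChart z₀ (foldOneForm σ W) y = oneForm (EuclideanSpace ℝ (Fin (2 * m - 1)))
      ((nullOneForm (inChart ((z₀, (0 : ℝ)) : fold σ × ℝ) (collarForm σ W)) y).comp
        (ContinuousLinearMap.inl ℝ (EuclideanSpace ℝ (Fin (2 * m - 1))) ℝ)) := by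
  refine ContinuousAlternatingMap.ext fun v => ?_
  rw [nullOneForm_covariant (ψ := asFamily (collarForm σ W))
    (fun t u v => inChart_asFamily (collarForm σ W) z₀ hy t u v), precompEquiv_apply]
  rfl

/-- The form `t² p^*α` in product charts. -/
theorem inChart_sq_smul (z₀ : fold σ) {y : EuclideanSpace ℝ (Fin (2 * m - 1))}
    (hy : y ∈ (extChartAt (𝓡 (2 * m - 1)) z₀).target) (t : ℝ) :
    inChart ((z₀, (0 : ℝ)) : fold σ × ℝ) (fun q : fold σ × ℝ => q.2 ^ 2 •
      pullback ((𝓡 (2 * m - 1)).prod 𝓘(ℝ, ℝ)) (Prod.fst : fold σ × ℝ → fold σ)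
        (foldOneForm σ W) q) (y, t) =
      oneForm (EuclideanSpace ℝ (Fin (2 * m - 1)) × ℝ)
        (t ^ 2 • nullOneForm (inChart ((z₀, (0 : ℝ)) : fold σ × ℝ) (collarForm σ W)) y) := by
  refine ContinuousAlternatingMap.ext fun v => ?_
  rw [nullOneForm_covariant (ψ := asFamily (collarForm σ W))
    (fun t u v => inChart_asFamily (collarForm σ W) z₀ hy t u v)]
  refine (inChart_prod_apply _ z₀ 0 hy t v).trans ?_
  change t ^ 2 * (nullOneForm (asFamily (collarForm σ W)) ((extChartAt (𝓡 (2 * m - 1)) z₀).symm y))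
    ((mfderiv ((𝓡 (2 * m - 1)).prod 𝓘(ℝ, ℝ)) (𝓡 (2 * m - 1)) (Prod.fst : fold σ × ℝ → fold σ)
      ((extChartAt (𝓡 (2 * m - 1)) z₀).symm y, t)
      (liftEquiv (chartEquiv (𝓡 (2 * m - 1)) z₀ hy) (v 0)) : EuclideanSpace ℝ (Fin (2 * m - 1))), 0) = _
  rw [oneForm_apply, smul_apply, smul_eq_mul, precompEquiv_apply, ContinuousLinearMap.comp_apply]
  congr 1
  have h1 : (mfderiv ((𝓡 (2 * m - 1)).prod 𝓘(ℝ, ℝ)) (𝓡 (2 * m - 1)) (Prod.fst : fold σ × ℝ → fold σ)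
      ((extChartAt (𝓡 (2 * m - 1)) z₀).symm y, t)
      (liftEquiv (chartEquiv (𝓡 (2 * m - 1)) z₀ hy) (v 0)) : EuclideanSpace ℝ (Fin (2 * m - 1))) =
      chartEquiv (𝓡 (2 * m - 1)) z₀ hy (v 0).1 := by
    rw [mfderiv_fst]; rfl
  rw [h1]
  have h2 : ((chartEquiv (𝓡 (2 * m - 1)) z₀ hy (v 0).1, (v 0).2) :
      EuclideanSpace ℝ (Fin (2 * m - 1)) × ℝ) = (chartEquiv (𝓡 (2 * m - 1)) z₀ hy (v 0).1, 0) +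
        (0, (v 0).2) := by simp
  change _ = nullOneForm (asFamily (collarForm σ W)) ((extChartAt (𝓡 (2 * m - 1)) z₀).symm y)
    (chartEquiv (𝓡 (2 * m - 1)) z₀ hy (v 0).1, (v 0).2)
  rw [h2, map_add, nullOneForm_vert, add_zero]

/-- The collar form in product charts satisfies the hypotheses of the Moser argument. -/
theorem exists_moserData (hσ : IsFoldedSymplectic σ)
    (hZ : Manifold.IsSmoothEmbedding (𝓡 (2 * m - 1)) (𝓡 (2 * m)) ∞ (Subtype.val : fold σ → M))
    (hW : ContMDiff (𝓡 (2 * m)) (𝓡 (2 * m)).tangent ∞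
      (fun x => (⟨x, W x⟩ : TangentBundle (𝓡 (2 * m)) M)))
    (hWk : ∀ z : fold σ, W z ∈ formKer σ (z : M)) (z₀ : fold σ)
    {y₀ : EuclideanSpace ℝ (Fin (2 * m - 1))}
    (hy₀ : y₀ ∈ (extChartAt (𝓡 (2 * m - 1)) z₀).target) :
    ∃ (U : Set (EuclideanSpace ℝ (Fin (2 * m - 1)))) (ε : ℝ), y₀ ∈ U ∧
      U ⊆ (extChartAt (𝓡 (2 * m - 1)) z₀).target ∧
      (∀ q : fold σ × ℝ, q.1 ∈ (extChartAt (𝓡 (2 * m - 1)) z₀).source →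
        extChartAt (𝓡 (2 * m - 1)) z₀ q.1 ∈ U → q.2 ∈ Ioo (-ε) ε →
        ContMDiffAt ((𝓡 (2 * m - 1)).prod 𝓘(ℝ, ℝ)) (𝓡 (2 * m)) ∞
          (collarMap (𝓡 (2 * m)) (Subtype.val : fold σ → M) W) q) ∧
      MoserData U ε (inChart ((z₀, (0 : ℝ)) : fold σ × ℝ) (modelForm σ (foldOneForm σ W)))
        (inChart ((z₀, (0 : ℝ)) : fold σ × ℝ) (collarForm σ W)) := by
  set eZ := extChartAt (𝓡 (2 * m - 1)) z₀ with heZ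
  set ψ := inChart ((z₀, (0 : ℝ)) : fold σ × ℝ) (collarForm σ W) with hψ
  set ch := extChartAt ((𝓡 (2 * m - 1)).prod 𝓘(ℝ, ℝ)) ((z₀, (0 : ℝ)) : fold σ × ℝ) with hch
  have hchs : ∀ p, ch.symm p = (eZ.symm p.1, p.2) := extChartAt_prod_symm_apply z₀ 0
  have hcht : ch.target = eZ.target ×ˢ univ := extChartAt_prod_target z₀ 0
  obtain ⟨⟨O, hO, hzO, hOs⟩, -⟩ :=
    exists_contMDiffOn_collarMap (I := 𝓡 (2 * m - 1)) hW hZ.contMDiff (eZ.symm y₀)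
  have hOp : IsOpen (ch.target ∩ ch.symm ⁻¹' O) :=
    (continuousOn_extChartAt_symm _).isOpen_inter_preimage (isOpen_extChartAt_target _) hO
  obtain ⟨r, hr, hrO⟩ := Metric.isOpen_iff.1 hOp (y₀, 0) ⟨by rw [hcht]; exact ⟨hy₀, mem_univ _⟩, by
    change ch.symm (y₀, 0) ∈ O
    rw [hchs]; exact hzO⟩
  have hrO' : ∀ y ∈ Metric.ball y₀ r, ∀ t ∈ Ioo (-r) r, y ∈ eZ.target ∧ (eZ.symm y, t) ∈ O := by
    intro y hy t ht
    have h1 : (y, t) ∈ Metric.ball (y₀, (0 : ℝ)) r := by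
      rw [← ball_prod_same]
      refine ⟨hy, ?_⟩
      rw [Real.ball_eq_Ioo]; simpa using ht
    obtain ⟨h2, h3⟩ := hrO h1
    rw [hcht] at h2
    refine ⟨h2.1, ?_⟩
    have h4 : ch.symm (y, t) ∈ O := h3
    rwa [hchs] at h4
  have hsm : ∀ q ∈ Metric.ball y₀ r ×ˢ Ioo (-r) r, q ∈ ch.target ∧
      ContMDiffAt ((𝓡 (2 * m - 1)).prod 𝓘(ℝ, ℝ)) (𝓡 (2 * m)) ∞
        (collarMap (𝓡 (2 * m)) (Subtype.val : fold σ → M) W) (ch.symm q) := by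
    rintro ⟨y, t⟩ ⟨hy, ht⟩
    obtain ⟨h1, h2⟩ := hrO' y hy t ht
    refine ⟨by rw [hcht]; exact ⟨h1, mem_univ _⟩, ?_⟩
    rw [hchs]
    exact hOs.contMDiffAt (hO.mem_nhds h2)
  have hzero : ∀ y ∈ eZ.target, ∀ u v : EuclideanSpace ℝ (Fin (2 * m - 1)) × ℝ, ψ (y, 0) ![u, v] =
      restrictFold σ (eZ.symm y) ![(mfderiv 𝓘(ℝ, EuclideanSpace ℝ (Fin (2 * m - 1)))
        (𝓡 (2 * m - 1)) eZ.symm y u.1), (mfderiv 𝓘(ℝ, EuclideanSpace ℝ (Fin (2 * m - 1)))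
        (𝓡 (2 * m - 1)) eZ.symm y v.1)] := fun y hy u v =>
    (inChart_asFamily (collarForm σ W) z₀ hy 0 u v).trans (collarForm_zero hZ hW hWk _ _ _)
  -- First the data with the model written directly in chart terms. This provides the smoothness of
  -- α needed to compute the exterior derivative of t² p^*α in the chart and to identify the model
  -- with the expression of `modelForm`.
  have d₀ : MoserData (Metric.ball y₀ r) r (fun q => (ψ (q.1, 0)).compContinuousLinearMap
      (projZero (EuclideanSpace ℝ (Fin (2 * m - 1)))) +
      extDeriv (fun x => oneForm _ (x.2 ^ 2 • nullOneForm ψ x.1)) q) ψ :=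
    { isOpen := Metric.isOpen_ball
      pos := hr
      smooth := fun q hq =>
        (contDiffAt_inChart_pullback hσ.smooth (hsm q hq).1 (hsm q hq).2).contDiffWithinAt
      closed := fun q hq => extDeriv_inChart_pullback hσ.smooth hσ.closed (hsm q hq).1 (hsm q hq).2
      ker := fun y hy w => by
        have hyt := (hrO' y hy 0 (by simpa using hr)).1
        rw [hzero y hyt]
        have h1 : ((mfderiv 𝓘(ℝ, EuclideanSpace ℝ (Fin (2 * m - 1))) (𝓡 (2 * m - 1)) eZ.symm y
          (0 : EuclideanSpace ℝ (Fin (2 * m - 1)))) : EuclideanSpace ℝ (Fin (2 * m - 1))) = 0 :=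
          map_zero _
        exact (restrictFold σ (eZ.symm y)).map_coord_zero (0 : Fin 2) h1
      model := fun q _ => rfl }
  refine ⟨Metric.ball y₀ r, r, Metric.mem_ball_self hr,
    fun y hy => (hrO' y hy 0 (by simpa using hr)).1, fun q hq hqU ht => ?_, ?_⟩
  · have := (hrO' _ hqU _ ht).2
    rw [eZ.left_inv hq] at this
    exact hOs.contMDiffAt (hO.mem_nhds this)
  · refine { d₀ with model := ?_ }
    rintro ⟨y, t⟩ hq
    have hyt := (hrO' y hq.1 t hq.2).1
    set η : DForm ((𝓡 (2 * m - 1)).prod 𝓘(ℝ, ℝ)) (fold σ × ℝ) 1 := fun q : fold σ × ℝ => q.2 ^ 2 •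
      pullback ((𝓡 (2 * m - 1)).prod 𝓘(ℝ, ℝ)) (Prod.fst : fold σ × ℝ → fold σ)
        (foldOneForm σ W) q with hη
    have hev : inChart ((z₀, (0 : ℝ)) : fold σ × ℝ) η =ᶠ[𝓝 (y, t)]
        fun x => oneForm _ (x.2 ^ 2 • nullOneForm ψ x.1) := by
      have h1 : ∀ᶠ x in 𝓝 (y, t), x ∈ eZ.target ×ˢ (univ : Set ℝ) :=
        ((isOpen_extChartAt_target z₀).prod isOpen_univ).mem_nhds ⟨hyt, mem_univ _⟩
      filter_upwards [h1] with x hx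
      exact inChart_sq_smul z₀ hx.1 x.2
    have hdiff : DifferentiableAt ℝ (inChart ((z₀, (0 : ℝ)) : fold σ × ℝ) η) (y, t) := by
      refine DifferentiableAt.congr_of_eventuallyEq ?_ hev
      have h1 : ContDiffAt ℝ ∞ (fun x : EuclideanSpace ℝ (Fin (2 * m - 1)) × ℝ =>
          x.2 ^ 2 • nullOneForm ψ x.1) (y, t) :=
        (contDiffAt_snd.pow 2).smul (d₀.contDiffOn_nullOneForm.contDiffAt (d₀.isOpen_prod.mem_nhds hq))
      exact (oneForm _).differentiableAt.comp (y, t) (h1.differentiableAt (by simp))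
    have hyT : (y, t) ∈ ch.target := by rw [hcht]; exact ⟨hyt, mem_univ _⟩
    refine (inChart_add _ _ _ _).trans (congrArg₂ (· + ·) ?_ ?_)
    · refine ContinuousAlternatingMap.ext fun v => ?_
      refine (inChart_prod_apply _ z₀ 0 hyt t v).trans ?_
      have h2 := hzero y hyt (projZero _ (v 0)) (projZero _ (v 1))
      have h3 : ψ (y, 0) ![projZero _ (v 0), projZero _ (v 1)] =
          (ψ (y, 0)).compContinuousLinearMap (projZero _) v := by
        rw [ContinuousAlternatingMap.compContinuousLinearMap_apply]
        refine congrArg (ψ (y, 0)) (funext fun i => ?_)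
        fin_cases i <;> rfl
      refine Eq.trans ?_ (h2.symm.trans h3)
      refine congrArg (restrictFold σ (eZ.symm y)) (funext fun i => ?_)
      have h4 : ∀ u : EuclideanSpace ℝ (Fin (2 * m - 1)) × ℝ,
          (mfderiv ((𝓡 (2 * m - 1)).prod 𝓘(ℝ, ℝ)) (𝓡 (2 * m - 1)) (Prod.fst : fold σ × ℝ → fold σ)
            (eZ.symm y, t) (liftEquiv (chartEquiv (𝓡 (2 * m - 1)) z₀ hyt) u) :
              EuclideanSpace ℝ (Fin (2 * m - 1))) = chartEquiv (𝓡 (2 * m - 1)) z₀ hyt u.1 := by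
        intro u; rw [mfderiv_fst]; rfl
      fin_cases i
      · exact h4 (v 0)
      · exact h4 (v 1)
    · exact (inChart_extD hyT hdiff).trans hev.extDeriv_eq

end CollarForm

end

end FoldedSymplectic

namespace FoldedSymplectic

/-! ### The one-form α on the null line -/

section

open Set Filter Bundle

/-- Differentiate s(Φ)(∂ₜΦ, ∂ᵤΦ) in t at t = 0. The terms with second derivatives of Φ vanish
because both first derivatives lie in the kernel of s, leaving the derivative of s along ∂ₜΦ. -/
theorem nullOneForm_pullback_apply {V E : Type*} [NormedAddCommGroup V] [NormedSpace ℝ V]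
    [NormedAddCommGroup E] [NormedSpace ℝ E] {Φ : V × ℝ → E} {s : E → E [⋀^Fin 2]→L[ℝ] ℝ} {y : V}
    {ψ : V × ℝ → (V × ℝ) [⋀^Fin 2]→L[ℝ] ℝ} (hΦ : ContDiffAt ℝ ∞ Φ (y, 0))
    (hs : ContDiffAt ℝ ∞ s (Φ (y, 0)))
    (hψ : ψ =ᶠ[𝓝 (y, 0)] fun q => (s (Φ q)).compContinuousLinearMap (fderiv ℝ Φ q)) {u : V}
    (ha : ∀ c, s (Φ (y, 0)) ![fderiv ℝ Φ (y, 0) (0, 1), c] = 0)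
    (hb : ∀ c, s (Φ (y, 0)) ![fderiv ℝ Φ (y, 0) (u, 0), c] = 0) :
    nullOneForm ψ y (u, 0) = 2⁻¹ * fderiv ℝ (fun x => toBilin E (s x)) (Φ (y, 0))
      (fderiv ℝ Φ (y, 0) (0, 1)) (fderiv ℝ Φ (y, 0) (0, 1)) (fderiv ℝ Φ (y, 0) (u, 0)) := by
  have hγ : HasDerivAt (fun t : ℝ => (y, t)) ((0 : V), (1 : ℝ)) 0 :=
    (hasDerivAt_const 0 y).prodMk (hasDerivAt_id 0)
  have hγc : Tendsto (fun t : ℝ => (y, t)) (𝓝 0) (𝓝 (y, 0)) := hγ.continuousAt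
  have hD : ContDiffAt ℝ ∞ (fderiv ℝ Φ) (y, 0) := hΦ.fderiv_right (by simp)
  have hψs : ContDiffAt ℝ ∞ ψ (y, 0) :=
    (contDiffAt_twoForm_comp (ContDiffAt.comp (g := s) (y, 0) hs hΦ) hD).congr_of_eventuallyEq hψ
  have hT : DifferentiableAt ℝ (tContract ψ) (y, 0) :=
    ((contDiff_toBilin.contDiffAt.comp (y, 0) hψs).clm_apply contDiffAt_const).differentiableAt
      (by simp)
  have hT1 : HasDerivAt (fun t : ℝ => tContract ψ (y, t)) (fderiv ℝ (tContract ψ) (y, 0) (0, 1)) 0 :=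
    HasFDerivAt.comp_hasDerivAt (l := tContract ψ) (f := fun t : ℝ => (y, t)) 0 hT.hasFDerivAt hγ
  have hT2 : HasDerivAt (fun t : ℝ => tContract ψ (y, t) (u, 0))
      (deriv (fun t : ℝ => tContract ψ (y, t)) 0 (u, 0)) 0 := by
    have h := hT1.clm_apply (hasDerivAt_const (0 : ℝ) ((u, 0) : V × ℝ))
    rw [map_zero, add_zero] at h
    rw [hT1.deriv]; exact h
  have hD1 : HasDerivAt (fun t : ℝ => fderiv ℝ Φ (y, t)) (fderiv ℝ (fderiv ℝ Φ) (y, 0) (0, 1)) 0 :=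
    HasFDerivAt.comp_hasDerivAt (l := fderiv ℝ Φ) (f := fun t : ℝ => (y, t)) 0
      (hD.differentiableAt (by simp)).hasFDerivAt hγ
  have hDv : ∀ v : V × ℝ, HasDerivAt (fun t : ℝ => fderiv ℝ Φ (y, t) v)
      (fderiv ℝ (fderiv ℝ Φ) (y, 0) (0, 1) v) 0 := fun v => by
    have h := hD1.clm_apply (hasDerivAt_const (0 : ℝ) v)
    rw [map_zero, add_zero] at h
    exact h
  have hΦ1 : HasDerivAt (fun t : ℝ => Φ (y, t)) (fderiv ℝ Φ (y, 0) (0, 1)) 0 :=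
    HasFDerivAt.comp_hasDerivAt (l := Φ) (f := fun t : ℝ => (y, t)) 0
      (hΦ.differentiableAt (by simp)).hasFDerivAt hγ
  have hB : HasDerivAt (fun t : ℝ => toBilin E (s (Φ (y, t))))
      (fderiv ℝ (fun x => toBilin E (s x)) (Φ (y, 0)) (fderiv ℝ Φ (y, 0) (0, 1))) 0 :=
    HasFDerivAt.comp_hasDerivAt (l := fun x => toBilin E (s x)) (f := fun t : ℝ => Φ (y, t)) 0
      ((contDiffAt_twoForm_iff.1 hs).differentiableAt (by simp)).hasFDerivAt hΦ1
  have h1 := (hB.clm_apply (hDv (0, 1))).clm_apply (hDv (u, 0))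
  have h2 : (fun t : ℝ => tContract ψ (y, t) (u, 0)) =ᶠ[𝓝 0] fun t =>
      toBilin E (s (Φ (y, t))) (fderiv ℝ Φ (y, t) (0, 1)) (fderiv ℝ Φ (y, t) (u, 0)) := by
    filter_upwards [hγc.eventually hψ] with t ht
    change toBilin _ (ψ (y, t)) (0, 1) (u, 0) = _
    rw [toBilin_apply, ht, comp_form_apply, toBilin_apply]
  have h3 := hT2.unique (h1.congr_of_eventuallyEq h2)
  have hz : ∀ c, toBilin E (s (Φ (y, 0))) c (fderiv ℝ Φ (y, 0) (u, 0)) = 0 := fun c => by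
    rw [toBilin_apply, form_swap, hb, neg_zero]
  have hz' : ∀ c, toBilin E (s (Φ (y, 0))) (fderiv ℝ Φ (y, 0) (0, 1)) c = 0 := fun c => by
    rw [toBilin_apply, ha]
  have h4 : nullOneForm ψ y (u, 0) = 2⁻¹ * deriv (fun t : ℝ => tContract ψ (y, t)) 0 (u, 0) := rfl
  rw [h4, h3, add_apply, hz, hz', add_zero, add_zero]

theorem fderiv_inCharts_self {E E' H H' M N : Type*} [NormedAddCommGroup E] [NormedSpace ℝ E]
    [TopologicalSpace H] [NormedAddCommGroup E'] [NormedSpace ℝ E'] [TopologicalSpace H']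
    {I : ModelWithCorners ℝ E H} {I' : ModelWithCorners ℝ E' H'} [I.Boundaryless]
    [TopologicalSpace M] [ChartedSpace H M] [TopologicalSpace N] [ChartedSpace H' N]
    {f : M → N} {x : M} {y : N} (hf : MDifferentiableAt I I' f x) (h : f x = y) (v : E) :
    fderiv ℝ (inCharts I I' x y f) (extChartAt I x x) v = (mfderiv I I' f x v : E') := by
  subst h
  rw [hf.mfderiv, I.range_eq_univ, fderivWithin_univ]
  rfl

section CollarForm

variable {m : ℕ} {M : Type*} [TopologicalSpace M] [ChartedSpace (EuclideanSpace ℝ (Fin (2 * m))) M]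
  [IsManifold (𝓡 (2 * m)) ∞ M] {σ : DForm (𝓡 (2 * m)) M 2}
  [ChartedSpace (EuclideanSpace ℝ (Fin (2 * m - 1))) (fold σ)]
  [IsManifold (𝓡 (2 * m - 1)) ∞ (fold σ)] [T2Space M] {W : ∀ x : M, TangentSpace (𝓡 (2 * m)) x}

theorem isSmooth_foldOneForm (hσ : IsFoldedSymplectic σ)
    (hZ : Manifold.IsSmoothEmbedding (𝓡 (2 * m - 1)) (𝓡 (2 * m)) ∞ (Subtype.val : fold σ → M))
    (hW : ContMDiff (𝓡 (2 * m)) (𝓡 (2 * m)).tangent ∞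
      (fun x => (⟨x, W x⟩ : TangentBundle (𝓡 (2 * m)) M)))
    (hWk : ∀ z : fold σ, W z ∈ formKer σ (z : M)) : IsSmooth (foldOneForm σ W) := by
  intro z₀ y hy
  obtain ⟨U, ε, hyU, hUt, -, d⟩ := exists_moserData hσ hZ hW hWk z₀ hy
  refine ContDiffAt.contDiffWithinAt ?_
  have h1 := d.contDiffOn_nullOneForm.contDiffAt (d.isOpen_prod.mem_nhds (d.mem_zero hyU))
  have h2 : ContDiffAt ℝ ∞ (fun y => nullOneForm
      (inChart ((z₀, (0 : ℝ)) : fold σ × ℝ) (collarForm σ W)) y) y :=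
    ContDiffAt.comp (g := fun q : EuclideanSpace ℝ (Fin (2 * m - 1)) × ℝ => nullOneForm
      (inChart ((z₀, (0 : ℝ)) : fold σ × ℝ) (collarForm σ W)) q.1) (f := fun y => (y, (0 : ℝ))) y h1
      (contDiffAt_id.prodMk contDiffAt_const)
  have h3 := contDiff_oneForm.contDiffAt.comp y (h2.clm_comp
    (contDiffAt_const (c := ContinuousLinearMap.inl ℝ (EuclideanSpace ℝ (Fin (2 * m - 1))) ℝ)))
  refine h3.congr_of_eventuallyEq ?_
  filter_upwards [(isOpen_extChartAt_target z₀).mem_nhds hy] with y' hy'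
  exact inChart_foldOneForm z₀ hy'

theorem foldOneForm_eq_nullOneForm (z : fold σ) (u : EuclideanSpace ℝ (Fin (2 * m - 1))) :
    (foldOneForm σ W z : EuclideanSpace ℝ (Fin (2 * m - 1)) [⋀^Fin 1]→L[ℝ] ℝ) ![u] =
      nullOneForm (inChart ((z, (0 : ℝ)) : fold σ × ℝ) (collarForm σ W))
        (extChartAt (𝓡 (2 * m - 1)) z z) (u, 0) :=
  (inChart_self (foldOneForm σ W) z ![u]).symm.trans
    (DFunLike.congr_fun (inChart_foldOneForm z (mem_extChartAt_target z)) ![u])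

/-- Here the t-derivative of the collar map is W and its u-derivative is the null vector; both lie
in ker σ, so only the derivative of σ along W contributes. -/
theorem foldOneForm_apply (hσ : IsFoldedSymplectic σ)
    (hZ : Manifold.IsSmoothEmbedding (𝓡 (2 * m - 1)) (𝓡 (2 * m)) ∞ (Subtype.val : fold σ → M))
    (hW : ContMDiff (𝓡 (2 * m)) (𝓡 (2 * m)).tangent ∞
      (fun x => (⟨x, W x⟩ : TangentBundle (𝓡 (2 * m)) M)))
    (hWk : ∀ z : fold σ, W z ∈ formKer σ (z : M)) (z : fold σ)
    {u : TangentSpace (𝓡 (2 * m - 1)) z} (hu : u ∈ nullFibre σ z) :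
    foldOneForm σ W z ![u] = 2⁻¹ * formDiff σ (z : M) (W z) (dIncl σ z u) (W z) := by
  have hM1 : IsManifold (𝓡 (2 * m)) 1 M := .of_le (n := ∞) (by simp)
  set κ := collarMap (𝓡 (2 * m)) (Subtype.val : fold σ → M) W with hκ
  set eZ := extChartAt (𝓡 (2 * m - 1)) z with heZ
  set J := (𝓡 (2 * m - 1)).prod 𝓘(ℝ, ℝ) with hJ
  have hyt : eZ z ∈ eZ.target := mem_extChartAt_target z
  have hyT : (eZ z, (0 : ℝ)) ∈ (extChartAt J ((z, (0 : ℝ)) : fold σ × ℝ)).target := by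
    rw [extChartAt_prod_target]; exact ⟨hyt, mem_univ _⟩
  have hsy : (extChartAt J ((z, (0 : ℝ)) : fold σ × ℝ)).symm (eZ z, 0) = (z, 0) := by
    rw [extChartAt_prod_symm_apply]
    exact congrArg (fun z => (z, (0 : ℝ))) (extChartAt_to_inv z)
  obtain ⟨⟨O, hO, hzO, hOs⟩, hd⟩ :=
    exists_contMDiffOn_collarMap (I := 𝓡 (2 * m - 1)) hW hZ.contMDiff z
  have hκs : ContMDiffAt J (𝓡 (2 * m)) ∞ κ
      ((extChartAt J ((z, (0 : ℝ)) : fold σ × ℝ)).symm (eZ z, 0)) := by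
    rw [hsy]; exact hOs.contMDiffAt (hO.mem_nhds hzO)
  have hκ0 : κ ((extChartAt J ((z, (0 : ℝ)) : fold σ × ℝ)).symm (eZ z, 0)) = z := by
    rw [hsy]; exact collarMap_zero hW z
  have hκy : κ ((extChartAt J ((z, (0 : ℝ)) : fold σ × ℝ)).symm (eZ z, 0)) ∈
      (extChartAt (𝓡 (2 * m)) (z : M)).source := by
    rw [hκ0]; exact mem_extChartAt_source (z : M)
  set Φ := inCharts J (𝓡 (2 * m)) ((z, (0 : ℝ)) : fold σ × ℝ) (z : M) κ with hΦ
  have hΦ0 : Φ (eZ z, 0) = extChartAt (𝓡 (2 * m)) (z : M) z := congrArg _ hκ0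
  have hΦd : ∀ v : EuclideanSpace ℝ (Fin (2 * m - 1)) × ℝ, fderiv ℝ Φ (eZ z, 0) v =
      ((dIncl σ z v.1 : EuclideanSpace ℝ (Fin (2 * m))) +
        v.2 • (W z : EuclideanSpace ℝ (Fin (2 * m)))) := by
    intro v
    rw [hsy] at hκs
    have h := fderiv_inCharts_self (hκs.mdifferentiableAt (by simp)) (collarMap_zero hW z) v
    rw [extChartAt_prod_apply] at h
    exact h.trans (hd v.1 v.2)
  have hev : inChart ((z, (0 : ℝ)) : fold σ × ℝ) (collarForm σ W) =ᶠ[𝓝 (eZ z, 0)] fun q =>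
      (inChart (z : M) σ (Φ q)).compContinuousLinearMap (fderiv ℝ Φ q) := by
    filter_upwards [eventually_pullback_chart hyT hκs hκy] with q hq
    exact inChart_pullback hq.1 hq.2.1 hq.2.2
  have hker : ∀ k : TangentSpace (𝓡 (2 * m)) (z : M), k ∈ formKer σ (z : M) →
      ∀ c : EuclideanSpace ℝ (Fin (2 * m)), inChart (z : M) σ (Φ (eZ z, 0)) ![k, c] = 0 := by
    intro k hk c
    rw [hΦ0]
    exact (inChart_self σ (z : M) _).trans (hk c)
  have hv1 : fderiv ℝ Φ (eZ z, 0) (0, 1) = W z :=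
    (hΦd (0, 1)).trans ((congrArg₂ (· + ·) (map_zero (dIncl σ z)) (one_smul ℝ (W z))).trans
      (zero_add _))
  have hvu : fderiv ℝ Φ (eZ z, 0) (u, 0) = dIncl σ z u :=
    (hΦd (u, 0)).trans ((congrArg₂ (· + ·) rfl (zero_smul ℝ (W z))).trans (add_zero _))
  have h1 := nullOneForm_pullback_apply (contDiffAt_inCharts hyT hκs hκy)
    (hσ.smooth.contDiffAt (x₀ := (z : M)) (y := Φ (eZ z, 0)) (by
      rw [hΦ0]; exact mem_extChartAt_target (z : M))) hev (u := u)
    (fun c => by rw [hv1]; exact hker _ (hWk z) c) (fun c => by rw [hvu]; exact hker _ hu c)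
  have h2 := foldOneForm_eq_nullOneForm (W := W) z u
  have h3 : fderiv ℝ (fun y => toBilin _ (inChart (z : M) σ y)) (Φ (eZ z, 0)) =
      fderiv ℝ (fun y => toBilin _ (inChart (z : M) σ y)) (extChartAt (𝓡 (2 * m)) (z : M) z) :=
    congrArg _ hΦ0
  refine h2.trans ?_
  rw [h1, hv1, hvu]
  exact congrArg (2⁻¹ * ·) ((DFunLike.congr_fun (DFunLike.congr_fun (DFunLike.congr_fun h3 (W z))
    (W z)) (dIncl σ z u)).trans (formDiff_eq hσ.smooth (z : M) (W z) (dIncl σ z u) (W z)).symm)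

end CollarForm

end

end FoldedSymplectic

namespace FoldedSymplectic

section

open Set Filter Bundle

/-! ### Differentials of equivariant maps -/

section Equivariance

variable {E E' H H' M N : Type*} [NormedAddCommGroup E] [NormedSpace ℝ E]
  [TopologicalSpace H] [NormedAddCommGroup E'] [NormedSpace ℝ E'] [TopologicalSpace H']
  {I : ModelWithCorners ℝ E H} {I' : ModelWithCorners ℝ E' H'}
  [TopologicalSpace M] [ChartedSpace H M] [TopologicalSpace N] [ChartedSpace H' N]

theorem mfderiv_comp_eq_self {f : M → N} {g : N → M} {x : M} {y : N} (hxy : f x = y)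
    (hf : MDifferentiableAt I I' f x) (hg : MDifferentiableAt I' I g y) (h : ∀ x, g (f x) = x)
    (v : E) : (mfderiv I' I g y (mfderiv I I' f x v : E') : E) = v := by
  subst hxy
  have h1 := mfderiv_comp x hg hf
  have h2 : g ∘ f = id := funext h
  rw [h2, mfderiv_id] at h1
  exact (DFunLike.congr_fun h1 v).symm

/-- Where κ is differentiable this is the chain rule. Otherwise κ is not differentiable at the
translated point either, and both sides are zero by default. -/
theorem mfderiv_equivariant {κ : N → M} {T T' : N → N} {S S' : M → M}
    (hT : MDifferentiable I' I' T) (hT' : MDifferentiable I' I' T')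
    (hS : MDifferentiable I I S) (hS' : MDifferentiable I I S')
    (hTT : ∀ q, T (T' q) = q) (hTT' : ∀ q, T' (T q) = q) (hSS : ∀ x, S' (S x) = x)
    (h : ∀ q, κ (T q) = S (κ q)) (q : N) (v : E') :
    (mfderiv I' I κ (T q) (mfderiv I' I' T q v : E') : E) =
      (mfderiv I I S (κ q) (mfderiv I' I κ q v : E) : E) := by
  by_cases hκ : MDifferentiableAt I' I κ q
  · have h1 : MDifferentiableAt I' I κ (T q) := by
      have e : κ = fun p => S (κ (T' p)) := funext fun p => by rw [← h, hTT]
      rw [e]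
      refine (hS _).comp (T q) (MDifferentiableAt.comp (T q) ?_ (hT' (T q)))
      rwa [hTT']
    have h2 := mfderiv_comp q h1 (hT q)
    have h3 := mfderiv_comp q (hS (κ q)) hκ
    have h4 : κ ∘ T = S ∘ κ := funext h
    rw [h4] at h2
    exact (DFunLike.congr_fun h2 v).symm.trans (DFunLike.congr_fun h3 v)
  · have h1 : ¬ MDifferentiableAt I' I κ (T q) := fun h1 => hκ <| by
      have e : κ = fun p => S' (κ (T p)) := funext fun p => by rw [h, hSS]
      rw [e]
      exact (hS' _).comp q (h1.comp q (hT q))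
    rw [mfderiv_zero_of_not_mdifferentiableAt hκ, mfderiv_zero_of_not_mdifferentiableAt h1]
    exact (map_zero (mfderiv I I S (κ q))).symm

end Equivariance

/-! ### Invariance of the collar form, of α and of the model -/

section Fold

variable {m : ℕ} {M : Type*} [TopologicalSpace M] [ChartedSpace (EuclideanSpace ℝ (Fin (2 * m))) M]
  [IsManifold (𝓡 (2 * m)) ∞ M] {G : Type*} [Group G] [MulAction G M] {σ : DForm (𝓡 (2 * m)) M 2}

theorem foldAct_foldAct (h : IsInvariant G σ) (g g' : G) (z : fold σ) :
    foldAct h g (foldAct h g' z) = foldAct h (g * g') z :=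
  Subtype.ext (smul_smul g g' (z : M))

theorem foldAct_one (h : IsInvariant G σ) (z : fold σ) : foldAct h (1 : G) z = z :=
  Subtype.ext (one_smul G (z : M))

theorem foldAct_inv_foldAct (h : IsInvariant G σ) (g : G) (z : fold σ) :
    foldAct h g⁻¹ (foldAct h g z) = z :=
  Subtype.ext (inv_smul_smul g (z : M))

theorem foldAct_foldAct_inv (h : IsInvariant G σ) (g : G) (z : fold σ) :
    foldAct h g (foldAct h g⁻¹ z) = z :=
  Subtype.ext (smul_inv_smul g (z : M))

/-- The action on `Z × ℝ`. -/
def prodAct (h : IsInvariant G σ) (g : G) (q : fold σ × ℝ) : fold σ × ℝ := (foldAct h g q.1, q.2)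

theorem prodAct_inv_prodAct (h : IsInvariant G σ) (g : G) (q : fold σ × ℝ) :
    prodAct h g⁻¹ (prodAct h g q) = q :=
  Prod.ext (foldAct_inv_foldAct h g q.1) rfl

theorem prodAct_prodAct_inv (h : IsInvariant G σ) (g : G) (q : fold σ × ℝ) :
    prodAct h g (prodAct h g⁻¹ q) = q :=
  Prod.ext (foldAct_foldAct_inv h g q.1) rfl

variable [ChartedSpace (EuclideanSpace ℝ (Fin (2 * m - 1))) (fold σ)]
  [IsManifold (𝓡 (2 * m - 1)) ∞ (fold σ)]

/-- The differential of the action on the fold. -/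
def foldActEquiv (hs : ∀ g : G, ContMDiff (𝓡 (2 * m)) (𝓡 (2 * m)) ∞ (fun x : M => g • x))
    (hZ : Manifold.IsSmoothEmbedding (𝓡 (2 * m - 1)) (𝓡 (2 * m)) ∞ (Subtype.val : fold σ → M))
    (h : IsInvariant G σ) (g : G) (z : fold σ) :
    EuclideanSpace ℝ (Fin (2 * m - 1)) ≃L[ℝ] EuclideanSpace ℝ (Fin (2 * m - 1)) :=
  ContinuousLinearEquiv.equivOfInverse
    (mfderiv (𝓡 (2 * m - 1)) (𝓡 (2 * m - 1)) (foldAct h g) z :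
      EuclideanSpace ℝ (Fin (2 * m - 1)) →L[ℝ] EuclideanSpace ℝ (Fin (2 * m - 1)))
    (mfderiv (𝓡 (2 * m - 1)) (𝓡 (2 * m - 1)) (foldAct h g⁻¹) (foldAct h g z) :
      EuclideanSpace ℝ (Fin (2 * m - 1)) →L[ℝ] EuclideanSpace ℝ (Fin (2 * m - 1)))
    (mfderiv_comp_eq_self rfl ((contMDiff_foldAct hs hZ h g).mdifferentiableAt (by simp))
      ((contMDiff_foldAct hs hZ h g⁻¹).mdifferentiableAt (by simp)) (foldAct_inv_foldAct h g))
    (mfderiv_comp_eq_self (foldAct_inv_foldAct h g z)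
      ((contMDiff_foldAct hs hZ h g⁻¹).mdifferentiableAt (by simp))
      ((contMDiff_foldAct hs hZ h g).mdifferentiableAt (by simp)) (foldAct_foldAct_inv h g))

theorem contMDiff_prodAct (hs : ∀ g : G, ContMDiff (𝓡 (2 * m)) (𝓡 (2 * m)) ∞ (fun x : M => g • x))
    (hZ : Manifold.IsSmoothEmbedding (𝓡 (2 * m - 1)) (𝓡 (2 * m)) ∞ (Subtype.val : fold σ → M))
    (h : IsInvariant G σ) (g : G) :
    ContMDiff ((𝓡 (2 * m - 1)).prod 𝓘(ℝ, ℝ)) ((𝓡 (2 * m - 1)).prod 𝓘(ℝ, ℝ)) ∞ (prodAct h g) :=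
  ((contMDiff_foldAct hs hZ h g).comp contMDiff_fst).prodMk contMDiff_snd

theorem mfderiv_prodAct (hs : ∀ g : G, ContMDiff (𝓡 (2 * m)) (𝓡 (2 * m)) ∞ (fun x : M => g • x))
    (hZ : Manifold.IsSmoothEmbedding (𝓡 (2 * m - 1)) (𝓡 (2 * m)) ∞ (Subtype.val : fold σ → M))
    (h : IsInvariant G σ) (g : G) (q : fold σ × ℝ) (v : EuclideanSpace ℝ (Fin (2 * m - 1)) × ℝ) :
    (mfderiv ((𝓡 (2 * m - 1)).prod 𝓘(ℝ, ℝ)) ((𝓡 (2 * m - 1)).prod 𝓘(ℝ, ℝ)) (prodAct h g) q v :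
      EuclideanSpace ℝ (Fin (2 * m - 1)) × ℝ) = liftEquiv (foldActEquiv hs hZ h g q.1) v := by
  have h1 := mfderiv_prodMap (p := q)
    ((contMDiff_foldAct hs hZ h g).mdifferentiableAt (x := q.1) (by simp))
    (mdifferentiableAt_id (I := 𝓘(ℝ, ℝ)) (x := q.2))
  have h2 : prodAct h g = Prod.map (foldAct h g) id := rfl
  rw [h2, h1, mfderiv_id]
  rfl

variable [T2Space M] {W : ∀ x : M, TangentSpace (𝓡 (2 * m)) x}

theorem collarMap_prodAct
    (hs : ∀ g : G, ContMDiff (𝓡 (2 * m)) (𝓡 (2 * m)) ∞ (fun x : M => g • x))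
    (h : IsInvariant G σ)
    (hW : ContMDiff (𝓡 (2 * m)) (𝓡 (2 * m)).tangent ∞
      (fun x => (⟨x, W x⟩ : TangentBundle (𝓡 (2 * m)) M)))
    (hWi : ∀ (g : G) (x : M), mfderiv (𝓡 (2 * m)) (𝓡 (2 * m)) (fun x : M => g • x) x (W x) =
      W (g • x)) (g : G) (q : fold σ × ℝ) :
    collarMap (𝓡 (2 * m)) (Subtype.val : fold σ → M) W (prodAct h g q) =
      g • collarMap (𝓡 (2 * m)) (Subtype.val : fold σ → M) W q :=
  collarMap_comp (j := (Subtype.val : fold σ → M)) (z := q.1) (z' := foldAct h g q.1)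
    (T := fun x : M => g • x) (T' := fun x : M => g⁻¹ • x) hW (hs g) (hs g⁻¹)
    (inv_smul_smul g) (hWi g) (hWi g⁻¹) rfl q.2

/-- Equivariance of the collar map combined with invariance of σ. It is phrased as a covariance
hypothesis, so that everything derived from the collar form is invariant at once. -/
theorem asFamily_collarForm_covariant
    (hs : ∀ g : G, ContMDiff (𝓡 (2 * m)) (𝓡 (2 * m)) ∞ (fun x : M => g • x))
    (hZ : Manifold.IsSmoothEmbedding (𝓡 (2 * m - 1)) (𝓡 (2 * m)) ∞ (Subtype.val : fold σ → M))
    (h : IsInvariant G σ)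
    (hW : ContMDiff (𝓡 (2 * m)) (𝓡 (2 * m)).tangent ∞
      (fun x => (⟨x, W x⟩ : TangentBundle (𝓡 (2 * m)) M)))
    (hWi : ∀ (g : G) (x : M), mfderiv (𝓡 (2 * m)) (𝓡 (2 * m)) (fun x : M => g • x) x (W x) =
      W (g • x)) (g : G) (z : fold σ) (t : ℝ) (u v : EuclideanSpace ℝ (Fin (2 * m - 1)) × ℝ) :
    asFamily (collarForm σ W) (z, t) ![u, v] = asFamily (collarForm σ W) (foldAct h g z, t)
      ![liftEquiv (foldActEquiv hs hZ h g z) u, liftEquiv (foldActEquiv hs hZ h g z) v] := by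
  set κ := collarMap (𝓡 (2 * m)) (Subtype.val : fold σ → M) W with hκ
  set J := (𝓡 (2 * m - 1)).prod 𝓘(ℝ, ℝ) with hJ
  have hd : ∀ v : EuclideanSpace ℝ (Fin (2 * m - 1)) × ℝ,
      (mfderiv J (𝓡 (2 * m)) κ (foldAct h g z, t) (liftEquiv (foldActEquiv hs hZ h g z) v) :
        EuclideanSpace ℝ (Fin (2 * m))) =
      (mfderiv (𝓡 (2 * m)) (𝓡 (2 * m)) (fun x : M => g • x) (κ (z, t))
        (mfderiv J (𝓡 (2 * m)) κ (z, t) v : EuclideanSpace ℝ (Fin (2 * m))) :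
          EuclideanSpace ℝ (Fin (2 * m))) := by
    intro v
    have h1 := mfderiv_equivariant (I := 𝓡 (2 * m)) (I' := J) (κ := κ) (T := prodAct h g)
      (T' := prodAct h g⁻¹)
      (S := fun x : M => g • x) (S' := fun x : M => g⁻¹ • x)
      ((contMDiff_prodAct hs hZ h g).mdifferentiable (by simp))
      ((contMDiff_prodAct hs hZ h g⁻¹).mdifferentiable (by simp))
      ((hs g).mdifferentiable (by simp)) ((hs g⁻¹).mdifferentiable (by simp))
      (prodAct_prodAct_inv h g) (prodAct_inv_prodAct h g) (inv_smul_smul g)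
      (collarMap_prodAct hs h hW hWi g) (z, t) v
    refine Eq.trans ?_ h1
    exact congrArg (mfderiv J (𝓡 (2 * m)) κ (foldAct h g z, t))
      (mfderiv_prodAct hs hZ h g (z, t) v).symm
  have h1 : σ (κ (z, t)) = pullback (𝓡 (2 * m)) (fun x : M => g • x) σ (κ (z, t)) :=
    (congrFun (h g) _).symm
  refine (pullback_apply _ _ _ _).trans (Eq.trans ?_ (pullback_apply _ _ _ _).symm)
  refine (DFunLike.congr_fun h1 _).trans ?_
  refine (pullback_apply _ _ _ _).trans ?_
  refine (form_congr (collarMap_prodAct hs h hW hWi g (z, t)).symm _).trans ?_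
  refine congrArg (σ (κ (foldAct h g z, t))) (funext fun i => ?_)
  fin_cases i
  · exact (hd u).symm
  · exact (hd v).symm

/-- α depends naturally on the collar form, which is covariant under the action. -/
theorem pullback_foldOneForm
    (hs : ∀ g : G, ContMDiff (𝓡 (2 * m)) (𝓡 (2 * m)) ∞ (fun x : M => g • x))
    (hZ : Manifold.IsSmoothEmbedding (𝓡 (2 * m - 1)) (𝓡 (2 * m)) ∞ (Subtype.val : fold σ → M))
    (h : IsInvariant G σ)
    (hW : ContMDiff (𝓡 (2 * m)) (𝓡 (2 * m)).tangent ∞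
      (fun x => (⟨x, W x⟩ : TangentBundle (𝓡 (2 * m)) M)))
    (hWi : ∀ (g : G) (x : M), mfderiv (𝓡 (2 * m)) (𝓡 (2 * m)) (fun x : M => g • x) x (W x) =
      W (g • x)) (g : G) :
    pullback (𝓡 (2 * m - 1)) (foldAct h g) (foldOneForm σ W) = foldOneForm σ W := by
  funext z
  refine ContinuousAlternatingMap.ext fun v => ?_
  have h1 := nullOneForm_covariant (b := foldAct h g z) (b' := z)
    (fun t u v => asFamily_collarForm_covariant hs hZ h hW hWi g z t u v)
  refine (pullback_apply _ _ _ _).trans ?_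
  refine Eq.trans ?_ (DFunLike.congr_fun h1 ((v 0 : EuclideanSpace ℝ (Fin (2 * m - 1))), 0)).symm
  rw [precompEquiv_apply]
  rfl

theorem restrictFold_covariant
    (hs : ∀ g : G, ContMDiff (𝓡 (2 * m)) (𝓡 (2 * m)) ∞ (fun x : M => g • x))
    (hZ : Manifold.IsSmoothEmbedding (𝓡 (2 * m - 1)) (𝓡 (2 * m)) ∞ (Subtype.val : fold σ → M))
    (h : IsInvariant G σ) (g : G) (z : fold σ) (u v : EuclideanSpace ℝ (Fin (2 * m - 1))) :
    restrictFold σ z ![u, v] = restrictFold σ (foldAct h g z)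
      ![foldActEquiv hs hZ h g z u, foldActEquiv hs hZ h g z v] := by
  refine (restrictFold_apply _ _ _).trans (Eq.trans ?_ (restrictFold_apply _ _ _).symm)
  refine (DFunLike.congr_fun (congrFun (h g) (z : M)) _).symm.trans ?_
  refine (pullback_apply _ _ _ _).trans ?_
  refine congrArg (σ (g • (z : M))) (funext fun i => ?_)
  fin_cases i
  · exact mfderiv_smul_dIncl hs hZ h g z u
  · exact mfderiv_smul_dIncl hs hZ h g z v

/-- The form `t² p^*α` on `Z × ℝ`. -/
def sqForm (α : DForm (𝓡 (2 * m - 1)) (fold σ) 1) :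
    DForm ((𝓡 (2 * m - 1)).prod 𝓘(ℝ, ℝ)) (fold σ × ℝ) 1 := fun q => q.2 ^ 2 •
  pullback ((𝓡 (2 * m - 1)).prod 𝓘(ℝ, ℝ)) (Prod.fst : fold σ × ℝ → fold σ) α q

theorem sqForm_apply (α : DForm (𝓡 (2 * m - 1)) (fold σ) 1) (z : fold σ) (t : ℝ)
    (v : Fin 1 → EuclideanSpace ℝ (Fin (2 * m - 1)) × ℝ) :
    sqForm α (z, t) v = t ^ 2 * α z ![(v 0).1] := by
  change t ^ 2 * α z _ = _
  refine congrArg (fun w => t ^ 2 * α z w) (funext fun i => ?_)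
  rw [mfderiv_fst, Subsingleton.elim i 0]
  rfl

theorem isSmooth_sqForm {α : DForm (𝓡 (2 * m - 1)) (fold σ) 1} (hα : IsSmooth α) :
    IsSmooth (sqForm α) := by
  rintro ⟨z₀, t₀⟩ ⟨y, t⟩ hy
  rw [extChartAt_prod_target] at hy
  refine ContDiffAt.contDiffWithinAt ?_
  have h1 : ContDiffAt ℝ ∞ (fun p : EuclideanSpace ℝ (Fin (2 * m - 1)) × ℝ => inChart z₀ α p.1)
      (y, t) := ContDiffAt.comp (g := inChart z₀ α) (y, t) (hα.contDiffAt hy.1) contDiffAt_fst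
  have h2 : ContDiffAt ℝ ∞ (fun p : EuclideanSpace ℝ (Fin (2 * m - 1)) × ℝ =>
      oneForm (EuclideanSpace ℝ (Fin (2 * m - 1)) × ℝ) (p.2 ^ 2 •
        (ofOneForm _ (inChart z₀ α p.1)).comp
          (ContinuousLinearMap.fst ℝ (EuclideanSpace ℝ (Fin (2 * m - 1))) ℝ))) (y, t) :=
    contDiff_oneForm.contDiffAt.comp (y, t) ((contDiffAt_snd.pow 2).smul
      (ContDiffAt.clm_comp (ContDiffAt.comp (y, t)
        (ofOneForm (EuclideanSpace ℝ (Fin (2 * m - 1)))).contDiff.contDiffAt h1) contDiffAt_const))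
  refine h2.congr_of_eventuallyEq ?_
  have h3 := (isOpen_extChartAt_target (I := 𝓡 (2 * m - 1)) z₀).prod (isOpen_univ (X := ℝ))
  filter_upwards [h3.mem_nhds ⟨hy.1, mem_univ _⟩] with p hp
  refine ContinuousAlternatingMap.ext fun v => ?_
  refine (inChart_prod_apply (sqForm α) z₀ t₀ hp.1 p.2 v).trans ((sqForm_apply _ _ _ _).trans ?_)
  rw [oneForm_apply, smul_apply, smul_eq_mul, ContinuousLinearMap.comp_apply, ofOneForm_apply]
  congr 1
  refine congrArg (α _) (funext fun i => ?_)
  rw [Subsingleton.elim i 0]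
  rfl

theorem pullback_sqForm
    (hs : ∀ g : G, ContMDiff (𝓡 (2 * m)) (𝓡 (2 * m)) ∞ (fun x : M => g • x))
    (hZ : Manifold.IsSmoothEmbedding (𝓡 (2 * m - 1)) (𝓡 (2 * m)) ∞ (Subtype.val : fold σ → M))
    (h : IsInvariant G σ) {α : DForm (𝓡 (2 * m - 1)) (fold σ) 1} (g : G)
    (hα : pullback (𝓡 (2 * m - 1)) (foldAct h g) α = α) :
    pullback ((𝓡 (2 * m - 1)).prod 𝓘(ℝ, ℝ)) (prodAct h g) (sqForm α) = sqForm α := by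
  funext ⟨z, t⟩
  refine ContinuousAlternatingMap.ext fun v => ?_
  refine (pullback_apply _ _ _ _).trans ((sqForm_apply _ _ _ _).trans ?_)
  refine Eq.trans ?_ (sqForm_apply α z t v).symm
  refine congrArg (t ^ 2 * ·) ?_
  refine Eq.trans ?_ (DFunLike.congr_fun (congrFun hα z) _)
  refine Eq.trans ?_ (pullback_apply _ _ _ _).symm
  refine congrArg (α (foldAct h g z)) (funext fun i => ?_)
  rw [Subsingleton.elim i 0]
  exact congrArg Prod.fst (mfderiv_prodAct hs hZ h g (z, t) (v 0))

/-- Both i_Z^*σ and t² p^*α are invariant, and the exterior derivative commutes with the pullback by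
the action on Z × ℝ. -/
theorem asFamily_modelForm_covariant
    (hs : ∀ g : G, ContMDiff (𝓡 (2 * m)) (𝓡 (2 * m)) ∞ (fun x : M => g • x))
    (hZ : Manifold.IsSmoothEmbedding (𝓡 (2 * m - 1)) (𝓡 (2 * m)) ∞ (Subtype.val : fold σ → M))
    (h : IsInvariant G σ) {α : DForm (𝓡 (2 * m - 1)) (fold σ) 1} (hαs : IsSmooth α) (g : G)
    (hα : pullback (𝓡 (2 * m - 1)) (foldAct h g) α = α)
    (z : fold σ) (t : ℝ) (u v : EuclideanSpace ℝ (Fin (2 * m - 1)) × ℝ) :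
    asFamily (modelForm σ α) (z, t) ![u, v] = asFamily (modelForm σ α) (foldAct h g z, t)
      ![liftEquiv (foldActEquiv hs hZ h g z) u, liftEquiv (foldActEquiv hs hZ h g z) v] := by
  have e : ∀ (z : fold σ) (u v : EuclideanSpace ℝ (Fin (2 * m - 1)) × ℝ),
      asFamily (modelForm σ α) (z, t) ![u, v] =
        restrictFold σ z ![u.1, v.1] + asFamily (extD (sqForm α)) (z, t) ![u, v] := by
    intro z u v
    refine congrArg (· + asFamily (extD (sqForm α)) (z, t) ![u, v]) ?_
    refine (pullback_apply _ _ _ _).trans ?_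
    refine congrArg (restrictFold σ z) (funext fun i => ?_)
    rw [mfderiv_fst]
    fin_cases i <;> rfl
  rw [e, e]
  refine congrArg₂ (fun a b : ℝ => a + b) (restrictFold_covariant hs hZ h g z u.1 v.1) ?_
  have h1 := extD_pullback (isSmooth_sqForm hαs) (x := (z, t)) (contMDiff_prodAct hs hZ h g).contMDiffAt
  rw [pullback_sqForm hs hZ h g hα] at h1
  refine (DFunLike.congr_fun h1 _).trans ?_
  refine congrArg (extD (sqForm α) (prodAct h g (z, t))) (funext fun i => ?_)
  fin_cases i
  · exact mfderiv_prodAct hs hZ h g (z, t) u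
  · exact mfderiv_prodAct hs hZ h g (z, t) v

end Fold

end

end FoldedSymplectic

namespace FoldedSymplectic

section

open Set Filter Bundle

/-! ### The inverse function theorem on manifolds -/

section InverseFunction

variable {E : Type*} [NormedAddCommGroup E] [NormedSpace ℝ E] {H : Type*} [TopologicalSpace H]
  {E' : Type*} [NormedAddCommGroup E'] [NormedSpace ℝ E'] {H' : Type*} [TopologicalSpace H']
  {I : ModelWithCorners ℝ E H} {I' : ModelWithCorners ℝ E' H'} [I.Boundaryless] [I'.Boundaryless]
  {M : Type*} [TopologicalSpace M] [ChartedSpace H M] [IsManifold I ∞ M]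
  {N : Type*} [TopologicalSpace N] [ChartedSpace H' N] [IsManifold I' ∞ N]

variable (I) in
/-- The preferred chart at a point as a partial diffeomorphism. -/
def chartDiffeo (x : M) : PartialDiffeomorph I 𝓘(ℝ, E) M E ∞ where
  toPartialEquiv := extChartAt I x
  open_source := isOpen_extChartAt_source x
  open_target := isOpen_extChartAt_target x
  contMDiffOn_toFun := by rw [extChartAt_source]; exact contMDiffOn_extChartAt
  contMDiffOn_invFun := contMDiffOn_extChartAt_symm x

/-- The inverse function theorem on manifolds without boundary. -/
theorem isLocalDiffeomorphAt_of_mfderiv [CompleteSpace E] {f : M → N} {O : Set M} {x : M}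
    (hO : IsOpen O) (hx : x ∈ O) (hf : ContMDiffOn I I' ∞ f O) (A : E ≃L[ℝ] E')
    (hA : ∀ v : E, (mfderiv I I' f x v : E') = A v) : IsLocalDiffeomorphAt I I' ∞ f x := by
  set e := extChartAt I x with he
  set e' := extChartAt I' (f x) with he'
  set s : Set E := e.target ∩ e.symm ⁻¹' (O ∩ f ⁻¹' e'.source) with hs
  have hso : IsOpen s := (continuousOn_extChartAt_symm x).isOpen_inter_preimage
    (isOpen_extChartAt_target x) (hf.continuousOn.isOpen_inter_preimage hO
      (isOpen_extChartAt_source (f x)))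
  have hxs : e x ∈ s := ⟨mem_extChartAt_target x, by
    change e.symm (e x) ∈ O ∩ f ⁻¹' e'.source
    rw [e.left_inv (mem_extChartAt_source x)]
    exact ⟨hx, mem_extChartAt_source (f x)⟩⟩
  have hF : ContDiffOn ℝ ∞ (inCharts I I' x (f x) f) s := fun y hy =>
    (contDiffAt_inCharts hy.1 (hf.contMDiffAt (hO.mem_nhds hy.2.1)) hy.2.2).contDiffWithinAt
  have hFd : HasFDerivAt (inCharts I I' x (f x) f) (A : E →L[ℝ] E') (e x) := by
    have h1 := ((hF.contDiffAt (hso.mem_nhds hxs)).differentiableAt (by simp)).hasFDerivAt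
    have h2 : fderiv ℝ (inCharts I I' x (f x) f) (e x) = A := ContinuousLinearMap.ext fun v =>
      (fderiv_inCharts_self ((hf.contMDiffAt (hO.mem_nhds hx)).mdifferentiableAt (by simp)) rfl
        v).trans (hA v)
    rwa [h2] at h1
  obtain ⟨ψ, hψx, hψs, hψf, hψi⟩ := exists_smooth_localInverse hso hxs hF A hFd
  let Ψ : PartialDiffeomorph 𝓘(ℝ, E) 𝓘(ℝ, E') E E' ∞ :=
    { toPartialEquiv := ψ.toPartialEquiv
      open_source := ψ.open_source
      open_target := ψ.open_target
      contMDiffOn_toFun := by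
        refine ContDiffOn.contMDiffOn ?_
        change ContDiffOn ℝ ∞ (ψ : E → E') ψ.source
        rw [hψf]; exact hF.mono hψs
      contMDiffOn_invFun := hψi.contMDiffOn }
  refine ⟨((chartDiffeo I x).trans Ψ).trans (chartDiffeo I' (f x)).symm, ?_, ?_⟩
  · refine ⟨⟨mem_extChartAt_source x, hψx⟩, ?_⟩
    change ψ (e x) ∈ e'.target
    rw [hψf]
    exact e'.map_source (hψs hψx).2.2
  · rintro q ⟨⟨hq, hqψ⟩, -⟩
    change f q = e'.symm (ψ (e q))
    have h1 := (hψs hqψ).2.2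
    have h2 : e.symm (e q) = q := e.left_inv hq
    rw [hψf]
    change f (e.symm (e q)) ∈ e'.source at h1
    change f q = e'.symm (e' (f (e.symm (e q))))
    rw [e'.left_inv h1, h2]

end InverseFunction

/-! ### Equivariance of flows -/

section FlowMap

variable {E : Type*} [NormedAddCommGroup E] [NormedSpace ℝ E] {H : Type*} [TopologicalSpace H]
  {I : ModelWithCorners ℝ E H} {N : Type*} [TopologicalSpace N] [ChartedSpace H N]

/-- The flow of an invariant vector field is equivariant, at points where trajectories are
unique. -/
theorem flowMap_equivariant {X : ℝ → ∀ x : N, TangentSpace I x} {x : N}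
    (hx : ∀ c, IsTraj I X c → c 0 = x → flowMap I X x = c 1) {T T' : N → N}
    (hT : MDifferentiable I I T) (hT' : MDifferentiable I I T')
    (hTT : ∀ q, T (T' q) = q) (hTT' : ∀ q, T' (T q) = q)
    (hX : ∀ s q, mfderiv I I T q (X s q) = X s (T q))
    (hX' : ∀ s q, mfderiv I I T' q (X s q) = X s (T' q)) :
    flowMap I X (T x) = T (flowMap I X x) := by
  by_cases h : ∃ c : ℝ → N, c 0 = T x ∧ IsTraj I X c
  · obtain ⟨hc0, hc⟩ := h.choose_spec
    have h1 := hx _ (hc.comp (fun s _ => hT' _) fun s _ => hX' s _)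
      (by rw [Function.comp_apply, hc0, hTT'])
    rw [flowMap, dif_pos h, h1, Function.comp_apply, hTT]
  · have h' : ¬ ∃ c : ℝ → N, c 0 = x ∧ IsTraj I X c := by
      rintro ⟨c, hc0, hc⟩
      exact h ⟨T ∘ c, by rw [Function.comp_apply, hc0], hc.comp (fun s _ => hT _) fun s _ => hX s _⟩
    rw [flowMap, flowMap, dif_neg h, dif_neg h']

end FlowMap

/-! ### The Moser field on Z × ℝ -/

section MoserFlow

variable {m : ℕ} {M : Type*} [TopologicalSpace M] [ChartedSpace (EuclideanSpace ℝ (Fin (2 * m))) M]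
  [IsManifold (𝓡 (2 * m)) ∞ M] {σ : DForm (𝓡 (2 * m)) M 2}
  [ChartedSpace (EuclideanSpace ℝ (Fin (2 * m - 1))) (fold σ)]
  [IsManifold (𝓡 (2 * m - 1)) ∞ (fold σ)]

/-- The time-dependent vector field of the Moser argument on `Z × ℝ`. -/
def moserVector (σ : DForm (𝓡 (2 * m)) M 2)
    [ChartedSpace (EuclideanSpace ℝ (Fin (2 * m - 1))) (fold σ)]
    (W : ∀ x : M, TangentSpace (𝓡 (2 * m)) x) (s : ℝ) (q : fold σ × ℝ) :
    TangentSpace ((𝓡 (2 * m - 1)).prod 𝓘(ℝ, ℝ)) q :=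
  moserField (asFamily (modelForm σ (foldOneForm σ W))) (asFamily (collarForm σ W)) s q

/-- The flow of the Moser vector field on `Z × ℝ`. -/
def moserFlow (σ : DForm (𝓡 (2 * m)) M 2)
    [ChartedSpace (EuclideanSpace ℝ (Fin (2 * m - 1))) (fold σ)]
    (W : ∀ x : M, TangentSpace (𝓡 (2 * m)) x) : fold σ × ℝ → fold σ × ℝ :=
  flowMap ((𝓡 (2 * m - 1)).prod 𝓘(ℝ, ℝ)) (moserVector σ W)

/-- The primitive β vanishes at t = 0, so no invertibility is involved. -/
theorem moserField_zero {B V : Type*} [NormedAddCommGroup V] [NormedSpace ℝ V]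
    (ψ₀ ψ₁ : B × ℝ → (V × ℝ) [⋀^Fin 2]→L[ℝ] ℝ) (s : ℝ) (b : B) :
    moserField ψ₀ ψ₁ s (b, 0) = 0 := by
  have h : moserForm ψ₁ (b, 0) = 0 := by simp [moserForm, tPrimitive]
  rw [moserField, h, neg_zero, map_zero]

variable [T2Space M] {W : ∀ x : M, TangentSpace (𝓡 (2 * m)) x}

/-- By covariance under the differential of the chart, the globally defined field reads in the
product chart as the Moser field of the chart expressions. -/
theorem chartField_moserVector (z₀ : fold σ) {y : EuclideanSpace ℝ (Fin (2 * m - 1))}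
    (hy : y ∈ (extChartAt (𝓡 (2 * m - 1)) z₀).target) (s t : ℝ) :
    chartField ((𝓡 (2 * m - 1)).prod 𝓘(ℝ, ℝ)) (moserVector σ W) (z₀, 0) (s, (y, t)) =
      moserField (inChart ((z₀, (0 : ℝ)) : fold σ × ℝ) (modelForm σ (foldOneForm σ W)))
        (inChart ((z₀, (0 : ℝ)) : fold σ × ℝ) (collarForm σ W)) s (y, t) := by
  set J := (𝓡 (2 * m - 1)).prod 𝓘(ℝ, ℝ) with hJ
  set ch := extChartAt J ((z₀, (0 : ℝ)) : fold σ × ℝ) with hch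
  have hyT : (y, t) ∈ ch.target := by rw [hch, extChartAt_prod_target]; exact ⟨hy, mem_univ _⟩
  set b := (extChartAt (𝓡 (2 * m - 1)) z₀).symm y with hb
  have h1 := moserField_covariant (b := b)
    (fun t u v => inChart_asFamily (modelForm σ (foldOneForm σ W)) z₀ hy t u v)
    (fun t u v => inChart_asFamily (collarForm σ W) z₀ hy t u v) s t
  have h2 := mfderiv_extChartAt_symm_apply hyT
    (moserField (inChart ((z₀, (0 : ℝ)) : fold σ × ℝ) (modelForm σ (foldOneForm σ W)))
        (inChart ((z₀, (0 : ℝ)) : fold σ × ℝ) (collarForm σ W)) s (y, t))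
  refine Eq.trans ?_ h2
  refine congrArg (mfderiv J 𝓘(ℝ, EuclideanSpace ℝ (Fin (2 * m - 1)) × ℝ) ch (ch.symm (y, t))) ?_
  have h3 : (moserVector σ W s (ch.symm (y, t)) : EuclideanSpace ℝ (Fin (2 * m - 1)) × ℝ) =
      moserVector σ W s (b, t) :=
    congrArg (moserField (asFamily (modelForm σ (foldOneForm σ W))) (asFamily (collarForm σ W)) s)
      (extChartAt_prod_symm_apply z₀ 0 (y, t))
  refine h3.trans (h1.symm.trans ?_)
  exact (mfderiv_extChartAt_prod_symm z₀ 0 (p := (y, t)) hy _).symm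

end MoserFlow

end

end FoldedSymplectic

namespace FoldedSymplectic

section

open Set Filter Bundle

/-! ### The Moser flow near the fold -/

section MoserFlow

variable {m : ℕ} {M : Type*} [TopologicalSpace M] [ChartedSpace (EuclideanSpace ℝ (Fin (2 * m))) M]
  [IsManifold (𝓡 (2 * m)) ∞ M] {σ : DForm (𝓡 (2 * m)) M 2}
  [ChartedSpace (EuclideanSpace ℝ (Fin (2 * m - 1))) (fold σ)]
  [IsManifold (𝓡 (2 * m - 1)) ∞ (fold σ)] [T2Space M] {W : ∀ x : M, TangentSpace (𝓡 (2 * m)) x}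

theorem foldOneForm_orientation (hσ : IsFoldedSymplectic σ)
    (hZ : Manifold.IsSmoothEmbedding (𝓡 (2 * m - 1)) (𝓡 (2 * m)) ∞ (Subtype.val : fold σ → M))
    (hW : ContMDiff (𝓡 (2 * m)) (𝓡 (2 * m)).tangent ∞
      (fun x => (⟨x, W x⟩ : TangentBundle (𝓡 (2 * m)) M)))
    (hWk : ∀ z : fold σ, W z ∈ formKer σ (z : M)) (hWt : ∀ z : fold σ, W z ∉ tangentFold σ z)
    (z : fold σ) {u : TangentSpace (𝓡 (2 * m - 1)) z} (hu : u ∈ nullFibre σ z) :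
    (u ≠ 0 → foldOneForm σ W z ![u] ≠ 0) ∧
      (0 < foldOneForm σ W z ![u] ↔ IsPositiveNull σ z u) := by
  rw [foldOneForm_apply hσ hZ hW hWk z hu]
  obtain ⟨h1, h2⟩ := isPositiveNull_iff hσ hZ hW hWk hWt z hu
  refine ⟨fun h => mul_ne_zero (by norm_num) (h1 h), ?_⟩
  rw [← h2]
  exact mul_pos_iff_of_pos_left (by norm_num)

/-- The local flow in a chart gives a trajectory on Z × ℝ, and uniqueness of trajectories identifies
its end point with the globally defined flow. The last clause records this uniqueness, on which
equivariance rests. -/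
theorem exists_moserFlow_local (hσ : IsFoldedSymplectic σ)
    (hZ : Manifold.IsSmoothEmbedding (𝓡 (2 * m - 1)) (𝓡 (2 * m)) ∞ (Subtype.val : fold σ → M))
    (hW : ContMDiff (𝓡 (2 * m)) (𝓡 (2 * m)).tangent ∞
      (fun x => (⟨x, W x⟩ : TangentBundle (𝓡 (2 * m)) M)))
    (hWk : ∀ z : fold σ, W z ∈ formKer σ (z : M)) (hWt : ∀ z : fold σ, W z ∉ tangentFold σ z)
    (z₀ : fold σ) :
    ∃ O : Set (fold σ × ℝ), IsOpen O ∧ (z₀, 0) ∈ O ∧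
      ContMDiffOn ((𝓡 (2 * m - 1)).prod 𝓘(ℝ, ℝ)) ((𝓡 (2 * m - 1)).prod 𝓘(ℝ, ℝ)) ∞
        (moserFlow σ W) O ∧
      moserFlow σ W (z₀, 0) = (z₀, 0) ∧
      (∀ v : EuclideanSpace ℝ (Fin (2 * m - 1)) × ℝ,
        (mfderiv ((𝓡 (2 * m - 1)).prod 𝓘(ℝ, ℝ)) ((𝓡 (2 * m - 1)).prod 𝓘(ℝ, ℝ)) (moserFlow σ W)
          (z₀, 0) v : EuclideanSpace ℝ (Fin (2 * m - 1)) × ℝ) = v) ∧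
      ∀ q ∈ O,
        ContMDiffAt ((𝓡 (2 * m - 1)).prod 𝓘(ℝ, ℝ)) (𝓡 (2 * m)) ∞
          (collarMap (𝓡 (2 * m)) (Subtype.val : fold σ → M) W) (moserFlow σ W q) ∧
        pullback ((𝓡 (2 * m - 1)).prod 𝓘(ℝ, ℝ)) (moserFlow σ W) (collarForm σ W) q =
          modelForm σ (foldOneForm σ W) q ∧
        ∀ c, IsTraj ((𝓡 (2 * m - 1)).prod 𝓘(ℝ, ℝ)) (moserVector σ W) c → c 0 = q →
          moserFlow σ W q = c 1 := by
  have hT2 : T2Space (fold σ × ℝ) := inferInstance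
  set J := (𝓡 (2 * m - 1)).prod 𝓘(ℝ, ℝ) with hJ
  set eZ := extChartAt (𝓡 (2 * m - 1)) z₀ with heZ
  set ch := extChartAt J ((z₀, (0 : ℝ)) : fold σ × ℝ) with hch
  set ψ₀ := inChart ((z₀, (0 : ℝ)) : fold σ × ℝ) (modelForm σ (foldOneForm σ W)) with hψ₀
  set ψ₁ := inChart ((z₀, (0 : ℝ)) : fold σ × ℝ) (collarForm σ W) with hψ₁
  obtain ⟨U, ε, hyU, hUt, hκ, d⟩ := exists_moserData hσ hZ hW hWk z₀ (mem_extChartAt_target z₀)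
  have hcht : ch.target = eZ.target ×ˢ univ := extChartAt_prod_target z₀ 0
  have hchs : ch.source = eZ.source ×ˢ univ := extChartAt_prod_source z₀ 0
  have hcha : ∀ q, ch q = (eZ q.1, q.2) := extChartAt_prod_apply z₀ 0
  have hchi : ∀ p, ch.symm p = (eZ.symm p.1, p.2) := extChartAt_prod_symm_apply z₀ 0
  have hψz : ∀ u v : EuclideanSpace ℝ (Fin (2 * m - 1)) × ℝ, ψ₁ (eZ z₀, 0) ![u, v] =
      restrictFold σ z₀ ![u.1, v.1] := fun u v => by
    have h1 := inChart_self (collarForm σ W) ((z₀, (0 : ℝ)) : fold σ × ℝ) ![u, v]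
    rw [extChartAt_prod_apply] at h1
    exact h1.trans (collarForm_zero hZ hW hWk z₀ u v)
  obtain ⟨n, w, hn0, hnull, hnk, -⟩ := exists_fold_frame hσ hZ z₀
  -- The hypotheses on n: it lies in ker σ, α(n) ≠ 0, and it spans the kernel of the restriction of
  -- σ to the fold.
  obtain ⟨Ω, O, c, hΩ, hΩU, hXs, -, hO, hy₀O, hc, hF, hFd, hFψ⟩ := d.exists_flow (n := n) hyU
    (fun v => (hψz (n, 0) v).trans ((restrictFold_apply _ _ _).trans (hnk _)))
    (fun h => (foldOneForm_orientation hσ hZ hW hWk hWt z₀ hnk).1 hn0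
      ((foldOneForm_eq_nullOneForm z₀ n).trans h))
    (fun v hv => hnull v fun v' => (restrictFold_apply _ _ _).symm.trans
      ((hψz (v, 0) (v', 0)).symm.trans (hv v')))
  set F : EuclideanSpace ℝ (Fin (2 * m - 1)) × ℝ → EuclideanSpace ℝ (Fin (2 * m - 1)) × ℝ :=
    fun p => c p 1 with hFdef
  have hmemU : ∀ p ∈ O, ∀ s ∈ Icc (0 : ℝ) 1, c p s ∈ U ×ˢ Ioo (-ε) ε := fun p hp s hs =>
    (hΩU ((hc p hp).2 s hs).1).2
  have hUT : ∀ p ∈ U ×ˢ Ioo (-ε) ε, p ∈ ch.target := fun p hp => by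
    rw [hcht]; exact ⟨hUt hp.1, mem_univ _⟩
  have hOT : ∀ p ∈ O, p ∈ U ×ˢ Ioo (-ε) ε := fun p hp => by
    have h1 := hmemU p hp 0 (by simp)
    rwa [(hc p hp).1] at h1
  have hFU : ∀ p ∈ O, F p ∈ U ×ˢ Ioo (-ε) ε := fun p hp => hmemU p hp 1 (by simp)
  have hfield : ∀ s, ∀ p ∈ U ×ˢ Ioo (-ε) ε, chartField J (moserVector σ W) (z₀, 0) (s, p) =
      moserField ψ₀ ψ₁ s p := fun s p hp => chartField_moserVector z₀ (hUt hp.1) s p.2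
  have htraj : ∀ p ∈ O, IsTraj J (moserVector σ W) (fun s => ch.symm (c p s)) := fun p hp =>
    isTraj_of_hasDerivWithinAt fun s hs => ⟨hUT _ (hmemU p hp s hs),
      ((hc p hp).2 s hs).2.congr_deriv (hfield s _ (hmemU p hp s hs)).symm⟩
  -- The trajectory stays where the chart field is smooth, as the uniqueness theorem demands.
  have hreg : ∀ p ∈ O, ∀ s ∈ Icc (0 : ℝ) 1, ∃ x₀ : fold σ × ℝ,
      ch.symm (c p s) ∈ (extChartAt J x₀).source ∧ ContDiffAt ℝ 1
        (chartField J (moserVector σ W) x₀) (s, extChartAt J x₀ (ch.symm (c p s))) := by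
    intro p hp s hs
    have h1 := hUT _ (hmemU p hp s hs)
    refine ⟨(z₀, 0), ch.map_target h1, ?_⟩
    change ContDiffAt ℝ 1 _ (s, ch (ch.symm (c p s)))
    rw [ch.right_inv h1]
    have h2 := ((hc p hp).2 s hs).1
    refine ((hXs.contDiffAt (hΩ.mem_nhds h2)).of_le (by simp)).congr_of_eventuallyEq ?_
    filter_upwards [hΩ.mem_nhds h2] with x hx
    exact hfield x.1 x.2 (hΩU hx).2
  have hρ : ∀ p ∈ O, moserFlow σ W (ch.symm p) = ch.symm (F p) := fun p hp => by
    have h1 := flowMap_eq (htraj p hp) (hreg p hp)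
    rw [(hc p hp).1] at h1
    exact h1
  have huniq : ∀ p ∈ O, ∀ c', IsTraj J (moserVector σ W) c' → c' 0 = ch.symm p →
      moserFlow σ W (ch.symm p) = c' 1 := fun p hp c' hc' h0 => by
    rw [hρ p hp]
    exact (htraj p hp).eqOn hc' (by simp only [(hc p hp).1, h0]) (hreg p hp) (by simp)
  have hchart : ∀ p ∈ O, inCharts J J ((z₀, (0 : ℝ)) : fold σ × ℝ) (z₀, 0) (moserFlow σ W) p =
      F p := fun p hp => by
    change ch (moserFlow σ W (ch.symm p)) = F p
    rw [hρ p hp, ch.right_inv (hUT _ (hFU p hp))]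
  set Oq : Set (fold σ × ℝ) := ch.source ∩ ch ⁻¹' O with hOq
  have hOqo : IsOpen Oq := (continuousOn_extChartAt _).isOpen_inter_preimage
    (isOpen_extChartAt_source _) hO
  have hz₀ : ch (z₀, 0) = (eZ z₀, 0) := hcha _
  have hzs : ((z₀, 0) : fold σ × ℝ) ∈ ch.source := mem_extChartAt_source _
  have hzq : ((z₀, 0) : fold σ × ℝ) ∈ Oq := ⟨hzs, by
    change ch (z₀, 0) ∈ O
    rw [hz₀]; exact hy₀O⟩
  have hsmooth : ContMDiffOn J J ∞ (moserFlow σ W) Oq := by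
    intro q hq
    have hFp : F (ch q) ∈ ch.target := hUT _ (hFU _ hq.2)
    have hsm : ContMDiffAt 𝓘(ℝ, EuclideanSpace ℝ (Fin (2 * m - 1)) × ℝ) J ∞ ch.symm (F (ch q)) :=
      (contMDiffOn_extChartAt_symm (I := J) (n := ∞) _ _ hFp).contMDiffAt
        ((isOpen_extChartAt_target _).mem_nhds hFp)
    have hFm : ContMDiffAt 𝓘(ℝ, EuclideanSpace ℝ (Fin (2 * m - 1)) × ℝ)
        𝓘(ℝ, EuclideanSpace ℝ (Fin (2 * m - 1)) × ℝ) ∞ F (ch q) :=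
      (hF.contDiffAt (hO.mem_nhds hq.2)).contMDiffAt
    have hcm : ContMDiffAt J 𝓘(ℝ, EuclideanSpace ℝ (Fin (2 * m - 1)) × ℝ) ∞ ch q :=
      contMDiffAt_extChartAt' (by have := hq.1; rwa [hch, extChartAt_source] at this)
    have h1 : ContMDiffAt J 𝓘(ℝ, EuclideanSpace ℝ (Fin (2 * m - 1)) × ℝ) ∞ (fun q => F (ch q)) q :=
      ContMDiffAt.comp q (g := F) hFm hcm
    refine ContMDiffAt.contMDiffWithinAt (ContMDiffAt.congr_of_eventuallyEq
      (ContMDiffAt.comp q (g := ch.symm) (f := fun q => F (ch q)) hsm h1) ?_)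
    filter_upwards [hOqo.mem_nhds hq] with q' hq'
    have h2 := hρ _ hq'.2
    rwa [ch.left_inv hq'.1] at h2
  have hfix : moserFlow σ W (z₀, 0) = (z₀, 0) := by
    have h1 := huniq _ hzq.2 (fun _ => (z₀, 0)) (isTraj_const fun s => moserField_zero _ _ s z₀)
      (ch.left_inv hzs).symm
    rwa [ch.left_inv hzs] at h1
  refine ⟨Oq, hOqo, hzq, hsmooth, hfix, fun v => ?_, fun q hq => ?_⟩
  · have h1 := fderiv_inCharts_self
      ((hsmooth.contMDiffAt (hOqo.mem_nhds hzq)).mdifferentiableAt (by simp)) hfix v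
    refine h1.symm.trans ?_
    have h2 : inCharts J J ((z₀, (0 : ℝ)) : fold σ × ℝ) (z₀, 0) (moserFlow σ W) =ᶠ[𝓝 (ch (z₀, 0))]
        F := by
      filter_upwards [hO.mem_nhds hzq.2] with p hp using hchart p hp
    rw [← hz₀] at hFd
    refine (DFunLike.congr_fun (h2.fderiv_eq.trans hFd.fderiv) v)
  · have hqs := ch.left_inv hq.1
    have hq2 : ch q ∈ O := hq.2
    have hqt := ch.map_source hq.1
    have hρq : moserFlow σ W q = ch.symm (F (ch q)) := by
      have := hρ _ hq2
      rwa [hqs] at this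
    have hFq := hFU _ hq2
    refine ⟨?_, ?_, fun c' hc' h0 => ?_⟩
    · rw [hρq]
      have h1 := hUT _ hFq
      have h2 : (ch.symm (F (ch q))).1 ∈ eZ.source := by
        have := ch.map_target h1
        rw [hchs] at this
        exact this.1
      have h3 : (eZ (ch.symm (F (ch q))).1, (ch.symm (F (ch q))).2) = F (ch q) := by
        rw [← hcha, ch.right_inv h1]
      refine hκ _ h2 ?_ ?_
      · have h4 := hFq.1
        rw [← h3] at h4
        exact h4
      · have h4 := hFq.2
        rw [← h3] at h4
        exact h4
    · have h1 : MDifferentiableAt J J (moserFlow σ W) (ch.symm (ch q)) := by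
        rw [hqs]
        exact (hsmooth.contMDiffAt (hOqo.mem_nhds hq)).mdifferentiableAt (by simp)
      have h2 : moserFlow σ W (ch.symm (ch q)) ∈ ch.source := by
        rw [hρ _ hq2]; exact ch.map_target (hUT _ hFq)
      have h3 := inChart_pullback (η := collarForm σ W) hqt h1 h2
      have h4 : inCharts J J ((z₀, (0 : ℝ)) : fold σ × ℝ) (z₀, 0) (moserFlow σ W) =ᶠ[𝓝 (ch q)]
          F := by
        filter_upwards [hO.mem_nhds hq2] with p hp using hchart p hp
      have h5 : inChart ((z₀, (0 : ℝ)) : fold σ × ℝ)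
          (pullback J (moserFlow σ W) (collarForm σ W)) (ch q) = ψ₀ (ch q) := by
        refine h3.trans ?_
        rw [hchart _ hq2, h4.fderiv_eq]
        refine toBilin_injective (ContinuousLinearMap.ext fun u => ContinuousLinearMap.ext fun v => ?_)
        rw [toBilin_apply, toBilin_apply, comp_form_apply]
        exact hFψ _ hq2 u v
      rw [eq_inChart_comp (pullback J (moserFlow σ W) (collarForm σ W)) hq.1,
        eq_inChart_comp (modelForm σ (foldOneForm σ W)) hq.1]
      exact congrArg (fun η : (EuclideanSpace ℝ (Fin (2 * m - 1)) × ℝ) [⋀^Fin 2]→L[ℝ] ℝ =>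
        η.compContinuousLinearMap (mfderiv J 𝓘(ℝ, EuclideanSpace ℝ (Fin (2 * m - 1)) × ℝ) ch q)) h5
    · have h1 := huniq _ hq2 c' hc' (h0.trans hqs.symm)
      rwa [hqs] at h1

end MoserFlow

end

end FoldedSymplectic

namespace FoldedSymplectic

section

open Set Filter Bundle

/-! ### The normal form map -/

section NormalForm

variable {m : ℕ} {M : Type*} [TopologicalSpace M] [ChartedSpace (EuclideanSpace ℝ (Fin (2 * m))) M]
  [IsManifold (𝓡 (2 * m)) ∞ M] {σ : DForm (𝓡 (2 * m)) M 2}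
  [ChartedSpace (EuclideanSpace ℝ (Fin (2 * m - 1))) (fold σ)]
  [IsManifold (𝓡 (2 * m - 1)) ∞ (fold σ)]

/-- The composition of the Moser flow with the collar map. -/
def foldMap (σ : DForm (𝓡 (2 * m)) M 2)
    [ChartedSpace (EuclideanSpace ℝ (Fin (2 * m - 1))) (fold σ)]
    (W : ∀ x : M, TangentSpace (𝓡 (2 * m)) x) (q : fold σ × ℝ) : M :=
  collarMap (𝓡 (2 * m)) (Subtype.val : fold σ → M) W (moserFlow σ W q)

/-- The splitting `TZ × ℝ ≃ TM` along the fold given by a transverse vector. -/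
theorem exists_foldSplitting
    (hZ : Manifold.IsSmoothEmbedding (𝓡 (2 * m - 1)) (𝓡 (2 * m)) ∞ (Subtype.val : fold σ → M))
    (z : fold σ) {w : TangentSpace (𝓡 (2 * m)) (z : M)} (hw : w ∉ tangentFold σ z) :
    ∃ A : (EuclideanSpace ℝ (Fin (2 * m - 1)) × ℝ) ≃L[ℝ] EuclideanSpace ℝ (Fin (2 * m)),
      ∀ u τ, A (u, τ) = dIncl σ z u + τ • w := by
  let D : EuclideanSpace ℝ (Fin (2 * m - 1)) →L[ℝ] EuclideanSpace ℝ (Fin (2 * m)) := dIncl σ z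
  let w' : EuclideanSpace ℝ (Fin (2 * m)) := w
  have hD : Function.Injective D := dIncl_injective hZ z
  have hw' : ∀ u, D u ≠ w' := fun u hu => hw ⟨u, hu⟩
  have hm : 0 < 2 * m := by
    by_contra hm
    have h0 : 2 * m = 0 := by omega
    have : IsEmpty (Fin (2 * m)) := by rw [h0]; infer_instance
    exact hw' 0 (Subsingleton.elim _ _)
  set B : EuclideanSpace ℝ (Fin (2 * m - 1)) × ℝ →L[ℝ] EuclideanSpace ℝ (Fin (2 * m)) :=
    D.coprod (ContinuousLinearMap.toSpanSingleton ℝ w') with hB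
  have hBa : ∀ u τ, B (u, τ) = D u + τ • w' := fun u τ => by simp [hB]
  have hBi : Function.Injective B := by
    refine (injective_iff_map_eq_zero B).2 ?_
    rintro ⟨u, τ⟩ h
    rw [hBa] at h
    by_cases hτ : τ = 0
    · rw [hτ, zero_smul, add_zero] at h
      rw [hτ, (injective_iff_map_eq_zero D).1 hD u h]; rfl
    · refine absurd ?_ (hw' (-(τ⁻¹ • u)))
      rw [map_neg, map_smul, eq_neg_of_add_eq_zero_left h, smul_neg, neg_neg, smul_smul,
        inv_mul_cancel₀ hτ, one_smul]
  have hdim : Module.finrank ℝ (EuclideanSpace ℝ (Fin (2 * m - 1)) × ℝ) =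
      Module.finrank ℝ (EuclideanSpace ℝ (Fin (2 * m))) := by
    rw [Module.finrank_prod, finrank_euclideanSpace_fin, finrank_euclideanSpace_fin,
      Module.finrank_self]
    omega
  exact ⟨(LinearEquiv.ofInjectiveOfFinrankEq
    (B : EuclideanSpace ℝ (Fin (2 * m - 1)) × ℝ →ₗ[ℝ] EuclideanSpace ℝ (Fin (2 * m))) hBi
      hdim).toContinuousLinearEquiv, fun u τ => hBa u τ⟩

variable [T2Space M] {W : ∀ x : M, TangentSpace (𝓡 (2 * m)) x}

/-- The Moser flow is the identity to first order at the zero section, so the differential of the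
composite there is that of the collar map, (u, τ) ↦ u + τW. This is an isomorphism because W is
transverse, and the inverse function theorem applies. -/
theorem exists_foldMap_local (hσ : IsFoldedSymplectic σ)
    (hZ : Manifold.IsSmoothEmbedding (𝓡 (2 * m - 1)) (𝓡 (2 * m)) ∞ (Subtype.val : fold σ → M))
    (hW : ContMDiff (𝓡 (2 * m)) (𝓡 (2 * m)).tangent ∞
      (fun x => (⟨x, W x⟩ : TangentBundle (𝓡 (2 * m)) M)))
    (hWk : ∀ z : fold σ, W z ∈ formKer σ (z : M)) (hWt : ∀ z : fold σ, W z ∉ tangentFold σ z)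
    (z₀ : fold σ) :
    foldMap σ W (z₀, 0) = z₀ ∧
    ∃ O : Set (fold σ × ℝ), IsOpen O ∧ (z₀, 0) ∈ O ∧ ∀ q ∈ O,
      IsLocalDiffeomorphAt ((𝓡 (2 * m - 1)).prod 𝓘(ℝ, ℝ)) (𝓡 (2 * m)) ∞ (foldMap σ W) q ∧
      pullback ((𝓡 (2 * m - 1)).prod 𝓘(ℝ, ℝ)) (foldMap σ W) σ q =
        modelForm σ (foldOneForm σ W) q ∧
      ∀ c, IsTraj ((𝓡 (2 * m - 1)).prod 𝓘(ℝ, ℝ)) (moserVector σ W) c → c 0 = q →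
        moserFlow σ W q = c 1 := by
  set J := (𝓡 (2 * m - 1)).prod 𝓘(ℝ, ℝ) with hJ
  set κ := collarMap (𝓡 (2 * m)) (Subtype.val : fold σ → M) W with hκ
  obtain ⟨O, hO, hzO, hρs, hρ0, hρd, hq⟩ := exists_moserFlow_local hσ hZ hW hWk hWt z₀
  have hsm : ContMDiffOn J (𝓡 (2 * m)) ∞ (foldMap σ W) O := fun q hqO =>
    ((hq q hqO).1.comp q (hρs.contMDiffAt (hO.mem_nhds hqO))).contMDiffWithinAt
  obtain ⟨A, hA⟩ := exists_foldSplitting hZ z₀ (hWt z₀)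
  have hmf : ∀ q ∈ O, mfderiv J (𝓡 (2 * m)) (foldMap σ W) q =
      (mfderiv J (𝓡 (2 * m)) κ (moserFlow σ W q)).comp (mfderiv J J (moserFlow σ W) q) :=
    fun q hqO => mfderiv_comp q ((hq q hqO).1.mdifferentiableAt (by simp))
      ((hρs.contMDiffAt (hO.mem_nhds hqO)).mdifferentiableAt (by simp))
  have hd : ∀ v : EuclideanSpace ℝ (Fin (2 * m - 1)) × ℝ,
      (mfderiv J (𝓡 (2 * m)) (foldMap σ W) (z₀, 0) v : EuclideanSpace ℝ (Fin (2 * m))) = A v := by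
    intro v
    refine (DFunLike.congr_fun (hmf _ hzO) v).trans ?_
    have h1 : ∀ q, q = ((z₀, 0) : fold σ × ℝ) → ∀ v v' : EuclideanSpace ℝ (Fin (2 * m - 1)) × ℝ,
        v = v' → (mfderiv J (𝓡 (2 * m)) κ q v : EuclideanSpace ℝ (Fin (2 * m))) =
          mfderiv J (𝓡 (2 * m)) κ (z₀, 0) v' := by rintro _ rfl v _ rfl; rfl
    refine (h1 _ hρ0 _ v (hρd v)).trans ?_
    obtain ⟨-, h2⟩ := exists_contMDiffOn_collarMap (I := 𝓡 (2 * m - 1)) hW hZ.contMDiff z₀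
    exact (h2 v.1 v.2).trans (hA v.1 v.2).symm
  obtain ⟨Φ, hzΦ, hΦ⟩ := isLocalDiffeomorphAt_of_mfderiv hO hzO hsm A hd
  refine ⟨?_, O ∩ Φ.source, hO.inter Φ.open_source, ⟨hzO, hzΦ⟩, fun q hqO => ⟨⟨Φ, hqO.2, hΦ⟩, ?_,
    (hq q hqO.1).2.2⟩⟩
  · exact (congrArg κ hρ0).trans (collarMap_zero hW z₀)
  · rw [← (hq q hqO.1).2.1]
    refine ContinuousAlternatingMap.ext fun v => ?_
    refine congrArg (σ (κ (moserFlow σ W q))) (funext fun i => ?_)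
    exact DFunLike.congr_fun (hmf q hqO.1) (v i)

variable {G : Type*} [Group G] [MulAction G M]

/-- Covariance of the Moser field for A the differential of the action on the fold. -/
theorem mfderiv_prodAct_moserVector (hσ : IsFoldedSymplectic σ)
    (hs : ∀ g : G, ContMDiff (𝓡 (2 * m)) (𝓡 (2 * m)) ∞ (fun x : M => g • x))
    (hZ : Manifold.IsSmoothEmbedding (𝓡 (2 * m - 1)) (𝓡 (2 * m)) ∞ (Subtype.val : fold σ → M))
    (h : IsInvariant G σ)
    (hW : ContMDiff (𝓡 (2 * m)) (𝓡 (2 * m)).tangent ∞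
      (fun x => (⟨x, W x⟩ : TangentBundle (𝓡 (2 * m)) M)))
    (hWk : ∀ z : fold σ, W z ∈ formKer σ (z : M))
    (hWi : ∀ (g : G) (x : M), mfderiv (𝓡 (2 * m)) (𝓡 (2 * m)) (fun x : M => g • x) x (W x) =
      W (g • x)) (g : G) (s : ℝ) (q : fold σ × ℝ) :
    mfderiv ((𝓡 (2 * m - 1)).prod 𝓘(ℝ, ℝ)) ((𝓡 (2 * m - 1)).prod 𝓘(ℝ, ℝ)) (prodAct h g) q
      (moserVector σ W s q) = moserVector σ W s (prodAct h g q) :=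
  (mfderiv_prodAct hs hZ h g q _).trans (moserField_covariant
    (fun t u v => asFamily_modelForm_covariant hs hZ h (isSmooth_foldOneForm hσ hZ hW hWk) g
      (pullback_foldOneForm hs hZ h hW hWi g) q.1 t u v)
    (fun t u v => asFamily_collarForm_covariant hs hZ h hW hWi g q.1 t u v) s q.2)

theorem foldMap_prodAct (hσ : IsFoldedSymplectic σ)
    (hs : ∀ g : G, ContMDiff (𝓡 (2 * m)) (𝓡 (2 * m)) ∞ (fun x : M => g • x))
    (hZ : Manifold.IsSmoothEmbedding (𝓡 (2 * m - 1)) (𝓡 (2 * m)) ∞ (Subtype.val : fold σ → M))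
    (h : IsInvariant G σ)
    (hW : ContMDiff (𝓡 (2 * m)) (𝓡 (2 * m)).tangent ∞
      (fun x => (⟨x, W x⟩ : TangentBundle (𝓡 (2 * m)) M)))
    (hWk : ∀ z : fold σ, W z ∈ formKer σ (z : M))
    (hWi : ∀ (g : G) (x : M), mfderiv (𝓡 (2 * m)) (𝓡 (2 * m)) (fun x : M => g • x) x (W x) =
      W (g • x)) {q : fold σ × ℝ}
    (hq : ∀ c, IsTraj ((𝓡 (2 * m - 1)).prod 𝓘(ℝ, ℝ)) (moserVector σ W) c → c 0 = q →
      moserFlow σ W q = c 1) (g : G) :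
    foldMap σ W (prodAct h g q) = g • foldMap σ W q := by
  have h1 := flowMap_equivariant hq ((contMDiff_prodAct hs hZ h g).mdifferentiable (by simp))
    ((contMDiff_prodAct hs hZ h g⁻¹).mdifferentiable (by simp)) (prodAct_prodAct_inv h g)
    (prodAct_inv_prodAct h g) (mfderiv_prodAct_moserVector hσ hs hZ h hW hWk hWi g)
    (mfderiv_prodAct_moserVector hσ hs hZ h hW hWk hWi g⁻¹)
  exact (congrArg (collarMap (𝓡 (2 * m)) (Subtype.val : fold σ → M) W) h1).trans
    (collarMap_prodAct hs h hW hWi g _)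

end NormalForm

/-- A map on a neighborhood of the zero section of `Z × ℝ` which is the inclusion of `Z` on the zero
section and injective near each of its points is injective near the zero section. -/
theorem exists_isOpen_injOn {X : Type*} [TopologicalSpace X] [TopologicalSpace.MetrizableSpace X]
    {Z : Set X} {f : Z × ℝ → X} {S : Set (Z × ℝ)} (hS : IsOpen S) (hZS : ∀ z, (z, 0) ∈ S)
    (hf : ContinuousOn f S) (hf0 : ∀ z : Z, f (z, 0) = z)
    (hinj : ∀ z : Z, ∃ O ∈ 𝓝 ((z, 0) : Z × ℝ), InjOn f O) :
    ∃ U ⊆ S, IsOpen U ∧ (∀ z, (z, 0) ∈ U) ∧ InjOn f U := by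
  let _ := TopologicalSpace.metrizableSpaceMetric X
  have h1 : ∀ z : Z, ∃ r > 0, InjOn f (Metric.ball ((z, 0) : Z × ℝ) r) := fun z => by
    obtain ⟨O, hO, hOi⟩ := hinj z
    obtain ⟨r, hr, hrO⟩ := Metric.mem_nhds_iff.1 hO
    exact ⟨r, hr, hOi.mono hrO⟩
  choose r hr hri using h1
  -- Near z both the point and its image are kept within a quarter of the radius of injectivity at
  -- z.
  set P : Z → Set (Z × ℝ) := fun z => Metric.ball (z, 0) (r z / 4) ∩
    (S ∩ f ⁻¹' Metric.ball (z : X) (r z / 4)) with hP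
  refine ⟨⋃ z, P z, iUnion_subset fun z q hq => hq.2.1, isOpen_iUnion fun z =>
    Metric.isOpen_ball.inter (hf.isOpen_inter_preimage hS Metric.isOpen_ball), fun z => ?_, ?_⟩
  · refine mem_iUnion.2 ⟨z, Metric.mem_ball_self (by linarith [hr z]), hZS z, ?_⟩
    change f (z, 0) ∈ Metric.ball (z : X) (r z / 4)
    rw [hf0]
    exact Metric.mem_ball_self (by linarith [hr z])
  -- A common image lies close to both z and z', so these are within r z / 2 of each other. Then q
  -- and q' lie in the injectivity ball of the point with the larger radius, since ¼ + ½ < 1.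
  · have key : ∀ z z' : Z, r z' ≤ r z → ∀ q ∈ P z, ∀ q' ∈ P z', f q = f q' → q = q' := by
      rintro z z' hzz q ⟨hq, -, hfq⟩ q' ⟨hq', -, hfq'⟩ h
      have hfq1 : dist (f q) z < r z / 4 := hfq
      have hfq2 : dist (f q') z' < r z' / 4 := hfq'
      rw [← h] at hfq2
      have hzd : dist z' z < r z / 2 := by
        have h3 := dist_triangle_left (z' : X) z (f q)
        change dist (z' : X) z < _
        linarith
      refine hri z (Metric.ball_subset_ball (by linarith [hr z]) hq) ?_ h
      have h5 : dist q' (z', 0) < r z' / 4 := hq'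
      have h6 := dist_triangle q' (z', 0) (z, 0)
      have h7 : dist ((z', 0) : Z × ℝ) (z, 0) = dist z' z := by
        rw [Prod.dist_eq, dist_self, max_eq_left dist_nonneg]
      rw [h7] at h6
      rw [Metric.mem_ball]
      linarith [hr z]
    intro q hq q' hq' h
    obtain ⟨z, hz⟩ := mem_iUnion.1 hq
    obtain ⟨z', hz'⟩ := mem_iUnion.1 hq'
    rcases le_total (r z') (r z) with hle | hle
    · exact key z z' hle q hz q' hz' h
    · exact (key z' z hle q' hz' q hz h.symm).symm

/-- The complement is the projection along the compact factor of a closed set, hence closed. -/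
theorem isOpen_forall_mem_of_compactSpace {K Y X : Type*} [TopologicalSpace K] [CompactSpace K]
    [TopologicalSpace Y] [TopologicalSpace X] {f : K × Y → X} (hf : Continuous f) {V : Set X}
    (hV : IsOpen V) : IsOpen {y | ∀ k, f (k, y) ∈ V} := by
  have h : {y | ∀ k, f (k, y) ∈ V}ᶜ = Prod.snd '' (f ⁻¹' Vᶜ) := by
    ext y; simp
  rw [← isClosed_compl_iff, h]
  exact isClosedMap_snd_of_compactSpace _ (hV.isClosed_compl.preimage hf)

end

end FoldedSymplectic

end

/-! ### Assembly of the equivariant normal form -/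

theorem mainTheorem8
    {m n : ℕ}
    {M : Type*} [TopologicalSpace M] [T2Space M] [SecondCountableTopology M]
    [ChartedSpace (EuclideanSpace ℝ (Fin (2 * m))) M] [IsManifold (𝓡 (2 * m)) ∞ M]
    {G : Type*} [TopologicalSpace G] [T2Space G] [SecondCountableTopology G]
    [ChartedSpace (EuclideanSpace ℝ (Fin n)) G] [Group G] [LieGroup (𝓡 n) ∞ G]
    [CompactSpace G] [ConnectedSpace G]
    [MulAction G M] [ContMDiffSMul (𝓡 n) (𝓡 (2 * m)) ∞ G M]
    (σ : FoldedSymplectic.DForm (𝓡 (2 * m)) M 2)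
    -- the fold is regarded as an embedded hypersurface: its (unique) smooth structure for which the
    -- inclusion is a smooth embedding
    [ChartedSpace (EuclideanSpace ℝ (Fin (2 * m - 1))) (FoldedSymplectic.fold σ)]
    [IsManifold (𝓡 (2 * m - 1)) ∞ (FoldedSymplectic.fold σ)]
    (hZ : Manifold.IsSmoothEmbedding (𝓡 (2 * m - 1)) (𝓡 (2 * m)) ∞
      (Subtype.val : FoldedSymplectic.fold σ → M))
    (hσ : FoldedSymplectic.IsFoldedSymplectic σ)
    (μ : M → Module.Dual ℝ (GroupLieAlgebra (𝓡 n) G))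
    (hμ : FoldedSymplectic.IsHamiltonian σ μ)
    (hco : FoldedSymplectic.IsCoorientable σ) :
    ∃ (U₁ : Set (FoldedSymplectic.fold σ × ℝ)) (U₂ : Set M)
      (φ : FoldedSymplectic.fold σ × ℝ → M)
      (α : FoldedSymplectic.DForm (𝓡 (2 * m - 1)) (FoldedSymplectic.fold σ) 1),
      -- `U₁` is an invariant open neighborhood of the zero section
      IsOpen U₁ ∧ (∀ z : FoldedSymplectic.fold σ, (z, (0 : ℝ)) ∈ U₁) ∧
      (∀ (g : G), ∀ q ∈ U₁, (FoldedSymplectic.foldAct hμ.invariant g q.1, q.2) ∈ U₁) ∧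
      -- `U₂` is an invariant open neighborhood of the fold
      IsOpen U₂ ∧ FoldedSymplectic.fold σ ⊆ U₂ ∧ (∀ (g : G), ∀ x ∈ U₂, g • x ∈ U₂) ∧
      -- `φ : U₁ → U₂` is a diffeomorphism
      Set.BijOn φ U₁ U₂ ∧
      IsLocalDiffeomorphOn ((𝓡 (2 * m - 1)).prod 𝓘(ℝ, ℝ)) (𝓡 (2 * m)) ∞ φ U₁ ∧
      -- `φ` is equivariant and is the identity on the fold
      (∀ (g : G), ∀ q ∈ U₁, φ (FoldedSymplectic.foldAct hμ.invariant g q.1, q.2) = g • φ q) ∧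
      (∀ z : FoldedSymplectic.fold σ, φ (z, 0) = z) ∧
      -- `α` is a smooth invariant one-form, nonvanishing on the null line bundle and inducing its
      -- canonical orientation
      FoldedSymplectic.IsSmooth α ∧
      (∀ g : G, FoldedSymplectic.pullback (𝓡 (2 * m - 1))
        (FoldedSymplectic.foldAct hμ.invariant g) α = α) ∧
      (∀ z : FoldedSymplectic.fold σ, ∀ u ∈ FoldedSymplectic.nullFibre σ z,
        (u ≠ 0 → α z ![u] ≠ 0) ∧ (0 < α z ![u] ↔ FoldedSymplectic.IsPositiveNull σ z u)) ∧
      -- the normal form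
      ∀ q ∈ U₁, FoldedSymplectic.pullback ((𝓡 (2 * m - 1)).prod 𝓘(ℝ, ℝ)) φ σ q =
        FoldedSymplectic.modelForm σ α q := by
  have hsm : ContMDiff ((𝓡 n).prod (𝓡 (2 * m))) (𝓡 (2 * m)) ∞ (fun p : G × M => p.1 • p.2) :=
    contMDiff_smul
  have hs : ∀ g : G, ContMDiff (𝓡 (2 * m)) (𝓡 (2 * m)) ∞ (fun x : M => g • x) := fun g =>
    hsm.comp (contMDiff_const.prodMk contMDiff_id)
  have hinv := hμ.invariant
  obtain ⟨W, hW, hWkt, hWi⟩ :=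
    FoldedSymplectic.exists_invariant_transverse_field (n := n) hs hinv hσ hZ hco
  have hWk := fun z => (hWkt z).1
  have hWt := fun z => (hWkt z).2
  have hloc := FoldedSymplectic.exists_foldMap_local hσ hZ hW hWk hWt
  choose hφ0 O hO hzO hq using hloc
  set φ := FoldedSymplectic.foldMap σ W with hφ
  -- The domain on which φ is a local diffeomorphism, has the normal form and is equivariant.
  set S : Set (FoldedSymplectic.fold σ × ℝ) := ⋃ z, O z with hS
  have hSo : IsOpen S := isOpen_iUnion hO
  have hSq : ∀ q ∈ S, IsLocalDiffeomorphAt ((𝓡 (2 * m - 1)).prod 𝓘(ℝ, ℝ)) (𝓡 (2 * m)) ∞ φ q ∧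
      FoldedSymplectic.pullback ((𝓡 (2 * m - 1)).prod 𝓘(ℝ, ℝ)) φ σ q =
        FoldedSymplectic.modelForm σ (FoldedSymplectic.foldOneForm σ W) q ∧
      ∀ g : G, φ (FoldedSymplectic.foldAct hinv g q.1, q.2) = g • φ q := fun q hqS => by
    obtain ⟨z, hz⟩ := Set.mem_iUnion.1 hqS
    obtain ⟨h1, h2, h3⟩ := hq z q hz
    exact ⟨h1, h2, FoldedSymplectic.foldMap_prodAct hσ hs hZ hinv hW hWk hWi h3⟩
  have hdiffS : IsLocalDiffeomorphOn ((𝓡 (2 * m - 1)).prod 𝓘(ℝ, ℝ)) (𝓡 (2 * m)) ∞ φ S :=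
    fun q => (hSq q q.2).1
  -- Metrizability of M, obtained from local compactness, Hausdorffness and second countability, is
  -- what the injectivity lemma needs.
  have : LocallyCompactSpace M := ChartedSpace.locallyCompactSpace (EuclideanSpace ℝ (Fin (2 * m))) M
  have : TopologicalSpace.MetrizableSpace M := TopologicalSpace.metrizableSpace_of_t3_secondCountable M
  obtain ⟨U, hUS, hU, hzU, hUi⟩ := FoldedSymplectic.exists_isOpen_injOn hSo
    (fun z => Set.mem_iUnion.2 ⟨z, hzO z⟩) hdiffS.contMDiffOn.continuousOn hφ0 fun z => by
      obtain ⟨Φ, hzΦ, hΦ⟩ := (hq z _ (hzO z)).1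
      exact ⟨Φ.source, Φ.open_source.mem_nhds hzΦ, hΦ.injOn_iff.2 Φ.injOn⟩
  have hact : Continuous (fun p : G × (FoldedSymplectic.fold σ × ℝ) =>
      FoldedSymplectic.prodAct hinv p.1 p.2) := by
    refine Continuous.prodMk (Continuous.subtype_mk ?_ _) (by fun_prop)
    exact hsm.continuous.comp (f := fun p : G × (FoldedSymplectic.fold σ × ℝ) => (p.1, (p.2.1 : M)))
      (by fun_prop)
  -- The largest invariant subset of U. It is open because G is compact, and contains the zero
  -- section because that section is invariant.
  set U₁ : Set (FoldedSymplectic.fold σ × ℝ) :=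
    {q | ∀ g : G, FoldedSymplectic.prodAct hinv g q ∈ U} with hU₁
  have hU₁o : IsOpen U₁ := FoldedSymplectic.isOpen_forall_mem_of_compactSpace hact hU
  have hU₁U : U₁ ⊆ U := fun q hq => by
    have h1 := hq 1
    rwa [FoldedSymplectic.prodAct, FoldedSymplectic.foldAct_one] at h1
  have hU₁i : ∀ (g : G), ∀ q ∈ U₁, (FoldedSymplectic.foldAct hinv g q.1, q.2) ∈ U₁ :=
    fun g q hq g' => by
      have h1 := hq (g' * g)
      rw [FoldedSymplectic.prodAct, ← FoldedSymplectic.foldAct_foldAct] at h1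
      exact h1
  have hzU₁ : ∀ z : FoldedSymplectic.fold σ, (z, (0 : ℝ)) ∈ U₁ := fun z g => hzU _
  have hgood := fun q (hq : q ∈ U₁) => hSq q (hUS (hU₁U hq))
  refine ⟨U₁, φ '' U₁, φ, FoldedSymplectic.foldOneForm σ W, hU₁o, hzU₁, hU₁i, ?_,
    fun x hx => ⟨(⟨x, hx⟩, 0), hzU₁ _, hφ0 _⟩, ?_, (hUi.mono hU₁U).bijOn_image,
    fun q => (hgood q q.2).1, fun g q hq => (hgood q hq).2.2 g, hφ0,
    FoldedSymplectic.isSmooth_foldOneForm hσ hZ hW hWk,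
    FoldedSymplectic.pullback_foldOneForm hs hZ hinv hW hWi,
    fun z u hu => FoldedSymplectic.foldOneForm_orientation hσ hZ hW hWk hWt z hu,
    fun q hq => (hgood q hq).2.1⟩
  · refine isOpen_iff_mem_nhds.2 ?_
    rintro _ ⟨q, hqU, rfl⟩
    obtain ⟨Φ, hqΦ, hΦ⟩ := (hgood q hqU).1
    -- The image of U₁ is open because φ agrees near each point with a partial diffeomorphism, which
    -- is an open map on its source.
    have h1 : IsOpen (Φ '' (Φ.source ∩ U₁)) :=
      Φ.toOpenPartialHomeomorph.isOpen_image_source_inter hU₁o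
    have h2 : φ '' (Φ.source ∩ U₁) = Φ '' (Φ.source ∩ U₁) :=
      Set.image_congr fun p hp => hΦ hp.1
    rw [← h2] at h1
    exact Filter.mem_of_superset (h1.mem_nhds ⟨q, ⟨hqΦ, hqU⟩, rfl⟩)
      (Set.image_mono Set.inter_subset_right)
  · rintro g _ ⟨q, hqU, rfl⟩
    exact ⟨_, hU₁i g q hqU, (hgood q hqU).2.2 g⟩
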